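/- **Setting.** There are two systems with parameters $\lambda$. L (radial oscillator): $\lambda=g$, $0<x<\infty$, $\eta(x)=x^2\in(0,\infty)$, $\phi_0=e^{-x^2/2}x^g$, $U=x^2+\frac{g(g-1)}{x^2}-1-2g$, $\mathcal E(n)=4n$, $P_n(\eta;g)=L_n^{(g-1/2)}(\eta)$, $c_{\mathcal F}=2$, $c_1=g+\frac12-\eta$, $c_2=\eta$, $\delta=1$, $W(\eta;g)=\frac12e^{-\eta}\eta^{g-1/2}$, $h_n=\frac{1}{2\,n!}\Gamma(n+g+\frac12)$. J (Pöschl–Teller): $\lambda=(g,h)$, $0<x<\frac\pi2$, $\eta(x)=\cos2x\in(-1,1)$, $\phi_0=(\sin x)^g(\cos x)^h$, $U=\frac{g(g-1)}{\sin^2x}+\frac{h(h-1)}{\cos^2x}-(g+h)^2$, $\mathcal E(n)=4n(n+g+h)$, $P_n(\eta;g,h)=P_n^{(g-1/2,h-1/2)}(\eta)$, $c_{\mathcal F}=-4$, $c_1=h-g-(g+h+1)\eta$, $c_2=1-\eta^2$, $\delta=(1,1)$, $W(\eta;g,h)=2^{-g-h-1}(1-\eta)^{g-1/2}(1+\eta)^{h-1/2}$,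 $h_n=\frac{\Gamma(n+g+1/2)\Gamma(n+h+1/2)}{2\,n!\,(2n+g+h)\Gamma(n+g+h)}$. In both cases $W(\eta)\,|d\eta|=\phi_0(x)^2dx$, and $\phi_n(x)=\phi_0(x)P_n(\eta(x))$. The virtual states are: for L, $\tilde\phi^{\rm I}_v=e^{x^2/2}x^g\xi^{\rm I}_v(\eta)$ with $\xi^{\rm I}_v(\eta)=P_v(-\eta;g)$ and energy $-4(g+v+\frac12)$, and $\tilde\phi^{\rm II}_v=e^{-x^2/2}x^{1-g}\xi^{\rm II}_v(\eta)$ with $\xi_v^{\rm II}=P_v(\eta;1-g)$ and energy $-4(g-v-\frac12)$; for J, $\tilde\phi^{\rm I}_v=(\sin x)^g(\cos x)^{1-h}\xi^{\rm I}_v(\eta)$ with $\xi_v^{\rm I}=P_v(\eta;g,1-h)$ and energy $-4(g+v+\frac12)(h-v-\frac12)$, and $\tilde\phi^{\rm II}_v=(\sin x)^{1-g}(\cos x)^{h}\xi^{\rm II}_v(\eta)$ with $\xi_v^{\rm II}=P_v(\eta;1-g,h)$ and energy $-4(g-v-\frac12)(h+v+\frac12)$. Let $\mathcal D=\{d_1^{\rm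 I},\dots,d_M^{\rm I},d_1^{\rm II},\dots,d_N^{\rm II}\}$ with $M$ distinct positive integers $d^{\rm I}_j$ and $N$ distinct positive integers $d_j^{\rm II}$. Assume, for L, $g>\max\{N+\frac32,d_j^{\rm II}+\frac12\}$; for J, $g>\max\{N+2,d_j^{\rm II}+\frac12\}$ and $h>\max\{M+2,d^{\rm I}_j+\frac12\}$. Assume also that the virtual states in $\mathcal D$ of the same type have pairwise distinct energies (automatic for L; for J this means $h-g\ne d_i^{\rm I}+d_j^{\rm I}+1$ and $g-h\neq d_i^{\rm II}+d_j^{\rm II}+1$ for $i\ne j$). Let ${\rm W}[f_1,\dots,f_k]=\det(f_j^{(i-1)})$ and $$\phi_{\mathcal D,n}=\frac{{\rm W}[\tilde\phi^{\rm I}_{d_1^{\rm I}},\dots,\tilde\phi^{\rm II}_{d_N^{\rm II}},\phi_n]}{{\rm W}[\tilde\phi^{\rm I}_{d_1^{\rm I}},\dots,\tilde\phi^{\rm II}_{d_N^{\rm II}}]},\qquad \mathcal H_{\mathcal D}=-\frac{d^2}{dx^2}+U-2\,\partial_x^2\log\bigl|{\rm W}[\tilde\phi^{\rm I}_{d_1^{\rm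 I}},\dots,\tilde\phi^{\rm II}_{d_N^{\rm II}}]\bigr|.$$ Put $\mu_j=e^\eta\xi^{\rm I}_{d_j^{\rm I}}$, $\nu_j=\eta^{\frac12-g}\xi^{\rm II}_{d^{\rm II}_j}$ for L and $\mu_j=(\frac{1+\eta}2)^{\frac12-h}\xi^{\rm I}_{d_j^{\rm I}}$, $\nu_j=(\frac{1-\eta}2)^{\frac12-g}\xi^{\rm II}_{d_j^{\rm II}}$ for J, and, with Wronskians in $\eta$, $$P_{\mathcal D,n}={\rm W}[\mu_1,\dots,\mu_M,\nu_1,\dots,\nu_N,P_n]\cdot\begin{cases}e^{-M\eta}\eta^{(M+g+\frac12)N}&:\text{L}\\(\frac{1-\eta}2)^{(M+g+\frac12)N}(\frac{1+\eta}2)^{(N+h+\frac12)M}&:\text{J}\end{cases}$$ $$\Xi_{\mathcal D}={\rm W}[\mu_1,\dots,\mu_M,\nu_1,\dots,\nu_N]\cdot\begin{cases}e^{-M\eta}\eta^{(M+g-\frac12)N}&:\text{L}\\(\frac{1-\eta}2)^{(M+g-\frac12)N}(\frac{1+\eta}2)^{(N+h-\frac12)M}&:\text{J.}\end{cases}$$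 Let $\lambda^{[M,N]}=g+M-N$ (L), $(g+M-N,h-M+N)$ (J), $\psi_{\mathcal D}(x)=\phi_0(x;\lambda^{[M,N]})/\Xi_{\mathcal D}(\eta(x);\lambda)$ and $\ell=\sum_jd_j^{\rm I}+\sum_jd_j^{\rm II}-\frac12M(M-1)-\frac12N(N-1)+MN$. **Claim.** The following hold for all $n,m\ge0$. 1. $\ell\ge1$ if $M+N\ge1$. $\Xi_{\mathcal D}$ and $P_{\mathcal D,n}$ are nonzero polynomials in $\eta$ of degrees at most $\ell$ and $\ell+n$. The degrees are exactly $\ell$ and $\ell+n$ for L always, and for J whenever no leading coefficient degenerates, i.e. $g-h\ne d_j^{\rm II}-d_i^{\rm I}$ for all $i,j$ and each $\xi^{\rm I}_{d}$, $\xi^{\rm II}_{d}$ with $d\in\mathcal D$ has degree $d$, that is, $h-g\notin\{d^{\rm I}_j+1,\dots,2d_j^{\rm I}\}$ and $g-h\notin\{d^{\rm II}_j+1,\dots,2d^{\rm II}_j\}$ (in particular whenever $g-h\notin\mathbb Z$). $\Xi_{\mathcal D}$ has no zeros in the range of $\eta$. 2. $\phi_{\mathcal D,n}(x)=c_{\mathcal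 F}^{M+N}\psi_{\mathcal D}(x)P_{\mathcal D,n}(\eta(x))$. This is a square integrable eigenfunction, $\mathcal H_{\mathcal D}\phi_{\mathcal D,n}=\mathcal E(n)\phi_{\mathcal D,n}$, with exactly $n$ zeros in the interval, all simple. 3. $\displaystyle\int\frac{W(\eta;\lambda^{[M,N]})}{\Xi_{\mathcal D}(\eta)^2}P_{\mathcal D,n}P_{\mathcal D,m}\,d\eta=h_n\delta_{nm}\cdot C_n$ over the range of $\eta$ (the integral converges absolutely), with $C_n=\prod_{j=1}^M(n+g+d_j^{\rm I}+\frac12)\prod_{j=1}^N(n+g-d_j^{\rm II}-\frac12)$ for L and $C_n=4^{-M-N}\prod_{j=1}^M(n+g+d_j^{\rm I}+\frac12)(n+h-d_j^{\rm I}-\frac12)\prod_{j=1}^N(n+g-d_j^{\rm II}-\frac12)(n+h+d_j^{\rm II}+\frac12)$ for J; $h_nC_n>0$. The $P_{\mathcal D,n}$, $n\ge0$, form a complete set: their linear span is dense in the $L^2$ space with weight $W(\eta;\lambda^{[M,N]})/\Xi_{\mathcal D}^2$. 4. $\phi_{\mathcal D,0}$ has no zeros, and with $\mathcal A_{\mathcal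 D}=\frac{d}{dx}-\frac{\partial_x\phi_{\mathcal D,0}}{\phi_{\mathcal D,0}}$, $\mathcal A_{\mathcal D}^\dagger=-\frac{d}{dx}-\frac{\partial_x\phi_{\mathcal D,0}}{\phi_{\mathcal D,0}}$ one has, on $C^2$ functions, $\mathcal H_{\mathcal D}=\mathcal A_{\mathcal D}^\dagger\mathcal A_{\mathcal D}$ and the shape invariance $\mathcal A_{\mathcal D}(\lambda)\mathcal A_{\mathcal D}(\lambda)^\dagger=\mathcal A_{\mathcal D}(\lambda+\delta)^\dagger\mathcal A_{\mathcal D}(\lambda+\delta)+\mathcal E(1;\lambda)$. 5. On $C^2$ functions of $\eta$, $\widetilde{\mathcal H}_{\mathcal D}=\psi_{\mathcal D}^{-1}\circ\mathcal H_{\mathcal D}\circ\psi_{\mathcal D}$ equals $$-4\Bigl(c_2\frac{d^2}{d\eta^2}+\Bigl(c_1(\eta,\lambda^{[M,N]})-2c_2\frac{\Xi_{\mathcal D}'}{\Xi_{\mathcal D}}\Bigr)\frac{d}{d\eta}+c_2\frac{\Xi_{\mathcal D}''}{\Xi_{\mathcal D}}-c_1(\eta,\lambda^{[M,N]}-\delta)\frac{\Xi_{\mathcal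 D}'}{\Xi_{\mathcal D}}\Bigr),$$ and $\widetilde{\mathcal H}_{\mathcal D}P_{\mathcal D,n}=\mathcal E(n)P_{\mathcal D,n}$. -/

import Mathlib

open MeasureTheory Set
open scoped ENNReal

noncomputable section

namespace MultiIndexed

/-- The two undeformed systems with their parameters: the radial oscillator `L` with parameter `g`
and the Pöschl–Teller system `J` with parameters `(g, h)`. -/
inductive System where
  | L (g : ℝ) : System
  | J (g h : ℝ) : System

/-! ### Classical polynomials -/

/-- Laguerre polynomial `L_n^{(α)}(x) = (α+1)_n / n! · ₁F₁(-n; α+1; x)`, with the quotient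
`(α+1)_n / (α+1)_k` written as `(α+k+1)_{n-k}`. -/
def laguerreP (n : ℕ) (α x : ℝ) : ℝ :=
  ∑ k ∈ Finset.range (n + 1),
    (-1) ^ k * (ascPochhammer ℝ (n - k)).eval (α + k + 1)
      / ((n - k).factorial * k.factorial : ℝ) * x ^ k

/-- Jacobi polynomial `P_n^{(α,β)}(x) = (α+1)_n / n! · ₂F₁(-n, n+α+β+1; α+1; (1-x)/2)`, with the
quotient `(α+1)_n / (α+1)_k` written as `(α+k+1)_{n-k}`. -/
def jacobiP (n : ℕ) (α β x : ℝ) : ℝ :=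
  ∑ k ∈ Finset.range (n + 1),
    (-1) ^ k * (ascPochhammer ℝ (n - k)).eval (α + k + 1)
      * (ascPochhammer ℝ k).eval (n + α + β + 1)
      / ((n - k).factorial * k.factorial : ℝ) * ((1 - x) / 2) ^ k

/-- The Wronskian `W[f_1, …, f_n](x) = det (d^{j-1} f_k / dx^{j-1})`; it is `1` for `n = 0`. -/
def wronskian {n : ℕ} (f : Fin n → ℝ → ℝ) (x : ℝ) : ℝ :=
  Matrix.det (Matrix.of fun i j : Fin n => iteratedDeriv (i : ℕ) (f j) x)

namespace System

/-! ### The undeformed systems -/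

/-- The interval `(x₁, x₂)` of the coordinate `x`. -/
def xDom : System → Set ℝ
  | L _ => Ioi 0
  | J _ _ => Ioo 0 (Real.pi / 2)

/-- The range of the sinusoidal coordinate `η`. -/
def etaDom : System → Set ℝ
  | L _ => Ioi 0
  | J _ _ => Ioo (-1) 1

/-- The sinusoidal coordinate `η(x)`: `x²` for L and `cos 2x` for J. -/
def eta : System → ℝ → ℝ
  | L _, x => x ^ 2
  | J _ _, x => Real.cos (2 * x)

/-- The ground state wavefunction `φ₀(x; λ)`. -/
def phi0 : System → ℝ → ℝ
  | L g, x => Real.exp (-x ^ 2 / 2) * x ^ g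
  | J g h, x => Real.sin x ^ g * Real.cos x ^ h

/-- The potential `U(x; λ)`, normalised so that the ground state energy is `0`. -/
def potential : System → ℝ → ℝ
  | L g, x => x ^ 2 + g * (g - 1) / x ^ 2 - 1 - 2 * g
  | J g h, x => g * (g - 1) / Real.sin x ^ 2 + h * (h - 1) / Real.cos x ^ 2 - (g + h) ^ 2

/-- The energy eigenvalues `E(n; λ)`. -/
def energy : System → ℕ → ℝ
  | L _, n => 4 * n
  | J g h, n => 4 * n * (n + g + h)

/-- The classical polynomials `P_n(η; λ)`. -/
def classicalP : System → ℕ → ℝ → ℝ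
  | L g, n, η => laguerreP n (g - 1 / 2) η
  | J g h, n, η => jacobiP n (g - 1 / 2) (h - 1 / 2) η

/-- The undeformed eigenfunctions `φ_n(x) = φ₀(x) P_n(η(x))`. -/
def phi (s : System) (n : ℕ) (x : ℝ) : ℝ := s.phi0 x * s.classicalP n (s.eta x)

/-- The squared norms `h_n(λ)` of the undeformed eigenfunctions. -/
def normSq : System → ℕ → ℝ
  | L g, n => 1 / (2 * n.factorial) * Real.Gamma (n + g + 1 / 2)
  | J g h, n => Real.Gamma (n + g + 1 / 2) * Real.Gamma (n + h + 1 / 2)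
      / (2 * n.factorial * (2 * n + g + h) * Real.Gamma (n + g + h))

/-- The weight function `W(η; λ)` of the classical polynomials. -/
def weight : System → ℝ → ℝ
  | L g, η => 1 / 2 * Real.exp (-η) * η ^ (g - 1 / 2)
  | J g h, η => 1 / (2 : ℝ) ^ (g + h + 1) * (1 - η) ^ (g - 1 / 2) * (1 + η) ^ (h - 1 / 2)

/-- The constant `c_F`. -/
def cF : System → ℝ
  | L _ => 2
  | J _ _ => -4

/-- The coefficient `c₁(η, λ)`. -/
def c1 : System → ℝ → ℝ
  | L g, η => g + 1 / 2 - η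
  | J g h, η => h - g - (g + h + 1) * η

/-- The coefficient `c₂(η)`. -/
def c2 : System → ℝ → ℝ
  | L _, η => η
  | J _ _, η => 1 - η ^ 2

/-- The parameter shift `λ + t δ`, where `δ = 1` for L and `δ = (1, 1)` for J. -/
def shift : System → ℝ → System
  | L g, t => L (g + t)
  | J g h, t => J (g + t) (h + t)

/-- The shifted parameters `λ^{[M,N]}`. -/
def shiftMN : System → ℕ → ℕ → System
  | L g, M, N => L (g + M - N)
  | J g h, M, N => J (g + M - N) (h - M + N)

/-! ### Virtual states -/

/-- The type I virtual state polynomials `ξ_v^I(η; λ)`. -/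
def xiI : System → ℕ → ℝ → ℝ
  | L g, v, η => (L g).classicalP v (-η)
  | J g h, v, η => (J g (1 - h)).classicalP v η

/-- The type II virtual state polynomials `ξ_v^II(η; λ)`. -/
def xiII : System → ℕ → ℝ → ℝ
  | L g, v, η => (L (1 - g)).classicalP v η
  | J g h, v, η => (J (1 - g) h).classicalP v η

/-- The type I virtual state wavefunctions. -/
def virtualI : System → ℕ → ℝ → ℝ
  | L g, v, x => Real.exp (x ^ 2 / 2) * x ^ g * (L g).xiI v ((L g).eta x)
  | J g h, v, x => Real.sin x ^ g * Real.cos x ^ (1 - h) * (J g h).xiI v ((J g h).eta x)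

/-- The type II virtual state wavefunctions. -/
def virtualII : System → ℕ → ℝ → ℝ
  | L g, v, x => Real.exp (-x ^ 2 / 2) * x ^ (1 - g) * (L g).xiII v ((L g).eta x)
  | J g h, v, x => Real.sin x ^ (1 - g) * Real.cos x ^ h * (J g h).xiII v ((J g h).eta x)

/-- The energies of the type I virtual states. -/
def energyI : System → ℕ → ℝ
  | L g, v => -4 * (g + v + 1 / 2)
  | J g h, v => -4 * (g + v + 1 / 2) * (h - v - 1 / 2)

/-- The energies of the type II virtual states. -/
def energyII : System → ℕ → ℝ
  | L g, v => -4 * (g - v - 1 / 2)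
  | J g h, v => -4 * (g - v - 1 / 2) * (h + v + 1 / 2)

/-- The parameter bounds: for L, `g > max {N + 3/2, d_j^II + 1/2}`; for J,
`g > max {N + 2, d_j^II + 1/2}` and `h > max {M + 2, d_j^I + 1/2}`. -/
def Bound {M N : ℕ} (dI : Fin M → ℕ) (dII : Fin N → ℕ) : System → Prop
  | L g => g > N + 3 / 2 ∧ ∀ j, g > dII j + 1 / 2
  | J g h => (g > N + 2 ∧ ∀ j, g > dII j + 1 / 2) ∧ (h > M + 2 ∧ ∀ j, h > dI j + 1 / 2)

/-- No top-degree coefficient degenerates. This is no condition for L. For J it says that each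
`ξ_d^I`, `ξ_d^II` with `d` in `D` has degree exactly `d` (the coefficient of `η^d` is, up to a
nonzero factor, `(d+g-h+1)_d` and `(d+h-g+1)_d` respectively), and that `g - h` is none of the
differences `d_j^II - d_i^I`. It always holds if `g - h` is not an integer. -/
def Generic {M N : ℕ} (dI : Fin M → ℕ) (dII : Fin N → ℕ) : System → Prop
  | L _ => True
  | J g h =>
      (∀ j, ∀ k < dI j, h - g ≠ dI j + k + 1) ∧
      (∀ j, ∀ k < dII j, g - h ≠ dII j + k + 1) ∧
      (∀ i j, g - h ≠ (dII j : ℝ) - dI i)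

/-! ### The deformed system -/

section Deformed

variable (s : System) {M N : ℕ} (dI : Fin M → ℕ) (dII : Fin N → ℕ)

/-- The seed solutions of the multiple Darboux transformation: the type I virtual states, then
the type II virtual states. -/
def seeds : Fin (M + N) → ℝ → ℝ :=
  Fin.append (fun j => s.virtualI (dI j)) (fun j => s.virtualII (dII j))

/-- The Darboux-transformed eigenfunctions `φ_{D,n} = W[seeds, φ_n] / W[seeds]`. -/
def phiD (n : ℕ) (x : ℝ) : ℝ :=
  wronskian (Fin.append (s.seeds dI dII) (fun _ : Fin 1 => s.phi n)) x
    / wronskian (s.seeds dI dII) x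

/-- The Darboux-transformed potential `U - 2 ∂ₓ² log |W[seeds]|`. -/
def potentialD (x : ℝ) : ℝ :=
  s.potential x
    - 2 * iteratedDeriv 2 (fun y => Real.log |wronskian (s.seeds dI dII) y|) x

/-- The deformed Hamiltonian `H_D = - d²/dx² + U_D` as a differential expression. -/
def hamD (f : ℝ → ℝ) (x : ℝ) : ℝ :=
  -iteratedDeriv 2 f x + s.potentialD dI dII x * f x

/-- `A_D = d/dx - ∂ₓ φ_{D,0} / φ_{D,0}`. -/
def opA (f : ℝ → ℝ) (x : ℝ) : ℝ :=
  deriv f x - deriv (s.phiD dI dII 0) x / s.phiD dI dII 0 x * f x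

/-- `A_D† = - d/dx - ∂ₓ φ_{D,0} / φ_{D,0}`. -/
def opAdag (f : ℝ → ℝ) (x : ℝ) : ℝ :=
  -deriv f x - deriv (s.phiD dI dII 0) x / s.phiD dI dII 0 x * f x

/-- The functions `μ_j(η)` (built from `ξ_{d}^I`). -/
def mu : System → ℕ → ℝ → ℝ
  | L g, d, η => Real.exp η * (L g).xiI d η
  | J g h, d, η => ((1 + η) / 2) ^ (1 / 2 - h) * (J g h).xiI d η

/-- The functions `ν_j(η)` (built from `ξ_{d}^II`). -/
def nu : System → ℕ → ℝ → ℝ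
  | L g, d, η => η ^ (1 / 2 - g) * (L g).xiII d η
  | J g h, d, η => ((1 - η) / 2) ^ (1 / 2 - g) * (J g h).xiII d η

/-- The family `μ_1, …, μ_M, ν_1, …, ν_N`. -/
def muNu : Fin (M + N) → ℝ → ℝ :=
  Fin.append (fun j => s.mu (dI j)) (fun j => s.nu (dII j))

/-- The prefactor of the Wronskian in `P_{D,n}`. -/
def prefactorP (M N : ℕ) : System → ℝ → ℝ
  | L g, η => Real.exp (-M * η) * η ^ ((M + g + 1 / 2) * N)
  | J g h, η => ((1 - η) / 2) ^ ((M + g + 1 / 2) * N) * ((1 + η) / 2) ^ ((N + h + 1 / 2) * M)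

/-- The prefactor of the Wronskian in `Ξ_D`. -/
def prefactorXi (M N : ℕ) : System → ℝ → ℝ
  | L g, η => Real.exp (-M * η) * η ^ ((M + g - 1 / 2) * N)
  | J g h, η => ((1 - η) / 2) ^ ((M + g - 1 / 2) * N) * ((1 + η) / 2) ^ ((N + h - 1 / 2) * M)

/-- The multi-indexed polynomial `P_{D,n}(η; λ)`, as a function on the range of `η`. -/
def multiP (n : ℕ) (η : ℝ) : ℝ :=
  wronskian (Fin.append (s.muNu dI dII) (fun _ : Fin 1 => s.classicalP n)) η
    * prefactorP M N s η

/-- The denominator polynomial `Ξ_D(η; λ)`, as a function on the range of `η`. -/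
def denomXi (η : ℝ) : ℝ :=
  wronskian (s.muNu dI dII) η * prefactorXi M N s η

/-- `ψ_D(x; λ) = φ₀(x; λ^{[M,N]}) / Ξ_D(η(x); λ)`. -/
def psiD (x : ℝ) : ℝ := (s.shiftMN M N).phi0 x / s.denomXi dI dII (s.eta x)

/-- The similarity-transformed Hamiltonian `ψ_D⁻¹ ∘ H_D ∘ ψ_D`, acting on `f (η (x))`. -/
def hamTilde (f : ℝ → ℝ) (x : ℝ) : ℝ :=
  (s.psiD dI dII x)⁻¹ * s.hamD dI dII (fun y => s.psiD dI dII y * f (s.eta y)) x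

/-- The explicit second order differential operator in `η`. -/
def etaOp (f : ℝ → ℝ) (η : ℝ) : ℝ :=
  -4 * (s.c2 η * iteratedDeriv 2 f η
    + ((s.shiftMN M N).c1 η
        - 2 * s.c2 η * (deriv (s.denomXi dI dII) η / s.denomXi dI dII η)) * deriv f η
    + (s.c2 η * (iteratedDeriv 2 (s.denomXi dI dII) η / s.denomXi dI dII η)
        - ((s.shiftMN M N).shift (-1)).c1 η
            * (deriv (s.denomXi dI dII) η / s.denomXi dI dII η)) * f η)

/-- The weight function `W(η; λ^{[M,N]}) / Ξ_D(η; λ)²`. -/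
def weightD (η : ℝ) : ℝ := (s.shiftMN M N).weight η / s.denomXi dI dII η ^ 2

/-- The measure `W(η; λ^{[M,N]}) / Ξ_D(η; λ)² dη` on the range of `η`. -/
def measureD : Measure ℝ :=
  (volume.restrict s.etaDom).withDensity fun η => ENNReal.ofReal (s.weightD dI dII η)

/-- The factor multiplying `h_n(λ)` in the squared norm of `P_{D,n}`. -/
def normFactor : System → ℕ → ℝ
  | L g, n => (∏ j, (n + g + dI j + 1 / 2)) * ∏ j, (n + g - dII j - 1 / 2)
  | J g h, n => ((4 : ℝ) ^ (M + N))⁻¹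
      * (∏ j, (n + g + dI j + 1 / 2) * (n + h - dI j - 1 / 2))
      * ∏ j, (n + g - dII j - 1 / 2) * (n + h + dII j + 1 / 2)

end Deformed

/-- The degree `ℓ` of the denominator polynomial; the divisions by `2` are exact. -/
def ell {M N : ℕ} (dI : Fin M → ℕ) (dII : Fin N → ℕ) : ℤ :=
  ∑ j, (dI j : ℤ) + ∑ j, (dII j : ℤ) - (M : ℤ) * (M - 1) / 2 - (N : ℤ) * (N - 1) / 2 + M * N

end System

end MultiIndexed

end

namespace MultiIndexed

open Filter Topology
open scoped ContDiff

/-! ### Smooth functions on open sets and Wronskians -/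

section Smooth

variable {D : Set ℝ} {f g : ℝ → ℝ}

/-! The deformed system arises from the classical one by `M + N` Darboux steps `w ↦ w' - (u'/u) w`,
one for each virtual state. By Crum's formula (`Stage.wronskian_append`) the iterated transform is
the quotient of Wronskians that defines `phiD`, so every spectral statement can be carried through a
single step and then inducted.

For a step to make sense the current seed must have no zeros. Each end of the interval carries a
rate `r` with primitive `R` tending to infinity, and `f` has rate `c` when `f'/(f r)` tends to `c`.
Solutions fall into a decaying class `σ = 1` and a growing class `σ = -1`, with rate `-σ p - κ/2`. A
step with a seed of class `σ` preserves the classes and moves `p` by `σ κ` (`darboux_rate`). Type I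
seeds decay on the left and grow on the right, type II seeds do the opposite. The Wronskian of two
seeds is monotone, and its behaviour at the ends keeps it away from zero (`Seed.darboux`), so the
remaining seeds stay nodeless. The virtual states are nodeless to begin with, by comparison with the
ground state (`ne_zero_of_lt`, `seed_of_isSol`).

One step with seed `u` of energy `e` preserves the rest. Zeros are counted by Rolle's theorem
applied to `u · darboux u φ` and to `φ / u` (`ZeroCount.darboux`). Integration by parts multiplies
inner products by `E - e` (`integral_darboux_mul`). Completeness passes through by inverting the
step with an integral operator and Fubini's theorem (`Complete.darboux`). The undeformed input is
proved from scratch: lowering by the ground state gives zeros and norms (`Regular.zeroCount`,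
`Regular.integral_mul`), Weierstrass approximation gives completeness (`Regular.complete`), after a
Gaussian regularisation on the half line.

The polynomial statements come from writing the seeds as `φ₀` times functions of `η`, whence the
Wronskian in `x` is an explicit gauge factor times `Ξ_D(η)`. A power of `c₂` times `Ξ_D` or
`P_{D,n}` is visibly a polynomial; the asymptotics of the Darboux steps give finite limits at the
finite ends, so this power divides (`exists_poly`). Degrees are read off from growth at infinity for
L, and from a Vandermonde determinant of leading coefficients for J.

Shape invariance follows from moving the ground state to the front of the Wronskian: as first seed
it sends every virtual state to the one with the same label and shifted parameters
(`darboux_phi0_seeds`), so `W[seeds, φ₀]` is a constant times `φ₀` times the Wronskian of the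
shifted seeds. The operator in `η` is a direct computation, since the gauge factor turns the
potential at `λ` into the one at `λ^{[M,N]}`. -/

theorem _root_.ContDiffOn.smooth_deriv (hD : IsOpen D) (hf : ContDiffOn ℝ ∞ f D) :
    ContDiffOn ℝ ∞ (deriv f) D :=
  hf.deriv_of_isOpen hD (by simp)

theorem _root_.ContDiffOn.smooth_differentiableAt (hD : IsOpen D) (hf : ContDiffOn ℝ ∞ f D) {x : ℝ}
    (hx : x ∈ D) : DifferentiableAt ℝ f x :=
  (hf.differentiableOn (by simp)).differentiableAt (hD.mem_nhds hx)

theorem _root_.ContDiffOn.smooth_hasDerivAt (hD : IsOpen D) (hf : ContDiffOn ℝ ∞ f D) {x : ℝ}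
    (hx : x ∈ D) : HasDerivAt f (deriv f x) x :=
  (hf.smooth_differentiableAt hD hx).hasDerivAt

theorem _root_.ContDiffOn.smooth_iteratedDeriv (hD : IsOpen D) (hf : ContDiffOn ℝ ∞ f D) (n : ℕ) :
    ContDiffOn ℝ ∞ (iteratedDeriv n f) D := by
  induction n with
  | zero => simpa using hf
  | succ n ih => rw [iteratedDeriv_succ]; exact ih.smooth_deriv hD

theorem iteratedDeriv_eqOn (hD : IsOpen D) (h : EqOn f g D) (n : ℕ) :
    EqOn (iteratedDeriv n f) (iteratedDeriv n g) D := by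
  induction n with
  | zero => simpa using h
  | succ n ih =>
    rw [iteratedDeriv_succ, iteratedDeriv_succ]
    intro x hx
    exact (ih.eventuallyEq_of_mem (hD.mem_nhds hx)).deriv_eq

theorem deriv_eqOn (hD : IsOpen D) (h : EqOn f g D) : EqOn (deriv f) (deriv g) D :=
  fun _ hx => (h.eventuallyEq_of_mem (hD.mem_nhds hx)).deriv_eq

theorem iteratedDeriv_two (f : ℝ → ℝ) : iteratedDeriv 2 f = deriv (deriv f) := by
  rw [iteratedDeriv_succ, iteratedDeriv_one]

theorem wronskian_eqOn (hD : IsOpen D) {n : ℕ} {F G : Fin n → ℝ → ℝ}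
    (h : ∀ j, EqOn (F j) (G j) D) : EqOn (wronskian F) (wronskian G) D := by
  intro x hx
  unfold wronskian
  congr 1
  ext i j
  exact iteratedDeriv_eqOn hD (h j) i hx

theorem contDiffOn_wronskian (hD : IsOpen D) {n : ℕ} {F : Fin n → ℝ → ℝ}
    (h : ∀ j, ContDiffOn ℝ ∞ (F j) D) : ContDiffOn ℝ ∞ (wronskian F) D := by
  have : wronskian F = fun x => ∑ σ : Equiv.Perm (Fin n), (Equiv.Perm.sign σ : ℝ) *
      ∏ i, iteratedDeriv (σ i : ℕ) (F i) x := by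
    ext x
    simp [wronskian, Matrix.det_apply', Matrix.of_apply]
  rw [this]
  refine ContDiffOn.sum fun σ _ => contDiffOn_const.mul ?_
  exact contDiffOn_prod fun i _ => (h i).smooth_iteratedDeriv hD _

end Smooth

/-- The coefficient of `f^{(k)} ∘ η` in the `i`-th derivative of `h · (f ∘ η)`. -/
noncomputable def chainCoeff (h η : ℝ → ℝ) : ℕ → ℕ → ℝ → ℝ
  | 0, 0 => h
  | 0, _ + 1 => 0
  | i + 1, 0 => deriv (chainCoeff h η i 0)
  | i + 1, k + 1 => fun x =>
      deriv (chainCoeff h η i (k + 1)) x + deriv η x * chainCoeff h η i k x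

/-! ### Wronskians under a gauge factor and a change of variable -/

section Chain

variable {D D' : Set ℝ} {h η : ℝ → ℝ}

theorem contDiffOn_chainCoeff (hD : IsOpen D) (hh : ContDiffOn ℝ ∞ h D) (hη : ContDiffOn ℝ ∞ η D)
    (i k : ℕ) : ContDiffOn ℝ ∞ (chainCoeff h η i k) D := by
  induction i generalizing k with
  | zero =>
    cases k with
    | zero => simpa [chainCoeff] using hh
    | succ k => exact contDiffOn_const
  | succ i ih =>
    cases k with
    | zero => exact (ih 0).smooth_deriv hD
    | succ k => exact ((ih _).smooth_deriv hD).add ((hη.smooth_deriv hD).mul (ih k))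

theorem chainCoeff_of_lt {i k : ℕ} (hik : i < k) : chainCoeff h η i k = 0 := by
  induction i generalizing k with
  | zero =>
    cases k with
    | zero => omega
    | succ k => rfl
  | succ i ih =>
    cases k with
    | zero => omega
    | succ k =>
      funext x
      simp only [chainCoeff, ih (show i < k + 1 by omega), ih (show i < k by omega)]
      simp

theorem chainCoeff_self (i : ℕ) (x : ℝ) : chainCoeff h η i i x = h x * deriv η x ^ i := by
  induction i with
  | zero => simp [chainCoeff]
  | succ i ih =>
    simp only [chainCoeff, chainCoeff_of_lt (show i < i + 1 by omega), ih]
    simp [pow_succ]; ring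

/-- The bound `n` is free above `i` because `chainCoeff` vanishes above the diagonal. It will be the
size of a Wronskian, so that all rows are sums over the same range. -/
theorem iteratedDeriv_mul_comp (hD : IsOpen D) (hD' : IsOpen D') (hh : ContDiffOn ℝ ∞ h D)
    (hη : ContDiffOn ℝ ∞ η D) (hmap : MapsTo η D D') {f : ℝ → ℝ} (hf : ContDiffOn ℝ ∞ f D')
    (i : ℕ) {n : ℕ} (hn : i < n) {x : ℝ} (hx : x ∈ D) :
    iteratedDeriv i (fun y => h y * f (η y)) x
      = ∑ k ∈ Finset.range n, chainCoeff h η i k x * iteratedDeriv k f (η x) := by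
  have ext_n : ∀ i x, (∑ k ∈ Finset.range (i + 1), chainCoeff h η i k x * iteratedDeriv k f (η x))
      = ∑ k ∈ Finset.range (i + 2), chainCoeff h η i k x * iteratedDeriv k f (η x) := by
    intro i x
    rw [Finset.sum_range_succ _ (i + 1), chainCoeff_of_lt (show i < i + 1 by omega)]
    simp
  have key : ∀ i, EqOn (iteratedDeriv i (fun y => h y * f (η y)))
      (fun x => ∑ k ∈ Finset.range (i + 1), chainCoeff h η i k x * iteratedDeriv k f (η x)) D := by
    intro i
    induction i with
    | zero => intro x _; simp [chainCoeff]
    | succ i ih =>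
      intro x hx
      rw [iteratedDeriv_succ, deriv_eqOn hD ih hx]
      have hd : ∀ k, HasDerivAt (fun x => chainCoeff h η i k x * iteratedDeriv k f (η x))
          (deriv (chainCoeff h η i k) x * iteratedDeriv k f (η x)
            + chainCoeff h η i k x * (iteratedDeriv (k + 1) f (η x) * deriv η x)) x := by
        intro k
        have h1 := (contDiffOn_chainCoeff hD hh hη i k).smooth_hasDerivAt hD hx
        have h2 : HasDerivAt (iteratedDeriv k f) (iteratedDeriv (k + 1) f (η x)) (η x) := by
          rw [iteratedDeriv_succ]
          exact (hf.smooth_iteratedDeriv hD' k).smooth_hasDerivAt hD' (hmap hx)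
        exact h1.mul (h2.comp x (hη.smooth_hasDerivAt hD hx))
      rw [(HasDerivAt.fun_sum fun k _ => hd k).deriv]
      simp only
      -- The index `0` is split off because `chainCoeff` has a separate clause there; the shifted
      -- sums then agree term by term.
      rw [Finset.sum_add_distrib, Finset.sum_range_succ' _ (i + 1)]
      simp only [chainCoeff, add_mul, Finset.sum_add_distrib]
      have e1 : ∑ k ∈ Finset.range (i + 1), deriv (chainCoeff h η i k) x * iteratedDeriv k f (η x)
          = ∑ k ∈ Finset.range (i + 1),
              deriv (chainCoeff h η i (k + 1)) x * iteratedDeriv (k + 1) f (η x)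
            + deriv (chainCoeff h η i 0) x * iteratedDeriv 0 f (η x) := by
        rw [← Finset.sum_range_succ' (fun k => deriv (chainCoeff h η i k) x * iteratedDeriv k f (η x)),
          Finset.sum_range_succ _ (i + 1), chainCoeff_of_lt (show i < i + 1 by omega)]
        simp
      rw [e1]
      have e2 : ∑ k ∈ Finset.range (i + 1),
          chainCoeff h η i k x * (iteratedDeriv (k + 1) f (η x) * deriv η x)
          = ∑ k ∈ Finset.range (i + 1),
            deriv η x * chainCoeff h η i k x * iteratedDeriv (k + 1) f (η x) :=
        Finset.sum_congr rfl fun k _ => by ring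
      rw [e2]; ring
  rw [key i hx]
  refine Finset.sum_subset (Finset.range_subset_range.2 hn) fun k _ hk => ?_
  rw [chainCoeff_of_lt (by simpa using hk)]
  simp

/-- The Wronskian matrix is the lower triangular matrix of `chainCoeff` times the Wronskian matrix
in the new variable. The diagonal entries `h η'^i` produce the exponent `0 + 1 + ⋯ + (n - 1)` of
`η'`. -/
theorem wronskian_mul_comp (hD : IsOpen D) (hD' : IsOpen D') (hh : ContDiffOn ℝ ∞ h D)
    (hη : ContDiffOn ℝ ∞ η D) (hmap : MapsTo η D D') {n : ℕ} {f : Fin n → ℝ → ℝ}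
    (hf : ∀ j, ContDiffOn ℝ ∞ (f j) D') {x : ℝ} (hx : x ∈ D) :
    wronskian (fun j y => h y * f j (η y)) x
      = h x ^ n * deriv η x ^ (n * (n - 1) / 2) * wronskian f (η x) := by
  have hmat : (Matrix.of fun i j : Fin n => iteratedDeriv (i : ℕ) (fun y => h y * f j (η y)) x)
      = (Matrix.of fun i k : Fin n => chainCoeff h η i k x)
        * Matrix.of fun i j : Fin n => iteratedDeriv (i : ℕ) (f j) (η x) := by
    ext i j
    simp only [Matrix.of_apply, Matrix.mul_apply]
    rw [iteratedDeriv_mul_comp hD hD' hh hη hmap (hf j) i i.2 hx, Finset.sum_range]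
  have hdet : (Matrix.of fun i k : Fin n => chainCoeff h η i k x).det
      = h x ^ n * deriv η x ^ (n * (n - 1) / 2) := by
    rw [Matrix.det_of_isLowerTriangular]
    · simp only [Matrix.of_apply, chainCoeff_self, Finset.prod_mul_distrib, Finset.prod_const,
        Finset.card_univ, Fintype.card_fin]
      rw [Finset.prod_pow_eq_pow_sum, Fin.sum_univ_eq_sum_range (fun i => i), Finset.sum_range_id]
    · intro i j hij
      have : (i : ℕ) < j := by simpa using hij
      simp [chainCoeff_of_lt this]
  unfold wronskian
  rw [hmat, Matrix.det_mul, hdet]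

theorem wronskian_mul (hD : IsOpen D) (hh : ContDiffOn ℝ ∞ h D) {n : ℕ} {f : Fin n → ℝ → ℝ}
    (hf : ∀ j, ContDiffOn ℝ ∞ (f j) D) {x : ℝ} (hx : x ∈ D) :
    wronskian (fun j y => h y * f j y) x = h x ^ n * wronskian f x := by
  have := wronskian_mul_comp hD hD hh contDiffOn_id (mapsTo_id D) hf hx
  simpa using this

end Chain

/-! ### The Darboux transformation -/

/-- The Darboux transform `w' - (u'/u) w` of `w` with seed `u`. -/
noncomputable def darboux (u w : ℝ → ℝ) (x : ℝ) : ℝ := deriv w x - deriv u x / u x * w x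

section Darboux

variable {D : Set ℝ} {u w : ℝ → ℝ}

theorem contDiffOn_darboux (hD : IsOpen D) (hu : ContDiffOn ℝ ∞ u D) (hw : ContDiffOn ℝ ∞ w D)
    (h0 : ∀ x ∈ D, u x ≠ 0) : ContDiffOn ℝ ∞ (darboux u w) D :=
  (hw.smooth_deriv hD).sub (((hu.smooth_deriv hD).div hu h0).mul hw)

theorem darboux_eq_mul_deriv_div (hD : IsOpen D) (hu : ContDiffOn ℝ ∞ u D)
    (hw : ContDiffOn ℝ ∞ w D) (h0 : ∀ x ∈ D, u x ≠ 0) :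
    EqOn (darboux u w) (fun x => u x * deriv (fun y => w y / u y) x) D := by
  intro x hx
  have h1 := (hw.smooth_hasDerivAt hD hx).div (hu.smooth_hasDerivAt hD hx) (h0 x hx)
  have h2 : deriv (fun y => w y / u y) x = _ := h1.deriv
  simp only [h2, darboux]
  have := h0 x hx
  field_simp

theorem darboux_congr (hD : IsOpen D) {u' w' : ℝ → ℝ} (hu : EqOn u u' D) (hw : EqOn w w' D) :
    EqOn (darboux u w) (darboux u' w') D := by
  intro x hx
  simp only [darboux, deriv_eqOn hD hu hx, deriv_eqOn hD hw hx, hu hx, hw hx]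

/-- The Wronskian of a family factors through the Darboux transform by its first member. -/
theorem wronskian_succ (hD : IsOpen D) {n : ℕ} {F : Fin (n + 1) → ℝ → ℝ}
    (hF : ∀ j, ContDiffOn ℝ ∞ (F j) D) (h0 : ∀ x ∈ D, F 0 x ≠ 0) {x : ℝ} (hx : x ∈ D) :
    wronskian F x = F 0 x * wronskian (fun j : Fin n => darboux (F 0) (F j.succ)) x := by
  -- After division by `F 0` the first function is `1`, whose column is `(1, 0, …, 0)`. Expanding
  -- along it leaves the Wronskian of the derivatives of `F j / F 0`, and these are the Darboux
  -- transforms divided by `F 0`.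
  have hq : ∀ j, ContDiffOn ℝ ∞ (fun y => F j y / F 0 y) D := fun j => (hF j).div (hF 0) h0
  have h1 : wronskian F x = F 0 x ^ (n + 1) * wronskian (fun j y => F j y / F 0 y) x := by
    rw [← wronskian_mul hD (hF 0) hq hx]
    refine wronskian_eqOn hD (fun j y hy => ?_) hx
    have := h0 y hy
    field_simp
  have h2 : wronskian (fun j : Fin n => darboux (F 0) (F j.succ)) x
      = F 0 x ^ n * wronskian (fun (j : Fin n) => deriv (fun y => F j.succ y / F 0 y)) x := by
    rw [← wronskian_mul hD (hF 0) (fun j => (hq j.succ).smooth_deriv hD) hx]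
    exact wronskian_eqOn hD (fun j => darboux_eq_mul_deriv_div hD (hF 0) (hF j.succ) h0) hx
  have hone : EqOn (fun y => F 0 y / F 0 y) (fun _ => 1) D := fun y hy => div_self (h0 y hy)
  have h3 : wronskian (fun j y => F j y / F 0 y) x
      = wronskian (fun (j : Fin n) => deriv (fun y => F j.succ y / F 0 y)) x := by
    unfold wronskian
    rw [Matrix.det_succ_column_zero, Fin.sum_univ_succ, Finset.sum_eq_zero]
    · simp only [Matrix.of_apply, Fin.val_zero, pow_zero, one_mul, iteratedDeriv_zero, add_zero]
      rw [div_self (h0 x hx), one_mul]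
      congr 1
      ext i j
      simp [Matrix.submatrix_apply, iteratedDeriv_succ']
    · intro i _
      have : iteratedDeriv ((i.succ : Fin (n + 1)) : ℕ) (fun y => F 0 y / F 0 y) x = 0 := by
        rw [iteratedDeriv_eqOn hD hone _ hx, Fin.val_succ, iteratedDeriv_succ']
        simp
      simp only [Matrix.of_apply, this]
      simp
  rw [h1, h2, h3]; ring

end Darboux

/-! ### Asymptotics at the ends of an interval -/

/-- The part of `D` between an end and the point `t`. -/
def sideSet (D : Set ℝ) (left : Bool) (t : ℝ) : Set ℝ := D ∩ (if left then Iio t else Ioi t)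

/-- Rate functions and asymptotic data at an end of the interval `D`: the filter `l` of
neighbourhoods of the end, a rate `r` with primitive `R` tending to infinity, and a reference
weight `ρ`. -/
structure IsEnd (D : Set ℝ) (ρ : ℝ → ℝ) (left : Bool) (l : Filter ℝ) (r R : ℝ → ℝ) (κ θ : ℝ) :
    Prop where
  basis : l.HasBasis (· ∈ D) (sideSet D left)
  neBot : l.NeBot
  countable : l.IsCountablyGenerated
  R_deriv : ∀ x ∈ D, HasDerivAt R (r x) x
  r_smooth : ContDiffOn ℝ ∞ r D
  R_top : Tendsto R l atTop
  r_top : Tendsto (fun x => |r x|) l atTop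
  κ_lim : Tendsto (fun x => deriv r x / (r x * r x)) l (𝓝 κ)
  κ_nonneg : 0 ≤ κ
  κ_le : κ ≤ 1
  sign : ∀ x ∈ D, if left then r x < 0 else 0 < r x
  ρ_rate : Tendsto (fun x => deriv ρ x / (ρ x * r x)) l (𝓝 (-θ))
  θ_nonneg : 0 ≤ θ
  θ_le : θ ≤ 1 / 2
  ρ_dom : ∃ C : ℝ, ∀ᶠ x in l, Real.exp (-R x / 2) ≤ C * ρ x

/-- `f` behaves like `exp (c R)`, where `R' = r`, in the sense of logarithmic derivatives. -/
def HasRate (l : Filter ℝ) (r f : ℝ → ℝ) (c : ℝ) : Prop :=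
  (∀ᶠ x in l, f x ≠ 0) ∧ Tendsto (fun x => deriv f x / (f x * r x)) l (𝓝 c)

/-- `f` is asymptotic to a nonzero constant times `g`. -/
def AsymC (l : Filter ℝ) (f g : ℝ → ℝ) : Prop :=
  ∃ C : ℝ, C ≠ 0 ∧ Tendsto (fun x => f x / g x) l (𝓝 C)

namespace AsymC

variable {l : Filter ℝ} {f g h f' g' : ℝ → ℝ}

theorem eventually_ne (hfg : AsymC l f g) : ∀ᶠ x in l, f x ≠ 0 ∧ g x ≠ 0 := by
  obtain ⟨C, hC, h⟩ := hfg
  filter_upwards [h.eventually_ne hC] with x hx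
  constructor <;> rintro h0 <;> simp [h0] at hx

theorem refl' (hf : ∀ᶠ x in l, f x ≠ 0) : AsymC l f f :=
  ⟨1, one_ne_zero, tendsto_const_nhds.congr' (by filter_upwards [hf] with x hx; rw [div_self hx])⟩

theorem symm (hfg : AsymC l f g) : AsymC l g f := by
  obtain ⟨C, hC, h⟩ := hfg
  exact ⟨C⁻¹, inv_ne_zero hC, (h.inv₀ hC).congr fun x => by rw [inv_div]⟩

theorem mul (hfg : AsymC l f g) (hfg' : AsymC l f' g') :
    AsymC l (fun x => f x * f' x) (fun x => g x * g' x) := by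
  obtain ⟨C, hC, h⟩ := hfg
  obtain ⟨C', hC', h'⟩ := hfg'
  exact ⟨C * C', mul_ne_zero hC hC', (h.mul h').congr fun x => by rw [div_mul_div_comm]⟩

theorem trans (hfg : AsymC l f g) (hgh : AsymC l g h) : AsymC l f h := by
  have hne := hfg.eventually_ne
  obtain ⟨C, hC, h1⟩ := hfg
  obtain ⟨C', hC', h2⟩ := hgh
  refine ⟨C * C', mul_ne_zero hC hC', (h1.mul h2).congr' ?_⟩
  filter_upwards [hne] with x hx
  rw [div_mul_div_cancel₀ hx.2]

theorem congr_left (hfg : AsymC l f g) (h : f =ᶠ[l] f') : AsymC l f' g := by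
  obtain ⟨C, hC, h1⟩ := hfg
  exact ⟨C, hC, h1.congr' (by filter_upwards [h] with x hx; rw [hx])⟩

theorem congr_right (hfg : AsymC l f g) (h : g =ᶠ[l] g') : AsymC l f g' := by
  obtain ⟨C, hC, h1⟩ := hfg
  exact ⟨C, hC, h1.congr' (by filter_upwards [h] with x hx; rw [hx])⟩

theorem prod {ι : Type*} (s : Finset ι) {F G : ι → ℝ → ℝ} (h : ∀ i ∈ s, AsymC l (F i) (G i)) :
    AsymC l (fun x => ∏ i ∈ s, F i x) (fun x => ∏ i ∈ s, G i x) := by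
  classical
  induction s using Finset.induction_on with
  | empty => exact ⟨1, one_ne_zero, by simpa using tendsto_const_nhds⟩
  | insert a s ha ih =>
    simp only [Finset.prod_insert ha]
    exact (h a (by simp)).mul (ih fun i hi => h i (by simp [hi]))

end AsymC

/-! ### L'Hôpital's rule at an end of an interval -/

section Lhopital

variable {D : Set ℝ} {left : Bool} {l : Filter ℝ}

theorem ordConnected_sideSet (hD : D.OrdConnected) (t : ℝ) : (sideSet D left t).OrdConnected := by
  unfold sideSet
  cases left
  · simpa using hD.inter ordConnected_Ioi
  · simpa using hD.inter ordConnected_Iio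

/-- Cauchy's mean value theorem: a ratio of increments is a ratio of derivatives at an intermediate
point. -/
theorem abs_sub_le_of_abs_deriv_le {S : Set ℝ} (hS : S.OrdConnected) {F G F' G' : ℝ → ℝ} {ε : ℝ}
    (hF : ∀ x ∈ S, HasDerivAt F (F' x) x) (hG : ∀ x ∈ S, HasDerivAt G (G' x) x)
    (h0 : ∀ x ∈ S, G' x ≠ 0) (hle : ∀ x ∈ S, |F' x| ≤ ε * |G' x|) {x y : ℝ} (hx : x ∈ S)
    (hy : y ∈ S) : |F x - F y| ≤ ε * |G x - G y| := by
  wlog hxy : x < y generalizing x y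
  · rcases (not_lt.1 hxy).eq_or_lt with h | h
    · simp [h]
    · rw [abs_sub_comm, abs_sub_comm (G x)]; exact this hy hx h
  have hsub : Icc x y ⊆ S := hS.out hx hy
  obtain ⟨c, hc, he⟩ := exists_ratio_hasDerivAt_eq_ratio_slope F F' hxy
    (fun z hz => (hF z (hsub hz)).continuousAt.continuousWithinAt)
    (fun z hz => hF z (hsub (Ioo_subset_Icc_self hz))) G G'
    (fun z hz => (hG z (hsub hz)).continuousAt.continuousWithinAt)
    (fun z hz => hG z (hsub (Ioo_subset_Icc_self hz)))
  have hcS := hsub (Ioo_subset_Icc_self hc)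
  have hpos : 0 < |G' c| := abs_pos.2 (h0 c hcS)
  have h1 : |G y - G x| * |F' c| = |F y - F x| * |G' c| := by rw [← abs_mul, ← abs_mul, he]
  rw [abs_sub_comm, abs_sub_comm (G x)]
  refine le_of_mul_le_mul_right ?_ hpos
  rw [← h1]
  nlinarith [hle c hcS, abs_nonneg (G y - G x)]

/-- A function with nonvanishing derivative which tends to zero at an end has no zeros. -/
theorem ne_zero_of_tendsto_zero_end (hb : l.HasBasis (· ∈ D) (sideSet D left)) (hne : l.NeBot)
    {A : Set ℝ} (hA : A.OrdConnected) (hAl : A ∈ l) (hAD : A ⊆ D) {G G' : ℝ → ℝ}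
    (hcont : ContinuousOn G A) (hG : ∀ x ∈ interior A, HasDerivAt G (G' x) x)
    (h0 : ∀ x ∈ interior A, G' x ≠ 0) (hlim : Tendsto G l (𝓝 0)) {x : ℝ} (hx : x ∈ A) :
    G x ≠ 0 := by
  intro hx0
  have hcvx : Convex ℝ A := hA.convex
  -- Derivatives have the intermediate value property, so a nonvanishing one has constant sign and
  -- `G` is strictly monotone. A zero at `x` would then keep `G` away from `0` beyond a point `y`
  -- between `x` and the end.
  have hinj : StrictMonoOn G A ∨ StrictAntiOn G A := by
    rcases hasDerivWithinAt_forall_lt_or_forall_gt_of_forall_ne hcvx.interior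
      (fun z hz => (hG z hz).hasDerivWithinAt) h0 with h | h
    · exact Or.inr (strictAntiOn_of_deriv_neg hcvx hcont fun z hz => by
        rw [(hG z hz).deriv]; exact h z hz)
    · exact Or.inl (strictMonoOn_of_deriv_pos hcvx hcont fun z hz => by
        rw [(hG z hz).deriv]; exact h z hz)
  obtain ⟨y, hy, hyt⟩ := hne.nonempty_of_mem (inter_mem (hb.mem_of_mem (hAD hx)) hAl)
  have hlim0 : ∀ {P : ℝ → Prop}, (∀ z ∈ sideSet D left y, z ∈ A → P (G z)) →
      ∀ᶠ z in l, P (G z) := fun hP => by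
    filter_upwards [hb.mem_of_mem (hAD hyt), hAl] with z h1 h2 using hP z h1 h2
  cases left
  · have hxy : x < y := by simpa [sideSet] using hy.2
    rcases hinj with h | h
    · have : G y ≤ 0 := ge_of_tendsto hlim (hlim0 (P := fun v => G y ≤ v) fun z h1 h2 =>
        (h hyt h2 (by simpa [sideSet] using h1.2)).le)
      have := h hx hyt hxy
      linarith
    · have : 0 ≤ G y := le_of_tendsto hlim (hlim0 (P := fun v => v ≤ G y) fun z h1 h2 =>
        (h hyt h2 (by simpa [sideSet] using h1.2)).le)
      have := h hx hyt hxy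
      linarith
  · have hxy : y < x := by simpa [sideSet] using hy.2
    rcases hinj with h | h
    · have : 0 ≤ G y := le_of_tendsto hlim (hlim0 (P := fun v => v ≤ G y) fun z h1 h2 =>
        (h h2 hyt (by simpa [sideSet] using h1.2)).le)
      have := h hyt hx hxy
      linarith
    · have : G y ≤ 0 := ge_of_tendsto hlim (hlim0 (P := fun v => G y ≤ v) fun z h1 h2 =>
        (h h2 hyt (by simpa [sideSet] using h1.2)).le)
      have := h hyt hx hxy
      linarith

/-- L'Hôpital's rule at an end, in the forms `0/0` and `∞/∞`. -/
theorem lhopital_end (hb : l.HasBasis (· ∈ D) (sideSet D left)) (hne : l.NeBot)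
    (hD : D.OrdConnected) {F G F' G' : ℝ → ℝ} {c : ℝ}
    (hF : ∀ᶠ x in l, HasDerivAt F (F' x) x) (hG : ∀ᶠ x in l, HasDerivAt G (G' x) x)
    (h0 : ∀ᶠ x in l, G' x ≠ 0) (hlim : Tendsto (fun x => F' x / G' x) l (𝓝 c))
    (hcase : (Tendsto F l (𝓝 0) ∧ Tendsto G l (𝓝 0)) ∨ Tendsto (fun x => |G x|) l atTop) :
    Tendsto (fun x => F x / G x) l (𝓝 c) := by
  -- Subtracting `c G` reduces the claim to the limit `0`; near the end the increments of `H` are at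
  -- most `ε` times those of `G`.
  set H : ℝ → ℝ := fun x => F x - c * G x with hH
  have hHd : ∀ᶠ x in l, HasDerivAt H (F' x - c * G' x) x := by
    filter_upwards [hF, hG] with x h1 h2 using h1.sub (h2.const_mul c)
  have key : ∀ ε > 0, ∃ t ∈ D, ∀ x ∈ sideSet D left t, ∀ y ∈ sideSet D left t,
      |H x - H y| ≤ ε * |G x - G y| := by
    intro ε hε
    have h3 : ∀ᶠ x in l, |F' x - c * G' x| ≤ ε * |G' x| := by
      filter_upwards [(Metric.tendsto_nhds.1 hlim) ε hε, h0] with x hx h0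
      rw [Real.dist_eq] at hx
      have : F' x - c * G' x = (F' x / G' x - c) * G' x := by field_simp
      rw [this, abs_mul]
      gcongr
    obtain ⟨t, ht, hs⟩ := hb.eventually_iff.1 (hHd.and (hG.and (h0.and h3)))
    exact ⟨t, ht, fun x hx y hy => abs_sub_le_of_abs_deriv_le (ordConnected_sideSet hD t)
      (fun z hz => (hs hz).1) (fun z hz => (hs hz).2.1) (fun z hz => (hs hz).2.2.1)
      (fun z hz => (hs hz).2.2.2) hx hy⟩
  have hGne : Tendsto (fun x => H x / G x) l (𝓝 0) := by
    rw [Metric.tendsto_nhds]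
    intro ε hε
    obtain ⟨t, ht, hs⟩ := key (ε / 2) (by positivity)
    have hmem : sideSet D left t ∈ l := hb.mem_of_mem ht
    rcases hcase with ⟨hF0, hG0⟩ | hGt
    · have hH0 : Tendsto H l (𝓝 0) := by simpa using hF0.sub (hG0.const_mul c)
      filter_upwards [hmem] with x hx
      have : |H x - 0| ≤ ε / 2 * |G x - 0| :=
        le_of_tendsto_of_tendsto (tendsto_const_nhds.sub hH0).abs
          ((tendsto_const_nhds.sub hG0).abs.const_mul _)
          (by filter_upwards [hmem] with y hy using hs x hx y hy)
      rw [sub_zero, sub_zero] at this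
      rw [Real.dist_eq, sub_zero, abs_div]
      rcases (abs_nonneg (G x)).eq_or_lt with h | h
      · rw [← h]; simpa using hε
      · rw [div_lt_iff₀ h]; nlinarith
    · obtain ⟨y, hy⟩ := hne.nonempty_of_mem hmem
      filter_upwards [hmem, hGt.eventually_gt_atTop
        (2 / ε * (|H y| + ε / 2 * |G y|)), hGt.eventually_gt_atTop 0] with x hx h1 h2
      have h3 := hs x hx y hy
      have h4 : |H x| ≤ |H x - H y| + |H y| := by
        have := abs_add_le (H x - H y) (H y); simpa using this
      have h5 : |G x - G y| ≤ |G x| + |G y| := abs_sub _ _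
      have h6 : ε / 2 * (2 / ε * (|H y| + ε / 2 * |G y|)) = |H y| + ε / 2 * |G y| := by
        field_simp
      rw [Real.dist_eq, sub_zero, abs_div, div_lt_iff₀ h2]
      nlinarith
  -- The identity `F / G = H / G + c` needs `G ≠ 0`. In the form `0/0` this holds because `G` is
  -- strictly monotone up to its limit `0`.
  have hGnz : ∀ᶠ x in l, G x ≠ 0 := by
    rcases hcase with ⟨_, hG0⟩ | hGt
    · obtain ⟨t, ht, hs⟩ := hb.eventually_iff.1 (hG.and h0)
      filter_upwards [hb.mem_of_mem ht] with x hx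
      exact ne_zero_of_tendsto_zero_end hb hne (ordConnected_sideSet hD t) (hb.mem_of_mem ht)
        inter_subset_left (fun z hz => (hs hz).1.continuousAt.continuousWithinAt)
        (fun z hz => (hs (interior_subset hz)).1) (fun z hz => (hs (interior_subset hz)).2) hG0 hx
    · filter_upwards [hGt.eventually_gt_atTop 0] with x hx using abs_pos.1 hx
  have : Tendsto (fun x => H x / G x + c) l (𝓝 (0 + c)) := hGne.add_const c
  rw [zero_add] at this
  refine this.congr' ?_
  filter_upwards [hGnz] with x hx
  simp only [hH]
  field_simp
  ring

end Lhopital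

namespace IsEnd

variable {D : Set ℝ} {ρ : ℝ → ℝ} {left : Bool} {l : Filter ℝ} {r R : ℝ → ℝ} {κ θ : ℝ}

theorem mem (he : IsEnd D ρ left l r R κ θ) : D ∈ l := by
  obtain ⟨t, ht, h⟩ := he.basis.mem_iff.1 (univ_mem : univ ∈ l)
  exact mem_of_superset (he.basis.mem_of_mem ht) inter_subset_left

theorem r_ne (he : IsEnd D ρ left l r R κ θ) {x : ℝ} (hx : x ∈ D) : r x ≠ 0 := by
  have := he.sign x hx
  cases left
  · exact (show 0 < r x by simpa using this).ne'
  · exact (show r x < 0 by simpa using this).ne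

theorem inv_r (he : IsEnd D ρ left l r R κ θ) : Tendsto (fun x => (r x)⁻¹) l (𝓝 0) :=
  (tendsto_zero_iff_abs_tendsto_zero _).2
    (he.r_top.inv_tendsto_atTop.congr fun x => by simp [abs_inv])

/-- So `κ` is the rate of `r` itself. It is `1` at the finite singular ends met below and `0` for `r
= x` at infinity. -/
theorem r_rate (he : IsEnd D ρ left l r R κ θ) : HasRate l r r κ :=
  ⟨by filter_upwards [he.mem] with x hx using he.r_ne hx, he.κ_lim⟩

end IsEnd

/-! ### Calculus of rates and their change under a Darboux step -/

section Rate

variable {D : Set ℝ} {ρ : ℝ → ℝ} {left : Bool} {l : Filter ℝ} {r R : ℝ → ℝ} {κ θ : ℝ}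
  {f g : ℝ → ℝ} {a b c c' : ℝ}

theorem HasRate.congr (he : IsEnd D ρ left l r R κ θ) (hD : IsOpen D) (hf : HasRate l r f c)
    (h : EqOn f g D) : HasRate l r g c := by
  refine ⟨?_, hf.2.congr' ?_⟩
  · filter_upwards [hf.1, he.mem] with x hx hxD using by rwa [← h hxD]
  · filter_upwards [he.mem] with x hx
    rw [deriv_eqOn hD h hx, h hx]

theorem HasRate.mul (he : IsEnd D ρ left l r R κ θ) (hf' : ∀ x ∈ D, DifferentiableAt ℝ f x)
    (hg' : ∀ x ∈ D, DifferentiableAt ℝ g x)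
    (hf : HasRate l r f a) (hg : HasRate l r g b) : HasRate l r (fun x => f x * g x) (a + b) := by
  refine ⟨?_, (hf.2.add hg.2).congr' ?_⟩
  · filter_upwards [hf.1, hg.1] with x h1 h2 using mul_ne_zero h1 h2
  · filter_upwards [hf.1, hg.1, he.mem] with x h1 h2 hx
    have := ((hf' x hx).hasDerivAt.mul (hg' x hx).hasDerivAt).deriv
    simp only [Pi.mul_def] at this
    rw [this]
    have := he.r_ne hx
    field_simp

theorem HasRate.div (he : IsEnd D ρ left l r R κ θ) (hf' : ∀ x ∈ D, DifferentiableAt ℝ f x)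
    (hg' : ∀ x ∈ D, DifferentiableAt ℝ g x)
    (hf : HasRate l r f a) (hg : HasRate l r g b) : HasRate l r (fun x => f x / g x) (a - b) := by
  refine ⟨?_, (hf.2.sub hg.2).congr' ?_⟩
  · filter_upwards [hf.1, hg.1] with x h1 h2 using div_ne_zero h1 h2
  · filter_upwards [hf.1, hg.1, he.mem] with x h1 h2 hx
    have := ((hf' x hx).hasDerivAt.div (hg' x hx).hasDerivAt h2).deriv
    simp only [Pi.div_def] at this
    rw [this]
    have := he.r_ne hx
    field_simp

/-- `log |f|` and `R` have derivatives `f'/f` and `r`, and `R` tends to infinity, so l'Hôpital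
applies. This converts a rate into exponential bounds with an arbitrarily small loss in the
exponent. -/
theorem HasRate.tendsto_log (he : IsEnd D ρ left l r R κ θ) (hD : D.OrdConnected)
    (hf' : ∀ x ∈ D, DifferentiableAt ℝ f x) (hf : HasRate l r f c) :
    Tendsto (fun x => Real.log |f x| / R x) l (𝓝 c) := by
  refine lhopital_end (F' := fun x => deriv f x / f x) (G' := r) he.basis he.neBot hD ?_ ?_ ?_ ?_
    (Or.inr (tendsto_abs_atTop_atTop.comp he.R_top))
  · filter_upwards [hf.1, he.mem] with x h hx
    simpa only [Real.log_abs] using (hf' x hx).hasDerivAt.log h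
  · filter_upwards [he.mem] with x hx using he.R_deriv x hx
  · filter_upwards [he.mem] with x hx using he.r_ne hx
  · simpa only [div_div] using hf.2

theorem HasRate.abs_le_exp (he : IsEnd D ρ left l r R κ θ) (hD : D.OrdConnected)
    (hf' : ∀ x ∈ D, DifferentiableAt ℝ f x) (hf : HasRate l r f c) (hc : c < c') :
    ∀ᶠ x in l, |f x| ≤ Real.exp (c' * R x) := by
  filter_upwards [(hf.tendsto_log he hD hf').eventually_lt_const hc, hf.1,
    he.R_top.eventually_gt_atTop 0] with x h1 h2 h3
  rw [div_lt_iff₀ h3] at h1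
  rw [← Real.log_le_iff_le_exp (abs_pos.2 h2)]
  exact h1.le

theorem HasRate.exp_le_abs (he : IsEnd D ρ left l r R κ θ) (hD : D.OrdConnected)
    (hf' : ∀ x ∈ D, DifferentiableAt ℝ f x) (hf : HasRate l r f c) (hc : c' < c) :
    ∀ᶠ x in l, Real.exp (c' * R x) ≤ |f x| := by
  filter_upwards [(hf.tendsto_log he hD hf').eventually_const_lt hc, hf.1,
    he.R_top.eventually_gt_atTop 0] with x h1 h2 h3
  rw [lt_div_iff₀ h3] at h1
  rw [← Real.le_log_iff_exp_le (abs_pos.2 h2)]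
  exact h1.le

theorem HasRate.tendsto_zero (he : IsEnd D ρ left l r R κ θ) (hD : D.OrdConnected)
    (hf' : ∀ x ∈ D, DifferentiableAt ℝ f x) (hf : HasRate l r f c) (hc : c < 0) :
    Tendsto f l (𝓝 0) := by
  have h := hf.abs_le_exp he hD hf' (show c < c / 2 by linarith)
  refine (tendsto_zero_iff_abs_tendsto_zero _).2 ?_
  refine squeeze_zero' (Eventually.of_forall fun x => abs_nonneg _) h ?_
  exact Real.tendsto_exp_atBot.comp (he.R_top.const_mul_atTop_of_neg (by linarith))

theorem HasRate.tendsto_abs_atTop (he : IsEnd D ρ left l r R κ θ) (hD : D.OrdConnected)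
    (hf' : ∀ x ∈ D, DifferentiableAt ℝ f x) (hf : HasRate l r f c) (hc : 0 < c) :
    Tendsto (fun x => |f x|) l atTop := by
  have h := hf.exp_le_abs he hD hf' (show c / 2 < c by linarith)
  refine tendsto_atTop_mono' l h ?_
  exact Real.tendsto_exp_atTop.comp (he.R_top.const_mul_atTop (by linarith))

variable {u w : ℝ → ℝ}

/-- The Wronskian `u w' - u' w = u · darboux u w` of two solutions with the same decaying rate
tends to zero. -/
theorem tendsto_mul_darboux_zero (he : IsEnd D ρ left l r R κ θ) (hD : IsOpen D)
    (hDc : D.OrdConnected) (hu : ContDiffOn ℝ ∞ u D) (hw : ContDiffOn ℝ ∞ w D)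
    (hur : HasRate l r u c) (hwr : HasRate l r w c) (hc : 2 * c + κ < 0) :
    Tendsto (fun x => u x * darboux u w x) l (𝓝 0) := by
  have du := fun x hx => hu.smooth_differentiableAt hD (x := x) hx
  have dw := fun x hx => hw.smooth_differentiableAt hD (x := x) hx
  have dr := fun x hx => he.r_smooth.smooth_differentiableAt hD (x := x) hx
  -- The product `u w r` has rate `2 c + κ < 0`, and `u · darboux u w` is this product times a
  -- difference of logarithmic derivatives over `r`, which tends to `c - c = 0`.
  have h1 : Tendsto (fun x => u x * w x * r x) l (𝓝 0) :=
    HasRate.tendsto_zero he hDc (fun x hx => ((du x hx).mul (dw x hx)).mul (dr x hx))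
      (HasRate.mul he (fun x hx => (du x hx).mul (dw x hx)) dr (hur.mul he du dw hwr) he.r_rate)
      (by linarith)
  have h2 := h1.mul (hwr.2.sub hur.2)
  rw [zero_mul] at h2
  refine h2.congr' ?_
  filter_upwards [hur.1, hwr.1, he.mem] with x hux hwx hx
  have := he.r_ne hx
  simp only [darboux]
  field_simp

/-- The effect of a Darboux transformation on rates, for two functions of the same class. -/
theorem darboux_rate_same (he : IsEnd D ρ left l r R κ θ) (hD : IsOpen D)
    (hDc : D.OrdConnected) (hu : ContDiffOn ℝ ∞ u D) (hw : ContDiffOn ℝ ∞ w D)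
    (hu0 : ∀ x ∈ D, u x ≠ 0) (hur : HasRate l r u c) (hwr : HasRate l r w c) {Δ : ℝ} (hΔ : Δ ≠ 0)
    (hder : ∀ x ∈ D, deriv (darboux u w) x = Δ * w x - deriv u x / u x * darboux u w x)
    (hc : (2 * c + κ < 0 ∧ 2 * c - κ < 0) ∨ 0 < 2 * c - κ) :
    HasRate l r (darboux u w) (c - κ) ∧ AsymC l (darboux u w) (fun x => w x / r x) := by
  have du := fun x hx => hu.smooth_differentiableAt hD (x := x) hx
  have dw := fun x hx => hw.smooth_differentiableAt hD (x := x) hx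
  have dr := fun x hx => he.r_smooth.smooth_differentiableAt hD (x := x) hx
  have hne : 2 * c - κ ≠ 0 := by rcases hc with h | h <;> [exact h.2.ne; exact h.ne']
  have dv : ∀ x ∈ D, DifferentiableAt ℝ (fun x => u x * w x / r x) x := fun x hx =>
    ((du x hx).mul (dw x hx)).div (dr x hx) (he.r_ne hx)
  have hV : HasRate l r (fun x => u x * w x / r x) (2 * c - κ) := by
    have := HasRate.div he (fun x hx => (du x hx).mul (dw x hx)) dr (hur.mul he du dw hwr) he.r_rate
    rwa [← two_mul] at this
  -- The leading terms of `w'/w` and `u'/u` cancel, so the size of the Darboux transform is found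
  -- indirectly. The numerator has derivative `Δ u w`, while `u w / r` has rate `2 c - κ` and hence
  -- derivative asymptotic to `(2 c - κ) u w`.
  have hlim : Tendsto (fun x => (u x * darboux u w x) / (u x * w x / r x)) l
      (𝓝 (Δ / (2 * c - κ))) := by
    refine lhopital_end (F' := fun x => Δ * (u x * w x))
      (G' := deriv fun x => u x * w x / r x) he.basis he.neBot hDc ?_ ?_ ?_ ?_ ?_
    · filter_upwards [he.mem] with x hx
      have h1 := (du x hx).hasDerivAt.mul
        ((contDiffOn_darboux hD hu hw hu0).smooth_hasDerivAt hD hx)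
      rw [hder x hx] at h1
      refine h1.congr_deriv ?_
      have := hu0 x hx
      field_simp
      ring
    · filter_upwards [he.mem] with x hx using (dv x hx).hasDerivAt
    · filter_upwards [hV.2.eventually_ne hne] with x hx h0
      simp [h0] at hx
    · have := (tendsto_const_nhds (x := Δ)).div hV.2 hne
      refine this.congr' ?_
      filter_upwards [hur.1, hwr.1, he.mem, hV.2.eventually_ne hne] with x h1 h2 hx h3
      have := he.r_ne hx
      have h4 : deriv (fun x => u x * w x / r x) x ≠ 0 := fun h0 => by simp [h0] at h3
      simp only [Pi.div_apply]
      field_simp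
    · rcases hc with h | h
      · exact Or.inl ⟨tendsto_mul_darboux_zero he hD hDc hu hw hur hwr h.1,
          hV.tendsto_zero he hDc dv h.2⟩
      · exact Or.inr (hV.tendsto_abs_atTop he hDc dv h)
  have hC : Δ / (2 * c - κ) ≠ 0 := div_ne_zero hΔ hne
  have hasym : AsymC l (darboux u w) (fun x => w x / r x) := by
    refine ⟨_, hC, hlim.congr' ?_⟩
    filter_upwards [hur.1] with x hx
    field_simp
  refine ⟨⟨hasym.eventually_ne.mono fun x hx => hx.1, ?_⟩, hasym⟩
  obtain ⟨C, hC0, hCl⟩ := hasym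
  have huniq : C = Δ / (2 * c - κ) := by
    have := he.neBot
    refine tendsto_nhds_unique hCl (hlim.congr' ?_)
    filter_upwards [hur.1] with x hx
    field_simp
  -- Dividing `hder` by `r · darboux u w` gives the rate `Δ / C - c`, and `Δ / C = 2 c - κ` by the
  -- limit just found.
  have h5 : Tendsto (fun x => Δ * (darboux u w x / (w x / r x))⁻¹ - deriv u x / (u x * r x)) l
      (𝓝 (Δ * C⁻¹ - c)) := ((hCl.inv₀ hC0).const_mul Δ).sub hur.2
  have h6 : Δ * C⁻¹ - c = c - κ := by
    rw [huniq]; field_simp; ring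
  rw [h6] at h5
  refine h5.congr' ?_
  filter_upwards [hur.1, hwr.1, he.mem, hCl.eventually_ne hC0] with x h1 h2 hx h3
  have := he.r_ne hx
  have h4 : darboux u w x ≠ 0 := fun h0 => by simp [h0] at h3
  rw [hder x hx]
  field_simp

/-- The effect of a Darboux transformation on rates, for two functions of different classes. -/
theorem darboux_rate_opp (he : IsEnd D ρ left l r R κ θ) (hur : HasRate l r u a)
    (hwr : HasRate l r w b) (hab : a ≠ b) {Δ : ℝ}
    (hder : ∀ x ∈ D, deriv (darboux u w) x = Δ * w x - deriv u x / u x * darboux u w x) :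
    HasRate l r (darboux u w) (-a) ∧ AsymC l (darboux u w) (fun x => w x * r x) := by
  have hlim : Tendsto (fun x => darboux u w x / (w x * r x)) l (𝓝 (b - a)) := by
    refine (hwr.2.sub hur.2).congr' ?_
    filter_upwards [hur.1, hwr.1, he.mem] with x h1 h2 hx
    have := he.r_ne hx
    simp only [darboux]
    field_simp
  have hC : b - a ≠ 0 := sub_ne_zero.2 hab.symm
  have hasym : AsymC l (darboux u w) (fun x => w x * r x) := ⟨_, hC, hlim⟩
  refine ⟨⟨hasym.eventually_ne.mono fun x hx => hx.1, ?_⟩, hasym⟩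
  -- The transform has size `w r`, so the term with `Δ` is of order `r⁻²` after division and
  -- disappears; the rate is `-a` for every `Δ`.
  have h5 : Tendsto (fun x => Δ * (darboux u w x / (w x * r x))⁻¹ * ((r x)⁻¹ * (r x)⁻¹)
      - deriv u x / (u x * r x)) l (𝓝 (Δ * (b - a)⁻¹ * (0 * 0) - a)) :=
    (((hlim.inv₀ hC).const_mul Δ).mul (he.inv_r.mul he.inv_r)).sub hur.2
  rw [mul_zero, mul_zero, zero_sub] at h5
  refine h5.congr' ?_
  filter_upwards [hur.1, hwr.1, he.mem, hlim.eventually_ne hC] with x h1 h2 hx h3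
  have := he.r_ne hx
  have h4 : darboux u w x ≠ 0 := fun h0 => by simp [h0] at h3
  rw [hder x hx]
  field_simp

/-- Rates of the functions of class `σ = ±1` at an end with parameter `p`. -/
noncomputable def endRate (κ p : ℝ) (σ : ℤ) : ℝ := -σ * p - κ / 2

/-- In these parameters both cases read alike: the class of `w` is kept and `p` moves by `σ κ`. A
factor `r` is lost for equal classes and gained for opposite ones. For two growing functions the
needed inequality is `κ < p`, which follows from the bound on `p` and `κ ≤ 1`. -/
theorem darboux_rate (he : IsEnd D ρ left l r R κ θ) (hD : IsOpen D)
    (hDc : D.OrdConnected) (hu : ContDiffOn ℝ ∞ u D) (hw : ContDiffOn ℝ ∞ w D)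
    (hu0 : ∀ x ∈ D, u x ≠ 0) {p : ℝ} (hp : (1 + κ) / 2 < p) {σ σ' : ℤ} (hσ : σ = 1 ∨ σ = -1)
    (hσ' : σ' = 1 ∨ σ' = -1) (hur : HasRate l r u (endRate κ p σ))
    (hwr : HasRate l r w (endRate κ p σ')) {Δ : ℝ} (hΔ : σ = σ' → Δ ≠ 0)
    (hder : ∀ x ∈ D, deriv (darboux u w) x = Δ * w x - deriv u x / u x * darboux u w x) :
    HasRate l r (darboux u w) (endRate κ (p + σ * κ) σ') ∧
      AsymC l (darboux u w) (fun x => w x * r x ^ (-(σ * σ'))) := by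
  have h0 := he.κ_nonneg
  have h1 := he.κ_le
  by_cases hs : σ = σ'
  · subst hs
    have := darboux_rate_same he hD hDc hu hw hu0 hur hwr (hΔ rfl) hder (by
      unfold endRate
      rcases hσ with rfl | rfl
      · left; constructor <;> push_cast <;> linarith
      · right; push_cast; linarith)
    convert this using 2
    · unfold endRate
      rcases hσ with rfl | rfl <;> push_cast <;> ring
    · rcases hσ with rfl | rfl <;> ext x <;> simp [div_eq_mul_inv]
  · have := darboux_rate_opp he hur hwr (by
      unfold endRate
      intro h
      rcases hσ with rfl | rfl <;> rcases hσ' with rfl | rfl <;> push_cast at h <;>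
        first | exact hs rfl | linarith) hder
    convert this using 2
    · unfold endRate
      rcases hσ with rfl | rfl <;> rcases hσ' with rfl | rfl <;> push_cast <;>
        first | exact absurd rfl hs | ring
    · rcases hσ with rfl | rfl <;> rcases hσ' with rfl | rfl <;> ext x <;>
        first | exact absurd rfl hs | simp

end Rate

/-! ### Schrödinger equations on an interval and one Darboux step -/

/-- An open interval with asymptotic data at its left (`true`) and right (`false`) end. -/
structure Dom where
  D : Set ℝ
  ρ : ℝ → ℝ
  l : Bool → Filter ℝ
  r : Bool → ℝ → ℝ
  R : Bool → ℝ → ℝ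
  κ : Bool → ℝ
  θ : Bool → ℝ
  isEnd : ∀ b, IsEnd D ρ b (l b) (r b) (R b) (κ b) (θ b)
  isOpen : IsOpen D
  ordConnected : D.OrdConnected
  ρ_smooth : ContDiffOn ℝ ∞ ρ D
  ρ_pos : ∀ x ∈ D, 0 < ρ x
  ρ_le : ∀ x ∈ D, ρ x ≤ 1
  ρ_int : IntegrableOn ρ D

/-- The class at an end of a function of type `s = ±1`. -/
def endSign (b : Bool) (s : ℤ) : ℤ := if b then s else -s

theorem endSign_eq_or {b : Bool} {s : ℤ} (hs : s = 1 ∨ s = -1) :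
    endSign b s = 1 ∨ endSign b s = -1 := by
  rcases hs with rfl | rfl <;> cases b <;> simp [endSign]

theorem endSign_injective (b : Bool) : Function.Injective (endSign b) := by
  intro s s' h
  cases b <;> simpa [endSign] using h

/-- A seed of either type decays at one end and grows at the other; the arguments below choose the
end that suits them. -/
theorem exists_endSign_eq {s : ℤ} (hs : s = 1 ∨ s = -1) (σ : ℤ) (hσ : σ = 1 ∨ σ = -1) :
    ∃ b, endSign b s = σ := by
  rcases hs with rfl | rfl <;> rcases hσ with rfl | rfl
  exacts [⟨true, rfl⟩, ⟨false, rfl⟩, ⟨false, rfl⟩, ⟨true, rfl⟩]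

/-- Smooth solutions of `-f'' + U f = e f` on `D`. -/
structure IsSol (D : Set ℝ) (U : ℝ → ℝ) (e : ℝ) (f : ℝ → ℝ) : Prop where
  smooth : ContDiffOn ℝ ∞ f D
  ode : ∀ x ∈ D, deriv (deriv f) x = (U x - e) * f x

/-- The potential `U - 2 (log u)''` after a Darboux transformation with seed `u` of energy `e`. -/
noncomputable def darbouxPot (U : ℝ → ℝ) (e : ℝ) (u : ℝ → ℝ) (x : ℝ) : ℝ :=
  2 * (deriv u x / u x) ^ 2 - U x + 2 * e

section Sol

variable {D : Set ℝ} {U u w : ℝ → ℝ} {e e' : ℝ}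

/-- With `A = d/dx - u'/u` this is the factorisation `A† A w = (e' - e) w`. The other differential
identities for Darboux transforms come from it. -/
theorem deriv_darboux (hD : IsOpen D) (hu : IsSol D U e u) (hw : IsSol D U e' w)
    (h0 : ∀ x ∈ D, u x ≠ 0) {x : ℝ} (hx : x ∈ D) :
    deriv (darboux u w) x = (e - e') * w x - deriv u x / u x * darboux u w x := by
  have h1 := (hw.smooth.smooth_deriv hD).smooth_hasDerivAt hD hx
  have h2 := (hu.smooth.smooth_deriv hD).smooth_hasDerivAt hD hx
  have h3 := hu.smooth.smooth_hasDerivAt hD hx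
  have h4 := hw.smooth.smooth_hasDerivAt hD hx
  have h5 : HasDerivAt (darboux u w) _ x := h1.sub ((h2.div h3 (h0 x hx)).mul h4)
  rw [h5.deriv, hu.ode x hx, hw.ode x hx]
  simp only [darboux, Pi.div_apply]
  have := h0 x hx
  field_simp
  ring

/-- `u · darboux u w` is the Wronskian `u w' - u' w`. Monotonicity and Rolle arguments are applied
to this function because the potential has dropped out of its derivative. -/
theorem hasDerivAt_mul_darboux (hD : IsOpen D) (hu : IsSol D U e u) (hw : IsSol D U e' w)
    (h0 : ∀ x ∈ D, u x ≠ 0) {x : ℝ} (hx : x ∈ D) :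
    HasDerivAt (fun x => u x * darboux u w x) ((e - e') * (u x * w x)) x := by
  have h1 := (hu.smooth.smooth_hasDerivAt hD hx).mul
    ((contDiffOn_darboux hD hu.smooth hw.smooth h0).smooth_hasDerivAt hD hx)
  rw [deriv_darboux hD hu hw h0 hx] at h1
  refine h1.congr_deriv ?_
  have := h0 x hx
  field_simp
  ring

theorem IsSol.darboux (hD : IsOpen D) (hu : IsSol D U e u) (hw : IsSol D U e' w)
    (h0 : ∀ x ∈ D, u x ≠ 0) : IsSol D (darbouxPot U e u) e' (darboux u w) := by
  refine ⟨contDiffOn_darboux hD hu.smooth hw.smooth h0, fun x hx => ?_⟩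
  rw [deriv_eqOn hD (fun y hy => deriv_darboux hD hu hw h0 hy) hx]
  have h2 := (hu.smooth.smooth_deriv hD).smooth_hasDerivAt hD hx
  have h3 := hu.smooth.smooth_hasDerivAt hD hx
  have h4 := hw.smooth.smooth_hasDerivAt hD hx
  have h6 := (contDiffOn_darboux hD hu.smooth hw.smooth h0).smooth_hasDerivAt hD hx
  have h5 : HasDerivAt (fun x => (e - e') * w x - deriv u x / u x * MultiIndexed.darboux u w x) _ x :=
    (h4.const_mul (e - e')).sub ((h2.div h3 (h0 x hx)).mul h6)
  rw [h5.deriv, hu.ode x hx, deriv_darboux hD hu hw h0 hx]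
  have hw' : deriv w x = MultiIndexed.darboux u w x + deriv u x / u x * w x := by
    simp only [MultiIndexed.darboux]; ring
  rw [hw']
  simp only [darbouxPot, Pi.div_apply]
  have := h0 x hx
  field_simp
  ring

/-- `darbouxPot` is written in Riccati form, without second derivatives; the equation for `u`
recovers the usual expression with `(log u)''`. -/
theorem IsSol.deriv_deriv_log (hD : IsOpen D) (hu : IsSol D U e u) (h0 : ∀ x ∈ D, u x ≠ 0) {x : ℝ}
    (hx : x ∈ D) : darbouxPot U e u x = U x - 2 * deriv (deriv fun y => Real.log (u y)) x := by
  have h1 : EqOn (deriv fun y => Real.log (u y)) (fun y => deriv u y / u y) D := fun y hy =>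
    ((hu.smooth.smooth_hasDerivAt hD hy).log (h0 y hy)).deriv
  have h2 := (hu.smooth.smooth_deriv hD).smooth_hasDerivAt hD hx
  have h3 : deriv (fun y => deriv u y / u y) x = _ :=
    (h2.div (hu.smooth.smooth_hasDerivAt hD hx) (h0 x hx)).deriv
  rw [deriv_eqOn hD h1 hx, h3, hu.ode x hx, darbouxPot]
  have := h0 x hx
  field_simp
  ring

end Sol

namespace Dom

variable (𝓓 : Dom)

/-- The parameters at the ends after a Darboux transformation with a seed of type `s`. -/
noncomputable def shiftP (p : Bool → ℝ) (s : ℤ) (b : Bool) : ℝ := p b + endSign b s * 𝓓.κ b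

/-- Admissible seed functions of type `s = ±1` and energy `e`. -/
structure Seed (U : ℝ → ℝ) (p : Bool → ℝ) (e : ℝ) (s : ℤ) (u : ℝ → ℝ) : Prop where
  sol : IsSol 𝓓.D U e u
  ne_zero : ∀ x ∈ 𝓓.D, u x ≠ 0
  sign : s = 1 ∨ s = -1
  rate : ∀ b, HasRate (𝓓.l b) (𝓓.r b) u (endRate (𝓓.κ b) (p b) (endSign b s))

/-- Eigenfunctions: solutions decaying at both ends. -/
structure Eig (U : ℝ → ℝ) (p : Bool → ℝ) (E : ℝ) (φ : ℝ → ℝ) : Prop where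
  sol : IsSol 𝓓.D U E φ
  rate : ∀ b, HasRate (𝓓.l b) (𝓓.r b) φ (endRate (𝓓.κ b) (p b) 1)

/-- The parameters for which the ends are well separated. -/
def Good (p : Bool → ℝ) : Prop := ∀ b, (1 + 𝓓.κ b) / 2 < p b

variable {𝓓} {U u w φ : ℝ → ℝ} {p : Bool → ℝ} {e e' E : ℝ} {s s' : ℤ}

theorem Eig.darboux (hp : 𝓓.Good p) (hu : 𝓓.Seed U p e s u) (hφ : 𝓓.Eig U p E φ) (hE : e ≠ E) :
    𝓓.Eig (darbouxPot U e u) (𝓓.shiftP p s) E (darboux u φ) ∧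
      ∀ b, AsymC (𝓓.l b) (darboux u φ) (fun x => φ x * 𝓓.r b x ^ (-endSign b s)) := by
  have key := fun b => darboux_rate (𝓓.isEnd b) 𝓓.isOpen 𝓓.ordConnected hu.sol.smooth hφ.sol.smooth
    hu.ne_zero (hp b) (endSign_eq_or (b := b) hu.sign) (Or.inl rfl) (hu.rate b) (hφ.rate b)
    (fun _ => sub_ne_zero.2 hE)
    (fun x hx => deriv_darboux 𝓓.isOpen hu.sol hφ.sol hu.ne_zero hx)
  refine ⟨⟨hu.sol.darboux 𝓓.isOpen hφ.sol hu.ne_zero, fun b => (key b).1⟩, fun b => ?_⟩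
  simpa using (key b).2

theorem const_sign {f : ℝ → ℝ} (hc : ContinuousOn f 𝓓.D) (h0 : ∀ x ∈ 𝓓.D, f x ≠ 0) :
    (∀ x ∈ 𝓓.D, 0 < f x) ∨ ∀ x ∈ 𝓓.D, f x < 0 := by
  by_contra! h
  obtain ⟨⟨x, hx, hfx⟩, y, hy, hfy⟩ := h
  obtain ⟨z, hz, hfz⟩ := 𝓓.ordConnected.isPreconnected.intermediate_value hx hy hc ⟨hfx, hfy⟩
  exact h0 z hz hfz

/-- Rates are handled by `darboux_rate`; the point is that the transformed seed has no zeros, that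
is, that the Wronskian of `u` and `w` has none. Its derivative is a constant times `u w`, which has
constant sign. -/
theorem Seed.darboux (hp : 𝓓.Good p) (hu : 𝓓.Seed U p e s u) (hw : 𝓓.Seed U p e' s' w)
    (hE : s = s' → e ≠ e') :
    𝓓.Seed (darbouxPot U e u) (𝓓.shiftP p s) e' s' (darboux u w) ∧
      ∀ b, AsymC (𝓓.l b) (darboux u w) (fun x => w x * 𝓓.r b x ^ (-(s * s'))) := by
  have key := fun b => darboux_rate (𝓓.isEnd b) 𝓓.isOpen 𝓓.ordConnected hu.sol.smooth hw.sol.smooth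
    hu.ne_zero (hp b) (endSign_eq_or (b := b) hu.sign) (endSign_eq_or (b := b) hw.sign)
    (hu.rate b) (hw.rate b) (fun h => sub_ne_zero.2 (hE (endSign_injective b h)))
    (fun x hx => deriv_darboux 𝓓.isOpen hu.sol hw.sol hu.ne_zero hx)
  have hWd := fun x hx => hasDerivAt_mul_darboux 𝓓.isOpen hu.sol hw.sol hu.ne_zero (x := x) hx
  have hWc : ContinuousOn (fun x => u x * MultiIndexed.darboux u w x) 𝓓.D := fun x hx =>
    (hWd x hx).continuousAt.continuousWithinAt
  have hne : ∀ x ∈ 𝓓.D, u x * MultiIndexed.darboux u w x ≠ 0 := by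
    -- For equal types there is an end where both decay and the Wronskian tends to `0`; distinct
    -- energies make it strictly monotone, so it never returns to `0`.
    by_cases hs : s = s'
    · subst hs
      obtain ⟨b, hb⟩ := exists_endSign_eq hu.sign 1 (Or.inl rfl)
      have he := 𝓓.isEnd b
      have h1 := he.κ_nonneg
      have h2 := hp b
      intro x hx
      refine ne_zero_of_tendsto_zero_end he.basis he.neBot 𝓓.ordConnected he.mem subset_rfl hWc
        (fun y hy => hWd y (interior_subset hy)) (fun y hy => mul_ne_zero (sub_ne_zero.2 (hE rfl))
          (mul_ne_zero (hu.ne_zero y (interior_subset hy)) (hw.ne_zero y (interior_subset hy)))) ?_ hx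
      refine tendsto_mul_darboux_zero he 𝓓.isOpen 𝓓.ordConnected hu.sol.smooth hw.sol.smooth
        (hu.rate b) (hw.rate b) ?_
      rw [hb, endRate]; push_cast; linarith
    · have hs' : s' = -s := by
        rcases hu.sign with rfl | rfl <;> rcases hw.sign with rfl | rfl <;> simp_all
      have hss : (s : ℝ) * s = 1 := by rcases hu.sign with rfl | rfl <;> norm_num
      obtain ⟨c, hc, hcp⟩ : ∃ c : ℝ, c ≠ 0 ∧ ∀ x ∈ 𝓓.D, 0 < c * (u x * w x) := by
        rcases 𝓓.const_sign (hu.sol.smooth.continuousOn.mul hw.sol.smooth.continuousOn)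
          (fun x hx => mul_ne_zero (hu.ne_zero x hx) (hw.ne_zero x hx)) with h | h
        · exact ⟨1, one_ne_zero, fun x hx => by simpa using h x hx⟩
        · exact ⟨-1, by norm_num, fun x hx => by
            have h1 : u x * w x < 0 := h x hx
            linarith⟩
      -- For opposite types, `V` is the Wronskian normalised to be negative near both ends. As it is
      -- monotone, its values are bounded by its values near one of the ends, so it is negative
      -- throughout.
      set V : ℝ → ℝ := fun x => c * s * (u x * MultiIndexed.darboux u w x) with hV
      have hVd : ∀ x ∈ 𝓓.D, HasDerivAt V (s * (e - e') * (c * (u x * w x))) x := fun x hx =>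
        ((hWd x hx).const_mul (c * s)).congr_deriv (by ring)
      have hVc : ContinuousOn V 𝓓.D := fun x hx => (hVd x hx).continuousAt.continuousWithinAt
      -- Near the end `b` the difference `w'/w - u'/u` is asymptotic to `2 σ p r`, with `σ` the
      -- class of `u`. Both `σ` and the sign of `r` are reversed between left and right, so `V` has
      -- the same sign at both ends.
      have hneg : ∀ b, ∀ᶠ x in 𝓓.l b, V x < 0 := by
        intro b
        have he := 𝓓.isEnd b
        have hq := (hw.rate b).2.sub (hu.rate b).2
        have hval : endRate (𝓓.κ b) (p b) (endSign b s') - endRate (𝓓.κ b) (p b) (endSign b s)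
            = 2 * endSign b s * p b := by
          rw [hs']; unfold endRate endSign; cases b <;> push_cast <;> simp <;> ring
        rw [hval] at hq
        have h2 : 0 < p b := by have := hp b; have := he.κ_nonneg; linarith
        have hq2 := hq.const_mul (endSign b s : ℝ)
        have hq3 : (0 : ℝ) < endSign b s * (2 * endSign b s * p b) := by
          rcases endSign_eq_or (b := b) hu.sign with h | h <;> rw [h] <;> push_cast <;> linarith
        filter_upwards [hq2.eventually_const_lt hq3, he.mem] with x h3 hx
        have h4 := hcp x hx
        have h5 := he.r_ne hx
        have h6 := hu.ne_zero x hx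
        have h7 := hw.ne_zero x hx
        have h8 : V x = (endSign b s * (deriv w x / (w x * 𝓓.r b x) - deriv u x / (u x * 𝓓.r b x)))
            * (c * (u x * w x)) * ((if b then 1 else -1) * 𝓓.r b x) := by
          simp only [hV, MultiIndexed.darboux, endSign]
          cases b <;> simp <;> field_simp
        rw [h8]
        refine mul_neg_of_pos_of_neg (mul_pos h3 h4) ?_
        have := he.sign x hx
        cases b <;> simpa using this
      have hVneg : ∀ x ∈ 𝓓.D, V x < 0 := by
        intro x hx
        rcases le_total 0 ((s : ℝ) * (e - e')) with h | h
        · have hmono : MonotoneOn V 𝓓.D := monotoneOn_of_deriv_nonneg 𝓓.ordConnected.convex hVc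
            (fun y hy => (hVd y (interior_subset hy)).differentiableAt.differentiableWithinAt)
            (fun y hy => by
              rw [(hVd y (interior_subset hy)).deriv]
              exact mul_nonneg h (hcp y (interior_subset hy)).le)
          have he := 𝓓.isEnd false
          obtain ⟨y, hy1, hy2⟩ := he.neBot.nonempty_of_mem
            (inter_mem (hneg false) (he.basis.mem_of_mem hx))
          have hy3 : x < y := by simpa [sideSet] using hy2.2
          exact (hmono hx hy2.1 hy3.le).trans_lt hy1
        · have hmono : AntitoneOn V 𝓓.D := antitoneOn_of_deriv_nonpos 𝓓.ordConnected.convex hVc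
            (fun y hy => (hVd y (interior_subset hy)).differentiableAt.differentiableWithinAt)
            (fun y hy => by
              rw [(hVd y (interior_subset hy)).deriv]
              exact mul_nonpos_of_nonpos_of_nonneg h (hcp y (interior_subset hy)).le)
          have he := 𝓓.isEnd true
          obtain ⟨y, hy1, hy2⟩ := he.neBot.nonempty_of_mem
            (inter_mem (hneg true) (he.basis.mem_of_mem hx))
          have hy3 : y < x := by simpa [sideSet] using hy2.2
          exact (hmono hy2.1 hx hy3.le).trans_lt hy1
      intro x hx h
      have := hVneg x hx
      simp [hV, h] at this
  refine ⟨⟨hu.sol.darboux 𝓓.isOpen hw.sol hu.ne_zero, fun x hx => right_ne_zero_of_mul (hne x hx),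
    hw.sign, fun b => (key b).1⟩, fun b => ?_⟩
  have : endSign b s * endSign b s' = s * s' := by cases b <;> simp [endSign]
  rw [← this]
  exact (key b).2

/-! ### Counting zeros -/

/-- Rolle's theorem between a zero and an end: without a critical point `F` would be strictly
monotone from `0` up to its limit `0`. The set `A` contains the zero itself, while the derivative is
only examined in its interior. -/
theorem exists_deriv_zero_end (b : Bool) {F F' : ℝ → ℝ} (hF : ∀ x ∈ 𝓓.D, HasDerivAt F (F' x) x)
    (hlim : Tendsto F (𝓓.l b) (𝓝 0)) {x : ℝ} (hx : x ∈ 𝓓.D) (h0 : F x = 0) :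
    ∃ c ∈ sideSet 𝓓.D b x, F' c = 0 := by
  by_contra! h
  have he := 𝓓.isEnd b
  set A : Set ℝ := 𝓓.D ∩ (if b then Iic x else Ici x) with hA
  have hint : interior A = sideSet 𝓓.D b x := by
    rw [hA, interior_inter, 𝓓.isOpen.interior_eq, sideSet]
    cases b <;> simp
  have hsub : sideSet 𝓓.D b x ⊆ A := hint ▸ interior_subset
  refine ne_zero_of_tendsto_zero_end (A := A) he.basis he.neBot ?_
    (mem_of_superset (he.basis.mem_of_mem hx) hsub) inter_subset_left
    (fun y hy => (hF y hy.1).continuousAt.continuousWithinAt) (fun y hy => hF y (interior_subset hy).1)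
    (fun y hy => h y (hint ▸ hy)) hlim ⟨hx, by cases b <;> simp⟩ h0
  cases b
  · simpa [hA] using 𝓓.ordConnected.inter ordConnected_Ici
  · simpa [hA] using 𝓓.ordConnected.inter ordConnected_Iic

theorem exists_deriv_zero_between {F F' : ℝ → ℝ} (hF : ∀ x ∈ 𝓓.D, HasDerivAt F (F' x) x)
    {x y : ℝ} (hx : x ∈ 𝓓.D) (hy : y ∈ 𝓓.D) (hxy : x < y) (h : F x = F y) :
    ∃ c ∈ 𝓓.D, x < c ∧ c < y ∧ F' c = 0 := by
  have hsub : Icc x y ⊆ 𝓓.D := 𝓓.ordConnected.out hx hy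
  obtain ⟨c, hc, h0⟩ := exists_hasDerivAt_eq_zero hxy
    (fun z hz => (hF z (hsub hz)).continuousAt.continuousWithinAt) h
    (fun z hz => hF z (hsub (Ioo_subset_Icc_self hz)))
  exact ⟨c, hsub (Ioo_subset_Icc_self hc), hc.1, hc.2, h0⟩

/-- Each zero receives a critical point lying before the next zero in the direction of the end `b`,
or before the end if there is none. The last clause makes this assignment injective. -/
theorem exists_deriv_zero_next (b : Bool) {F F' : ℝ → ℝ} (hF : ∀ x ∈ 𝓓.D, HasDerivAt F (F' x) x)
    (hlim : Tendsto F (𝓓.l b) (𝓝 0)) (S : Finset ℝ) (hS : ∀ x ∈ S, x ∈ 𝓓.D ∧ F x = 0) {x : ℝ}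
    (hx : x ∈ S) : ∃ c ∈ 𝓓.D, F' c = 0 ∧ c ∈ sideSet 𝓓.D b x ∧
      ∀ y ∈ S, y ∈ sideSet 𝓓.D b x → y ∈ sideSet 𝓓.D b c := by
  classical
  by_cases hne : (S.filter fun y => y ∈ sideSet 𝓓.D b x).Nonempty
  · cases b
    · obtain ⟨hm1, hm2⟩ := Finset.mem_filter.1 (Finset.min'_mem _ hne)
      obtain ⟨c, hc, h1, h2, h3⟩ := exists_deriv_zero_between hF (hS x hx).1 (hS _ hm1).1
        (by simpa [sideSet] using hm2.2) ((hS x hx).2.trans (hS _ hm1).2.symm)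
      refine ⟨c, hc, h3, ⟨hc, by simpa using h1⟩, fun y hy hyx => ⟨(hS y hy).1, ?_⟩⟩
      have := Finset.min'_le _ y (Finset.mem_filter.2 ⟨hy, hyx⟩)
      simpa using h2.trans_le this
    · obtain ⟨hm1, hm2⟩ := Finset.mem_filter.1 (Finset.max'_mem _ hne)
      obtain ⟨c, hc, h1, h2, h3⟩ := exists_deriv_zero_between hF (hS _ hm1).1 (hS x hx).1
        (by simpa [sideSet] using hm2.2) ((hS _ hm1).2.trans (hS x hx).2.symm)
      refine ⟨c, hc, h3, ⟨hc, by simpa using h2⟩, fun y hy hyx => ⟨(hS y hy).1, ?_⟩⟩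
      have := Finset.le_max' _ y (Finset.mem_filter.2 ⟨hy, hyx⟩)
      simpa using this.trans_lt h1
  · obtain ⟨c, hc, h0⟩ := exists_deriv_zero_end b hF hlim (hS x hx).1 (hS x hx).2
    exact ⟨c, hc.1, h0, hc, fun y hy hyx => absurd ⟨y, Finset.mem_filter.2 ⟨hy, hyx⟩⟩ hne⟩

/-- Rolle's theorem, counting zeros: a differentiable function tending to zero at one end has at
most as many zeros as its derivative. -/
theorem encard_zeros_le (b : Bool) {F F' : ℝ → ℝ} (hF : ∀ x ∈ 𝓓.D, HasDerivAt F (F' x) x)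
    (hlim : Tendsto F (𝓓.l b) (𝓝 0)) :
    {x ∈ 𝓓.D | F x = 0}.encard ≤ {x ∈ 𝓓.D | F' x = 0}.encard := by
  have key : ∀ S : Finset ℝ, (∀ x ∈ S, x ∈ 𝓓.D ∧ F x = 0) →
      (S.card : ℕ∞) ≤ {x ∈ 𝓓.D | F' x = 0}.encard := by
    intro S hS
    choose! c hcD hc0 hcx hcy using fun x hx => exists_deriv_zero_next b hF hlim S hS (x := x) hx
    rw [← Set.encard_coe_eq_coe_finsetCard]
    refine Set.encard_le_encard_of_injOn (f := c) (fun x hx => ⟨hcD x hx, hc0 x hx⟩) ?_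
    intro x hx y hy hxy
    by_contra hne
    have hlt : ∀ x ∈ S, ∀ y ∈ S, y ∈ sideSet 𝓓.D b x → c x ≠ c y := by
      intro x hx y hy h heq
      have h1 := (hcy x hx y hy h).2
      have h2 := (hcx y hy).2
      rw [heq] at h1
      cases b <;> simp at h1 h2 <;> linarith
    rcases lt_or_gt_of_ne hne with h | h
    · cases b
      · exact hlt x hx y hy ⟨(hS y hy).1, by simpa using h⟩ hxy
      · exact hlt y hy x hx ⟨(hS x hx).1, by simpa using h⟩ hxy.symm
    · cases b
      · exact hlt y hy x hx ⟨(hS x hx).1, by simpa using h⟩ hxy.symm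
      · exact hlt x hx y hy ⟨(hS y hy).1, by simpa using h⟩ hxy
  by_cases hfin : {x ∈ 𝓓.D | F x = 0}.Finite
  · rw [hfin.encard_eq_coe_toFinset_card]
    exact key _ fun x hx => by simpa using hx
  · have : {x ∈ 𝓓.D | F' x = 0}.encard = ⊤ := by
      refine ENat.eq_top_iff_forall_ge.2 fun n => ?_
      obtain ⟨S, hS, hn⟩ := Set.Infinite.exists_subset_card_eq hfin n
      rw [← hn]
      exact key S fun x hx => hS hx
    rw [this]; exact le_top

/-- `φ` has exactly `n` zeros in `D`, all simple. -/
def ZeroCount (D : Set ℝ) (φ : ℝ → ℝ) (n : ℕ) : Prop :=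
  {x ∈ D | φ x = 0}.encard = n ∧ ∀ x ∈ D, φ x = 0 → deriv φ x ≠ 0

/-- Upper bound: `u · darboux u φ` tends to `0` where `u` decays and has derivative `(e - E) u φ`.
Lower bound: `φ / u` tends to `0` where `u` grows and has derivative `darboux u φ / u`. A double
zero of the transform would be a double zero of `φ`. -/
theorem ZeroCount.darboux {n : ℕ} (hp : 𝓓.Good p) (hu : 𝓓.Seed U p e s u) (hφ : 𝓓.Eig U p E φ)
    (hE : e ≠ E) (h : ZeroCount 𝓓.D φ n) : ZeroCount 𝓓.D (darboux u φ) n := by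
  have hu0 := hu.ne_zero
  have du := fun x hx => hu.sol.smooth.smooth_differentiableAt 𝓓.isOpen (x := x) hx
  have dφ := fun x hx => hφ.sol.smooth.smooth_differentiableAt 𝓓.isOpen (x := x) hx
  constructor
  · rw [← h.1]
    refine le_antisymm ?_ ?_
    · obtain ⟨b, hb⟩ := exists_endSign_eq hu.sign 1 (Or.inl rfl)
      have he := 𝓓.isEnd b
      have h1 := he.κ_nonneg
      have h2 := hp b
      have hur := hu.rate b
      rw [hb] at hur
      have := encard_zeros_le b (F := fun x => u x * MultiIndexed.darboux u φ x)
        (fun x hx => hasDerivAt_mul_darboux 𝓓.isOpen hu.sol hφ.sol hu0 hx)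
        (tendsto_mul_darboux_zero he 𝓓.isOpen 𝓓.ordConnected hu.sol.smooth hφ.sol.smooth
          hur (hφ.rate b) (by rw [endRate]; push_cast; linarith))
      refine (le_of_eq ?_).trans (this.trans (le_of_eq ?_))
      · congr 1; ext x
        exact and_congr_right fun hx => by simp [hu0 x hx]
      · congr 1; ext x
        exact and_congr_right fun hx => by simp [hu0 x hx, sub_ne_zero.2 hE]
    · obtain ⟨b, hb⟩ := exists_endSign_eq hu.sign (-1) (Or.inr rfl)
      have he := 𝓓.isEnd b
      have h1 := he.κ_nonneg
      have h2 := hp b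
      have hur := hu.rate b
      rw [hb] at hur
      have hd : ∀ x ∈ 𝓓.D, DifferentiableAt ℝ (fun x => φ x / u x) x := fun x hx =>
        (dφ x hx).div (du x hx) (hu0 x hx)
      have hF : ∀ x ∈ 𝓓.D, HasDerivAt (fun x => φ x / u x) (MultiIndexed.darboux u φ x / u x) x :=
        fun x hx => (hd x hx).hasDerivAt.congr_deriv (by
          rw [darboux_eq_mul_deriv_div 𝓓.isOpen hu.sol.smooth hφ.sol.smooth hu0 hx]
          have := hu0 x hx
          field_simp)
      have := encard_zeros_le b hF (HasRate.tendsto_zero he 𝓓.ordConnected hd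
        (HasRate.div he dφ du (hφ.rate b) hur) (by unfold endRate; push_cast; linarith))
      refine (le_of_eq ?_).trans (this.trans (le_of_eq ?_))
      · congr 1; ext x
        exact and_congr_right fun hx => by simp [hu0 x hx]
      · congr 1; ext x
        exact and_congr_right fun hx => by simp [hu0 x hx]
  · intro x hx h0 h1
    rw [deriv_darboux 𝓓.isOpen hu.sol hφ.sol hu0 hx, h0, mul_zero, sub_zero] at h1
    have h2 : φ x = 0 := (mul_eq_zero.1 h1).resolve_left (sub_ne_zero.2 hE)
    refine h.2 x hx h2 ?_
    simpa [MultiIndexed.darboux, h2] using h0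

end Dom

namespace Dom

variable {𝓓 : Dom} {U u w φ : ℝ → ℝ} {p : Bool → ℝ} {e e' E : ℝ} {s s' : ℤ}

/-! ### Norms and completeness -/

theorem bounded_of_ends {g : ℝ → ℝ} (hg : ContinuousOn g 𝓓.D)
    (h : ∀ b, ∃ C : ℝ, ∀ᶠ x in 𝓓.l b, |g x| ≤ C) : ∃ C : ℝ, 0 ≤ C ∧ ∀ x ∈ 𝓓.D, |g x| ≤ C := by
  choose C hC using h
  choose t ht hs using fun b => (𝓓.isEnd b).basis.eventually_iff.1 (hC b)
  have hsub : Icc (t true) (t false) ⊆ 𝓓.D := 𝓓.ordConnected.out (ht _) (ht _)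
  obtain ⟨K, hK⟩ := isCompact_Icc.exists_bound_of_continuousOn (hg.mono hsub)
  refine ⟨max (max (C true) (C false)) (max K 0), by simp, fun x hx => ?_⟩
  rcases lt_or_ge x (t true) with h1 | h1
  · have := hs true (x := x) ⟨hx, by simpa using h1⟩
    exact this.trans (by simp)
  · rcases lt_or_ge (t false) x with h2 | h2
    · have := hs false (x := x) ⟨hx, by simpa using h2⟩
      exact this.trans (by simp)
    · exact (hK x ⟨h1, h2⟩).trans (by simp)

/-- Since `p > (1 + κ)/2`, the rate lies below `-1/2`, so near each end `φ` is dominated by `exp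
(-R/2)` and hence by `ρ`; in between compactness suffices. -/
theorem Eig.bound (hp : 𝓓.Good p) (hφ : 𝓓.Eig U p E φ) :
    ∃ C : ℝ, 0 ≤ C ∧ ∀ x ∈ 𝓓.D, |φ x| ≤ C * 𝓓.ρ x := by
  obtain ⟨C, hC, h⟩ := bounded_of_ends (g := fun x => φ x / 𝓓.ρ x)
    (hφ.sol.smooth.continuousOn.div 𝓓.ρ_smooth.continuousOn fun x hx => (𝓓.ρ_pos x hx).ne')
    (fun b => by
      have he := 𝓓.isEnd b
      obtain ⟨C, hC⟩ := he.ρ_dom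
      have h1 := (hφ.rate b).abs_le_exp he 𝓓.ordConnected
        (fun x hx => hφ.sol.smooth.smooth_differentiableAt 𝓓.isOpen hx) (c' := -1 / 2) (by
          have := hp b; have := he.κ_nonneg; unfold endRate; push_cast; linarith)
      refine ⟨C, ?_⟩
      filter_upwards [h1, hC, he.mem] with x h2 h3 hx
      have := 𝓓.ρ_pos x hx
      rw [abs_div, abs_of_pos this, div_le_iff₀ this]
      refine h2.trans (le_trans (le_of_eq ?_) h3)
      congr 1; ring)
  refine ⟨C, hC, fun x hx => ?_⟩
  have h1 := h x hx
  have := 𝓓.ρ_pos x hx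
  rwa [abs_div, abs_of_pos this, div_le_iff₀ this] at h1

theorem measurableSet_D : MeasurableSet 𝓓.D := 𝓓.isOpen.measurableSet

theorem measurableSet_sideSet (b : Bool) (t : ℝ) : MeasurableSet (sideSet 𝓓.D b t) := by
  unfold sideSet
  cases b
  · simpa using measurableSet_D.inter measurableSet_Ioi
  · simpa using measurableSet_D.inter measurableSet_Iio

theorem integrableOn_of_bound {f : ℝ → ℝ} (hf : ContinuousOn f 𝓓.D) {C : ℝ} {S : Set ℝ}
    (hS : MeasurableSet S) (hSD : S ⊆ 𝓓.D) (h : ∀ x ∈ S, |f x| ≤ C * 𝓓.ρ x) : IntegrableOn f S := by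
  refine Integrable.mono' ((𝓓.ρ_int.mono_set hSD).const_mul C)
    ((hf.mono hSD).aestronglyMeasurable hS) ?_
  exact (ae_restrict_of_forall_mem hS) h

theorem abs_mul_le_of_bounds {f g : ℝ → ℝ} {C C' : ℝ} (hC : 0 ≤ C) (hC' : 0 ≤ C') {x : ℝ}
    (hx : x ∈ 𝓓.D) (hf : |f x| ≤ C * 𝓓.ρ x) (hg : |g x| ≤ C' * 𝓓.ρ x) :
    |f x * g x| ≤ C * C' * 𝓓.ρ x := by
  have h1 := 𝓓.ρ_pos x hx
  have h2 := 𝓓.ρ_le x hx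
  rw [abs_mul]
  calc |f x| * |g x| ≤ (C * 𝓓.ρ x) * (C' * 𝓓.ρ x) := by gcongr
    _ = C * C' * 𝓓.ρ x * 𝓓.ρ x := by ring
    _ ≤ C * C' * 𝓓.ρ x * 1 := by gcongr
    _ = _ := by ring

theorem Eig.integrableOn_mul {E' : ℝ} {φ' U' : ℝ → ℝ} {p' : Bool → ℝ} (hp : 𝓓.Good p)
    (hp' : 𝓓.Good p') (hφ : 𝓓.Eig U p E φ) (hφ' : 𝓓.Eig U' p' E' φ') :
    IntegrableOn (fun x => φ x * φ' x) 𝓓.D := by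
  obtain ⟨C, hC, h⟩ := hφ.bound hp
  obtain ⟨C', hC', h'⟩ := hφ'.bound hp'
  exact integrableOn_of_bound (hφ.sol.smooth.continuousOn.mul hφ'.sol.smooth.continuousOn)
    measurableSet_D subset_rfl fun x hx => abs_mul_le_of_bounds hC hC' hx (h x hx) (h' x hx)

theorem Icc_subset {x y : ℝ} (hx : x ∈ 𝓓.D) (hy : y ∈ 𝓓.D) : uIcc x y ⊆ 𝓓.D :=
  𝓓.ordConnected.uIcc_subset hx hy

theorem intervalIntegrable {V : ℝ → ℝ} (hV : ContinuousOn V 𝓓.D) {x y : ℝ} (hx : x ∈ 𝓓.D)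
    (hy : y ∈ 𝓓.D) : IntervalIntegrable V volume x y :=
  (hV.mono (Icc_subset hx hy)).intervalIntegrable

/-- The sign with which `∫ x in sideSet D b t, V x` varies with `t`. -/
noncomputable def sideSign (b : Bool) : ℝ := if b then 1 else -1

theorem integral_sideSet_sub (b : Bool) {V : ℝ → ℝ}
    (hi : ∀ t ∈ 𝓓.D, IntegrableOn V (sideSet 𝓓.D b t)) {t y : ℝ} (ht : t ∈ 𝓓.D) (hy : y ∈ 𝓓.D) :
    (∫ x in sideSet 𝓓.D b t, V x) - ∫ x in sideSet 𝓓.D b y, V x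
      = sideSign b * ∫ x in y..t, V x := by
  wlog h : y ≤ t generalizing y t
  · have := this hy ht (not_le.1 h).le
    rw [intervalIntegral.integral_symm, mul_neg, ← this]; ring
  have hsub : Icc y t ⊆ 𝓓.D := 𝓓.ordConnected.out hy ht
  rw [intervalIntegral.integral_of_le h]
  cases b
  · have hset : sideSet 𝓓.D false y = sideSet 𝓓.D false t ∪ Ioc y t := by
      ext x
      simp only [sideSet, Bool.false_eq_true, if_false, mem_inter_iff, mem_Ioi, mem_union, mem_Ioc]
      constructor
      · rintro ⟨h1, h2⟩
        rcases lt_or_ge t x with h3 | h3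
        · exact Or.inl ⟨h1, h3⟩
        · exact Or.inr ⟨h2, h3⟩
      · rintro (⟨h1, h2⟩ | ⟨h1, h2⟩)
        · exact ⟨h1, h.trans_lt h2⟩
        · exact ⟨hsub ⟨h1.le, h2⟩, h1⟩
    have hd : Disjoint (sideSet 𝓓.D false t) (Ioc y t) := by
      rw [Set.disjoint_left]
      rintro x ⟨_, hx⟩ hx'
      exact absurd hx'.2 (not_le.2 (by simpa using hx))
    rw [hset, setIntegral_union hd measurableSet_Ioc (hi t ht)
      ((hi y hy).mono_set (hset ▸ subset_union_right))]
    simp [sideSign]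
  · have hset : sideSet 𝓓.D true t = sideSet 𝓓.D true y ∪ Ico y t := by
      ext x
      simp only [sideSet, if_true, mem_inter_iff, mem_Iio, mem_union, mem_Ico]
      constructor
      · rintro ⟨h1, h2⟩
        rcases lt_or_ge x y with h3 | h3
        · exact Or.inl ⟨h1, h3⟩
        · exact Or.inr ⟨h3, h2⟩
      · rintro (⟨h1, h2⟩ | ⟨h1, h2⟩)
        · exact ⟨h1, h2.trans_le h⟩
        · exact ⟨hsub ⟨h1, h2.le⟩, h2⟩
    have hd : Disjoint (sideSet 𝓓.D true y) (Ico y t) := by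
      rw [Set.disjoint_left]
      rintro x ⟨_, hx⟩ hx'
      exact absurd hx'.1 (not_le.2 (by simpa using hx))
    rw [hset, setIntegral_union hd measurableSet_Ico (hi y hy)
      ((hi t ht).mono_set (hset ▸ subset_union_right)), integral_Ico_eq_integral_Ioo,
      ← integral_Ioc_eq_integral_Ioo]
    simp [sideSign]

theorem tendsto_intervalIntegral_end (b : Bool) {V : ℝ → ℝ} {t : ℝ} (ht : t ∈ 𝓓.D)
    (hi : IntegrableOn V (sideSet 𝓓.D b t)) :
    Tendsto (fun y => sideSign b * ∫ x in y..t, V x) (𝓓.l b)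
      (𝓝 (∫ x in sideSet 𝓓.D b t, V x)) := by
  have he := 𝓓.isEnd b
  have := he.countable
  have hcov : AECover (volume.restrict (sideSet 𝓓.D b t)) (𝓓.l b)
      (fun y => if b then Ioi y else Iio y) := by
    constructor
    · refine ae_restrict_of_forall_mem (measurableSet_sideSet b t) fun x hx => ?_
      filter_upwards [he.basis.mem_of_mem hx.1] with y hy
      cases b
      · simpa [sideSet] using hy.2
      · simpa [sideSet] using hy.2
    · intro y
      cases b
      · simp
      · simp
  refine (hcov.integral_tendsto_of_countably_generated hi).congr' ?_
  filter_upwards [he.basis.mem_of_mem ht] with y hy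
  rw [Measure.restrict_restrict (hcov.measurableSet y)]
  cases b
  · have hty : t < y := by simpa using hy.2
    have hset : (if false = true then Ioi y else Iio y) ∩ sideSet 𝓓.D false t = Ioo t y := by
      ext x
      simp only [sideSet, Bool.false_eq_true, if_false, mem_inter_iff, mem_Ioi, mem_Iio, mem_Ioo]
      exact ⟨fun h => ⟨h.2.2, h.1⟩, fun h => ⟨h.2, 𝓓.ordConnected.out ht hy.1 ⟨h.1.le, h.2.le⟩, h.1⟩⟩
    rw [hset, ← integral_Ioc_eq_integral_Ioo, ← intervalIntegral.integral_of_le hty.le,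
      intervalIntegral.integral_symm]
    simp [sideSign]
  · have hty : y < t := by simpa using hy.2
    have hset : (if true = true then Ioi y else Iio y) ∩ sideSet 𝓓.D true t = Ioo y t := by
      ext x
      simp only [sideSet, if_true, mem_inter_iff, mem_Ioi, mem_Iio, mem_Ioo]
      exact ⟨fun h => ⟨h.1, h.2.2⟩, fun h => ⟨h.1, 𝓓.ordConnected.out hy.1 ht ⟨h.1.le, h.2.le⟩, h.2⟩⟩
    rw [hset, ← integral_Ioc_eq_integral_Ioo, ← intervalIntegral.integral_of_le hty.le]
    simp [sideSign]

theorem integral_sideSet_deriv (b : Bool) {F F' : ℝ → ℝ} (hF : ∀ x ∈ 𝓓.D, HasDerivAt F (F' x) x)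
    (hc : ContinuousOn F' 𝓓.D) {t : ℝ} (ht : t ∈ 𝓓.D) (hi : IntegrableOn F' (sideSet 𝓓.D b t))
    (hlim : Tendsto F (𝓓.l b) (𝓝 0)) :
    ∫ x in sideSet 𝓓.D b t, F' x = sideSign b * F t := by
  have he := 𝓓.isEnd b
  have := he.neBot
  refine tendsto_nhds_unique (tendsto_intervalIntegral_end b ht hi) ?_
  have h1 : Tendsto (fun y => sideSign b * (F t - F y)) (𝓓.l b) (𝓝 (sideSign b * (F t - 0))) :=
    (tendsto_const_nhds.sub hlim).const_mul _
  rw [sub_zero] at h1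
  refine h1.congr' ?_
  filter_upwards [he.mem] with y hy
  rw [intervalIntegral.integral_eq_sub_of_hasDerivAt (fun x hx => hF x (Icc_subset hy ht hx))
    (intervalIntegrable hc hy ht)]

theorem integral_deriv_eq_zero {F F' : ℝ → ℝ} (hF : ∀ x ∈ 𝓓.D, HasDerivAt F (F' x) x)
    (hc : ContinuousOn F' 𝓓.D) (hi : IntegrableOn F' 𝓓.D)
    (hlim : ∀ b, Tendsto F (𝓓.l b) (𝓝 0)) : ∫ x in 𝓓.D, F' x = 0 := by
  have he := 𝓓.isEnd true
  obtain ⟨t, ht⟩ := he.neBot.nonempty_of_mem he.mem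
  have h1 := fun b => integral_sideSet_deriv b hF hc ht (hi.mono_set inter_subset_left) (hlim b)
  have hset : 𝓓.D = sideSet 𝓓.D true t ∪ (𝓓.D ∩ Ici t) := by
    simp only [sideSet, if_true, ← inter_union_distrib_left, Iio_union_Ici, inter_univ]
  have hd : Disjoint (sideSet 𝓓.D true t) (𝓓.D ∩ Ici t) := by
    rw [Set.disjoint_left]
    rintro x ⟨_, hx⟩ hx'
    exact absurd hx'.2 (not_le.2 (by simpa using hx))
  have h2 : ∫ x in 𝓓.D ∩ Ici t, F' x = ∫ x in sideSet 𝓓.D false t, F' x := by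
    refine setIntegral_congr_set ?_
    simp only [sideSet, Bool.false_eq_true, if_false]
    exact (ae_eq_refl _).inter Ioi_ae_eq_Ici.symm
  have hi' : IntegrableOn F' (𝓓.D ∩ Ici t) := hi.mono_set inter_subset_left
  have h3 : ∫ x in 𝓓.D, F' x
      = (∫ x in sideSet 𝓓.D true t, F' x) + ∫ x in 𝓓.D ∩ Ici t, F' x := by
    conv_lhs => rw [hset]
    exact setIntegral_union hd (measurableSet_D.inter measurableSet_Ici)
      (hi.mono_set inter_subset_left) hi'
  rw [h3, h2, h1, h1]
  simp [sideSign]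

theorem hasDerivAt_integral_sideSet (b : Bool) {V : ℝ → ℝ} (hV : ContinuousOn V 𝓓.D)
    (hi : ∀ t ∈ 𝓓.D, IntegrableOn V (sideSet 𝓓.D b t)) {t : ℝ} (ht : t ∈ 𝓓.D) :
    HasDerivAt (fun t => ∫ x in sideSet 𝓓.D b t, V x) (sideSign b * V t) t := by
  have h1 : HasDerivAt (fun y => ∫ x in t..y, V x) (V t) t :=
    intervalIntegral.integral_hasDerivAt_right (intervalIntegrable hV ht ht)
      ((hV.stronglyMeasurableAtFilter 𝓓.isOpen) t ht) (hV.continuousAt (𝓓.isOpen.mem_nhds ht))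
  have h2 := (h1.const_mul (sideSign b)).const_add (∫ x in sideSet 𝓓.D b t, V x)
  refine h2.congr_of_eventuallyEq ?_
  filter_upwards [𝓓.isOpen.mem_nhds ht] with y hy
  have := integral_sideSet_sub b hi hy ht
  linarith

theorem tendsto_integral_sideSet (b : Bool) {V : ℝ → ℝ}
    (hi : ∀ t ∈ 𝓓.D, IntegrableOn V (sideSet 𝓓.D b t)) :
    Tendsto (fun t => ∫ x in sideSet 𝓓.D b t, V x) (𝓓.l b) (𝓝 0) := by
  have he := 𝓓.isEnd b
  obtain ⟨t, ht⟩ := he.neBot.nonempty_of_mem he.mem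
  have h1 := (tendsto_intervalIntegral_end b ht (hi t ht)).const_sub
    (∫ x in sideSet 𝓓.D b t, V x)
  rw [sub_self] at h1
  refine h1.congr' ?_
  filter_upwards [he.mem] with y hy
  have := integral_sideSet_sub b hi ht hy
  linarith

/-- Norms and orthogonality relations under a Darboux transformation. -/
theorem integral_darboux_mul {E' : ℝ} {φ' : ℝ → ℝ} (hp : 𝓓.Good p)
    (hp' : 𝓓.Good (𝓓.shiftP p s)) (hu : 𝓓.Seed U p e s u) (hφ : 𝓓.Eig U p E φ)
    (hφ' : 𝓓.Eig U p E' φ') (hE : e ≠ E) (hE' : e ≠ E') :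
    ∫ x in 𝓓.D, darboux u φ x * darboux u φ' x = (E' - e) * ∫ x in 𝓓.D, φ x * φ' x := by
  have h1 := (Eig.darboux hp hu hφ hE).1
  have h2 := (Eig.darboux hp hu hφ' hE').1
  -- This is integration by parts for `⟨A φ, A φ'⟩ = ⟨φ, A† A φ'⟩`; in the boundary term `φ · A φ'`
  -- both factors decay at both ends.
  have hd : ∀ x ∈ 𝓓.D, HasDerivAt (fun x => φ x * darboux u φ' x)
      (darboux u φ x * darboux u φ' x - (E' - e) * (φ x * φ' x)) x := by
    intro x hx
    have h3 := (hφ.sol.smooth.smooth_hasDerivAt 𝓓.isOpen hx).mul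
      (h2.sol.smooth.smooth_hasDerivAt 𝓓.isOpen hx)
    rw [deriv_darboux 𝓓.isOpen hu.sol hφ'.sol hu.ne_zero hx] at h3
    refine h3.congr_deriv ?_
    have h4 : deriv φ x = darboux u φ x + deriv u x / u x * φ x := by
      simp only [MultiIndexed.darboux]; ring
    rw [h4]; ring
  have i1 := Eig.integrableOn_mul hp' hp' h1 h2
  have i2 := (Eig.integrableOn_mul hp hp hφ hφ').const_mul (E' - e)
  have hz := integral_deriv_eq_zero hd
    ((h1.sol.smooth.continuousOn.mul h2.sol.smooth.continuousOn).sub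
      (continuousOn_const.mul (hφ.sol.smooth.continuousOn.mul hφ'.sol.smooth.continuousOn)))
    (i1.sub i2) (fun b => by
      have he := 𝓓.isEnd b
      have h3 := he.κ_nonneg
      have h4 := hp b
      have h5 := hp' b
      have h6 := he.κ_le
      have z1 := (hφ.rate b).tendsto_zero he 𝓓.ordConnected
        (fun x hx => hφ.sol.smooth.smooth_differentiableAt 𝓓.isOpen hx)
        (by unfold endRate; push_cast; linarith)
      have z2 := (h2.rate b).tendsto_zero he 𝓓.ordConnected
        (fun x hx => h2.sol.smooth.smooth_differentiableAt 𝓓.isOpen hx)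
        (by unfold endRate; push_cast; linarith)
      simpa using z1.mul z2)
  rw [integral_sub i1 i2, integral_const_mul] at hz
  linarith

/-- Completeness in the weighted space `L¹(ρ)`: only the zero function is orthogonal to all
members of the family. -/
def Complete (𝓓 : Dom) (φ : ℕ → ℝ → ℝ) : Prop :=
  ∀ f : ℝ → ℝ, IntegrableOn (fun x => f x * 𝓓.ρ x) 𝓓.D → (∀ n, ∫ x in 𝓓.D, f x * φ n x = 0) →
    f =ᵐ[volume.restrict 𝓓.D] 0

/-- Near the end where `u` tends to `0` it is bounded by `1`, and the rest of the side is compact,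
so `ρ u` is dominated by a multiple of `ρ`. -/
theorem Seed.integrableOn_sideSet (hp : 𝓓.Good p) (hu : 𝓓.Seed U p e s u) {b : Bool}
    (hb : endSign b s = 1) :
    ∀ t ∈ 𝓓.D, IntegrableOn (fun x => 𝓓.ρ x * u x) (sideSet 𝓓.D b t) := by
  intro t ht
  have he := 𝓓.isEnd b
  have h3 := he.κ_nonneg
  have h4 := hp b
  have hc := hu.sol.smooth.continuousOn
  have z1 := (hu.rate b).tendsto_zero he 𝓓.ordConnected
    (fun x hx => hu.sol.smooth.smooth_differentiableAt 𝓓.isOpen hx)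
    (by rw [hb]; unfold endRate; push_cast; linarith)
  have z2 : ∀ᶠ x in 𝓓.l b, |u x| ≤ 1 := by
    filter_upwards [Metric.tendsto_nhds.1 z1 1 one_pos] with x hx
    simpa using hx.le
  obtain ⟨t0, ht0, hs⟩ := he.basis.eventually_iff.1 z2
  obtain ⟨K, hK⟩ := isCompact_uIcc.exists_bound_of_continuousOn (hc.mono (Icc_subset ht0 ht))
  refine integrableOn_of_bound (C := max 1 K) (𝓓.ρ_smooth.continuousOn.mul hc)
    (measurableSet_sideSet b t) inter_subset_left fun x hx => ?_
  have hρ := 𝓓.ρ_pos x hx.1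
  change |𝓓.ρ x * u x| ≤ _
  rw [abs_mul, abs_of_pos hρ, mul_comm]
  gcongr
  by_cases hx' : x ∈ sideSet 𝓓.D b t0
  · exact (hs hx').trans (le_max_left _ _)
  · refine (hK x ?_).trans (le_max_right _ _)
    have h5 : x ∉ (if b then Iio t0 else Ioi t0) := fun h => hx' ⟨hx.1, h⟩
    have h6 := hx.2
    cases b
    · simp at h5 h6
      exact ⟨(min_le_right _ _).trans h6.le, h5.trans (le_max_left _ _)⟩
    · simp at h5 h6
      exact ⟨(min_le_left _ _).trans h5, h6.le.trans (le_max_right _ _)⟩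

/-- The quotient of the integral by `ρ u` tends to `0` at both ends by l'Hôpital, in the form `0/0`
where `u` decays and `∞/∞` where it grows: the quotient of derivatives is `±1/(c r)` asymptotically.
That `ρ u` still grows at the second end uses `θ ≤ 1/2`. -/
theorem Seed.integral_sideSet_le (hp : 𝓓.Good p) (hu : 𝓓.Seed U p e s u) {b : Bool}
    (hb : endSign b s = 1) : ∃ C : ℝ, 0 ≤ C ∧ ∀ t ∈ 𝓓.D,
      |∫ x in sideSet 𝓓.D b t, 𝓓.ρ x * u x| ≤ C * (𝓓.ρ t * |u t|) := by
  have hi := hu.integrableOn_sideSet hp hb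
  have hVc : ContinuousOn (fun x => 𝓓.ρ x * u x) 𝓓.D :=
    𝓓.ρ_smooth.continuousOn.mul hu.sol.smooth.continuousOn
  have dρ := fun x hx => 𝓓.ρ_smooth.smooth_differentiableAt 𝓓.isOpen (x := x) hx
  have du := fun x hx => hu.sol.smooth.smooth_differentiableAt 𝓓.isOpen (x := x) hx
  have hV0 : ∀ x ∈ 𝓓.D, 𝓓.ρ x * u x ≠ 0 := fun x hx =>
    mul_ne_zero (𝓓.ρ_pos x hx).ne' (hu.ne_zero x hx)
  have hId := fun t ht => hasDerivAt_integral_sideSet b hVc hi (t := t) ht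
  obtain ⟨C, hC, h⟩ := bounded_of_ends (𝓓 := 𝓓)
    (g := fun t => (∫ x in sideSet 𝓓.D b t, 𝓓.ρ x * u x) / (𝓓.ρ t * u t))
    (ContinuousOn.div (fun t ht => (hId t ht).continuousAt.continuousWithinAt) hVc hV0)
    (fun b' => by
      have he := 𝓓.isEnd b'
      have hρr : HasRate (𝓓.l b') (𝓓.r b') 𝓓.ρ (-𝓓.θ b') :=
        ⟨by filter_upwards [he.mem] with x hx using (𝓓.ρ_pos x hx).ne', he.ρ_rate⟩
      have dV : ∀ x ∈ 𝓓.D, DifferentiableAt ℝ (fun x => 𝓓.ρ x * u x) x := fun x hx =>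
        (dρ x hx).mul (du x hx)
      have hVr := HasRate.mul he dρ du hρr (hu.rate b')
      set c := -𝓓.θ b' + endRate (𝓓.κ b') (p b') (endSign b' s) with hcdef
      have h1 := hp b'
      have h2 := he.κ_nonneg
      have h3 := he.κ_le
      have h4 := he.θ_nonneg
      have h5 := he.θ_le
      have hcase : (b' = b ∧ c < 0) ∨ 0 < c := by
        rcases endSign_eq_or (b := b') hu.sign with h6 | h6
        · left
          refine ⟨?_, ?_⟩
          · by_contra hbb
            have : b' = !b := by cases b <;> cases b' <;> simp_all
            subst this
            rcases hu.sign with rfl | rfl <;> cases b <;> simp [endSign] at h6 hb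
          · rw [hcdef, h6]; unfold endRate; push_cast; linarith
        · right
          rw [hcdef, h6]; unfold endRate; push_cast; linarith
      have hc0 : c ≠ 0 := by
        rcases hcase with h | h
        · exact h.2.ne
        · exact h.ne'
      have hlim := lhopital_end (F := fun t => ∫ x in sideSet 𝓓.D b t, 𝓓.ρ x * u x)
        (G := fun x => 𝓓.ρ x * u x) (F' := fun x => sideSign b * (𝓓.ρ x * u x))
        (G' := deriv fun x => 𝓓.ρ x * u x) (c := 0)
        he.basis he.neBot 𝓓.ordConnected (by filter_upwards [he.mem] with t ht using hId t ht)
        (by filter_upwards [he.mem] with t ht using (dV t ht).hasDerivAt)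
        (by
          filter_upwards [hVr.2.eventually_ne hc0] with x hx h0
          simp [h0] at hx)
        (by
          have h6 := ((hVr.2.inv₀ hc0).mul he.inv_r).const_mul (sideSign b)
          rw [mul_zero, mul_zero] at h6
          refine h6.congr' ?_
          filter_upwards [hVr.2.eventually_ne hc0, he.mem] with x hx hxD
          have h8 : deriv (fun x => 𝓓.ρ x * u x) x ≠ 0 := fun h0 => by simp [h0] at hx
          have := hV0 x hxD
          have := he.r_ne hxD
          simp only at *
          field_simp)
        (by
          rcases hcase with ⟨rfl, h⟩ | h
          · exact Or.inl ⟨tendsto_integral_sideSet b' hi, hVr.tendsto_zero he 𝓓.ordConnected dV h⟩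
          · exact Or.inr (hVr.tendsto_abs_atTop he 𝓓.ordConnected dV h))
      refine ⟨1, ?_⟩
      filter_upwards [Metric.tendsto_nhds.1 hlim 1 one_pos] with x hx
      simpa only [Real.dist_eq, sub_zero] using hx.le)
  refine ⟨C, hC, fun t ht => ?_⟩
  have h1 := h t ht
  have h2 := abs_pos.2 (hV0 t ht)
  rw [abs_div, div_le_iff₀ h2, abs_mul, abs_of_pos (𝓓.ρ_pos t ht)] at h1
  exact h1

/-- Lebesgue differentiation. The primitive vanishes only almost everywhere, so difference quotients
are taken along good points, which exist in every nonempty open subinterval. -/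
theorem ae_eq_zero_of_integral_sideSet (b : Bool) {g : ℝ → ℝ}
    (h : ∀ᵐ x ∂volume.restrict 𝓓.D, IntegrableOn g (sideSet 𝓓.D b x) ∧
      ∫ t in sideSet 𝓓.D b x, g t = 0) : g =ᵐ[volume.restrict 𝓓.D] 0 := by
  have he := 𝓓.isEnd b
  -- a point of the good set may be chosen in every nonempty open part of `D`
  have hex : ∀ x y : ℝ, x ∈ 𝓓.D → y ∈ 𝓓.D → x < y → ∃ z ∈ Ioo x y,
      IntegrableOn g (sideSet 𝓓.D b z) ∧ ∫ t in sideSet 𝓓.D b z, g t = 0 := by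
    intro x y hx hy hxy
    have hsub : Ioo x y ⊆ 𝓓.D := Ioo_subset_Icc_self.trans (𝓓.ordConnected.out hx hy)
    have h1 := ae_restrict_of_ae_restrict_of_subset hsub h
    have h2 : (ae (volume.restrict (Ioo x y))).NeBot := by
      rw [ae_neBot, Ne, Measure.restrict_eq_zero, Real.volume_Ioo]
      simpa using hxy
    obtain ⟨z, hz1, hz2⟩ := (h1.and (ae_restrict_mem measurableSet_Ioo)).exists
    exact ⟨z, hz2, hz1⟩
  have hnbr : ∀ x ∈ 𝓓.D, (∃ y ∈ 𝓓.D, x < y) ∧ ∃ y ∈ 𝓓.D, y < x := by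
    intro x hx
    obtain ⟨y1, hy1⟩ := (𝓓.isEnd true).neBot.nonempty_of_mem ((𝓓.isEnd true).basis.mem_of_mem hx)
    obtain ⟨y2, hy2⟩ := (𝓓.isEnd false).neBot.nonempty_of_mem
      ((𝓓.isEnd false).basis.mem_of_mem hx)
    exact ⟨⟨y2, hy2.1, by simpa using hy2.2⟩, ⟨y1, hy1.1, by simpa using hy1.2⟩⟩
  have hi : ∀ x ∈ 𝓓.D, IntegrableOn g (sideSet 𝓓.D b x) := by
    intro x hx
    obtain ⟨⟨y2, hy2, hxy2⟩, y1, hy1, hxy1⟩ := hnbr x hx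
    cases b
    · obtain ⟨z, hz, hz1, _⟩ := hex y1 x hy1 hx hxy1
      refine hz1.mono_set (inter_subset_inter_right _ ?_)
      simpa using Ioi_subset_Ioi hz.2.le
    · obtain ⟨z, hz, hz1, _⟩ := hex x y2 hx hy2 hxy2
      refine hz1.mono_set (inter_subset_inter_right _ ?_)
      simpa using Iio_subset_Iio hz.1.le
  have hint : ∀ x ∈ 𝓓.D, ∀ y ∈ 𝓓.D, IntervalIntegrable g volume x y := by
    intro x hx y hy
    wlog hxy : x ≤ y generalizing x y
    · exact (this y hy x hx (not_le.1 hxy).le).symm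
    rw [intervalIntegrable_iff_integrableOn_Ioo_of_le hxy]
    have hsub : Ioo x y ⊆ 𝓓.D := Ioo_subset_Icc_self.trans (𝓓.ordConnected.out hx hy)
    cases b
    · exact (hi x hx).mono_set fun z hz => ⟨hsub hz, by simpa using hz.1⟩
    · exact (hi y hy).mono_set fun z hz => ⟨hsub hz, by simpa using hz.2⟩
  obtain ⟨x0, hx0⟩ := he.neBot.nonempty_of_mem he.mem
  -- At a good point `z` where the integral is differentiable with derivative `g z ≠ 0`, the slopes
  -- from the right would be nonzero near `z`; the slope at a good point `q` is zero.
  have hder : ∀ x ∈ 𝓓.D, ∀ y ∈ 𝓓.D, ∀ᵐ z, z ∈ uIcc x y → g z = 0 := by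
    intro x hx y hy
    filter_upwards [(hint x hx y hy).ae_hasDerivAt_integral,
      (ae_restrict_iff' measurableSet_D).1 h] with z hz hz0 hzI
    have hzD : z ∈ 𝓓.D := Icc_subset hx hy hzI
    obtain ⟨_, hz2⟩ := hz0 hzD
    have hd := hasDerivAt_iff_tendsto_slope.1 (hz hzI x left_mem_uIcc)
    by_contra hne
    have hev := (hd.eventually_ne hne).filter_mono (nhdsGT_le_nhdsNE z)
    obtain ⟨v, hv, hsub⟩ := (mem_nhdsGT_iff_exists_Ioo_subset' (lt_add_one z)).1 hev
    obtain ⟨⟨y', hy', hzy'⟩, -⟩ := hnbr z hzD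
    have hmin : min v ((z + y') / 2) ∈ 𝓓.D := by
      refine 𝓓.ordConnected.out hzD hy' ⟨le_min (le_of_lt hv) (by linarith), ?_⟩
      exact (min_le_right _ _).trans (by linarith)
    obtain ⟨q, hq, _, hq2⟩ := hex z _ hzD hmin (lt_min hv (by linarith))
    have hqD : q ∈ 𝓓.D := 𝓓.ordConnected.out hzD hmin ⟨hq.1.le, hq.2.le⟩
    refine hsub ⟨hq.1, hq.2.trans_le (min_le_left _ _)⟩ ?_
    have h3 := integral_sideSet_sub b hi hqD hzD
    rw [hz2, hq2, sub_zero] at h3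
    have hs0 : sideSign b ≠ 0 := by cases b <;> simp [sideSign]
    have h4 : ∫ t in q..z, g t = 0 := by
      rw [intervalIntegral.integral_symm, (mul_eq_zero.1 h3.symm).resolve_left hs0, neg_zero]
    have h5 := intervalIntegral.integral_add_adjacent_intervals (hint x hx q hqD)
      (hint q hqD z hzD)
    rw [slope_def_field, ← h5, h4]
    simp
  have hnull : volume {z | z ∈ 𝓓.D ∧ g z ≠ 0} = 0 := by
    refine measure_null_of_locally_null _ fun z hz => ?_
    obtain ⟨⟨y2, hy2, hxy2⟩, y1, hy1, hxy1⟩ := hnbr z hz.1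
    refine ⟨{z | z ∈ uIcc y1 y2 ∧ g z ≠ 0}, ?_, ?_⟩
    · have : uIcc y1 y2 ∈ 𝓝 z := by
        rw [uIcc_of_le (hxy1.trans hxy2).le]; exact Icc_mem_nhds hxy1 hxy2
      filter_upwards [mem_nhdsWithin_of_mem_nhds this, self_mem_nhdsWithin] with a ha hb
      exact ⟨ha, hb.2⟩
    · have := hder y1 hy1 y2 hy2
      rw [ae_iff] at this
      convert this using 3
      simp
  rw [EventuallyEq, ae_restrict_iff' measurableSet_D, ae_iff]
  convert hnull using 3
  simp

/-- The step is inverted by an integral operator. With `b` the end where `u` decays, put `g = f / u`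
and let `J x` be the integral of `g` over the side of `x` away from `b`. Fubini moves the inner
integral onto `u φ_n`, whose primitive is the Wronskian over `e - E_n`, so `u J` is orthogonal to
every `φ_n` as soon as `f` is orthogonal to their transforms. Completeness gives `J = 0`, and then
`g = 0`. -/
theorem Complete.darboux {φ : ℕ → ℝ → ℝ} {E : ℕ → ℝ} (hp : 𝓓.Good p) (hu : 𝓓.Seed U p e s u)
    (hφ : ∀ n, 𝓓.Eig U p (E n) (φ n)) (hE : ∀ n, e ≠ E n) (hc : 𝓓.Complete φ) :
    𝓓.Complete fun n => darboux u (φ n) := by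
  intro f hf h0
  obtain ⟨b, hb⟩ := exists_endSign_eq hu.sign 1 (Or.inl rfl)
  obtain ⟨C, hC0, hC⟩ := hu.integral_sideSet_le hp hb
  have he := 𝓓.isEnd b
  have hu0 := hu.ne_zero
  set μ := volume.restrict 𝓓.D with hμ
  have hD := measurableSet_D (𝓓 := 𝓓)
  -- relation between the two variables
  set T : Set (ℝ × ℝ) := {q | if b then q.1 < q.2 else q.2 < q.1} with hT
  have hTm : MeasurableSet T := by
    rw [hT]
    cases b
    · simpa using measurableSet_lt measurable_snd measurable_fst
    · simpa using measurableSet_lt measurable_fst measurable_snd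
  have hTt : ∀ t ∈ 𝓓.D, {x | (x, t) ∈ T} ∩ 𝓓.D = sideSet 𝓓.D b t := by
    intro t _
    ext x
    cases b <;> simp [hT, sideSet, and_comm]
  have hTx : ∀ x ∈ 𝓓.D, {t | (x, t) ∈ T} ∩ 𝓓.D = sideSet 𝓓.D (!b) x := by
    intro x _
    ext t
    cases b <;> simp [hT, sideSet, and_comm]
  have uc := hu.sol.smooth.continuousOn
  have ρm : AEStronglyMeasurable 𝓓.ρ μ := 𝓓.ρ_smooth.continuousOn.aestronglyMeasurable hD
  have um : AEStronglyMeasurable u μ := uc.aestronglyMeasurable hD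
  have fm : AEStronglyMeasurable f μ := by
    have h1 : AEStronglyMeasurable (fun x => f x * 𝓓.ρ x / 𝓓.ρ x) μ :=
      hf.aestronglyMeasurable.div₀ ρm
    refine h1.congr (ae_restrict_of_forall_mem hD fun x hx => ?_)
    have := (𝓓.ρ_pos x hx).ne'
    field_simp
  have gm : AEStronglyMeasurable (fun t => f t / u t) μ := fm.div₀ um
  set g : ℝ → ℝ := fun t => f t / u t with hg
  -- Absolute integrability of the double integral, for any `v` dominated by `ρ`: integrating first
  -- in `x` gives at most a constant times `ρ |u|` by `integral_sideSet_le`, and `ρ |u| |g| = ρ |f|`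
  -- is integrable.
  have hK : ∀ v : ℝ → ℝ, AEStronglyMeasurable v μ → (∃ K, ∀ x ∈ 𝓓.D, |v x| ≤ K * (𝓓.ρ x)) →
      Integrable (T.indicator fun q : ℝ × ℝ => (u q.1 * v q.1) * g q.2) (μ.prod μ) := by
    rintro v vm ⟨K, hv⟩
    have uvm : AEStronglyMeasurable (fun x => u x * v x) μ := um.mul vm
    have hm : AEStronglyMeasurable (T.indicator fun q : ℝ × ℝ => (u q.1 * v q.1) * g q.2)
        (μ.prod μ) := (uvm.comp_fst.mul gm.comp_snd).indicator hTm
    have hsec : ∀ t x, T.indicator (fun q : ℝ × ℝ => (u q.1 * v q.1) * g q.2) (x, t)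
        = {x | (x, t) ∈ T}.indicator (fun x => u x * v x) x * g t := by
      intro t x
      by_cases h : (x, t) ∈ T <;> simp [Set.indicator, h]
    have hTs : ∀ t, MeasurableSet {x | (x, t) ∈ T} := fun t => measurable_prodMk_right hTm
    have hle : ∀ x ∈ 𝓓.D, |u x * v x| ≤ K * |𝓓.ρ x * u x| := by
      intro x hx
      rw [abs_mul, abs_mul, abs_of_pos (𝓓.ρ_pos x hx)]
      calc |u x| * |v x| ≤ |u x| * (K * 𝓓.ρ x) := by gcongr; exact hv x hx
        _ = _ := by ring
    have hint : ∀ t ∈ 𝓓.D, IntegrableOn (fun x => u x * v x) (sideSet 𝓓.D b t) := by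
      intro t ht
      refine Integrable.mono' ((hu.integrableOn_sideSet hp hb t ht).norm.const_mul K)
        (uvm.mono_measure (Measure.restrict_mono inter_subset_left le_rfl)) ?_
      exact ae_restrict_of_forall_mem (measurableSet_sideSet b t) fun x hx => hle x hx.1
    have hrestr : ∀ t ∈ 𝓓.D, μ.restrict {x | (x, t) ∈ T} = volume.restrict (sideSet 𝓓.D b t) := by
      intro t ht
      rw [hμ, Measure.restrict_restrict (hTs t), hTt t ht]
    rw [integrable_prod_iff' hm]
    constructor
    · refine ae_restrict_of_forall_mem hD fun t ht => ?_
      simp only [hsec]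
      refine Integrable.mul_const ?_ _
      rw [integrable_indicator_iff (hTs t), IntegrableOn, hrestr t ht]
      exact hint t ht
    · refine Integrable.mono' (hf.norm.const_mul (K * C)) hm.norm.prod_swap.integral_prod_right' ?_
      refine ae_restrict_of_forall_mem hD fun t ht => ?_
      have hK0 : 0 ≤ K := by
        have := (abs_nonneg _).trans (hv t ht)
        exact nonneg_of_mul_nonneg_left this (𝓓.ρ_pos t ht)
      have h1 : ∫ x, ‖T.indicator (fun q : ℝ × ℝ => (u q.1 * v q.1) * g q.2) (x, t)‖ ∂μ
          = (∫ x in sideSet 𝓓.D b t, |u x * v x|) * |g t| := by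
        simp only [hsec, norm_mul, norm_indicator_eq_indicator_norm]
        rw [integral_mul_const, integral_indicator (hTs t), hrestr t ht]
        simp [abs_mul]
      have h2 : ∫ x in sideSet 𝓓.D b t, |𝓓.ρ x * u x| = |∫ x in sideSet 𝓓.D b t, 𝓓.ρ x * u x| := by
        rcases 𝓓.const_sign uc hu0 with h | h
        · rw [abs_of_nonneg]
          · refine setIntegral_congr_fun (measurableSet_sideSet b t) fun x hx => ?_
            exact abs_of_pos (mul_pos (𝓓.ρ_pos x hx.1) (h x hx.1))
          · exact setIntegral_nonneg (measurableSet_sideSet b t) fun x hx =>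
              (mul_pos (𝓓.ρ_pos x hx.1) (h x hx.1)).le
        · rw [abs_of_nonpos, ← integral_neg]
          · refine setIntegral_congr_fun (measurableSet_sideSet b t) fun x hx => ?_
            exact abs_of_neg (mul_neg_of_pos_of_neg (𝓓.ρ_pos x hx.1) (h x hx.1))
          · exact setIntegral_nonpos (measurableSet_sideSet b t) fun x hx =>
              (mul_neg_of_pos_of_neg (𝓓.ρ_pos x hx.1) (h x hx.1)).le
      have h3 : ∫ x in sideSet 𝓓.D b t, |u x * v x| ≤ K * (C * (𝓓.ρ t * |u t|)) := by
        refine le_trans ?_ (mul_le_mul_of_nonneg_left (hC t ht) hK0)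
        rw [← h2, ← integral_const_mul]
        refine setIntegral_mono_on (hint t ht).norm
          ((hu.integrableOn_sideSet hp hb t ht).norm.const_mul K) (measurableSet_sideSet b t)
          fun x hx => hle x hx.1
      rw [h1, Real.norm_of_nonneg (by positivity)]
      calc (∫ x in sideSet 𝓓.D b t, |u x * v x|) * |g t|
          ≤ K * (C * (𝓓.ρ t * |u t|)) * |g t| := by gcongr
        _ = K * C * ‖f t * 𝓓.ρ t‖ := by
          have h4 := abs_pos.2 (hu0 t ht)
          rw [hg, abs_div, Real.norm_eq_abs, abs_mul, abs_of_pos (𝓓.ρ_pos t ht)]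
          field_simp
  have hTs : ∀ t, MeasurableSet {x | (x, t) ∈ T} := fun t => measurable_prodMk_right hTm
  have hTs' : ∀ x, MeasurableSet {t | (x, t) ∈ T} := fun x => measurable_prodMk_left hTm
  have hsec' : ∀ (v : ℝ → ℝ) x t, T.indicator (fun q : ℝ × ℝ => (u q.1 * v q.1) * g q.2) (x, t)
      = (u x * v x) * {t | (x, t) ∈ T}.indicator g t := by
    intro v x t
    by_cases h : (x, t) ∈ T <;> simp [Set.indicator, h]
  have hsec : ∀ (v : ℝ → ℝ) t x, T.indicator (fun q : ℝ × ℝ => (u q.1 * v q.1) * g q.2) (x, t)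
      = {x | (x, t) ∈ T}.indicator (fun x => u x * v x) x * g t := by
    intro v t x
    by_cases h : (x, t) ∈ T <;> simp [Set.indicator, h]
  set J : ℝ → ℝ := fun x => ∫ t, {t | (x, t) ∈ T}.indicator g t ∂μ with hJ
  have hsecJ : ∀ (v : ℝ → ℝ) x,
      ∫ t, T.indicator (fun q : ℝ × ℝ => (u q.1 * v q.1) * g q.2) (x, t) ∂μ
        = u x * J x * v x := by
    intro v x
    simp only [hsec' v]
    rw [integral_const_mul]; ring
  have Kρ := hK 𝓓.ρ ρm ⟨1, fun x hx => by rw [one_mul, abs_of_pos (𝓓.ρ_pos x hx)]⟩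
  -- The case `v = ρ` shows that `u J` is an admissible test function, the case `v = φ n` that it is
  -- orthogonal to the old family.
  have hy : (fun x => u x * J x) =ᵐ[μ] 0 := by
    refine hc _ ?_ fun n => ?_
    · have := Kρ.integral_prod_left
      simp only [hsecJ] at this
      exact this
    · have hφn := hφ n
      have Kφ := hK (φ n) (hφn.sol.smooth.continuousOn.aestronglyMeasurable hD)
        (by obtain ⟨K, _, hK⟩ := hφn.bound hp; exact ⟨K, hK⟩)
      have h1 := integral_integral_swap
        (f := fun x t => T.indicator (fun q : ℝ × ℝ => (u q.1 * φ n q.1) * g q.2) (x, t)) Kφ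
      simp only [hsecJ] at h1
      rw [h1]
      -- The inner integral of `u φ_n` from the end `b` up to `t` is evaluated by
      -- `hasDerivAt_mul_darboux`; the boundary term at `b` vanishes because both functions decay
      -- there.
      have h2 : ∀ t ∈ 𝓓.D,
          ∫ x, T.indicator (fun q : ℝ × ℝ => (u q.1 * φ n q.1) * g q.2) (x, t) ∂μ
          = sideSign b / (e - E n) * (f t * MultiIndexed.darboux u (φ n) t) := by
        intro t ht
        simp only [hsec]
        rw [integral_mul_const, integral_indicator (hTs t), hμ,
          Measure.restrict_restrict (hTs t), hTt t ht]
        have hne : e - E n ≠ 0 := sub_ne_zero.2 (hE n)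
        have huφ : ContinuousOn (fun x => u x * φ n x) 𝓓.D := uc.mul hφn.sol.smooth.continuousOn
        have hκ := he.κ_nonneg
        have hpb := hp b
        have hur := hu.rate b
        rw [hb] at hur
        have hIu : IntegrableOn (fun x => (e - E n) * (u x * φ n x)) (sideSet 𝓓.D b t) := by
          obtain ⟨K, _, hK⟩ := hφn.bound hp
          refine Integrable.const_mul ?_ _
          refine Integrable.mono' ((hu.integrableOn_sideSet hp hb t ht).norm.const_mul K)
            ((huφ.mono inter_subset_left).aestronglyMeasurable (measurableSet_sideSet b t)) ?_
          refine ae_restrict_of_forall_mem (measurableSet_sideSet b t) fun x hx => ?_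
          rw [Real.norm_eq_abs, Real.norm_eq_abs, abs_mul, abs_mul, abs_of_pos (𝓓.ρ_pos x hx.1)]
          calc |u x| * |φ n x| ≤ |u x| * (K * 𝓓.ρ x) := by gcongr; exact hK x hx.1
            _ = _ := by ring
        have h3 := integral_sideSet_deriv b (F := fun x => u x * MultiIndexed.darboux u (φ n) x)
          (fun x hx => hasDerivAt_mul_darboux 𝓓.isOpen hu.sol hφn.sol hu0 hx)
          (continuousOn_const.mul huφ) ht hIu
          (tendsto_mul_darboux_zero he 𝓓.isOpen 𝓓.ordConnected hu.sol.smooth hφn.sol.smooth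
            hur (hφn.rate b) (by rw [endRate]; push_cast; linarith))
        rw [integral_const_mul] at h3
        have h4 : ∫ x in sideSet 𝓓.D b t, u x * φ n x
            = sideSign b * (u t * MultiIndexed.darboux u (φ n) t) / (e - E n) := by
          rw [← h3]; field_simp
        rw [h4, hg]
        have := hu0 t ht
        field_simp
      rw [setIntegral_congr_fun hD h2, integral_const_mul, h0 n, mul_zero]
  have hg0 : g =ᵐ[μ] 0 := by
    refine ae_eq_zero_of_integral_sideSet (!b) ?_
    filter_upwards [hy, Kρ.prod_right_ae, ae_restrict_mem hD] with x h1 h2 hx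
    have hr : μ.restrict {t | (x, t) ∈ T} = volume.restrict (sideSet 𝓓.D (!b) x) := by
      rw [hμ, Measure.restrict_restrict (hTs' x), hTx x hx]
    constructor
    · simp only [hsec'] at h2
      have hne : u x * 𝓓.ρ x ≠ 0 := mul_ne_zero (hu0 x hx) (𝓓.ρ_pos x hx).ne'
      have h3 := h2.const_mul (u x * 𝓓.ρ x)⁻¹
      simp only [inv_mul_cancel_left₀ hne] at h3
      rw [integrable_indicator_iff (hTs' x), IntegrableOn, hr] at h3
      exact h3
    · have h3 : J x = 0 := (mul_eq_zero.1 h1).resolve_left (hu0 x hx)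
      rw [hJ] at h3
      simp only at h3
      rw [integral_indicator (hTs' x), hr] at h3
      exact h3
  filter_upwards [hg0, ae_restrict_mem hD] with t h1 ht
  have h2 : f t / u t = 0 := h1
  simpa [hu0 t ht] using h2

end Dom

/-! ### Iterated Darboux transformations -/

/-- The remaining seeds after a Darboux step with the first seed. -/
noncomputable def darbouxTail {k : ℕ} (f : Fin (k + 1) → ℝ → ℝ) (j : Fin k) : ℝ → ℝ :=
  darboux (f 0) (f j.succ)

/-- The multiple Darboux transform of `w` with seeds `f`. -/
noncomputable def iterDarboux : {k : ℕ} → (Fin k → ℝ → ℝ) → (ℝ → ℝ) → ℝ → ℝ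
  | 0, _, w => w
  | _ + 1, f, w => iterDarboux (darbouxTail f) (darboux (f 0) w)

/-- The potential after a multiple Darboux transformation. -/
noncomputable def iterPot : {k : ℕ} → (ℝ → ℝ) → (Fin k → ℝ) → (Fin k → ℝ → ℝ) → ℝ → ℝ
  | 0, U, _, _ => U
  | _ + 1, U, ε, f => iterPot (darbouxPot U (ε 0) (f 0)) (fun j => ε j.succ) (darbouxTail f)

/-- The exponent of the rate function in the asymptotics of a Wronskian of seeds of types `s`. -/
def crossExp : {k : ℕ} → (Fin k → ℤ) → ℤ
  | 0, _ => 0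
  | k + 1, s => crossExp (fun j : Fin k => s j.succ) - s 0 * ∑ j : Fin k, s j.succ

/-- `crossExp s` is minus the sum of `s i * s j` over pairs `i < j`, and each sign squares to `1`.
-/
theorem two_mul_crossExp {k : ℕ} (s : Fin k → ℤ) (hs : ∀ j, s j = 1 ∨ s j = -1) :
    2 * crossExp s = k - (∑ j, s j) ^ 2 := by
  induction k with
  | zero => simp [crossExp]
  | succ k ih =>
    have h1 := ih (fun j => s j.succ) fun j => hs j.succ
    have h2 : s 0 * s 0 = 1 := by rcases hs 0 with h | h <;> rw [h] <;> norm_num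
    rw [crossExp, Fin.sum_univ_succ, mul_sub, h1]
    push_cast
    linear_combination h2

namespace Dom

variable (𝓓 : Dom)

/-- A family of seeds to which a multiple Darboux transformation can be applied. -/
structure Stage (U : ℝ → ℝ) (p : Bool → ℝ) {k : ℕ} (ε : Fin k → ℝ) (s : Fin k → ℤ)
    (f : Fin k → ℝ → ℝ) : Prop where
  seed : ∀ j, 𝓓.Seed U p (ε j) (s j) (f j)
  inj : ∀ i j, i ≠ j → s i = s j → ε i ≠ ε j
  good : ∀ b, (1 + 𝓓.κ b) / 2 + ∑ j, (if endSign b (s j) = -1 then 𝓓.κ b else 0) < p b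

variable {𝓓} {U φ : ℝ → ℝ} {p : Bool → ℝ} {E : ℝ} {k : ℕ}

theorem Stage.good' {ε : Fin k → ℝ} {s : Fin k → ℤ} {f : Fin k → ℝ → ℝ}
    (h : 𝓓.Stage U p ε s f) : 𝓓.Good p := fun b => by
  refine lt_of_le_of_lt ?_ (h.good b)
  have h0 := (𝓓.isEnd b).κ_nonneg
  have : 0 ≤ ∑ j, (if endSign b (s j) = -1 then 𝓓.κ b else 0) :=
    Finset.sum_nonneg fun j _ => by split_ifs <;> simp [h0]
  linarith

/-- The field `good` reserves `κ` for every seed growing at the end `b`, which is exactly what such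
a seed removes from `p`; a decaying seed adds `κ`. So the remaining seeds satisfy the same
condition. -/
theorem Stage.tail {ε : Fin (k + 1) → ℝ} {s : Fin (k + 1) → ℤ} {f : Fin (k + 1) → ℝ → ℝ}
    (h : 𝓓.Stage U p ε s f) :
    𝓓.Stage (darbouxPot U (ε 0) (f 0)) (𝓓.shiftP p (s 0)) (fun j => ε j.succ) (fun j => s j.succ)
      (darbouxTail f) := by
  have hp := h.good'
  refine ⟨fun j => (Seed.darboux hp (h.seed 0) (h.seed j.succ)
    (h.inj 0 j.succ (Fin.succ_ne_zero j).symm)).1, fun i j hij => h.inj _ _ (by simpa using hij),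
    fun b => ?_⟩
  have h1 := h.good b
  have h0 := (𝓓.isEnd b).κ_nonneg
  rw [Fin.sum_univ_succ] at h1
  unfold shiftP
  rcases endSign_eq_or (b := b) (h.seed 0).sign with h2 | h2
  · rw [h2] at h1 ⊢
    norm_num at h1 ⊢
    linarith
  · rw [h2] at h1 ⊢
    norm_num at h1 ⊢
    linarith

/-- The parameters at the ends after a multiple Darboux transformation. -/
noncomputable def finalP (𝓓 : Dom) : {k : ℕ} → (Bool → ℝ) → (Fin k → ℤ) → Bool → ℝ
  | 0, p, _ => p
  | _ + 1, p, s => finalP 𝓓 (𝓓.shiftP p (s 0)) (fun j => s j.succ)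

theorem smooth_wronskian {ε : Fin k → ℝ} {s : Fin k → ℤ} {f : Fin k → ℝ → ℝ}
    (h : 𝓓.Stage U p ε s f) : ContDiffOn ℝ ∞ (wronskian f) 𝓓.D :=
  contDiffOn_wronskian 𝓓.isOpen fun j => (h.seed j).sol.smooth

theorem Stage.wronskian_succ {ε : Fin (k + 1) → ℝ} {s : Fin (k + 1) → ℤ}
    {f : Fin (k + 1) → ℝ → ℝ} (h : 𝓓.Stage U p ε s f) {x : ℝ} (hx : x ∈ 𝓓.D) :
    wronskian f x = f 0 x * wronskian (darbouxTail f) x :=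
  MultiIndexed.wronskian_succ 𝓓.isOpen (fun j => (h.seed j).sol.smooth) (h.seed 0).ne_zero hx

/-- The Wronskian is the product of the first seeds of the successive stages, and each of them is
nodeless. -/
theorem Stage.wronskian_ne_zero {ε : Fin k → ℝ} {s : Fin k → ℤ} {f : Fin k → ℝ → ℝ}
    (h : 𝓓.Stage U p ε s f) : ∀ x ∈ 𝓓.D, wronskian f x ≠ 0 := by
  induction k generalizing U p with
  | zero => intro x _; simp [wronskian]
  | succ k ih =>
    intro x hx
    rw [h.wronskian_succ hx]
    exact mul_ne_zero ((h.seed 0).ne_zero x hx) (ih h.tail x hx)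

/-- Crum's formula, obtained by peeling the first seed off both Wronskians; the common factor `f 0`
cancels and the tails are again a stage. -/
theorem Stage.wronskian_append {ε : Fin k → ℝ} {s : Fin k → ℤ} {f : Fin k → ℝ → ℝ}
    (h : 𝓓.Stage U p ε s f) {w : ℝ → ℝ} (hw : ContDiffOn ℝ ∞ w 𝓓.D) {x : ℝ} (hx : x ∈ 𝓓.D) :
    wronskian (Fin.append f fun _ : Fin 1 => w) x = wronskian f x * iterDarboux f w x := by
  induction k generalizing U p w with
  | zero =>
    simp [wronskian, iterDarboux, Matrix.det_unique, Fin.append]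
    rfl
  | succ k ih =>
    have hF0 : Fin.append f (fun _ : Fin 1 => w) 0 = f 0 := by
      have : (0 : Fin (k + 1 + 1)) = Fin.castAdd 1 (0 : Fin (k + 1)) := rfl
      rw [this, Fin.append_left]
    have hF : ∀ j, ContDiffOn ℝ ∞ (Fin.append f (fun _ : Fin 1 => w) j) 𝓓.D := by
      intro j
      refine Fin.addCases (fun i => ?_) (fun i => ?_) j
      · rw [Fin.append_left]; exact (h.seed i).sol.smooth
      · rw [Fin.append_right]; exact hw
    have h1 := MultiIndexed.wronskian_succ 𝓓.isOpen hF
      (by rw [hF0]; exact (h.seed 0).ne_zero) hx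
    have h2 : (fun j : Fin (k + 1) => darboux (Fin.append f (fun _ : Fin 1 => w) 0)
        (Fin.append f (fun _ : Fin 1 => w) j.succ))
        = Fin.append (darbouxTail f) (fun _ : Fin 1 => darboux (f 0) w) := by
      funext j
      rw [hF0]
      refine Fin.addCases (fun i => ?_) (fun i => ?_) j
      · rw [Fin.append_left]
        have : (Fin.castAdd 1 i).succ = Fin.castAdd 1 i.succ := rfl
        rw [this, Fin.append_left]; rfl
      · rw [Fin.append_right]
        have : (Fin.natAdd k i).succ = Fin.natAdd (k + 1) i := by ext; simp
        rw [this, Fin.append_right]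
    rw [h1, h2, hF0, ih h.tail (contDiffOn_darboux 𝓓.isOpen (h.seed 0).sol.smooth hw
      (h.seed 0).ne_zero), h.wronskian_succ hx, iterDarboux]
    ring

/-- A step with the seed `0` multiplies the seed `j` by `r ^ (-(s 0 * s j))` up to a constant
factor. Summing the exponents over all pairs gives `crossExp`, the same at both ends because
products of two signs do not depend on the end. -/
theorem Stage.asym_wronskian {ε : Fin k → ℝ} {s : Fin k → ℤ} {f : Fin k → ℝ → ℝ}
    (h : 𝓓.Stage U p ε s f) (b : Bool) :
    AsymC (𝓓.l b) (wronskian f) (fun x => (∏ j, f j x) * 𝓓.r b x ^ crossExp s) := by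
  have he := 𝓓.isEnd b
  induction k generalizing U p with
  | zero => exact ⟨1, one_ne_zero, by simpa [wronskian, crossExp] using tendsto_const_nhds⟩
  | succ k ih =>
    have h1 := ih h.tail
    have h2 : ∀ j ∈ Finset.univ, AsymC (𝓓.l b) (darbouxTail f j)
        (fun x => f j.succ x * 𝓓.r b x ^ (-(s 0 * s j.succ))) := fun j _ =>
      (Seed.darboux h.good' (h.seed 0) (h.seed j.succ)
        (h.inj 0 j.succ (Fin.succ_ne_zero j).symm)).2 b
    have h3 := AsymC.prod Finset.univ h2
    have hr : AsymC (𝓓.l b) (fun x => 𝓓.r b x ^ crossExp fun j : Fin k => s j.succ)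
        (fun x => 𝓓.r b x ^ crossExp fun j : Fin k => s j.succ) :=
      AsymC.refl' (by filter_upwards [he.mem] with x hx using zpow_ne_zero _ (he.r_ne hx))
    have hf : AsymC (𝓓.l b) (f 0) (f 0) := AsymC.refl' ((h.seed 0).rate b).1
    refine ((hf.mul (h1.trans (h3.mul hr))).congr_left ?_).congr_right ?_
    · filter_upwards [he.mem] with x hx using (h.wronskian_succ hx).symm
    · filter_upwards [he.mem] with x hx
      have hr0 := he.r_ne hx
      have : (∏ j : Fin k, 𝓓.r b x ^ (-(s 0 * s j.succ)))
          = 𝓓.r b x ^ (-(s 0 * ∑ j : Fin k, s j.succ)) := by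
        rw [Finset.mul_sum, ← Finset.sum_neg_distrib]
        induction (Finset.univ : Finset (Fin k)) using Finset.induction_on with
        | empty => simp
        | insert a t ha ih' => rw [Finset.prod_insert ha, Finset.sum_insert ha, zpow_add₀ hr0, ih']
      rw [Finset.prod_mul_distrib, this, crossExp, sub_eq_neg_add, zpow_add₀ hr0,
        Fin.prod_univ_succ]
      ring

theorem Stage.eig {ε : Fin k → ℝ} {s : Fin k → ℤ} {f : Fin k → ℝ → ℝ}
    (h : 𝓓.Stage U p ε s f) (hφ : 𝓓.Eig U p E φ) (hE : ∀ j, ε j ≠ E) :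
    𝓓.Eig (iterPot U ε f) (𝓓.finalP p s) E (iterDarboux f φ) := by
  induction k generalizing U p φ with
  | zero => exact hφ
  | succ k ih =>
    exact ih h.tail (Eig.darboux h.good' (h.seed 0) hφ (hE 0)).1 fun j => hE j.succ

theorem Stage.good_finalP {ε : Fin k → ℝ} {s : Fin k → ℤ} {f : Fin k → ℝ → ℝ}
    (h : 𝓓.Stage U p ε s f) : 𝓓.Good (𝓓.finalP p s) := by
  induction k generalizing U p with
  | zero => exact h.good'
  | succ k ih => exact ih h.tail

/-- An eigenfunction has class `1` at both ends, so its exponent changes by minus the class of each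
seed at that end, which does depend on the end. -/
theorem Stage.asym_eig {ε : Fin k → ℝ} {s : Fin k → ℤ} {f : Fin k → ℝ → ℝ}
    (h : 𝓓.Stage U p ε s f) (hφ : 𝓓.Eig U p E φ) (hE : ∀ j, ε j ≠ E) (b : Bool) :
    AsymC (𝓓.l b) (iterDarboux f φ) (fun x => φ x * 𝓓.r b x ^ (-∑ j, endSign b (s j))) := by
  have he := 𝓓.isEnd b
  induction k generalizing U p φ with
  | zero => simpa [iterDarboux] using AsymC.refl' (hφ.rate b).1
  | succ k ih =>
    have h0 := Eig.darboux h.good' (h.seed 0) hφ (hE 0)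
    have h1 := ih h.tail h0.1 fun j => hE j.succ
    have hr : AsymC (𝓓.l b) (fun x => 𝓓.r b x ^ (-∑ j : Fin k, endSign b (s j.succ)))
        (fun x => 𝓓.r b x ^ (-∑ j : Fin k, endSign b (s j.succ))) :=
      AsymC.refl' (by filter_upwards [he.mem] with x hx using zpow_ne_zero _ (he.r_ne hx))
    refine (h1.trans ((h0.2 b).mul hr)).congr_right ?_
    filter_upwards [he.mem] with x hx
    rw [Fin.sum_univ_succ, neg_add, zpow_add₀ (he.r_ne hx)]
    ring

theorem Stage.zeroCount {ε : Fin k → ℝ} {s : Fin k → ℤ} {f : Fin k → ℝ → ℝ} {n : ℕ}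
    (h : 𝓓.Stage U p ε s f) (hφ : 𝓓.Eig U p E φ) (hE : ∀ j, ε j ≠ E) (hz : ZeroCount 𝓓.D φ n) :
    ZeroCount 𝓓.D (iterDarboux f φ) n := by
  induction k generalizing U p φ with
  | zero => exact hz
  | succ k ih =>
    exact ih h.tail (Eig.darboux h.good' (h.seed 0) hφ (hE 0)).1 (fun j => hE j.succ)
      (hz.darboux h.good' (h.seed 0) hφ (hE 0))

theorem Stage.integral_mul {ε : Fin k → ℝ} {s : Fin k → ℤ} {f : Fin k → ℝ → ℝ} {E' : ℝ}
    {φ' : ℝ → ℝ} (h : 𝓓.Stage U p ε s f) (hφ : 𝓓.Eig U p E φ) (hE : ∀ j, ε j ≠ E)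
    (hφ' : 𝓓.Eig U p E' φ') (hE' : ∀ j, ε j ≠ E') :
    ∫ x in 𝓓.D, iterDarboux f φ x * iterDarboux f φ' x
      = (∏ j, (E' - ε j)) * ∫ x in 𝓓.D, φ x * φ' x := by
  induction k generalizing U p φ φ' with
  | zero => simp [iterDarboux]
  | succ k ih =>
    rw [Fin.prod_univ_succ]
    have h1 := ih h.tail (Eig.darboux h.good' (h.seed 0) hφ (hE 0)).1 (fun j => hE j.succ)
      (Eig.darboux h.good' (h.seed 0) hφ' (hE' 0)).1 (fun j => hE' j.succ)
    rw [iterDarboux, iterDarboux, h1,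
      integral_darboux_mul h.good' h.tail.good' (h.seed 0) hφ hφ' (hE 0) (hE' 0)]
    ring

theorem Stage.complete {ε : Fin k → ℝ} {s : Fin k → ℤ} {f : Fin k → ℝ → ℝ} {E : ℕ → ℝ}
    {φ : ℕ → ℝ → ℝ} (h : 𝓓.Stage U p ε s f) (hφ : ∀ n, 𝓓.Eig U p (E n) (φ n))
    (hE : ∀ n j, ε j ≠ E n) (hc : 𝓓.Complete φ) : 𝓓.Complete fun n => iterDarboux f (φ n) := by
  induction k generalizing U p φ with
  | zero => exact hc
  | succ k ih =>
    exact ih h.tail (fun n => (Eig.darboux h.good' (h.seed 0) (hφ n) (hE n 0)).1)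
      (fun n j => hE n j.succ) (hc.darboux h.good' (h.seed 0) hφ fun n => hE n 0)

theorem deriv_deriv_log_mul {u v : ℝ → ℝ} (hu : ContDiffOn ℝ ∞ u 𝓓.D) (hv : ContDiffOn ℝ ∞ v 𝓓.D)
    (hu0 : ∀ x ∈ 𝓓.D, u x ≠ 0) (hv0 : ∀ x ∈ 𝓓.D, v x ≠ 0) {x : ℝ} (hx : x ∈ 𝓓.D) :
    deriv (deriv fun y => Real.log (u y * v y)) x
      = deriv (deriv fun y => Real.log (u y)) x + deriv (deriv fun y => Real.log (v y)) x := by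
  have hl : ∀ {w : ℝ → ℝ}, ContDiffOn ℝ ∞ w 𝓓.D → (∀ x ∈ 𝓓.D, w x ≠ 0) →
      ContDiffOn ℝ ∞ (fun y => Real.log (w y)) 𝓓.D := fun hw hw0 => hw.log hw0
  have h1 : EqOn (fun y => Real.log (u y * v y)) (fun y => Real.log (u y) + Real.log (v y)) 𝓓.D :=
    fun y hy => Real.log_mul (hu0 y hy) (hv0 y hy)
  have h2 : EqOn (deriv fun y => Real.log (u y * v y))
      (fun y => deriv (fun y => Real.log (u y)) y + deriv (fun y => Real.log (v y)) y) 𝓓.D := by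
    intro y hy
    rw [deriv_eqOn 𝓓.isOpen h1 hy]
    exact deriv_add ((hl hu hu0).smooth_differentiableAt 𝓓.isOpen hy)
      ((hl hv hv0).smooth_differentiableAt 𝓓.isOpen hy)
  rw [deriv_eqOn 𝓓.isOpen h2 hx]
  exact deriv_add (((hl hu hu0).smooth_deriv 𝓓.isOpen).smooth_differentiableAt 𝓓.isOpen hx)
      (((hl hv hv0).smooth_deriv 𝓓.isOpen).smooth_differentiableAt 𝓓.isOpen hx)

theorem Stage.iterPot_eq {ε : Fin k → ℝ} {s : Fin k → ℤ} {f : Fin k → ℝ → ℝ}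
    (h : 𝓓.Stage U p ε s f) {x : ℝ} (hx : x ∈ 𝓓.D) :
    iterPot U ε f x = U x - 2 * deriv (deriv fun y => Real.log (wronskian f y)) x := by
  induction k generalizing U p with
  | zero => simp [iterPot, wronskian]
  | succ k ih =>
    have h1 : EqOn (fun y => Real.log (wronskian f y))
        (fun y => Real.log (f 0 y * wronskian (darbouxTail f) y)) 𝓓.D := fun y hy => by
      simp only [h.wronskian_succ hy]
    have h2 := deriv_eqOn 𝓓.isOpen (deriv_eqOn 𝓓.isOpen h1) hx
    rw [iterPot, ih h.tail, h2, deriv_deriv_log_mul (h.seed 0).sol.smooth (smooth_wronskian h.tail)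
      (h.seed 0).ne_zero h.tail.wronskian_ne_zero hx,
      (h.seed 0).sol.deriv_deriv_log 𝓓.isOpen (h.seed 0).ne_zero hx]
    ring

/-- A solution which decays at one end, with energy below a nodeless solution decaying there, has
no zeros. -/
theorem ne_zero_of_lt {u w : ℝ → ℝ} {e e' : ℝ} (hp : 𝓓.Good p) (hu : IsSol 𝓓.D U e u)
    (hu0 : ∀ x ∈ 𝓓.D, u x ≠ 0) (hw : IsSol 𝓓.D U e' w) (hlt : e' < e) (b : Bool)
    (hur : HasRate (𝓓.l b) (𝓓.r b) u (endRate (𝓓.κ b) (p b) 1))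
    (hwr : HasRate (𝓓.l b) (𝓓.r b) w (endRate (𝓓.κ b) (p b) 1)) : ∀ x ∈ 𝓓.D, w x ≠ 0 := by
  have he := 𝓓.isEnd b
  have hpb := hp b
  have hκ := he.κ_nonneg
  have dw := fun x hx => hw.smooth.smooth_differentiableAt 𝓓.isOpen (x := x) hx
  have hv := contDiffOn_darboux 𝓓.isOpen hu.smooth hw.smooth hu0
  have dv := fun x hx => hv.smooth_differentiableAt 𝓓.isOpen (x := x) hx
  have hvr := (darboux_rate he 𝓓.isOpen 𝓓.ordConnected hu.smooth hw.smooth hu0 hpb (Or.inl rfl)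
    (Or.inl rfl) hur hwr (fun _ => (sub_pos.2 hlt).ne')
    (fun x hx => deriv_darboux 𝓓.isOpen hu hw hu0 hx)).1
  have hlim : Tendsto (fun x => w x * darboux u w x) (𝓓.l b) (𝓝 0) := by
    have h1 := hwr.tendsto_zero he 𝓓.ordConnected dw (by unfold endRate; push_cast; linarith)
    have h2 := hvr.tendsto_zero he 𝓓.ordConnected dv (by unfold endRate; push_cast; linarith)
    simpa using h1.mul h2
  -- The derivative is nonnegative. If `w` vanished at `x`, this monotone function would be `0` at
  -- `x` and tend to `0` at the end, hence vanish in between; its derivative then forces `w = 0`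
  -- there, against the rate of `w`.
  have hY : ∀ x ∈ 𝓓.D, HasDerivAt (fun x => w x * darboux u w x)
      (darboux u w x ^ 2 + (e - e') * w x ^ 2) x := by
    intro x hx
    have h1 := (dw x hx).hasDerivAt.mul (dv x hx).hasDerivAt
    rw [deriv_darboux 𝓓.isOpen hu hw hu0 hx] at h1
    refine h1.congr_deriv ?_
    have h4 : deriv w x = darboux u w x + deriv u x / u x * w x := by
      simp only [darboux]; ring
    rw [h4]; ring
  have hmono : MonotoneOn (fun x => w x * darboux u w x) 𝓓.D :=
    monotoneOn_of_deriv_nonneg 𝓓.ordConnected.convex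
      (fun x hx => (hY x hx).continuousAt.continuousWithinAt)
      (fun x hx => (hY x (interior_subset hx)).differentiableAt.differentiableWithinAt)
      (fun x hx => by
        rw [(hY x (interior_subset hx)).deriv]
        have := sub_pos.2 hlt
        positivity)
  intro x hx hx0
  have hzero : ∀ y ∈ sideSet 𝓓.D b x, w y * darboux u w y = 0 := by
    intro y hy
    have hb := he.basis.mem_of_mem hy.1
    have := he.neBot
    cases b
    · have hxy : x < y := by simpa [sideSet] using hy.2
      have h1 := hmono hx hy.1 hxy.le
      simp only [hx0, zero_mul] at h1
      refine le_antisymm (ge_of_tendsto hlim ?_) h1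
      filter_upwards [hb] with z hz
      exact hmono hy.1 hz.1 (by simpa [sideSet] using hz.2.le)
    · have hxy : y < x := by simpa [sideSet] using hy.2
      have h1 := hmono hy.1 hx hxy.le
      simp only [hx0, zero_mul] at h1
      refine le_antisymm h1 (le_of_tendsto hlim ?_)
      filter_upwards [hb] with z hz
      exact hmono hz.1 hy.1 (by simpa [sideSet] using hz.2.le)
  obtain ⟨y, hy, hwy⟩ := he.neBot.nonempty_of_mem
    (inter_mem (he.basis.mem_of_mem hx) hwr.1)
  have hopen : sideSet 𝓓.D b x ∈ 𝓝 y := by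
    refine IsOpen.mem_nhds ?_ hy
    unfold sideSet
    cases b
    · simpa using 𝓓.isOpen.inter isOpen_Ioi
    · simpa using 𝓓.isOpen.inter isOpen_Iio
  have hev : (fun x => w x * darboux u w x) =ᶠ[𝓝 y] fun _ => 0 := by
    filter_upwards [hopen] with z hz using hzero z hz
  have h5 := (hY y hy.1).deriv
  rw [hev.deriv_eq, deriv_const] at h5
  have h6 := sub_pos.2 hlt
  have h7 : 0 < w y ^ 2 := by
    have : w y ≠ 0 := hwy
    positivity
  nlinarith [sq_nonneg (darboux u w y), mul_pos h6 h7]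

end Dom

/-! ### Laguerre and Jacobi polynomials: coefficients, equations and contiguous relations -/

open Polynomial in
/-- The coefficients `(-1)^k (α+k+1)_{n-k} / ((n-k)! k!)` of the Laguerre polynomials. -/
noncomputable def hyperCoeff (n : ℕ) (α : ℝ) (k : ℕ) : ℝ :=
  if k ≤ n then (-1) ^ k * (ascPochhammer ℝ (n - k)).eval (α + k + 1)
    / ((n - k).factorial * k.factorial : ℝ) else 0

open Polynomial in
/-- The polynomial with coefficients `hyperCoeff n α k * t k`. -/
noncomputable def hyperPoly (n : ℕ) (α : ℝ) (t : ℕ → ℝ) : ℝ[X] :=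
  ∑ k ∈ Finset.range (n + 1), monomial k (hyperCoeff n α k * t k)

/-- The Laguerre polynomial as a polynomial. -/
noncomputable def lagPoly (n : ℕ) (α : ℝ) : Polynomial ℝ := hyperPoly n α fun _ => 1

/-- The Jacobi polynomial as a polynomial in `(1 - η) / 2`. -/
noncomputable def jacPoly (n : ℕ) (α β : ℝ) : Polynomial ℝ :=
  hyperPoly n α fun k => (ascPochhammer ℝ k).eval (n + α + β + 1)

theorem hyperCoeff_of_lt {n k : ℕ} (α : ℝ) (h : n < k) : hyperCoeff n α k = 0 :=
  if_neg (by omega)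

theorem hyperCoeff_add (m k : ℕ) (α : ℝ) :
    hyperCoeff (k + m) α k = (-1) ^ k * (ascPochhammer ℝ m).eval (α + k + 1)
      / (m.factorial * k.factorial : ℝ) := by
  rw [hyperCoeff, if_pos (by omega), Nat.add_sub_cancel_left]

theorem coeff_hyperPoly (n : ℕ) (α : ℝ) (t : ℕ → ℝ) (k : ℕ) :
    (hyperPoly n α t).coeff k = hyperCoeff n α k * t k := by
  rw [hyperPoly, Polynomial.finsetSum_coeff]
  simp only [Polynomial.coeff_monomial]
  rw [Finset.sum_ite_eq']
  split_ifs with h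
  · rfl
  · rw [hyperCoeff_of_lt _ (by simpa using h), zero_mul]

theorem natDegree_hyperPoly_le (n : ℕ) (α : ℝ) (t : ℕ → ℝ) : (hyperPoly n α t).natDegree ≤ n := by
  rw [Polynomial.natDegree_le_iff_coeff_eq_zero]
  intro k hk
  rw [coeff_hyperPoly, hyperCoeff_of_lt _ hk, zero_mul]

theorem hyperCoeff_self (n : ℕ) (α : ℝ) : hyperCoeff n α n = (-1) ^ n / n.factorial := by
  have := hyperCoeff_add 0 n α
  simpa using this

theorem hyperCoeff_zero (n : ℕ) (α : ℝ) :
    hyperCoeff n α 0 = (ascPochhammer ℝ n).eval (α + 1) / n.factorial := by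
  have := hyperCoeff_add n 0 α
  simpa using this

theorem eval_ascPochhammer_succ_left (m : ℕ) (x : ℝ) :
    (ascPochhammer ℝ (m + 1)).eval x = x * (ascPochhammer ℝ m).eval (x + 1) := by
  rw [ascPochhammer_succ_left]; simp

/-- The term ratio of the hypergeometric series, multiplied out so that it stays valid when `α + k +
1` is zero. Compared coefficientwise it gives both differential equations. -/
theorem succ_mul_hyperCoeff_succ (n k : ℕ) (α : ℝ) :
    (k + 1) * (α + k + 1) * hyperCoeff n α (k + 1) = -(n - k) * hyperCoeff n α k := by
  rcases lt_or_ge k n with h | h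
  · obtain ⟨m, rfl⟩ := Nat.exists_eq_add_of_le (Nat.succ_le_of_lt h)
    have h1 := hyperCoeff_add (m + 1) k α
    rw [show k + (m + 1) = k.succ + m by omega] at h1
    rw [h1, Nat.succ_eq_add_one, hyperCoeff_add, eval_ascPochhammer_succ_left]
    have := Nat.cast_ne_zero (R := ℝ).2 (Nat.factorial_ne_zero m)
    have := Nat.cast_ne_zero (R := ℝ).2 (Nat.factorial_ne_zero k)
    push_cast [Nat.factorial_succ]
    rw [show α + (k + 1) + 1 = α + k + 1 + 1 by ring, pow_succ]
    field_simp
    ring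
  · rw [hyperCoeff_of_lt _ (by omega)]
    rcases h.eq_or_lt with rfl | h
    · simp
    · rw [hyperCoeff_of_lt _ h]; simp

theorem succ_mul_hyperCoeff_succ_succ (n k : ℕ) (α : ℝ) :
    (k + 1) * hyperCoeff (n + 1) α (k + 1) = -hyperCoeff n (α + 1) k := by
  rcases le_or_gt k n with h | h
  · obtain ⟨m, rfl⟩ := Nat.exists_eq_add_of_le h
    rw [show k + m + 1 = (k + 1) + m by omega, hyperCoeff_add, hyperCoeff_add]
    have := Nat.cast_ne_zero (R := ℝ).2 (Nat.factorial_ne_zero m)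
    have := Nat.cast_ne_zero (R := ℝ).2 (Nat.factorial_ne_zero k)
    push_cast [Nat.factorial_succ]
    rw [show α + (k + 1) + 1 = α + 1 + k + 1 by ring, pow_succ]
    field_simp
  · rw [hyperCoeff_of_lt _ h, hyperCoeff_of_lt _ (by omega)]; simp

theorem eval_ascPochhammer_add_one_mul (m : ℕ) (x : ℝ) :
    x * (ascPochhammer ℝ m).eval (x + 1) = (ascPochhammer ℝ m).eval x * (x + m) := by
  rw [← eval_ascPochhammer_succ_left, ascPochhammer_succ_eval]

/-- Coefficient form of the Jacobi relation moving `(α, β)` to `(α + 1, β - 1)`. Both sides are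
affine in `β`, so the difference of two instances gives the Laguerre relation. -/
theorem mul_hyperCoeff_sub (n k : ℕ) (α β : ℝ) :
    (k + β) * hyperCoeff n α k - (k + 1) * (n + k + α + β + 1) * hyperCoeff n α (k + 1)
      = (n + β) * hyperCoeff n (α + 1) k := by
  rcases lt_trichotomy k n with h | rfl | h
  · obtain ⟨m, rfl⟩ := Nat.exists_eq_add_of_le (Nat.succ_le_of_lt h)
    have h1 := hyperCoeff_add (m + 1) k α
    have h2 := hyperCoeff_add (m + 1) k (α + 1)
    rw [show k + (m + 1) = k.succ + m by omega] at h1 h2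
    rw [h1, h2, Nat.succ_eq_add_one, hyperCoeff_add, eval_ascPochhammer_succ_left,
      ascPochhammer_succ_eval]
    have := Nat.cast_ne_zero (R := ℝ).2 (Nat.factorial_ne_zero m)
    have := Nat.cast_ne_zero (R := ℝ).2 (Nat.factorial_ne_zero k)
    push_cast [Nat.factorial_succ]
    rw [show α + (k + 1) + 1 = α + 1 + k + 1 by ring,
      show α + k + 1 + 1 = α + 1 + k + 1 by ring, pow_succ]
    field_simp
    ring
  · rw [hyperCoeff_of_lt (n := k) (k := k + 1) _ (by omega), hyperCoeff_self, hyperCoeff_self]; ring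
  · rw [hyperCoeff_of_lt _ (by omega), hyperCoeff_of_lt _ (by omega),
      hyperCoeff_of_lt _ (by omega)]; ring

theorem hyperCoeff_sub_succ (n k : ℕ) (α : ℝ) :
    hyperCoeff n α k - (k + 1) * hyperCoeff n α (k + 1) = hyperCoeff n (α + 1) k := by
  have h0 := mul_hyperCoeff_sub n k α 0
  have h1 := mul_hyperCoeff_sub n k α 1
  linear_combination h1 - h0

theorem add_mul_hyperCoeff (n k : ℕ) (α : ℝ) :
    (k + α) * hyperCoeff n α k = (n + α) * hyperCoeff n (α - 1) k := by
  rcases le_or_gt k n with h | h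
  · obtain ⟨m, rfl⟩ := Nat.exists_eq_add_of_le h
    rw [hyperCoeff_add, hyperCoeff_add]
    have := eval_ascPochhammer_add_one_mul m (α + k)
    rw [show α - 1 + k + 1 = α + k by ring]
    push_cast
    linear_combination ((-1) ^ k / (m.factorial * k.factorial : ℝ)) * this
  · rw [hyperCoeff_of_lt _ h, hyperCoeff_of_lt _ h]; simp

open Polynomial

theorem laguerreP_eq (n : ℕ) (α x : ℝ) : laguerreP n α x = (lagPoly n α).eval x := by
  rw [laguerreP, lagPoly, hyperPoly, eval_finsetSum]
  refine Finset.sum_congr rfl fun k hk => ?_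
  rw [eval_monomial, hyperCoeff, if_pos (by simpa [Nat.lt_succ_iff] using hk)]
  ring

theorem jacobiP_eq (n : ℕ) (α β x : ℝ) :
    jacobiP n α β x = (jacPoly n α β).eval ((1 - x) / 2) := by
  rw [jacobiP, jacPoly, hyperPoly, eval_finsetSum]
  refine Finset.sum_congr rfl fun k hk => ?_
  rw [eval_monomial, hyperCoeff, if_pos (by simpa [Nat.lt_succ_iff] using hk)]
  ring

theorem lagPoly_zero (α : ℝ) : lagPoly 0 α = 1 := by
  ext k
  rw [lagPoly, coeff_hyperPoly, coeff_one]
  rcases Nat.eq_zero_or_pos k with rfl | h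
  · rw [hyperCoeff_self]; simp
  · rw [hyperCoeff_of_lt _ h, if_neg (by omega)]; simp

theorem jacPoly_zero (α β : ℝ) : jacPoly 0 α β = 1 := by
  ext k
  rw [jacPoly, coeff_hyperPoly, coeff_one]
  rcases Nat.eq_zero_or_pos k with rfl | h
  · rw [hyperCoeff_self]; simp
  · rw [hyperCoeff_of_lt _ h, if_neg (by omega)]; simp

theorem natDegree_lagPoly_le (n : ℕ) (α : ℝ) : (lagPoly n α).natDegree ≤ n :=
  natDegree_hyperPoly_le ..

theorem natDegree_jacPoly_le (n : ℕ) (α β : ℝ) : (jacPoly n α β).natDegree ≤ n :=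
  natDegree_hyperPoly_le ..

theorem coeff_lagPoly_self (n : ℕ) (α : ℝ) : (lagPoly n α).coeff n = (-1) ^ n / n.factorial := by
  rw [lagPoly, coeff_hyperPoly, hyperCoeff_self, mul_one]

theorem coeff_jacPoly_self (n : ℕ) (α β : ℝ) : (jacPoly n α β).coeff n
    = (-1) ^ n / n.factorial * (ascPochhammer ℝ n).eval (n + α + β + 1) := by
  rw [jacPoly, coeff_hyperPoly, hyperCoeff_self]

theorem eval_zero_lagPoly (n : ℕ) (α : ℝ) :
    (lagPoly n α).eval 0 = (ascPochhammer ℝ n).eval (α + 1) / n.factorial := by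
  rw [← coeff_zero_eq_eval_zero, lagPoly, coeff_hyperPoly, hyperCoeff_zero, mul_one]

theorem eval_zero_jacPoly (n : ℕ) (α β : ℝ) :
    (jacPoly n α β).eval 0 = (ascPochhammer ℝ n).eval (α + 1) / n.factorial := by
  rw [← coeff_zero_eq_eval_zero, jacPoly, coeff_hyperPoly, hyperCoeff_zero]; simp

theorem lagPoly_ode (n : ℕ) (α : ℝ) :
    X * derivative (derivative (lagPoly n α)) + (C (α + 1) - X) * derivative (lagPoly n α)
      + C (n : ℝ) * lagPoly n α = 0 := by
  ext k
  have h := succ_mul_hyperCoeff_succ n k α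
  rcases k with _ | k
  · simp only [sub_mul, coeff_add, coeff_sub, coeff_C_mul, coeff_X_mul_zero, coeff_derivative,
      lagPoly, coeff_hyperPoly, coeff_zero]
    push_cast at h ⊢
    linear_combination h
  · simp only [sub_mul, coeff_add, coeff_sub, coeff_C_mul, coeff_X_mul, coeff_derivative,
      lagPoly, coeff_hyperPoly, coeff_zero]
    push_cast at h ⊢
    linear_combination h

theorem jacPoly_ode (n : ℕ) (α β : ℝ) :
    X * (1 - X) * derivative (derivative (jacPoly n α β))
      + (C (α + 1) - C (α + β + 2) * X) * derivative (jacPoly n α β)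
      + C (n * (n + α + β + 1)) * jacPoly n α β = 0 := by
  ext k
  have h := succ_mul_hyperCoeff_succ n k α
  have ht := ascPochhammer_succ_eval k (n + α + β + 1 : ℝ)
  have e : X * (1 - X) * derivative (derivative (jacPoly n α β))
      + (C (α + 1) - C (α + β + 2) * X) * derivative (jacPoly n α β)
      + C (n * (n + α + β + 1)) * jacPoly n α β
      = X * derivative (derivative (jacPoly n α β))
      - X * (X * derivative (derivative (jacPoly n α β)))
      + C (α + 1) * derivative (jacPoly n α β)
      - C (α + β + 2) * (X * derivative (jacPoly n α β))
      + C (n * (n + α + β + 1)) * jacPoly n α β := by ring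
  rw [e]
  rcases k with _ | _ | k
  · simp only [coeff_add, coeff_sub, coeff_C_mul, coeff_X_mul_zero, coeff_derivative,
      jacPoly, coeff_hyperPoly, coeff_zero, ht]
    push_cast at h ⊢
    linear_combination (n + α + β + 1 + 0) * eval (n + α + β + 1) (ascPochhammer ℝ 0) * h
  · simp only [coeff_add, coeff_sub, coeff_C_mul, coeff_X_mul, coeff_X_mul_zero,
      coeff_derivative, jacPoly, coeff_hyperPoly, coeff_zero, ht, zero_add]
    push_cast at h ⊢
    linear_combination (n + α + β + 1 + 1) * eval (n + α + β + 1) (ascPochhammer ℝ 1) * h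
  · simp only [coeff_add, coeff_sub, coeff_C_mul, coeff_X_mul, coeff_X_mul_zero,
      coeff_derivative, jacPoly, coeff_hyperPoly, coeff_zero, ht, zero_add]
    push_cast at h ⊢
    linear_combination (n + α + β + 1 + (k + 1 + 1)) *
      eval (n + α + β + 1) (ascPochhammer ℝ (k + 1 + 1)) * h

theorem derivative_lagPoly (n : ℕ) (α : ℝ) :
    derivative (lagPoly (n + 1) α) = -lagPoly n (α + 1) := by
  ext k
  rw [coeff_derivative, coeff_neg, lagPoly, lagPoly, coeff_hyperPoly, coeff_hyperPoly]
  linear_combination succ_mul_hyperCoeff_succ_succ n k α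

theorem derivative_jacPoly (n : ℕ) (α β : ℝ) :
    derivative (jacPoly (n + 1) α β) = -C (n + α + β + 2) * jacPoly n (α + 1) (β + 1) := by
  ext k
  rw [coeff_derivative, neg_mul, coeff_neg, coeff_C_mul, jacPoly, jacPoly, coeff_hyperPoly,
    coeff_hyperPoly, eval_ascPochhammer_succ_left]
  push_cast
  rw [show (n + 1 + α + β + 1 + 1 : ℝ) = n + (α + 1) + (β + 1) + 1 by ring]
  linear_combination (n + α + β + 2) * eval (n + (α + 1) + (β + 1) + 1) (ascPochhammer ℝ k) *
    succ_mul_hyperCoeff_succ_succ n k α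

theorem lagPoly_sub_derivative (n : ℕ) (α : ℝ) :
    lagPoly n α - derivative (lagPoly n α) = lagPoly n (α + 1) := by
  ext k
  rw [coeff_sub, coeff_derivative, lagPoly, lagPoly, coeff_hyperPoly, coeff_hyperPoly,
    coeff_hyperPoly]
  linear_combination hyperCoeff_sub_succ n k α

theorem X_mul_derivative_hyperPoly (n : ℕ) (α : ℝ) (t : ℕ → ℝ) :
    X * derivative (hyperPoly n α t) + C α * hyperPoly n α t
      = C (n + α) * hyperPoly n (α - 1) t := by
  ext k
  have h := add_mul_hyperCoeff n k α
  rcases k with _ | k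
  · simp only [coeff_add, coeff_X_mul_zero, coeff_C_mul, coeff_hyperPoly]
    push_cast at h ⊢
    linear_combination (t 0) * h
  · simp only [coeff_add, coeff_X_mul, coeff_C_mul, coeff_hyperPoly, coeff_derivative]
    push_cast at h ⊢
    linear_combination (t (k + 1)) * h

theorem X_mul_derivative_lagPoly (n : ℕ) (α : ℝ) :
    X * derivative (lagPoly n α) + C α * lagPoly n α = C (n + α) * lagPoly n (α - 1) :=
  X_mul_derivative_hyperPoly ..

theorem X_mul_derivative_jacPoly (n : ℕ) (α β : ℝ) :
    X * derivative (jacPoly n α β) + C α * jacPoly n α β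
      = C (n + α) * jacPoly n (α - 1) (β + 1) := by
  have := X_mul_derivative_hyperPoly n α fun k => (ascPochhammer ℝ k).eval (n + α + β + 1)
  rw [jacPoly, jacPoly, show (n + (α - 1) + (β + 1) + 1 : ℝ) = n + α + β + 1 by ring]
  exact this

theorem one_sub_X_mul_derivative_jacPoly (n : ℕ) (α β : ℝ) :
    C β * jacPoly n α β - (1 - X) * derivative (jacPoly n α β)
      = C (n + β) * jacPoly n (α + 1) (β - 1) := by
  ext k
  have h := mul_hyperCoeff_sub n k α β
  have ht := ascPochhammer_succ_eval k (n + α + β + 1 : ℝ)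
  have h3 : (n + (α + 1) + (β - 1) + 1 : ℝ) = n + α + β + 1 := by ring
  rcases k with _ | k
  · simp only [sub_mul, one_mul, coeff_sub, coeff_X_mul_zero, coeff_C_mul, jacPoly,
      coeff_hyperPoly, coeff_derivative, h3, ht]
    push_cast at h ⊢
    linear_combination (eval (n + α + β + 1) (ascPochhammer ℝ 0)) * h
  · simp only [sub_mul, one_mul, coeff_sub, coeff_X_mul, coeff_C_mul, jacPoly,
      coeff_hyperPoly, coeff_derivative, h3, ht]
    push_cast at h ⊢
    linear_combination (eval (n + α + β + 1) (ascPochhammer ℝ (k + 1))) * h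

/-- At `X = 1` the second order term of `jacPoly_ode` drops out, so the value there is determined by
the first derivative, which induction covers. This divides by `n + α + β + 2`; if that is zero the
polynomial is constant, and its value at `0` is rewritten by reflecting the Pochhammer symbol. -/
theorem eval_one_jacPoly (n : ℕ) (α β : ℝ) :
    (jacPoly n α β).eval 1 = (-1) ^ n * (ascPochhammer ℝ n).eval (β + 1) / n.factorial := by
  induction n generalizing α β with
  | zero => rw [jacPoly_zero]; simp
  | succ n ih =>
    by_cases hs : (n : ℝ) + α + β + 2 = 0
    · have h0 : jacPoly (n + 1) α β = C ((jacPoly (n + 1) α β).coeff 0) :=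
        eq_C_of_derivative_eq_zero (by rw [derivative_jacPoly, hs]; simp)
      rw [h0, eval_C, coeff_zero_eq_eval_zero, eval_zero_jacPoly,
        show α + 1 = -(β + 1 + n) by linear_combination hs,
        ascPochhammer_eval_neg_eq_descPochhammer, descPochhammer_eval_eq_ascPochhammer]
      congr 4
      push_cast
      ring
    · have h := congrArg (eval 1) (jacPoly_ode (n + 1) α β)
      simp only [derivative_jacPoly, eval_add, eval_mul, eval_sub, eval_X, eval_C, eval_one,
        eval_zero, eval_neg, ih] at h
      rw [eval_ascPochhammer_succ_left]
      have hf := Nat.cast_ne_zero (R := ℝ).2 (Nat.factorial_ne_zero n)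
      have hn : (n + 1 : ℝ) ≠ 0 := by positivity
      push_cast [Nat.factorial_succ] at h ⊢
      field_simp at h ⊢
      have h2 : (n + α + β + 2 : ℝ) * ((n + 1) * n.factorial * eval 1 (jacPoly (n + 1) α β)
        - (-1) ^ (n + 1) * (β + 1) * eval (β + 1 + 1) (ascPochhammer ℝ n)) = 0 := by
        rw [pow_succ]
        linear_combination h
      have h3 := (mul_eq_zero.1 h2).resolve_left hs
      linear_combination h3

theorem eval_ascPochhammer_ne_zero {n : ℕ} {x : ℝ} (h : ∀ k < n, x + k ≠ 0) :
    (ascPochhammer ℝ n).eval x ≠ 0 := by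
  induction n with
  | zero => simp
  | succ n ih =>
    rw [ascPochhammer_succ_eval]
    exact mul_ne_zero (ih fun k hk => h k (by omega)) (h n (by omega))

/-! ### The half line and the interval `(0, π/2)` with their end data -/

theorem hasBasis_sideSet_Ioi_left :
    (𝓝[>] (0 : ℝ)).HasBasis (· ∈ Ioi (0 : ℝ)) (sideSet (Ioi 0) true) := nhdsGT_basis 0

theorem hasBasis_sideSet_Ioi_right :
    (atTop : Filter ℝ).HasBasis (· ∈ Ioi (0 : ℝ)) (sideSet (Ioi 0) false) := by
  refine (atTop_basis_Ioi (α := ℝ)).to_hasBasis (fun t _ => ⟨max t 1, ?_, ?_⟩) fun t ht => ⟨t, trivial, ?_⟩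
  · exact (one_pos.trans_le (le_max_right _ _) : (0 : ℝ) < max t 1)
  · rintro x ⟨-, hx⟩
    exact lt_of_le_of_lt (le_max_left t 1) hx
  · intro x hx
    exact ⟨lt_trans (mem_Ioi.1 ht) hx, hx⟩

theorem hasBasis_sideSet_Ioo_left {a b : ℝ} (hab : a < b) :
    (𝓝[>] a).HasBasis (· ∈ Ioo a b) (sideSet (Ioo a b) true) := by
  refine (nhdsGT_basis a).to_hasBasis (fun t ht => ?_) fun t ht => ⟨t, ht.1, ?_⟩
  · obtain ⟨c, hc, hc'⟩ := exists_between (lt_min ht hab)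
    exact ⟨c, ⟨hc, hc'.trans_le (min_le_right _ _)⟩, fun x hx =>
      ⟨hx.1.1, hx.2.trans (hc'.trans_le (min_le_left _ _))⟩⟩
  · exact fun x hx => ⟨⟨hx.1, hx.2.trans ht.2⟩, hx.2⟩

theorem hasBasis_sideSet_Ioo_right {a b : ℝ} (hab : a < b) :
    (𝓝[<] b).HasBasis (· ∈ Ioo a b) (sideSet (Ioo a b) false) := by
  refine (nhdsLT_basis b).to_hasBasis (fun t ht => ?_) fun t ht => ⟨t, ht.2, ?_⟩
  · obtain ⟨c, hc, hc'⟩ := exists_between (max_lt ht hab)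
    exact ⟨c, ⟨(le_max_right _ _).trans_lt hc, hc'⟩, fun x hx =>
      ⟨(le_max_left _ _).trans_lt (hc.trans hx.2), hx.1.2⟩⟩
  · exact fun x hx => ⟨⟨ht.1.trans hx.1, hx.2⟩, hx.1⟩

theorem hasDerivAt_exp_neg_sq_div_four (x : ℝ) :
    HasDerivAt (fun x : ℝ => Real.exp (-x ^ 2 / 4)) (Real.exp (-x ^ 2 / 4) * (-x / 2)) x := by
  refine ((hasDerivAt_pow 2 x).fun_neg.div_const 4).exp.congr_deriv ?_
  push_cast
  ring

theorem isEnd_radial_left : IsEnd (Ioi 0) (fun x => Real.exp (-x ^ 2 / 4)) true (𝓝[>] 0)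
    (fun x => -x⁻¹) (fun x => -Real.log x) 1 0 where
  basis := hasBasis_sideSet_Ioi_left
  neBot := inferInstance
  countable := inferInstance
  R_deriv x hx := (Real.hasDerivAt_log (ne_of_gt hx)).neg
  r_smooth := (contDiffOn_id.inv fun x hx => ne_of_gt hx).neg
  R_top := tendsto_neg_atBot_atTop.comp Real.tendsto_log_nhdsGT_zero
  r_top := by
    simp only [abs_neg]
    exact tendsto_abs_atTop_atTop.comp tendsto_inv_nhdsGT_zero
  κ_lim := by
    refine tendsto_const_nhds.congr' ?_
    filter_upwards [self_mem_nhdsWithin] with x hx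
    have : x ≠ 0 := ne_of_gt hx
    rw [(hasDerivAt_inv this).fun_neg.deriv]
    field_simp
  κ_nonneg := zero_le_one
  κ_le := le_rfl
  sign x hx := neg_neg_of_pos (inv_pos.2 hx)
  ρ_rate := by
    have h : Tendsto (fun x : ℝ => x ^ 2 / 2) (𝓝[>] 0) (𝓝 (-0)) := by
      have : Continuous fun x : ℝ => x ^ 2 / 2 := by fun_prop
      simpa using (this.tendsto 0).mono_left nhdsWithin_le_nhds
    refine h.congr' ?_
    filter_upwards [self_mem_nhdsWithin] with x hx
    have h0 : x ≠ 0 := ne_of_gt hx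
    rw [(hasDerivAt_exp_neg_sq_div_four x).deriv]
    have := (Real.exp_pos (-x ^ 2 / 4)).ne'
    field_simp
  θ_nonneg := le_rfl
  θ_le := by norm_num
  ρ_dom := by
    refine ⟨Real.exp 1, ?_⟩
    filter_upwards [Ioo_mem_nhdsGT one_pos] with x hx
    rw [← Real.exp_add]
    refine Real.exp_le_exp.2 ?_
    have := Real.log_nonpos hx.1.le hx.2.le
    nlinarith [hx.1, hx.2]

/-- The weight `exp (-x² / 4)` has rate `-1/2`, half of that of the ground state. It therefore
dominates the eigenfunctions, while its product with a seed growing at rate `1` still grows. -/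
theorem isEnd_radial_right : IsEnd (Ioi 0) (fun x => Real.exp (-x ^ 2 / 4)) false atTop
    (fun x => x) (fun x => x ^ 2 / 2) 0 (1 / 2) where
  basis := hasBasis_sideSet_Ioi_right
  neBot := inferInstance
  countable := inferInstance
  R_deriv x hx := by
    refine ((hasDerivAt_pow 2 x).div_const 2).congr_deriv ?_
    push_cast
    ring
  r_smooth := contDiffOn_id
  R_top := (tendsto_pow_atTop two_ne_zero).atTop_div_const two_pos
  r_top := tendsto_abs_atTop_atTop
  κ_lim := by
    have : Tendsto (fun x : ℝ => (x * x)⁻¹) atTop (𝓝 0) :=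
      tendsto_inv_atTop_zero.comp (tendsto_id.atTop_mul_atTop₀ tendsto_id)
    simpa using this
  κ_nonneg := le_rfl
  κ_le := zero_le_one
  sign x hx := hx
  ρ_rate := by
    refine tendsto_const_nhds.congr' ?_
    filter_upwards [eventually_gt_atTop 0] with x hx
    have h0 : x ≠ 0 := ne_of_gt hx
    rw [(hasDerivAt_exp_neg_sq_div_four x).deriv]
    have := (Real.exp_pos (-x ^ 2 / 4)).ne'
    field_simp
  θ_nonneg := by norm_num
  θ_le := le_rfl
  ρ_dom := ⟨1, Eventually.of_forall fun x => by rw [one_mul]; exact Real.exp_le_exp.2 (by linarith)⟩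

/-- The half line with the end data of the radial oscillator. -/
noncomputable def radialDom : Dom where
  D := Ioi 0
  ρ x := Real.exp (-x ^ 2 / 4)
  l b := if b then 𝓝[>] 0 else atTop
  r b x := if b then -x⁻¹ else x
  R b x := if b then -Real.log x else x ^ 2 / 2
  κ b := if b then 1 else 0
  θ b := if b then 0 else 1 / 2
  isEnd b := by
    cases b
    · exact isEnd_radial_right
    · exact isEnd_radial_left
  isOpen := isOpen_Ioi
  ordConnected := ordConnected_Ioi
  ρ_smooth := (by fun_prop : ContDiff ℝ ∞ fun x : ℝ => Real.exp (-x ^ 2 / 4)).contDiffOn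
  ρ_pos x _ := Real.exp_pos _
  ρ_le x _ := Real.exp_le_one_iff.2 (by nlinarith [sq_nonneg x])
  ρ_int := by
    have := integrable_exp_neg_mul_sq (b := 1 / 4) (by norm_num)
    refine Integrable.integrableOn ?_
    convert this using 3
    ring

theorem sin_pos_of_mem {x : ℝ} (hx : x ∈ Ioo 0 (Real.pi / 2)) : 0 < Real.sin x :=
  Real.sin_pos_of_pos_of_lt_pi hx.1 (by linarith [hx.2, Real.pi_pos])

theorem cos_pos_of_mem {x : ℝ} (hx : x ∈ Ioo 0 (Real.pi / 2)) : 0 < Real.cos x :=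
  Real.cos_pos_of_mem_Ioo ⟨by linarith [hx.1, Real.pi_pos], hx.2⟩

theorem tendsto_sin_nhdsGT_zero : Tendsto Real.sin (𝓝[>] 0) (𝓝[>] 0) := by
  refine tendsto_nhdsWithin_iff.2 ⟨?_, ?_⟩
  · simpa using (Real.continuous_sin.tendsto 0).mono_left nhdsWithin_le_nhds
  · filter_upwards [Ioo_mem_nhdsGT (div_pos Real.pi_pos two_pos)] with x hx using sin_pos_of_mem hx

theorem tendsto_cos_nhdsLT_pi_div_two : Tendsto Real.cos (𝓝[<] (Real.pi / 2)) (𝓝[>] 0) := by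
  refine tendsto_nhdsWithin_iff.2 ⟨?_, ?_⟩
  · simpa using (Real.continuous_cos.tendsto (Real.pi / 2)).mono_left nhdsWithin_le_nhds
  · filter_upwards [Ioo_mem_nhdsLT (div_pos Real.pi_pos two_pos)] with x hx using cos_pos_of_mem hx

theorem isEnd_trig_left : IsEnd (Ioo 0 (Real.pi / 2)) (fun _ => 1) true (𝓝[>] 0)
    (fun x => -(Real.cos x / Real.sin x)) (fun x => -Real.log (Real.sin x)) 1 0 where
  basis := hasBasis_sideSet_Ioo_left (div_pos Real.pi_pos two_pos)
  neBot := inferInstance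
  countable := inferInstance
  R_deriv x hx := ((Real.hasDerivAt_sin x).log (sin_pos_of_mem hx).ne').neg
  r_smooth := (Real.contDiff_cos.contDiffOn.div Real.contDiff_sin.contDiffOn
    fun x hx => (sin_pos_of_mem hx).ne').neg
  R_top := tendsto_neg_atBot_atTop.comp (Real.tendsto_log_nhdsGT_zero.comp tendsto_sin_nhdsGT_zero)
  r_top := by
    simp only [abs_neg]
    refine tendsto_abs_atTop_atTop.comp ?_
    have h1 : Tendsto Real.cos (𝓝[>] 0) (𝓝 1) := by
      simpa using (Real.continuous_cos.tendsto 0).mono_left nhdsWithin_le_nhds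
    exact h1.pos_mul_atTop one_pos (tendsto_inv_nhdsGT_zero.comp tendsto_sin_nhdsGT_zero)
  κ_lim := by
    have h1 : Tendsto (fun x => (Real.cos x ^ 2)⁻¹) (𝓝[>] 0) (𝓝 1) := by
      have h := ((Real.continuous_cos.tendsto 0).mono_left (nhdsWithin_le_nhds (s := Ioi 0)))
      simpa using (h.pow 2).inv₀ (by simp)
    refine h1.congr' ?_
    filter_upwards [Ioo_mem_nhdsGT (div_pos Real.pi_pos two_pos)] with x hx
    have hs := (sin_pos_of_mem hx).ne'
    have hc := (cos_pos_of_mem hx).ne'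
    rw [((Real.hasDerivAt_cos x).fun_div (Real.hasDerivAt_sin x) hs).fun_neg.deriv]
    field_simp
    linear_combination -Real.sin_sq_add_cos_sq x
  κ_nonneg := zero_le_one
  κ_le := le_rfl
  sign x hx := neg_neg_of_pos (div_pos (cos_pos_of_mem hx) (sin_pos_of_mem hx))
  ρ_rate := by simp
  θ_nonneg := le_rfl
  θ_le := by norm_num
  ρ_dom := by
    refine ⟨1, ?_⟩
    filter_upwards [Ioo_mem_nhdsGT (div_pos Real.pi_pos two_pos)] with x hx
    rw [mul_one, Real.exp_le_one_iff]
    have := Real.log_nonpos (sin_pos_of_mem hx).le (Real.sin_le_one x)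
    linarith

theorem isEnd_trig_right : IsEnd (Ioo 0 (Real.pi / 2)) (fun _ => 1) false (𝓝[<] (Real.pi / 2))
    (fun x => Real.sin x / Real.cos x) (fun x => -Real.log (Real.cos x)) 1 0 where
  basis := hasBasis_sideSet_Ioo_right (div_pos Real.pi_pos two_pos)
  neBot := inferInstance
  countable := inferInstance
  R_deriv x hx := by
    refine ((Real.hasDerivAt_cos x).log (cos_pos_of_mem hx).ne').neg.congr_deriv ?_
    rw [neg_div, neg_neg]
  r_smooth := (Real.contDiff_sin.contDiffOn.div Real.contDiff_cos.contDiffOn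
    fun x hx => (cos_pos_of_mem hx).ne')
  R_top := tendsto_neg_atBot_atTop.comp
    (Real.tendsto_log_nhdsGT_zero.comp tendsto_cos_nhdsLT_pi_div_two)
  r_top := by
    refine tendsto_abs_atTop_atTop.comp ?_
    have h1 : Tendsto Real.sin (𝓝[<] (Real.pi / 2)) (𝓝 1) := by
      simpa using (Real.continuous_sin.tendsto (Real.pi / 2)).mono_left nhdsWithin_le_nhds
    exact h1.pos_mul_atTop one_pos (tendsto_inv_nhdsGT_zero.comp tendsto_cos_nhdsLT_pi_div_two)
  κ_lim := by
    have h1 : Tendsto (fun x => (Real.sin x ^ 2)⁻¹) (𝓝[<] (Real.pi / 2)) (𝓝 1) := by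
      have h := ((Real.continuous_sin.tendsto (Real.pi / 2)).mono_left
        (nhdsWithin_le_nhds (s := Iio (Real.pi / 2))))
      simpa using (h.pow 2).inv₀ (by simp)
    refine h1.congr' ?_
    filter_upwards [Ioo_mem_nhdsLT (div_pos Real.pi_pos two_pos)] with x hx
    have hs := (sin_pos_of_mem hx).ne'
    have hc := (cos_pos_of_mem hx).ne'
    rw [((Real.hasDerivAt_sin x).fun_div (Real.hasDerivAt_cos x) hc).deriv]
    field_simp
    linear_combination -Real.sin_sq_add_cos_sq x
  κ_nonneg := zero_le_one
  κ_le := le_rfl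
  sign x hx := div_pos (sin_pos_of_mem hx) (cos_pos_of_mem hx)
  ρ_rate := by simp
  θ_nonneg := le_rfl
  θ_le := by norm_num
  ρ_dom := by
    refine ⟨1, ?_⟩
    filter_upwards [Ioo_mem_nhdsLT (div_pos Real.pi_pos two_pos)] with x hx
    rw [mul_one, Real.exp_le_one_iff]
    have := Real.log_nonpos (cos_pos_of_mem hx).le (Real.cos_le_one x)
    linarith

/-- The interval `(0, π/2)` with the end data of the Pöschl–Teller system. -/
noncomputable def trigDom : Dom where
  D := Ioo 0 (Real.pi / 2)
  ρ _ := 1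
  l b := if b then 𝓝[>] 0 else 𝓝[<] (Real.pi / 2)
  r b x := if b then -(Real.cos x / Real.sin x) else Real.sin x / Real.cos x
  R b x := if b then -Real.log (Real.sin x) else -Real.log (Real.cos x)
  κ _ := 1
  θ _ := 0
  isEnd b := by
    cases b
    · exact isEnd_trig_right
    · exact isEnd_trig_left
  isOpen := isOpen_Ioo
  ordConnected := ordConnected_Ioo
  ρ_smooth := contDiffOn_const
  ρ_pos x _ := one_pos
  ρ_le x _ := le_rfl
  ρ_int := integrableOn_const (by simp)

namespace System

/-- The end data of the two systems. -/
noncomputable def dom : System → Dom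
  | L _ => radialDom
  | J _ _ => trigDom

/-- The exponents of the undeformed eigenfunctions at the two ends. -/
noncomputable def endP : System → Bool → ℝ
  | L g, b => if b then g - 1 / 2 else 1
  | J g h, b => if b then g - 1 / 2 else h - 1 / 2

theorem dom_D (s : System) : s.dom.D = s.xDom := by cases s <;> rfl

end System

/-! ### Products of a gauge factor and a polynomial in a new variable -/

section Gauge

variable {D : Set ℝ} {h a b ζ c d : ℝ → ℝ}

theorem hasDerivAt_gauge_mul (hh : ∀ x ∈ D, HasDerivAt h (a x * h x) x)
    (hζ : ∀ x ∈ D, HasDerivAt ζ (c x) x) (q : ℝ[X]) {x : ℝ} (hx : x ∈ D) :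
    HasDerivAt (fun y => h y * q.eval (ζ y))
      (h x * (a x * q.eval (ζ x) + c x * (derivative q).eval (ζ x))) x := by
  refine ((hh x hx).mul ((q.hasDerivAt (ζ x)).comp x (hζ x hx))).congr_deriv ?_
  simp only [Function.comp]
  ring

theorem deriv_deriv_gauge_mul (hD : IsOpen D) (hh : ∀ x ∈ D, HasDerivAt h (a x * h x) x)
    (ha : ∀ x ∈ D, HasDerivAt a (b x) x) (hζ : ∀ x ∈ D, HasDerivAt ζ (c x) x)
    (hc : ∀ x ∈ D, HasDerivAt c (d x) x) (q : ℝ[X]) {x : ℝ} (hx : x ∈ D) :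
    deriv (deriv fun y => h y * q.eval (ζ y)) x
      = h x * ((b x + a x ^ 2) * q.eval (ζ x)
        + (2 * a x * c x + d x) * (derivative q).eval (ζ x)
        + c x ^ 2 * (derivative (derivative q)).eval (ζ x)) := by
  have h1 : EqOn (deriv fun y => h y * q.eval (ζ y))
      (fun x => h x * (a x * q.eval (ζ x) + c x * (derivative q).eval (ζ x))) D :=
    fun y hy => (hasDerivAt_gauge_mul hh hζ q hy).deriv
  rw [deriv_eqOn hD h1 hx]
  refine (((hh x hx).mul (((ha x hx).mul ((q.hasDerivAt (ζ x)).comp x (hζ x hx))).add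
    ((hc x hx).mul (((derivative q).hasDerivAt (ζ x)).comp x (hζ x hx))))).congr_deriv ?_).deriv
  simp only [Function.comp, Pi.add_apply, Pi.mul_apply]
  ring

/-- The logarithmic derivative of the product is `a + c q'/q`, and the hypotheses say that the
polynomial contributes nothing on the scale of `r`. -/
theorem hasRate_gauge_mul {l : Filter ℝ} {r : ℝ → ℝ} (hDl : D ∈ l) (h0 : ∀ x ∈ D, h x ≠ 0)
    (hh : ∀ x ∈ D, HasDerivAt h (a x * h x) x) (hζ : ∀ x ∈ D, HasDerivAt ζ (c x) x) {q : ℝ[X]}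
    (hq : ∀ᶠ x in l, q.eval (ζ x) ≠ 0) {c₀ : ℝ} (ha : Tendsto (fun x => a x / r x) l (𝓝 c₀))
    (hc : Tendsto (fun x => c x / r x * ((derivative q).eval (ζ x) / q.eval (ζ x))) l (𝓝 0)) :
    HasRate l r (fun y => h y * q.eval (ζ y)) c₀ := by
  refine ⟨?_, ?_⟩
  · filter_upwards [hDl, hq] with x hx hqx using mul_ne_zero (h0 x hx) hqx
  · have := ha.add hc
    rw [add_zero] at this
    refine this.congr' ?_
    filter_upwards [hDl, hq] with x hx hqx
    rw [(hasDerivAt_gauge_mul hh hζ q hx).deriv]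
    have := h0 x hx
    by_cases hr : r x = 0
    · simp [hr]
    · field_simp

theorem hasRate_gauge_mul_of_tendsto {l : Filter ℝ} {r : ℝ → ℝ} (hDl : D ∈ l)
    (h0 : ∀ x ∈ D, h x ≠ 0) (hh : ∀ x ∈ D, HasDerivAt h (a x * h x) x)
    (hζ : ∀ x ∈ D, HasDerivAt ζ (c x) x) {q : ℝ[X]} {ζ₀ : ℝ} (hζ₀ : Tendsto ζ l (𝓝 ζ₀))
    (hq : q.eval ζ₀ ≠ 0) {c₀ : ℝ} (ha : Tendsto (fun x => a x / r x) l (𝓝 c₀))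
    (hc : Tendsto (fun x => c x / r x) l (𝓝 0)) :
    HasRate l r (fun y => h y * q.eval (ζ y)) c₀ := by
  have hq' : Tendsto (fun x => q.eval (ζ x)) l (𝓝 (q.eval ζ₀)) := (q.continuous.tendsto _).comp hζ₀
  refine hasRate_gauge_mul hDl h0 hh hζ (hq'.eventually_ne hq) ha ?_
  have := hc.mul ((((derivative q).continuous.tendsto _).comp hζ₀).div hq' hq)
  rwa [zero_mul] at this

theorem tendsto_derivative_div_atTop {q : ℝ[X]} (hq : q ≠ 0) :
    Tendsto (fun x => (derivative q).eval x / q.eval x) atTop (𝓝 0) :=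
  Polynomial.div_tendsto_atTop_zero_of_degree_lt _ _ (degree_derivative_lt hq)

theorem eventually_eval_ne_zero_atTop {q : ℝ[X]} (hq : q ≠ 0) : ∀ᶠ x in atTop, q.eval x ≠ 0 :=
  Polynomial.eventually_atTop_not_isRoot q hq

end Gauge

/-! ### The undeformed systems and their Schrödinger equations -/

namespace System

/-- The classical polynomials as polynomials in `η`. -/
noncomputable def classicalPoly : System → ℕ → ℝ[X]
  | L g, n => lagPoly n (g - 1 / 2)
  | J g h, n => (jacPoly n (g - 1 / 2) (h - 1 / 2)).comp (C (1 / 2) - C (1 / 2) * X)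

/-- The type I virtual state polynomials as polynomials in `η`. -/
noncomputable def xiIPoly : System → ℕ → ℝ[X]
  | L g, v => (lagPoly v (g - 1 / 2)).comp (-X)
  | J g h, v => (J g (1 - h)).classicalPoly v

/-- The type II virtual state polynomials as polynomials in `η`. -/
noncomputable def xiIIPoly : System → ℕ → ℝ[X]
  | L g, v => (L (1 - g)).classicalPoly v
  | J g h, v => (J (1 - g) h).classicalPoly v

/-- The coefficient `c₂` as a polynomial. -/
noncomputable def c2Poly : System → ℝ[X]
  | L _ => X
  | J _ _ => 1 - X ^ 2

/-- The coefficient `c₁` as a polynomial. -/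
noncomputable def c1Poly : System → ℝ[X]
  | L g => C (g + 1 / 2) - X
  | J g h => C (h - g) - C (g + h + 1) * X

theorem eval_c2Poly (s : System) (x : ℝ) : s.c2Poly.eval x = s.c2 x := by
  cases s <;> simp [c2Poly, c2]

theorem eval_c1Poly (s : System) (x : ℝ) : s.c1Poly.eval x = s.c1 x := by
  cases s <;> simp [c1Poly, c1]

theorem classicalP_eq (s : System) (n : ℕ) (x : ℝ) :
    s.classicalP n x = (s.classicalPoly n).eval x := by
  cases s
  · exact laguerreP_eq ..
  · simp only [classicalP, classicalPoly, jacobiP_eq, eval_comp]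
    congr 1
    simp
    ring

theorem xiI_eq (s : System) (v : ℕ) (x : ℝ) : s.xiI v x = (s.xiIPoly v).eval x := by
  cases s
  · simp only [xiI, xiIPoly, classicalP_eq, classicalPoly, eval_comp]
    simp
  · exact (J _ _).classicalP_eq _ _

theorem xiII_eq (s : System) (v : ℕ) (x : ℝ) : s.xiII v x = (s.xiIIPoly v).eval x := by
  cases s
  · exact (L _).classicalP_eq _ _
  · exact (J _ _).classicalP_eq _ _

theorem classicalPoly_zero (s : System) : s.classicalPoly 0 = 1 := by
  cases s <;> simp [classicalPoly, lagPoly_zero, jacPoly_zero]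

theorem classicalPoly_ode (s : System) (n : ℕ) :
    s.c2Poly * derivative (derivative (s.classicalPoly n))
      + s.c1Poly * derivative (s.classicalPoly n) + C (s.energy n / 4) * s.classicalPoly n = 0 := by
  cases s with
  | L g =>
    have h := lagPoly_ode n (g - 1 / 2)
    simp only [c2Poly, c1Poly, classicalPoly, energy]
    rw [show (4 * n / 4 : ℝ) = n by ring, ← h]
    congr 5
    ring
  | J g h =>
    have h1 := congrArg (fun p => p.comp (C (1 / 2) - C (1 / 2) * X))
      (jacPoly_ode n (g - 1 / 2) (h - 1 / 2))
    simp only [c2Poly, c1Poly, classicalPoly, energy, derivative_comp, derivative_sub,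
      derivative_mul, derivative_C, derivative_X, zero_mul, mul_one, zero_add, zero_sub,
      mul_neg, neg_mul, derivative_neg, neg_neg]
    simp only [add_comp, mul_comp, sub_comp, X_comp, C_comp, one_comp, zero_comp] at h1
    rw [← h1]
    -- The affine substitution introduces halves. They are replaced by an atom subject only to this
    -- relation, after which the claim is a polynomial identity.
    have e : (C (1 / 2) : ℝ[X]) * 2 = 1 := by
      rw [← C_ofNat, ← C_mul]; norm_num
    have e2 : (C (h - g) : ℝ[X]) = 2 * C (1/2) * (C (g + h + 1) - 2 * C (g - 1 / 2 + 1)) := by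
      rw [mul_comm (2 : ℝ[X]), e, one_mul, ← C_ofNat, ← C_mul, ← C_sub]; congr 1; ring
    have e3 : (C (4 * n * (n + g + h) / 4) : ℝ[X]) = C (n * (n + (g - 1 / 2) + (h - 1 / 2) + 1)) := by
      congr 1; ring
    have e4 : (C (g - 1 / 2 + (h - 1 / 2) + 2) : ℝ[X]) = C (g + h + 1) := by congr 1; ring
    rw [e3, e4, e2]
    generalize (C (1 / 2) : ℝ[X]) = k at *
    linear_combination e * (k * (1 - X) *
      (derivative (derivative (jacPoly n (g - 1 / 2) (h - 1 / 2)))).comp (k - k * X)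
      + (C (g - 1 / 2 + 1) * (2 * k + 1) - k * C (g + h + 1)) *
        (derivative (jacPoly n (g - 1 / 2) (h - 1 / 2))).comp (k - k * X))

end System

theorem contDiff_eval (q : ℝ[X]) : ContDiff ℝ ∞ fun x => q.eval x := by
  simpa only [coe_aeval_eq_eval] using q.contDiff_aeval (𝕜 := ℝ) ∞

theorem hasDerivAt_exp_mul_rpow (σ c : ℝ) {x : ℝ} (hx : 0 < x) :
    HasDerivAt (fun x : ℝ => Real.exp (σ * x ^ 2 / 2) * x ^ c)
      ((σ * x + c / x) * (Real.exp (σ * x ^ 2 / 2) * x ^ c)) x := by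
  refine (((((hasDerivAt_pow 2 x).const_mul σ).div_const 2).exp).mul
    (Real.hasDerivAt_rpow_const (p := c) (Or.inl hx.ne'))).congr_deriv ?_
  rw [Real.rpow_sub_one hx.ne']
  push_cast
  field_simp

theorem hasDerivAt_mul_add_div (σ c : ℝ) {x : ℝ} (hx : 0 < x) :
    HasDerivAt (fun x : ℝ => σ * x + c / x) (σ - c / x ^ 2) x := by
  have h := ((hasDerivAt_id' x).const_mul σ).fun_add ((hasDerivAt_inv hx.ne').const_mul c)
  refine (h.congr_deriv ?_).congr_of_eventuallyEq ?_
  · field_simp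
    ring
  · exact Eventually.of_forall fun y => by simp [div_eq_mul_inv]

theorem hasDerivAt_sin_rpow_mul_cos_rpow (g h : ℝ) {x : ℝ} (hx : x ∈ Ioo 0 (Real.pi / 2)) :
    HasDerivAt (fun x : ℝ => Real.sin x ^ g * Real.cos x ^ h)
      ((g * (Real.cos x / Real.sin x) - h * (Real.sin x / Real.cos x)) *
        (Real.sin x ^ g * Real.cos x ^ h)) x := by
  have hs := (sin_pos_of_mem hx).ne'
  have hc := (cos_pos_of_mem hx).ne'
  refine (((Real.hasDerivAt_sin x).rpow_const (p := g) (Or.inl hs)).mul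
    ((Real.hasDerivAt_cos x).rpow_const (p := h) (Or.inl hc))).congr_deriv ?_
  rw [Real.rpow_sub_one hs, Real.rpow_sub_one hc]
  field_simp
  ring

theorem hasDerivAt_cot_sub_tan (g h : ℝ) {x : ℝ} (hx : x ∈ Ioo 0 (Real.pi / 2)) :
    HasDerivAt (fun x : ℝ => g * (Real.cos x / Real.sin x) - h * (Real.sin x / Real.cos x))
      (-g / Real.sin x ^ 2 - h / Real.cos x ^ 2) x := by
  have hs := (sin_pos_of_mem hx).ne'
  have hc := (cos_pos_of_mem hx).ne'
  refine ((((Real.hasDerivAt_cos x).fun_div (Real.hasDerivAt_sin x) hs).const_mul g).fun_sub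
    (((Real.hasDerivAt_sin x).fun_div (Real.hasDerivAt_cos x) hc).const_mul h)).congr_deriv ?_
  field_simp
  have := Real.sin_sq_add_cos_sq x
  linear_combination (-g * Real.cos x ^ 2 - h * Real.sin x ^ 2) * this

theorem hasDerivAt_cos_two_mul (x : ℝ) :
    HasDerivAt (fun x : ℝ => Real.cos (2 * x)) (-4 * Real.sin x * Real.cos x) x := by
  refine (((hasDerivAt_id' x).const_mul 2).cos).congr_deriv ?_
  rw [Real.sin_two_mul]
  ring

theorem hasDerivAt_neg_four_sin_mul_cos (x : ℝ) :
    HasDerivAt (fun x : ℝ => -4 * Real.sin x * Real.cos x)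
      (-4 * (Real.cos x ^ 2 - Real.sin x ^ 2)) x := by
  refine (((Real.hasDerivAt_sin x).const_mul (-4)).mul (Real.hasDerivAt_cos x)).congr_deriv ?_
  ring

namespace System

/-- The derivative of the sinusoidal coordinate. -/
noncomputable def etaD : System → ℝ → ℝ
  | L _, x => 2 * x
  | J _ _, x => -4 * Real.sin x * Real.cos x

/-- The second derivative of the sinusoidal coordinate. -/
noncomputable def etaDD : System → ℝ → ℝ
  | L _, _ => 2
  | J _ _, x => -4 * (Real.cos x ^ 2 - Real.sin x ^ 2)

/-- The logarithmic derivative of the ground state. -/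
noncomputable def phi0D : System → ℝ → ℝ
  | L g, x => -1 * x + g / x
  | J g h, x => g * (Real.cos x / Real.sin x) - h * (Real.sin x / Real.cos x)

/-- The second logarithmic derivative of the ground state. -/
noncomputable def phi0DD : System → ℝ → ℝ
  | L g, x => -1 - g / x ^ 2
  | J g h, x => -g / Real.sin x ^ 2 - h / Real.cos x ^ 2

theorem isOpen_xDom (s : System) : IsOpen s.xDom := by
  cases s
  · exact isOpen_Ioi
  · exact isOpen_Ioo

theorem isOpen_etaDom (s : System) : IsOpen s.etaDom := by
  cases s
  · exact isOpen_Ioi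
  · exact isOpen_Ioo

theorem hasDerivAt_eta (s : System) (x : ℝ) : HasDerivAt s.eta (s.etaD x) x := by
  cases s
  · refine (hasDerivAt_pow 2 x).congr_deriv ?_
    simp [etaD]
  · exact hasDerivAt_cos_two_mul x

theorem hasDerivAt_etaD (s : System) (x : ℝ) : HasDerivAt s.etaD (s.etaDD x) x := by
  cases s
  · exact ((hasDerivAt_id' x).const_mul (2 : ℝ)).congr_deriv (mul_one _)
  · exact hasDerivAt_neg_four_sin_mul_cos x

theorem hasDerivAt_phi0 (s : System) {x : ℝ} (hx : x ∈ s.xDom) :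
    HasDerivAt s.phi0 (s.phi0D x * s.phi0 x) x := by
  cases s with
  | L g =>
    have := hasDerivAt_exp_mul_rpow (-1) g hx
    change HasDerivAt (fun x : ℝ => Real.exp (-x ^ 2 / 2) * x ^ g)
      ((-1 * x + g / x) * (Real.exp (-x ^ 2 / 2) * x ^ g)) x
    simpa only [neg_mul, one_mul] using this
  | J g h => exact hasDerivAt_sin_rpow_mul_cos_rpow g h hx

theorem hasDerivAt_phi0D (s : System) {x : ℝ} (hx : x ∈ s.xDom) :
    HasDerivAt s.phi0D (s.phi0DD x) x := by
  cases s with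
  | L g => exact hasDerivAt_mul_add_div (-1) g hx
  | J g h => exact hasDerivAt_cot_sub_tan g h hx

theorem phi0_pos (s : System) {x : ℝ} (hx : x ∈ s.xDom) : 0 < s.phi0 x := by
  cases s with
  | L g => exact mul_pos (Real.exp_pos _) (Real.rpow_pos_of_pos hx _)
  | J g h =>
    exact mul_pos (Real.rpow_pos_of_pos (sin_pos_of_mem hx) _)
      (Real.rpow_pos_of_pos (cos_pos_of_mem hx) _)

theorem contDiff_eta (s : System) : ContDiff ℝ ∞ s.eta := by
  cases s
  · exact contDiff_id.pow 2
  · exact Real.contDiff_cos.comp (contDiff_const.mul contDiff_id)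

theorem contDiffOn_phi0 (s : System) : ContDiffOn ℝ ∞ s.phi0 s.xDom := by
  intro x hx
  refine ContDiffAt.contDiffWithinAt ?_
  cases s with
  | L g =>
    exact (by fun_prop : ContDiff ℝ ∞ fun x : ℝ => Real.exp (-x ^ 2 / 2)).contDiffAt.mul
      (contDiffAt_id.rpow_const_of_ne (ne_of_gt hx))
  | J g h =>
    exact (Real.contDiff_sin.contDiffAt.rpow_const_of_ne (sin_pos_of_mem hx).ne').mul
      (Real.contDiff_cos.contDiffAt.rpow_const_of_ne (cos_pos_of_mem hx).ne')

theorem mapsTo_eta (s : System) : MapsTo s.eta s.xDom s.etaDom := by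
  intro x hx
  cases s with
  | L g => exact pow_pos (mem_Ioi.1 hx) 2
  | J g h =>
    have hs := sin_pos_of_mem hx
    have hc := cos_pos_of_mem hx
    have := Real.sin_sq_add_cos_sq x
    simp only [eta, etaDom, mem_Ioo, Real.cos_two_mul]
    constructor <;> nlinarith

theorem etaD_sq (s : System) (x : ℝ) : s.etaD x ^ 2 = 4 * s.c2 (s.eta x) := by
  cases s
  · simp only [etaD, c2, eta]; ring
  · simp only [etaD, c2, eta, Real.cos_two_mul]
    linear_combination 16 * Real.cos x ^ 2 * Real.sin_sq_add_cos_sq x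

theorem etaDD_add (s : System) {x : ℝ} (hx : x ∈ s.xDom) :
    2 * s.phi0D x * s.etaD x + s.etaDD x = 4 * s.c1 (s.eta x) := by
  cases s with
  | L g =>
    have : x ≠ 0 := ne_of_gt hx
    simp only [etaD, c1, eta, phi0D, etaDD]
    field_simp
    ring
  | J g h =>
    have hs := (sin_pos_of_mem hx).ne'
    have hc := (cos_pos_of_mem hx).ne'
    simp only [etaD, c1, eta, phi0D, etaDD, Real.cos_two_mul]
    field_simp
    linear_combination (2 * h + 1) * Real.sin_sq_add_cos_sq x

theorem phi0DD_add (s : System) {x : ℝ} (hx : x ∈ s.xDom) :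
    s.phi0DD x + s.phi0D x ^ 2 = s.potential x := by
  cases s with
  | L g =>
    have : x ≠ 0 := ne_of_gt hx
    simp only [potential, phi0D, phi0DD]
    field_simp
    ring
  | J g h =>
    have hs := (sin_pos_of_mem hx).ne'
    have hc := (cos_pos_of_mem hx).ne'
    have e : Real.cos x ^ 2 = 1 - Real.sin x ^ 2 := by linarith [Real.sin_sq_add_cos_sq x]
    simp only [potential, phi0D, phi0DD]
    field_simp
    simp only [e]
    ring

theorem phi_eq (s : System) (n : ℕ) :
    s.phi n = fun x => s.phi0 x * (s.classicalPoly n).eval (s.eta x) := by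
  funext x
  rw [phi, classicalP_eq]

/-- Multiplication by the ground state turns the differential equation in `η` into the
Schrödinger equation. -/
theorem deriv_deriv_phi0_mul (s : System) (q : ℝ[X]) {x : ℝ} (hx : x ∈ s.xDom) :
    deriv (deriv fun y => s.phi0 y * q.eval (s.eta y)) x
      = s.phi0 x * (s.potential x * q.eval (s.eta x)
        + 4 * (s.c1Poly * derivative q + s.c2Poly * derivative (derivative q)).eval (s.eta x)) := by
  rw [deriv_deriv_gauge_mul s.isOpen_xDom (fun x hx => s.hasDerivAt_phi0 hx)
    (fun x hx => s.hasDerivAt_phi0D hx) (fun x _ => s.hasDerivAt_eta x)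
    (fun x _ => s.hasDerivAt_etaD x) q hx, etaD_sq, etaDD_add s hx, phi0DD_add s hx]
  simp only [eval_add, eval_mul, eval_c1Poly, eval_c2Poly]
  ring

theorem contDiffOn_phi0_mul (s : System) (q : ℝ[X]) :
    ContDiffOn ℝ ∞ (fun y => s.phi0 y * q.eval (s.eta y)) s.xDom :=
  s.contDiffOn_phi0.mul ((contDiff_eval q).comp s.contDiff_eta).contDiffOn

theorem isSol_phi (s : System) (n : ℕ) : IsSol s.xDom s.potential (s.energy n) (s.phi n) := by
  rw [phi_eq]
  refine ⟨s.contDiffOn_phi0_mul _, fun x hx => ?_⟩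
  rw [deriv_deriv_phi0_mul s _ hx]
  have := congrArg (eval (s.eta x)) (s.classicalPoly_ode n)
  simp only [eval_add, eval_mul, eval_C, eval_zero] at this ⊢
  linear_combination 4 * s.phi0 x * this

/-- Only `U - e` matters. The reflections `g ↦ 1 - g` and `h ↦ 1 - h` change the potential by a
constant, so they turn the equation for `φ_v` into the one for a virtual state. -/
theorem IsSol.of_eq {D : Set ℝ} {U U' : ℝ → ℝ} {e e' : ℝ} {f : ℝ → ℝ} (hf : IsSol D U e f)
    (h : ∀ x ∈ D, U x - e = U' x - e') : IsSol D U' e' f :=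
  ⟨hf.smooth, fun x hx => by rw [hf.ode x hx, h x hx]⟩

/-- The type I states of L arise from `η ↦ -η` and not from a reflection of the parameter, so they
need an equation of their own. -/
theorem xiIPoly_ode_L (g : ℝ) (v : ℕ) :
    X * derivative (derivative ((L g).xiIPoly v)) + (C (g + 1 / 2) + X) *
      derivative ((L g).xiIPoly v) - C (v : ℝ) * (L g).xiIPoly v = 0 := by
  have h := congrArg (fun p => p.comp (-X)) (lagPoly_ode v (g - 1 / 2))
  simp only [add_comp, mul_comp, sub_comp, X_comp, C_comp, zero_comp] at h
  rw [show g - 1 / 2 + 1 = g + 1 / 2 by ring] at h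
  simp only [xiIPoly, derivative_comp, derivative_neg, derivative_X, neg_mul, one_mul,
    neg_neg]
  linear_combination -h

theorem virtualI_L_eq (g : ℝ) (v : ℕ) : (L g).virtualI v = fun x =>
    Real.exp (1 * x ^ 2 / 2) * x ^ g * ((L g).xiIPoly v).eval ((L g).eta x) := by
  funext x
  rw [virtualI, xiI_eq, one_mul]

theorem virtualI_J_eq (g h : ℝ) (v : ℕ) : (J g h).virtualI v = (J g (1 - h)).phi v := rfl

theorem virtualII_L_eq (g : ℝ) (v : ℕ) : (L g).virtualII v = (L (1 - g)).phi v := rfl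

theorem virtualII_J_eq (g h : ℝ) (v : ℕ) : (J g h).virtualII v = (J (1 - g) h).phi v := rfl

theorem isSol_virtualI (s : System) (v : ℕ) :
    IsSol s.xDom s.potential (s.energyI v) (s.virtualI v) := by
  cases s with
  | L g =>
    rw [virtualI_L_eq]
    have hh : ∀ x ∈ (L g).xDom, HasDerivAt (fun x : ℝ => Real.exp (1 * x ^ 2 / 2) * x ^ g)
      ((1 * x + g / x) * (Real.exp (1 * x ^ 2 / 2) * x ^ g)) x :=
      fun x hx => hasDerivAt_exp_mul_rpow 1 g hx
    refine ⟨ContDiffOn.mul (fun x hx => ContDiffAt.contDiffWithinAt ?_)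
      ((contDiff_eval ((L g).xiIPoly v)).comp (L g).contDiff_eta).contDiffOn, fun x hx => ?_⟩
    · exact (by fun_prop : ContDiff ℝ ∞ fun x : ℝ => Real.exp (1 * x ^ 2 / 2)).contDiffAt.mul
        (contDiffAt_id.rpow_const_of_ne (ne_of_gt hx))
    · rw [deriv_deriv_gauge_mul (L g).isOpen_xDom hh (fun x hx => hasDerivAt_mul_add_div 1 g hx)
        (fun x _ => (L g).hasDerivAt_eta x) (fun x _ => (L g).hasDerivAt_etaD x) _ hx]
      have := congrArg (eval ((L g).eta x)) (xiIPoly_ode_L g v)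
      simp only [eval_add, eval_sub, eval_mul, eval_C, eval_X, eval_zero] at this
      have h0 : x ≠ 0 := ne_of_gt hx
      generalize eval ((L g).eta x) ((L g).xiIPoly v) = q0 at *
      generalize eval ((L g).eta x) (derivative ((L g).xiIPoly v)) = q1 at *
      generalize eval ((L g).eta x) (derivative (derivative ((L g).xiIPoly v))) = q2 at *
      simp only [etaD, etaDD, potential, energyI, eta] at *
      field_simp
      linear_combination 8 * x ^ 2 * x ^ g * this
  | J g h =>
    rw [virtualI_J_eq]
    refine IsSol.of_eq ((J g (1 - h)).isSol_phi v) fun x _ => ?_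
    simp only [potential, energy, energyI]
    ring

theorem isSol_virtualII (s : System) (v : ℕ) :
    IsSol s.xDom s.potential (s.energyII v) (s.virtualII v) := by
  cases s with
  | L g =>
    rw [virtualII_L_eq]
    refine IsSol.of_eq ((L (1 - g)).isSol_phi v) fun x _ => ?_
    simp only [potential, energy, energyII]
    ring
  | J g h =>
    rw [virtualII_J_eq]
    refine IsSol.of_eq ((J (1 - g) h).isSol_phi v) fun x _ => ?_
    simp only [potential, energy, energyII]
    ring

end System

/-! ### Rates of eigenfunctions and virtual states at the ends -/

theorem hasRate_radial_left (σ c : ℝ) {q : ℝ[X]} (hq : q.eval 0 ≠ 0) :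
    HasRate (𝓝[>] 0) (fun x => -x⁻¹)
      (fun x : ℝ => Real.exp (σ * x ^ 2 / 2) * x ^ c * q.eval (x ^ 2)) (-c) := by
  have hx2 : Tendsto (fun x : ℝ => x ^ 2) (𝓝[>] 0) (𝓝 0) := by
    have : Continuous fun x : ℝ => x ^ 2 := by fun_prop
    simpa using (this.tendsto 0).mono_left (nhdsWithin_le_nhds (s := Ioi 0))
  refine hasRate_gauge_mul_of_tendsto (D := Ioi 0) (c := fun x => 2 * x) self_mem_nhdsWithin
    (fun x hx => (mul_pos (Real.exp_pos _) (Real.rpow_pos_of_pos hx _)).ne')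
    (fun x hx => hasDerivAt_exp_mul_rpow σ c hx) (fun x _ => ?_) hx2 hq ?_ ?_
  · simpa using hasDerivAt_pow 2 x
  · have := (hx2.const_mul (-σ)).sub_const c
    rw [mul_zero, zero_sub] at this
    refine this.congr' ?_
    filter_upwards [self_mem_nhdsWithin] with x hx
    have : x ≠ 0 := ne_of_gt hx
    field_simp
    ring
  · have := hx2.const_mul (-2)
    rw [mul_zero] at this
    refine this.congr' ?_
    filter_upwards [self_mem_nhdsWithin] with x hx
    have : x ≠ 0 := ne_of_gt hx
    field_simp

theorem hasRate_radial_right (σ c : ℝ) {q : ℝ[X]} (hq : q ≠ 0) :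
    HasRate atTop (fun x => x)
      (fun x : ℝ => Real.exp (σ * x ^ 2 / 2) * x ^ c * q.eval (x ^ 2)) σ := by
  have hx2 : Tendsto (fun x : ℝ => x ^ 2) atTop atTop := tendsto_pow_atTop two_ne_zero
  refine hasRate_gauge_mul (D := Ioi 0) (c := fun x => 2 * x) (Ioi_mem_atTop 0)
    (fun x hx => (mul_pos (Real.exp_pos _) (Real.rpow_pos_of_pos hx _)).ne')
    (fun x hx => hasDerivAt_exp_mul_rpow σ c hx) (fun x _ => ?_)
    (hx2.eventually (eventually_eval_ne_zero_atTop hq)) ?_ ?_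
  · simpa using hasDerivAt_pow 2 x
  · have := ((tendsto_inv_atTop_zero.comp hx2).const_mul c).const_add σ
    rw [mul_zero, add_zero] at this
    refine this.congr' ?_
    filter_upwards [eventually_gt_atTop 0] with x hx
    have : x ≠ 0 := ne_of_gt hx
    simp only [Function.comp]
    field_simp
  · have := ((tendsto_derivative_div_atTop hq).comp hx2).const_mul 2
    rw [mul_zero] at this
    refine this.congr' ?_
    filter_upwards [eventually_gt_atTop 0] with x hx
    have : x ≠ 0 := ne_of_gt hx
    simp only [Function.comp]
    field_simp

theorem tendsto_sin_cos_nhdsGT_zero :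
    Tendsto Real.sin (𝓝[>] 0) (𝓝 0) ∧ Tendsto Real.cos (𝓝[>] 0) (𝓝 1) := by
  constructor
  · simpa using (Real.continuous_sin.tendsto 0).mono_left nhdsWithin_le_nhds
  · simpa using (Real.continuous_cos.tendsto 0).mono_left nhdsWithin_le_nhds

theorem tendsto_sin_cos_nhdsLT_pi_div_two :
    Tendsto Real.sin (𝓝[<] (Real.pi / 2)) (𝓝 1) ∧
      Tendsto Real.cos (𝓝[<] (Real.pi / 2)) (𝓝 0) := by
  constructor
  · simpa using (Real.continuous_sin.tendsto (Real.pi / 2)).mono_left nhdsWithin_le_nhds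
  · simpa using (Real.continuous_cos.tendsto (Real.pi / 2)).mono_left nhdsWithin_le_nhds

theorem hasRate_trig_left (g h : ℝ) {q : ℝ[X]} (hq : q.eval 1 ≠ 0) :
    HasRate (𝓝[>] 0) (fun x => -(Real.cos x / Real.sin x))
      (fun x : ℝ => Real.sin x ^ g * Real.cos x ^ h * q.eval (Real.cos (2 * x))) (-g) := by
  obtain ⟨hs, hc⟩ := tendsto_sin_cos_nhdsGT_zero
  have hI := Ioo_mem_nhdsGT (div_pos Real.pi_pos two_pos)
  refine hasRate_gauge_mul_of_tendsto hI
    (fun x hx => (mul_pos (Real.rpow_pos_of_pos (sin_pos_of_mem hx) _)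
      (Real.rpow_pos_of_pos (cos_pos_of_mem hx) _)).ne')
    (fun x hx => hasDerivAt_sin_rpow_mul_cos_rpow g h hx) (fun x _ => hasDerivAt_cos_two_mul x)
    (ζ₀ := 1) ?_ hq ?_ ?_
  · have := (Real.continuous_cos.comp' (continuous_const_mul (2 : ℝ))).tendsto
      (0 : ℝ)
    simpa using this.mono_left (nhdsWithin_le_nhds (s := Ioi 0))
  · have := (((hs.div hc one_ne_zero).pow 2).const_mul h).sub_const g
    rw [zero_div, zero_pow two_ne_zero, mul_zero, zero_sub] at this
    refine this.congr' ?_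
    filter_upwards [hI] with x hx
    have := (sin_pos_of_mem hx).ne'
    have := (cos_pos_of_mem hx).ne'
    simp only [Pi.div_apply]
    field_simp
    ring
  · have := (hs.pow 2).const_mul 4
    rw [zero_pow two_ne_zero, mul_zero] at this
    refine this.congr' ?_
    filter_upwards [hI] with x hx
    have := (sin_pos_of_mem hx).ne'
    have := (cos_pos_of_mem hx).ne'
    field_simp

theorem hasRate_trig_right (g h : ℝ) {q : ℝ[X]} (hq : q.eval (-1) ≠ 0) :
    HasRate (𝓝[<] (Real.pi / 2)) (fun x => Real.sin x / Real.cos x)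
      (fun x : ℝ => Real.sin x ^ g * Real.cos x ^ h * q.eval (Real.cos (2 * x))) (-h) := by
  obtain ⟨hs, hc⟩ := tendsto_sin_cos_nhdsLT_pi_div_two
  have hI := Ioo_mem_nhdsLT (div_pos Real.pi_pos two_pos)
  refine hasRate_gauge_mul_of_tendsto hI
    (fun x hx => (mul_pos (Real.rpow_pos_of_pos (sin_pos_of_mem hx) _)
      (Real.rpow_pos_of_pos (cos_pos_of_mem hx) _)).ne')
    (fun x hx => hasDerivAt_sin_rpow_mul_cos_rpow g h hx) (fun x _ => hasDerivAt_cos_two_mul x)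
    (ζ₀ := -1) ?_ hq ?_ ?_
  · have := (Real.continuous_cos.comp' (continuous_const_mul (2 : ℝ))).tendsto
      (Real.pi / 2)
    simpa [mul_div_cancel₀] using this.mono_left (nhdsWithin_le_nhds (s := Iio (Real.pi / 2)))
  · have := (((hc.div hs one_ne_zero).pow 2).const_mul g).sub_const h
    rw [zero_div, zero_pow two_ne_zero, mul_zero, zero_sub] at this
    refine this.congr' ?_
    filter_upwards [hI] with x hx
    have := (sin_pos_of_mem hx).ne'
    have := (cos_pos_of_mem hx).ne'
    simp only [Pi.div_apply]
    field_simp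
  · have := (hc.pow 2).const_mul (-4)
    rw [zero_pow two_ne_zero, mul_zero] at this
    refine this.congr' ?_
    filter_upwards [hI] with x hx
    have := (sin_pos_of_mem hx).ne'
    have := (cos_pos_of_mem hx).ne'
    field_simp

namespace System

/-- The rates of the undeformed eigenfunctions at the two ends. -/
noncomputable def endExp : System → Bool → ℝ
  | L g, b => if b then -g else -1
  | J g h, b => if b then -g else -h

/-- The values of the classical polynomials at the two ends, up to a nonzero factor. -/
noncomputable def endVal : System → ℕ → Bool → ℝ
  | L g, n, b => if b then (ascPochhammer ℝ n).eval (g + 1 / 2) else 1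
  | J g h, n, b => if b then (ascPochhammer ℝ n).eval (g + 1 / 2)
      else (ascPochhammer ℝ n).eval (h + 1 / 2)

theorem lagPoly_ne_zero (n : ℕ) (α : ℝ) : lagPoly n α ≠ 0 := by
  intro h
  have := coeff_lagPoly_self n α
  rw [h, coeff_zero, eq_comm, div_eq_zero_iff] at this
  rcases this with h | h
  · exact pow_ne_zero n (by norm_num) h
  · exact Nat.cast_ne_zero.2 n.factorial_ne_zero h

theorem eval_one_classicalPoly_J (g h : ℝ) (n : ℕ) : ((J g h).classicalPoly n).eval 1
    = (ascPochhammer ℝ n).eval (g + 1 / 2) / n.factorial := by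
  rw [classicalPoly, eval_comp]
  simp only [eval_sub, eval_C, eval_mul, eval_X, mul_one, sub_self]
  rw [eval_zero_jacPoly]
  congr 2
  ring

theorem eval_neg_one_classicalPoly_J (g h : ℝ) (n : ℕ) : ((J g h).classicalPoly n).eval (-1)
    = (-1) ^ n * (ascPochhammer ℝ n).eval (h + 1 / 2) / n.factorial := by
  rw [classicalPoly, eval_comp]
  simp only [eval_sub, eval_C, eval_mul, eval_X]
  rw [show (1 / 2 - 1 / 2 * -1 : ℝ) = 1 by norm_num, eval_one_jacPoly]
  congr 3
  ring

theorem eval_zero_lagPoly_sub (g : ℝ) (n : ℕ) : (lagPoly n (g - 1 / 2)).eval 0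
    = (ascPochhammer ℝ n).eval (g + 1 / 2) / n.factorial := by
  rw [eval_zero_lagPoly]
  congr 2
  ring

/-- At a finite end only the nonvanishing of the polynomial matters, and at infinity any nonzero
polynomial is negligible against the exponential. The parameters need not be positive, so the
reflected systems of the virtual states are covered. -/
theorem hasRate_phi (s : System) (n : ℕ) (b : Bool) (h : s.endVal n b ≠ 0) :
    HasRate (s.dom.l b) (s.dom.r b) (s.phi n) (s.endExp b) := by
  have hf := Nat.cast_ne_zero (R := ℝ).2 n.factorial_ne_zero
  rw [phi_eq]
  cases s with
  | L g =>
    have e : (fun x => (L g).phi0 x * ((L g).classicalPoly n).eval ((L g).eta x))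
        = fun x : ℝ => Real.exp (-1 * x ^ 2 / 2) * x ^ g * (lagPoly n (g - 1 / 2)).eval (x ^ 2) := by
      funext x
      rw [neg_one_mul]
      rfl
    rw [e]
    cases b
    · exact hasRate_radial_right _ _ (lagPoly_ne_zero _ _)
    · refine hasRate_radial_left _ _ ?_
      rw [eval_zero_lagPoly_sub]
      exact div_ne_zero h hf
  | J g h =>
    cases b
    · refine hasRate_trig_right _ _ ?_
      rw [eval_neg_one_classicalPoly_J]
      exact div_ne_zero (mul_ne_zero (pow_ne_zero _ (by norm_num)) ‹_›) hf
    · refine hasRate_trig_left _ _ ?_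
      rw [eval_one_classicalPoly_J]
      exact div_ne_zero ‹_› hf

/-- The parameters of the system are positive. -/
def Pos : System → Prop
  | L g => 0 < g
  | J g h => 0 < g ∧ 0 < h

theorem endVal_ne_zero {s : System} (hs : s.Pos) (n : ℕ) (b : Bool) : s.endVal n b ≠ 0 := by
  cases s with
  | L g =>
    have hg : 0 < g := hs
    cases b
    · exact one_ne_zero
    · exact (ascPochhammer_pos n _ (by linarith)).ne'
  | J g h =>
    have hg : 0 < g ∧ 0 < h := hs
    cases b
    · exact (ascPochhammer_pos n _ (by linarith)).ne'
    · exact (ascPochhammer_pos n _ (by linarith)).ne'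

theorem endRate_one (s : System) (b : Bool) : endRate (s.dom.κ b) (s.endP b) 1 = s.endExp b := by
  cases s <;> cases b <;> simp [endRate, dom, radialDom, trigDom, endP, endExp]

theorem eig_phi {s : System} (hs : s.Pos) (n : ℕ) :
    s.dom.Eig s.potential s.endP (s.energy n) (s.phi n) := by
  refine ⟨?_, fun b => ?_⟩
  · rw [dom_D]
    exact s.isSol_phi n
  · rw [endRate_one]
    exact hasRate_phi s n b (endVal_ne_zero hs n b)

/-! ### Virtual states as admissible seeds -/

section Seeds

/-- The condition on a type I label. -/
def LabelI : System → ℕ → Prop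
  | L g, _ => 0 < g
  | J g h, v => 0 < g ∧ v + 1 / 2 < h

/-- The condition on a type II label. -/
def LabelII : System → ℕ → Prop
  | L g, v => v + 1 / 2 < g
  | J g h, v => v + 1 / 2 < g ∧ 0 < h

theorem phi_zero (s : System) : s.phi 0 = s.phi0 := by
  rw [phi_eq, classicalPoly_zero]
  simp

/-- All factors are negative: the largest of them is `v + 1/2 - g`. -/
theorem ascPochhammer_ne_zero_of_label {v : ℕ} {g : ℝ} (h : v + 1 / 2 < g) :
    (ascPochhammer ℝ v).eval (1 - g + 1 / 2) ≠ 0 := by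
  refine eval_ascPochhammer_ne_zero fun k hk h0 => ?_
  have : (k : ℝ) + 1 ≤ v := by exact_mod_cast hk
  linarith

theorem energyI_neg {s : System} {v : ℕ} (h : s.LabelI v) : s.energyI v < 0 := by
  have hv : (0 : ℝ) ≤ v := v.cast_nonneg
  cases s with
  | L g =>
    have : 0 < g := h
    simp only [energyI]
    linarith
  | J g h' =>
    have : 0 < g ∧ v + 1 / 2 < h' := h
    simp only [energyI]
    have := mul_pos (by linarith : 0 < g + v + 1 / 2) (by linarith : 0 < h' - v - 1 / 2)
    linarith

theorem energyII_neg {s : System} {v : ℕ} (h : s.LabelII v) : s.energyII v < 0 := by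
  have hv : (0 : ℝ) ≤ v := v.cast_nonneg
  cases s with
  | L g =>
    have : v + 1 / 2 < g := h
    simp only [energyII]
    linarith
  | J g h' =>
    have : v + 1 / 2 < g ∧ 0 < h' := h
    simp only [energyII]
    have := mul_pos (by linarith : 0 < g - v - 1 / 2) (by linarith : 0 < h' + v + 1 / 2)
    linarith

theorem energy_zero (s : System) : s.energy 0 = 0 := by cases s <;> simp [energy]

theorem energy_nonneg {s : System} (hs : s.Pos) (n : ℕ) : 0 ≤ s.energy n := by
  have hn : (0 : ℝ) ≤ n := n.cast_nonneg
  cases s with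
  | L g => exact mul_nonneg (by norm_num) hn
  | J g h =>
    have : 0 < g ∧ 0 < h := hs
    exact mul_nonneg (mul_nonneg (by norm_num) hn) (by linarith)

theorem LabelI.pos {s : System} {v : ℕ} (h : s.LabelI v) : s.Pos := by
  have hv : (0 : ℝ) ≤ v := v.cast_nonneg
  cases s with
  | L g => exact h
  | J g h' =>
    have : 0 < g ∧ v + 1 / 2 < h' := h
    exact ⟨this.1, by linarith⟩

theorem LabelII.pos {s : System} {v : ℕ} (h : s.LabelII v) : s.Pos := by
  have hv : (0 : ℝ) ≤ v := v.cast_nonneg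
  cases s with
  | L g =>
    have : v + 1 / 2 < g := h
    exact (by linarith : 0 < g)
  | J g h' =>
    have : v + 1 / 2 < g ∧ 0 < h' := h
    exact ⟨by linarith, this.2⟩

theorem hasRate_virtualI {s : System} {v : ℕ} (h : s.LabelI v) (b : Bool) :
    HasRate (s.dom.l b) (s.dom.r b) (s.virtualI v)
      (endRate (s.dom.κ b) (s.endP b) (endSign b 1)) := by
  have hf := Nat.cast_ne_zero (R := ℝ).2 v.factorial_ne_zero
  cases s with
  | L g =>
    have hg : 0 < g := h
    have hq : ((L g).xiIPoly v).eval 0 ≠ 0 := by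
      rw [xiIPoly, eval_comp]
      simp only [eval_neg, eval_X, neg_zero]
      rw [eval_zero_lagPoly_sub]
      exact div_ne_zero (ascPochhammer_pos v _ (by linarith)).ne' hf
    rw [virtualI_L_eq]
    cases b
    · rw [show endRate ((L g).dom.κ false) ((L g).endP false) (endSign false 1) = 1 by
        simp [endRate, dom, radialDom, endP, endSign]]
      refine hasRate_radial_right 1 g (q := (L g).xiIPoly v) ?_
      rintro h0
      simp [h0] at hq
    · rw [show endRate ((L g).dom.κ true) ((L g).endP true) (endSign true 1) = -g by
        simp [endRate, dom, radialDom, endP, endSign]]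
      exact hasRate_radial_left 1 g hq
  | J g h' =>
    have hg : 0 < g ∧ v + 1 / 2 < h' := h
    rw [virtualI_J_eq]
    rw [show endRate ((J g h').dom.κ b) ((J g h').endP b) (endSign b 1) = (J g (1 - h')).endExp b by
      cases b <;> simp [endRate, dom, trigDom, endP, endSign, endExp] <;> ring]
    refine hasRate_phi (J g (1 - h')) v b ?_
    · cases b
      · exact ascPochhammer_ne_zero_of_label hg.2
      · exact (ascPochhammer_pos v _ (by linarith [hg.1, hg.2, v.cast_nonneg (α := ℝ)])).ne'

theorem hasRate_virtualII {s : System} {v : ℕ} (h : s.LabelII v) (b : Bool) :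
    HasRate (s.dom.l b) (s.dom.r b) (s.virtualII v)
      (endRate (s.dom.κ b) (s.endP b) (endSign b (-1))) := by
  cases s with
  | L g =>
    have hg : v + 1 / 2 < g := h
    rw [virtualII_L_eq]
    rw [show endRate ((L g).dom.κ b) ((L g).endP b) (endSign b (-1)) = (L (1 - g)).endExp b by
      cases b <;> simp [endRate, dom, radialDom, endP, endSign, endExp] <;> ring]
    refine hasRate_phi (L (1 - g)) v b ?_
    · cases b
      · exact one_ne_zero' ℝ
      · exact ascPochhammer_ne_zero_of_label hg
  | J g h' =>
    have hg : v + 1 / 2 < g ∧ 0 < h' := h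
    rw [virtualII_J_eq]
    rw [show endRate ((J g h').dom.κ b) ((J g h').endP b) (endSign b (-1)) = (J (1 - g) h').endExp b by
      cases b <;> simp [endRate, dom, trigDom, endP, endSign, endExp] <;> ring]
    refine hasRate_phi (J (1 - g) h') v b ?_
    · cases b
      · exact (ascPochhammer_pos v _ (by linarith [hg.1, hg.2, v.cast_nonneg (α := ℝ)])).ne'
      · exact ascPochhammer_ne_zero_of_label hg.1

/-- The ground state is nodeless, has energy `0` and decays at both ends. It can therefore be
compared with `w` at whichever end `w` decays, through `ne_zero_of_lt`. -/
theorem seed_of_isSol {s : System} (hs : s.Pos) (hp : s.dom.Good s.endP) {w : ℝ → ℝ} {e : ℝ}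
    (hw : IsSol s.xDom s.potential e w) (he : e < 0) {t : ℤ} (ht : t = 1 ∨ t = -1)
    (hr : ∀ b, HasRate (s.dom.l b) (s.dom.r b) w (endRate (s.dom.κ b) (s.endP b) (endSign b t))) :
    s.dom.Seed s.potential s.endP e t w := by
  rw [← dom_D] at hw
  refine ⟨hw, ?_, ht, hr⟩
  obtain ⟨b, hb⟩ := exists_endSign_eq ht 1 (Or.inl rfl)
  have h0 := eig_phi hs 0
  rw [energy_zero] at h0
  refine Dom.ne_zero_of_lt hp h0.sol ?_ hw he b (h0.rate b) (hb ▸ hr b)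
  intro x hx
  rw [phi_zero]
  rw [dom_D] at hx
  exact (s.phi0_pos hx).ne'

theorem seed_virtualI {s : System} {v : ℕ} (hp : s.dom.Good s.endP) (h : s.LabelI v) :
    s.dom.Seed s.potential s.endP (s.energyI v) 1 (s.virtualI v) :=
  seed_of_isSol h.pos hp (s.isSol_virtualI v) (energyI_neg h) (Or.inl rfl) (hasRate_virtualI h)

theorem seed_virtualII {s : System} {v : ℕ} (hp : s.dom.Good s.endP) (h : s.LabelII v) :
    s.dom.Seed s.potential s.endP (s.energyII v) (-1) (s.virtualII v) :=
  seed_of_isSol h.pos hp (s.isSol_virtualII v) (energyII_neg h) (Or.inr rfl) (hasRate_virtualII h)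

variable {s : System} {M N : ℕ} {dI : Fin M → ℕ} {dII : Fin N → ℕ}

theorem Bound.labelI (h : s.Bound dI dII) (j : Fin M) : s.LabelI (dI j) := by
  have hN : (0 : ℝ) ≤ N := N.cast_nonneg
  cases s with
  | L g => exact (by linarith [h.1] : 0 < g)
  | J g h' => exact ⟨by linarith [h.1.1], h.2.2 j⟩

theorem Bound.labelII (h : s.Bound dI dII) (j : Fin N) : s.LabelII (dII j) := by
  have hM : (0 : ℝ) ≤ M := M.cast_nonneg
  cases s with
  | L g => exact h.2 j
  | J g h' => exact ⟨h.1.2 j, by linarith [h.2.1]⟩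

theorem Bound.pos (h : s.Bound dI dII) : s.Pos := by
  have hM : (0 : ℝ) ≤ M := M.cast_nonneg
  have hN : (0 : ℝ) ≤ N := N.cast_nonneg
  cases s with
  | L g => exact (by linarith [h.1] : 0 < g)
  | J g h' => exact ⟨by linarith [h.1.1], by linarith [h.2.1]⟩

/-- The types of the seed solutions. -/
def seedSign (M N : ℕ) : Fin (M + N) → ℤ := Fin.append (fun _ => 1) fun _ => -1

/-- The energies of the seed solutions. -/
noncomputable def seedEnergy (s : System) (dI : Fin M → ℕ) (dII : Fin N → ℕ) : Fin (M + N) → ℝ :=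
  Fin.append (fun j => s.energyI (dI j)) fun j => s.energyII (dII j)

/-- At the left end `κ = 1` and `p = g - 1/2`, and the `N` type II seeds are the growing ones, so
the condition reads `1 + N < g - 1/2`. At the right end of J the roles are taken by `h` and `M`; at
infinity `κ = 0` and it reads `1/2 < 1`. -/
theorem Bound.stageGood (h : s.Bound dI dII) (b : Bool) :
    (1 + s.dom.κ b) / 2
      + ∑ j, (if endSign b (seedSign M N j) = -1 then s.dom.κ b else 0) < s.endP b := by
  rw [Fin.sum_univ_add]
  simp only [seedSign, Fin.append_left, Fin.append_right]
  cases s with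
  | L g =>
    cases b
    · simp [dom, radialDom, endP]
      norm_num
    · simp [dom, radialDom, endP, endSign]
      linarith [h.1]
  | J g h' =>
    cases b
    · simp [dom, trigDom, endP, endSign]
      linarith [h.2.1]
    · simp [dom, trigDom, endP, endSign]
      linarith [h.1.1]

theorem Bound.good (h : s.Bound dI dII) : s.dom.Good s.endP := fun b =>
  lt_of_le_of_lt (le_add_of_nonneg_right (Finset.sum_nonneg fun j _ => by
    split_ifs
    · exact (s.dom.isEnd b).κ_nonneg
    · exact le_rfl)) (h.stageGood b)

theorem Bound.stage (h : s.Bound dI dII) (hEI : Function.Injective fun j => s.energyI (dI j))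
    (hEII : Function.Injective fun j => s.energyII (dII j)) :
    s.dom.Stage s.potential s.endP (s.seedEnergy dI dII) (seedSign M N) (s.seeds dI dII) where
  seed j := by
    refine Fin.addCases (fun i => ?_) (fun i => ?_) j
    · simp only [seedEnergy, seedSign, seeds, Fin.append_left]
      exact seed_virtualI h.good (h.labelI i)
    · simp only [seedEnergy, seedSign, seeds, Fin.append_right]
      exact seed_virtualII h.good (h.labelII i)
  inj i j := by
    refine Fin.addCases (fun i => ?_) (fun i => ?_) i <;>
      refine Fin.addCases (fun j => ?_) (fun j => ?_) j <;>
      simp only [seedEnergy, seedSign, Fin.append_left, Fin.append_right]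
    · exact fun hij _ he => hij (congrArg _ (hEI he))
    · exact fun _ h => absurd h (by norm_num)
    · exact fun _ h => absurd h (by norm_num)
    · exact fun hij _ he => hij (congrArg _ (hEII he))
  good := h.stageGood

theorem Bound.seedEnergy_neg (h : s.Bound dI dII) (j : Fin (M + N)) :
    s.seedEnergy dI dII j < 0 := by
  refine Fin.addCases (fun i => ?_) (fun i => ?_) j
  · simp only [seedEnergy, Fin.append_left]
    exact energyI_neg (h.labelI i)
  · simp only [seedEnergy, Fin.append_right]
    exact energyII_neg (h.labelII i)

theorem Bound.seedEnergy_ne (h : s.Bound dI dII) (n : ℕ) (j : Fin (M + N)) :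
    s.seedEnergy dI dII j ≠ s.energy n :=
  ((h.seedEnergy_neg j).trans_le (energy_nonneg h.pos n)).ne

end Seeds

end System

/-! ### Zeros and norms of the undeformed eigenfunctions -/

namespace Dom

variable {𝓓 : Dom}

theorem sideSet_mem (b : Bool) {x : ℝ} (hx : x ∈ 𝓓.D) : sideSet 𝓓.D b x ∈ 𝓓.l b :=
  (𝓓.isEnd b).basis.mem_of_mem hx

theorem nonempty_D (𝓓 : Dom) : 𝓓.D.Nonempty := by
  have := (𝓓.isEnd true).neBot
  exact Filter.nonempty_of_mem (𝓓.isEnd true).mem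

/-- Rolle's theorem between the two ends. Unless `F` has a zero at the chosen point, `F²` drops
below its value there towards both ends and so has an interior maximum; squaring makes the sign of
`F` irrelevant. -/
theorem exists_deriv_zero {F F' : ℝ → ℝ} (hF : ∀ x ∈ 𝓓.D, HasDerivAt F (F' x) x)
    (hlim : ∀ b, Tendsto F (𝓓.l b) (𝓝 0)) : ∃ c ∈ 𝓓.D, F' c = 0 := by
  obtain ⟨x, hx⟩ := 𝓓.nonempty_D
  by_cases h0 : F x = 0
  · obtain ⟨c, hc, h⟩ := exists_deriv_zero_end true hF (hlim true) hx h0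
    exact ⟨c, hc.1, h⟩
  have hy : ∀ b, ∃ y ∈ sideSet 𝓓.D b x, F y ^ 2 < F x ^ 2 := fun b => by
    have := (𝓓.isEnd b).neBot
    have h2 : Tendsto (fun y => F y ^ 2) (𝓓.l b) (𝓝 0) := by simpa using (hlim b).pow 2
    exact ((h2.eventually_lt_const (by positivity)).and (sideSet_mem b hx)).exists.imp
      fun y hy => ⟨hy.2, hy.1⟩
  obtain ⟨a, ha, ha'⟩ := hy true
  obtain ⟨b, hb, hb'⟩ := hy false
  have hax : a < x := by simpa using ha.2
  have hxb : x < b := by simpa using hb.2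
  have hsub : Icc a b ⊆ 𝓓.D := 𝓓.ordConnected.out ha.1 hb.1
  have hG : ∀ y ∈ 𝓓.D, HasDerivAt (fun y => F y ^ 2) (2 * F y * F' y) y := fun y hy => by
    refine ((hF y hy).fun_pow 2).congr_deriv ?_
    push_cast
    ring
  obtain ⟨c, hc, hmax⟩ := isCompact_Icc.exists_isMaxOn (nonempty_Icc.2 (hax.trans hxb).le)
    fun y hy => (hG y (hsub hy)).continuousAt.continuousWithinAt
  have hcx : F x ^ 2 ≤ F c ^ 2 := hmax ⟨hax.le, hxb.le⟩
  have hca : c ≠ a := by rintro rfl; linarith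
  have hcb : c ≠ b := by rintro rfl; linarith
  have hnh : Icc a b ∈ 𝓝 c :=
    Icc_mem_nhds (lt_of_le_of_ne hc.1 hca.symm) (lt_of_le_of_ne hc.2 hcb)
  have h1 := (hmax.isLocalMax hnh).hasDerivAt_eq_zero (hG c (hsub hc))
  refine ⟨c, hsub hc, (mul_eq_zero.1 h1).resolve_left ?_⟩
  refine mul_ne_zero two_ne_zero fun h => ?_
  rw [h] at hcx
  have : 0 < F x ^ 2 := by positivity
  simp at hcx
  exact h0 hcx

/-- Every zero yields a critical point on its left, and there is one more between the last zero and
the right end. -/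
theorem succ_le_encard_zeros {F F' : ℝ → ℝ} (hF : ∀ x ∈ 𝓓.D, HasDerivAt F (F' x) x)
    (hlim : ∀ b, Tendsto F (𝓓.l b) (𝓝 0)) {n : ℕ} (hn : {x ∈ 𝓓.D | F x = 0}.encard = n) :
    ((n + 1 : ℕ) : ℕ∞) ≤ {x ∈ 𝓓.D | F' x = 0}.encard := by
  have hfin : {x ∈ 𝓓.D | F x = 0}.Finite := Set.finite_of_encard_eq_coe hn
  set S := hfin.toFinset with hSdef
  have hS : ∀ x ∈ S, x ∈ 𝓓.D ∧ F x = 0 := fun x hx => by simpa [hSdef] using hx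
  have hcard : S.card = n := by
    rw [hfin.encard_eq_coe_toFinset_card] at hn
    exact_mod_cast hn
  rcases S.eq_empty_or_nonempty with hE | hne
  · rw [hE, Finset.card_empty] at hcard
    obtain ⟨c, hc, h⟩ := exists_deriv_zero hF hlim
    rw [← hcard]
    have : ({c} : Set ℝ) ⊆ {x ∈ 𝓓.D | F' x = 0} := by
      rintro _ rfl
      exact ⟨hc, h⟩
    simpa using Set.encard_le_encard this
  choose! c hcD hc0 hcx hcy using
    fun x hx => exists_deriv_zero_next true hF (hlim true) S hS (x := x) hx
  have hm := Finset.max'_mem S hne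
  obtain ⟨d, hd, hd0⟩ := exists_deriv_zero_end false hF (hlim false) (hS _ hm).1 (hS _ hm).2
  have hinj : Set.InjOn c S := by
    have hlt : ∀ x ∈ S, ∀ y ∈ S, y < x → c y < c x := fun x hx y hy hyx => by
      have h1 := (hcy x hx y hy ⟨(hS y hy).1, by simpa using hyx⟩).2
      have h2 := (hcx y hy).2
      simp at h1 h2
      linarith
    intro x hx y hy hxy
    rcases lt_trichotomy x y with h | h | h
    · exact absurd hxy (hlt y hy x hx h).ne
    · exact h
    · exact absurd hxy (hlt x hx y hy h).ne'
  have hdn : d ∉ S.image c := by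
    intro h
    obtain ⟨x, hx, rfl⟩ := Finset.mem_image.1 h
    have h1 := (hcx x hx).2
    have h2 := hd.2
    simp at h1 h2
    linarith [h2 x hx]
  rw [← hcard, ← Finset.card_image_of_injOn hinj, ← Finset.card_insert_of_notMem hdn,
    ← Set.encard_coe_eq_coe_finsetCard]
  refine Set.encard_le_encard fun x hx => ?_
  rcases Finset.mem_insert.1 (Finset.mem_coe.1 hx) with rfl | h
  · exact ⟨hd.1, hd0⟩
  · obtain ⟨y, hy, rfl⟩ := Finset.mem_image.1 h
    exact ⟨hcD y hy, hc0 y hy⟩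

theorem Eig.tendsto_zero {U : ℝ → ℝ} {p : Bool → ℝ} {E : ℝ} {φ : ℝ → ℝ} (hp : 𝓓.Good p)
    (hφ : 𝓓.Eig U p E φ) (b : Bool) : Tendsto φ (𝓓.l b) (𝓝 0) := by
  have he := 𝓓.isEnd b
  have h1 := he.κ_nonneg
  have h2 := hp b
  exact (hφ.rate b).tendsto_zero he 𝓓.ordConnected
    (fun x hx => hφ.sol.smooth.smooth_differentiableAt 𝓓.isOpen hx)
    (by unfold endRate; push_cast; linarith)

/-- If two families are related by the Darboux transformation with a nodeless solution `u`, and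
everything decays at the ends, then the inner products are related by the energy. -/
theorem Eig.integral_darboux_mul_of_eig {U U' u φ φ' χ χ' : ℝ → ℝ} {p p' : Bool → ℝ}
    {e E E' F F' : ℝ} (hp : 𝓓.Good p) (hp' : 𝓓.Good p') (hu : IsSol 𝓓.D U e u)
    (hu0 : ∀ x ∈ 𝓓.D, u x ≠ 0) (hφ : 𝓓.Eig U p E φ) (hφ' : 𝓓.Eig U p E' φ')
    (hχ : 𝓓.Eig U' p' F χ) (hχ' : 𝓓.Eig U' p' F' χ') {a a' : ℝ}
    (h : ∀ x ∈ 𝓓.D, MultiIndexed.darboux u φ x = a * χ x)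
    (h' : ∀ x ∈ 𝓓.D, MultiIndexed.darboux u φ' x = a' * χ' x) :
    a * a' * ∫ x in 𝓓.D, χ x * χ' x = (E' - e) * ∫ x in 𝓓.D, φ x * φ' x := by
  have hd : ∀ x ∈ 𝓓.D, HasDerivAt (fun x => φ x * (a' * χ' x))
      (a * a' * (χ x * χ' x) - (E' - e) * (φ x * φ' x)) x := by
    intro x hx
    have h2 : HasDerivAt (MultiIndexed.darboux u φ') (deriv (MultiIndexed.darboux u φ') x) x :=
      (contDiffOn_darboux 𝓓.isOpen hu.smooth hφ'.sol.smooth hu0).smooth_hasDerivAt 𝓓.isOpen hx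
    have h2' := h2.congr_of_eventuallyEq (f₁ := fun x => a' * χ' x)
      (by filter_upwards [𝓓.isOpen.mem_nhds hx] with y hy using (h' y hy).symm)
    have h3 := (hφ.sol.smooth.smooth_hasDerivAt 𝓓.isOpen hx).mul h2'
    rw [deriv_darboux 𝓓.isOpen hu hφ'.sol hu0 hx, h' x hx] at h3
    refine h3.congr_deriv ?_
    have h4 : deriv φ x = a * χ x + deriv u x / u x * φ x := by
      rw [← h x hx]
      simp only [MultiIndexed.darboux]; ring
    rw [h4]; ring
  have i1 := (Eig.integrableOn_mul hp' hp' hχ hχ').const_mul (a * a')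
  have i2 := (Eig.integrableOn_mul hp hp hφ hφ').const_mul (E' - e)
  have hz := integral_deriv_eq_zero hd
    ((continuousOn_const.mul (hχ.sol.smooth.continuousOn.mul hχ'.sol.smooth.continuousOn)).sub
      (continuousOn_const.mul (hφ.sol.smooth.continuousOn.mul hφ'.sol.smooth.continuousOn)))
    (i1.sub i2) (fun b => by
      simpa using (hφ.tendsto_zero hp b).mul ((hχ'.tendsto_zero hp' b).const_mul a'))
  rw [integral_sub i1 i2, integral_const_mul, integral_const_mul] at hz
  linarith

end Dom

namespace System

/-- The factor relating the derivative of `P_n` to `P_{n-1}` with shifted parameters. -/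
noncomputable def lowerC : System → ℕ → ℝ
  | L _, _ => -2
  | J g h, n => -2 * (n + g + h + 1)

theorem darboux_phi0_mul (s : System) {f f' : ℝ → ℝ} {x : ℝ} (hx : x ∈ s.xDom)
    (hf : HasDerivAt f (f' x) (s.eta x)) :
    darboux s.phi0 (fun y => s.phi0 y * f (s.eta y)) x = s.phi0 x * s.etaD x * f' x := by
  have h0 := (s.phi0_pos hx).ne'
  have h1 : HasDerivAt (fun y => f (s.eta y)) (f' x * s.etaD x) x :=
    hf.comp x (s.hasDerivAt_eta x)
  rw [darboux, ((s.hasDerivAt_phi0 hx).fun_mul h1).deriv,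
    (s.hasDerivAt_phi0 hx).deriv]
  field_simp
  ring

theorem phi0_shift_L (g : ℝ) {x : ℝ} (hx : 0 < x) :
    ((L g).shift 1).phi0 x = x * (L g).phi0 x := by
  simp only [shift, phi0, Real.rpow_add_one hx.ne']
  ring

theorem phi0_shift_J (g h : ℝ) {x : ℝ} (hx : x ∈ Ioo 0 (Real.pi / 2)) :
    ((J g h).shift 1).phi0 x = Real.sin x * Real.cos x * (J g h).phi0 x := by
  simp only [shift, phi0, Real.rpow_add_one (sin_pos_of_mem hx).ne',
    Real.rpow_add_one (cos_pos_of_mem hx).ne']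
  ring

/-- Differentiating a classical polynomial lowers its degree and raises its parameters, and `φ₀ η'`
is a multiple of the ground state with raised parameters. This is the shape invariance of the
undeformed systems. -/
theorem darboux_phi (s : System) (n : ℕ) {x : ℝ} (hx : x ∈ s.xDom) :
    darboux s.phi0 (s.phi (n + 1)) x = s.lowerC n * (s.shift 1).phi n x := by
  have := s.darboux_phi0_mul (f := fun y => (s.classicalPoly (n + 1)).eval y)
    (f' := fun y => (derivative (s.classicalPoly (n + 1))).eval (s.eta x)) hx
    ((s.classicalPoly (n + 1)).hasDerivAt (s.eta x))
  rw [phi_eq, this, phi_eq]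
  cases s with
  | L g =>
    simp only [phi0_shift_L g hx]
    simp only [classicalPoly, derivative_lagPoly, lowerC, etaD, shift]
    rw [show g + 1 - 1 / 2 = g - 1 / 2 + 1 by ring, eval_neg]
    simp only [eta]
    ring
  | J g h =>
    simp only [phi0_shift_J g h hx]
    simp only [classicalPoly, derivative_comp, derivative_jacPoly, lowerC,
      etaD, shift, eval_mul, eval_neg, eval_comp, mul_comp, neg_comp, C_comp, derivative_sub,
      derivative_C, derivative_X, derivative_mul, eval_sub, eval_C, eval_X, eta,
      zero_mul, mul_one, zero_add, zero_sub]
    rw [show g + 1 - 1 / 2 = g - 1 / 2 + 1 by ring, show h + 1 - 1 / 2 = h - 1 / 2 + 1 by ring]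
    ring

theorem darboux_phi_zero (s : System) (x : ℝ) (hx : x ∈ s.xDom) :
    darboux s.phi0 (s.phi 0) x = 0 := by
  rw [phi_zero, darboux, div_mul_cancel₀ _ (s.phi0_pos hx).ne', sub_self]

/-- The condition under which all the eigenfunctions decay fast enough. -/
def Regular (s : System) : Prop := s.Pos ∧ s.dom.Good s.endP

theorem dom_shift (s : System) (t : ℝ) : (s.shift t).dom = s.dom := by cases s <;> rfl

theorem xDom_shift (s : System) (t : ℝ) : (s.shift t).xDom = s.xDom := by cases s <;> rfl

theorem eta_shift (s : System) (t : ℝ) : (s.shift t).eta = s.eta := by cases s <;> rfl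

theorem Regular.shift {s : System} (h : s.Regular) : (s.shift 1).Regular := by
  obtain ⟨h1, h2⟩ := h
  cases s with
  | L g =>
    have h3 : 0 < g := h1
    refine ⟨(by linarith : 0 < g + 1), fun b => ?_⟩
    have := h2 b
    cases b
    · exact this
    · exact this.trans (by simp [endP, System.shift])
  | J g h =>
    have h3 : 0 < g ∧ 0 < h := h1
    refine ⟨(by constructor <;> linarith : 0 < g + 1 ∧ 0 < h + 1), fun b => ?_⟩
    have := h2 b
    cases b
    · exact this.trans (by simp [endP, System.shift])
    · exact this.trans (by simp [endP, System.shift])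

theorem Regular.eig {s : System} (hs : s.Regular) (n : ℕ) :
    s.dom.Eig s.potential s.endP (s.energy n) (s.phi n) := eig_phi hs.1 n

theorem Regular.eig_shift {s : System} (hs : s.Regular) (n : ℕ) :
    s.dom.Eig (s.shift 1).potential (s.shift 1).endP ((s.shift 1).energy n)
      ((s.shift 1).phi n) := by
  rw [← s.dom_shift 1]
  exact hs.shift.eig n

theorem Regular.good_shift {s : System} (hs : s.Regular) : s.dom.Good (s.shift 1).endP := by
  rw [← s.dom_shift 1]
  exact hs.shift.2

theorem isSol_phi0 (s : System) : IsSol s.dom.D s.potential 0 s.phi0 := by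
  rw [dom_D, ← phi_zero, ← s.energy_zero]
  exact s.isSol_phi 0

theorem phi0_ne_zero (s : System) : ∀ x ∈ s.dom.D, s.phi0 x ≠ 0 := fun x hx =>
  (s.phi0_pos (by rwa [dom_D] at hx)).ne'

theorem lowerC_ne_zero {s : System} (hs : s.Pos) (n : ℕ) : s.lowerC n ≠ 0 := by
  cases s with
  | L g => norm_num [lowerC]
  | J g h =>
    have : 0 < g ∧ 0 < h := hs
    have hn : (0 : ℝ) ≤ n := n.cast_nonneg
    exact mul_ne_zero (by norm_num) (by linarith)

theorem energy_succ_pos {s : System} (hs : s.Pos) (n : ℕ) : 0 < s.energy (n + 1) := by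
  have hn : (0 : ℝ) ≤ n := n.cast_nonneg
  cases s with
  | L g => simp only [energy]; push_cast; linarith
  | J g h =>
    have : 0 < g ∧ 0 < h := hs
    simp only [energy]; push_cast
    exact mul_pos (by linarith) (by linarith)

theorem eta_injOn (s : System) : InjOn s.eta s.xDom := by
  cases s with
  | L g =>
    intro x hx y hy h
    exact (pow_left_inj₀ (le_of_lt hx) (le_of_lt hy) two_ne_zero).1 h
  | J g h =>
    intro x hx y hy h
    have hx' : 0 < x ∧ x < Real.pi / 2 := hx
    have hy' : 0 < y ∧ y < Real.pi / 2 := hy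
    have := Real.injOn_cos ⟨by linarith, by linarith⟩ ⟨by linarith, by linarith⟩ h
    linarith

theorem etaD_ne_zero (s : System) {x : ℝ} (hx : x ∈ s.xDom) : s.etaD x ≠ 0 := by
  cases s with
  | L g => exact mul_ne_zero two_ne_zero (ne_of_gt hx)
  | J g h =>
    exact mul_ne_zero (mul_ne_zero (by norm_num) (sin_pos_of_mem hx).ne') (cos_pos_of_mem hx).ne'

theorem natDegree_classicalPoly_le (s : System) (n : ℕ) : (s.classicalPoly n).natDegree ≤ n := by
  cases s with
  | L g => exact natDegree_lagPoly_le ..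
  | J g h =>
    rw [classicalPoly, natDegree_comp]
    have : (C (1 / 2) - C (1 / 2) * X : ℝ[X]).natDegree ≤ 1 := by
      compute_degree
    calc _ ≤ n * 1 := Nat.mul_le_mul (natDegree_jacPoly_le ..) this
      _ = n := mul_one n

theorem classicalPoly_ne_zero {s : System} (hs : s.Pos) (n : ℕ) : s.classicalPoly n ≠ 0 := by
  intro h0
  cases s with
  | L g => exact lagPoly_ne_zero _ _ h0
  | J g h =>
    have h1 := eval_one_classicalPoly_J g h n
    rw [h0, eval_zero, eq_comm, div_eq_zero_iff] at h1
    rcases h1 with h1 | h1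
    · exact endVal_ne_zero hs n true h1
    · exact Nat.cast_ne_zero.2 n.factorial_ne_zero h1

/-- Zeros of a function `φ₀ · q(η)` with a polynomial `q` having as many zeros as its degree. -/
theorem zeroCount_of_le (s : System) {q : ℝ[X]} (hq : q ≠ 0) {n : ℕ} (hn : q.natDegree ≤ n)
    (h : (n : ℕ∞) ≤ {x ∈ s.xDom | s.phi0 x * q.eval (s.eta x) = 0}.encard) :
    Dom.ZeroCount s.xDom (fun x => s.phi0 x * q.eval (s.eta x)) n := by
  set Z := {x ∈ s.xDom | s.phi0 x * q.eval (s.eta x) = 0} with hZ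
  have hmap : s.eta '' Z ⊆ q.roots.toFinset := by
    rintro _ ⟨x, ⟨hx, h0⟩, rfl⟩
    have := (mul_eq_zero.1 h0).resolve_left (s.phi0_pos hx).ne'
    simpa [hq] using this
  have h1 : Z.encard = (s.eta '' Z).encard :=
    (InjOn.encard_image (s.eta_injOn.mono fun x hx => hx.1)).symm
  have h2 : Z.encard ≤ q.roots.toFinset.card := by
    rw [h1, ← Set.encard_coe_eq_coe_finsetCard]
    exact Set.encard_le_encard hmap
  have h3 : q.roots.toFinset.card ≤ q.roots.card := Multiset.toFinset_card_le _
  have h4 : q.roots.card ≤ n := (card_roots' q).trans hn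
  have h5 : n ≤ q.roots.toFinset.card := by exact_mod_cast h.trans h2
  refine ⟨le_antisymm (h2.trans (by exact_mod_cast h3.trans h4)) h, ?_⟩
  -- There are as many distinct roots as the degree allows, so none is repeated; a multiple zero of
  -- the function would be a multiple root of `q`.
  have hnodup : q.roots.Nodup := by
    rw [← Multiset.toFinset_card_eq_card_iff_nodup]
    omega
  intro x hx h0 hd
  have hq0 := (mul_eq_zero.1 h0).resolve_left (s.phi0_pos hx).ne'
  rw [(hasDerivAt_gauge_mul (fun x hx => s.hasDerivAt_phi0 hx) (fun x _ => s.hasDerivAt_eta x)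
    q hx).deriv, hq0, mul_zero, zero_add] at hd
  have hq1 := (mul_eq_zero.1 ((mul_eq_zero.1 hd).resolve_left (s.phi0_pos hx).ne')).resolve_left
    (s.etaD_ne_zero hx)
  have h6 := (one_lt_rootMultiplicity_iff_isRoot hq).2 ⟨hq0, hq1⟩
  rw [← count_roots] at h6
  have := Multiset.nodup_iff_count_le_one.1 hnodup (s.eta x)
  omega

/-- Induction on `n` with varying parameters. By `darboux_phi` the Wronskian of `φ₀` and `φ_{n+1}`
has the `n` zeros of `φ_n` at the shifted parameters. It vanishes at both ends and its derivative is
a multiple of `φ₀ φ_{n+1}`, so `φ_{n+1}` has at least `n + 1` zeros; the degree forbids more. -/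
theorem Regular.zeroCount {s : System} (hs : s.Regular) (n : ℕ) :
    Dom.ZeroCount s.dom.D (s.phi n) n := by
  induction n generalizing s with
  | zero =>
    rw [phi_zero]
    refine ⟨?_, fun x hx h => absurd h (s.phi0_ne_zero x hx)⟩
    rw [Set.encard_eq_zero.2]
    · rfl
    · exact Set.eq_empty_of_forall_notMem fun x hx => s.phi0_ne_zero x hx.1 hx.2
  | succ n ih =>
    rw [dom_D, phi_eq]
    refine s.zeroCount_of_le (classicalPoly_ne_zero hs.1 _) (s.natDegree_classicalPoly_le _) ?_
    have hl := lowerC_ne_zero hs.1 n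
    have h1 := (ih hs.shift).1
    rw [dom_shift] at h1
    have hF : ∀ x ∈ s.dom.D, HasDerivAt (fun x => s.phi0 x * (s.lowerC n * (s.shift 1).phi n x))
        ((0 - s.energy (n + 1)) * (s.phi0 x * s.phi (n + 1) x)) x := fun x hx => by
      refine (hasDerivAt_mul_darboux s.dom.isOpen s.isSol_phi0 (hs.eig (n + 1)).sol s.phi0_ne_zero
        hx).congr_of_eventuallyEq ?_
      filter_upwards [s.dom.isOpen.mem_nhds hx] with y hy
      rw [s.darboux_phi n (by rwa [dom_D] at hy)]
    have hlim : ∀ b, Tendsto (fun x => s.phi0 x * (s.lowerC n * (s.shift 1).phi n x))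
        (s.dom.l b) (𝓝 0) := fun b => by
      have e0 := (hs.eig 0).tendsto_zero hs.2 b
      rw [phi_zero] at e0
      simpa using e0.mul (((hs.eig_shift n).tendsto_zero hs.good_shift b).const_mul (s.lowerC n))
    have hset : {x ∈ s.dom.D | s.phi0 x * (s.lowerC n * (s.shift 1).phi n x) = 0}
        = {x ∈ s.dom.D | (s.shift 1).phi n x = 0} := by
      ext x
      refine and_congr_right fun hx => ?_
      simp [s.phi0_ne_zero x hx, hl]
    have h2 := Dom.succ_le_encard_zeros hF hlim (hset ▸ h1)
    refine h2.trans (Set.encard_le_encard fun x hx => ?_)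
    have hx1 : x ∈ s.xDom := by rw [← dom_D]; exact hx.1
    have hx2 := hx.2
    refine ⟨hx1, ?_⟩
    rw [zero_sub, mul_eq_zero, neg_eq_zero, mul_eq_zero] at hx2
    have := (hx2.resolve_left (energy_succ_pos hs.1 n).ne').resolve_left (s.phi0_pos hx1).ne'
    rw [phi_eq] at this
    exact this

end System

/-! ### Norms of the undeformed eigenfunctions and the change of variable -/

theorem integral_rpow_mul_one_sub_rpow {a b : ℝ} (ha : 0 < a) (hb : 0 < b) :
    ∫ x in Ioo (0 : ℝ) 1, x ^ (a - 1) * (1 - x) ^ (b - 1)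
      = Real.Gamma a * Real.Gamma b / Real.Gamma (a + b) := by
  have h := ProbabilityTheory.beta_eq_betaIntegralReal a b ha hb
  rw [ProbabilityTheory.beta] at h
  rw [h, Complex.betaIntegral, intervalIntegral.integral_of_le zero_le_one,
    ← integral_Ioc_eq_integral_Ioo]
  have : ∀ x ∈ Ioc (0 : ℝ) 1, (x : ℂ) ^ ((a : ℂ) - 1) * (1 - (x : ℂ)) ^ ((b : ℂ) - 1)
      = ((x ^ (a - 1) * (1 - x) ^ (b - 1) : ℝ) : ℂ) := fun x hx => by
    rw [Complex.ofReal_mul, Complex.ofReal_cpow hx.1.le, Complex.ofReal_cpow (by linarith [hx.2])]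
    push_cast
    rfl
  rw [setIntegral_congr_fun measurableSet_Ioc this, integral_complex_ofReal, Complex.ofReal_re]

theorem image_sin_sq : (fun x => Real.sin x ^ 2) '' Ioo 0 (Real.pi / 2) = Ioo (0 : ℝ) 1 := by
  ext y
  constructor
  · rintro ⟨x, hx, rfl⟩
    have hs := sin_pos_of_mem hx
    have hc := cos_pos_of_mem hx
    have := Real.sin_sq_add_cos_sq x
    exact ⟨by positivity, by simp only; nlinarith⟩
  · intro hy
    have h1 : 0 < √y := Real.sqrt_pos.2 hy.1
    have h2 : √y < 1 := by rw [Real.sqrt_lt' one_pos]; simpa using hy.2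
    refine ⟨Real.arcsin √y, ⟨Real.arcsin_pos.2 h1, Real.arcsin_lt_pi_div_two.2 h2⟩, ?_⟩
    simp only
    rw [Real.sin_arcsin (by linarith) h2.le, Real.sq_sqrt hy.1.le]

theorem injOn_sin_sq : InjOn (fun x => Real.sin x ^ 2) (Ioo 0 (Real.pi / 2)) := by
  intro x hx y hy h
  have h1 := (pow_left_inj₀ (sin_pos_of_mem hx).le (sin_pos_of_mem hy).le two_ne_zero).1 h
  exact Real.injOn_sin ⟨by linarith [hx.1, Real.pi_pos], hx.2.le⟩
    ⟨by linarith [hy.1, Real.pi_pos], hy.2.le⟩ h1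

/-- Euler's beta integral under the substitution `t = sin² x`. -/
theorem integral_sin_rpow_mul_cos_rpow {g h : ℝ} (hg : 0 < g) (hh : 0 < h) :
    ∫ x in Ioo 0 (Real.pi / 2), (Real.sin x ^ g * Real.cos x ^ h) ^ 2
      = Real.Gamma (g + 1 / 2) * Real.Gamma (h + 1 / 2) / (2 * Real.Gamma (g + h + 1)) := by
  have h1 := integral_rpow_mul_one_sub_rpow (a := g + 1 / 2) (b := h + 1 / 2) (by linarith)
    (by linarith)
  rw [← image_sin_sq, integral_image_eq_integral_abs_deriv_smul measurableSet_Ioo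
    (fun x _ => (((Real.hasDerivAt_sin x).fun_pow 2)).hasDerivWithinAt) injOn_sin_sq] at h1
  rw [show g + h + 1 = g + 1 / 2 + (h + 1 / 2) by ring]
  rw [mul_comm (2 : ℝ), ← div_div, ← h1, eq_div_iff two_ne_zero, ← integral_mul_const]
  refine setIntegral_congr_fun measurableSet_Ioo fun x hx => ?_
  have hs := sin_pos_of_mem hx
  have hc := cos_pos_of_mem hx
  have e : 1 - Real.sin x ^ 2 = Real.cos x ^ 2 := by linarith [Real.sin_sq_add_cos_sq x]
  simp only [e, smul_eq_mul]
  have key : ∀ (y c : ℝ), 0 < y → (y ^ c) ^ 2 = y * (y ^ 2) ^ (c + 1 / 2 - 1) := fun y c hy => by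
    rw [← Real.rpow_natCast, ← Real.rpow_natCast, ← Real.rpow_mul hy.le, ← Real.rpow_mul hy.le,
      mul_comm y, ← Real.rpow_add_one hy.ne']
    congr 1
    push_cast
    ring
  rw [abs_of_pos (by positivity), mul_pow, key _ g hs, key _ h hc]
  push_cast
  ring

theorem integral_exp_mul_rpow_sq {g : ℝ} (hg : 0 < g) :
    ∫ x in Ioi (0 : ℝ), (Real.exp (-x ^ 2 / 2) * x ^ g) ^ 2 = 1 / 2 * Real.Gamma (g + 1 / 2) := by
  have h := integral_rpow_mul_exp_neg_rpow (p := 2) (q := 2 * g) two_pos (by linarith)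
  rw [show (2 * g + 1) / 2 = g + 1 / 2 by ring] at h
  rw [← h]
  refine setIntegral_congr_fun measurableSet_Ioi fun x hx => ?_
  have hx' : 0 < x := hx
  rw [mul_pow, ← Real.exp_nat_mul, ← Real.rpow_natCast (x ^ g), ← Real.rpow_mul hx'.le,
    show x ^ (2 : ℝ) = x ^ 2 by norm_cast, mul_comm]
  push_cast
  congr 2 <;> ring

namespace System

theorem integral_phi0_sq {s : System} (hs : s.Pos) :
    ∫ x in s.dom.D, s.phi 0 x * s.phi 0 x = s.normSq 0 := by
  simp_rw [phi_zero, ← sq]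
  cases s with
  | L g =>
    refine (integral_exp_mul_rpow_sq (hs : 0 < g)).trans ?_
    simp [normSq]
  | J g h =>
    have hs : 0 < g ∧ 0 < h := hs
    refine (integral_sin_rpow_mul_cos_rpow hs.1 hs.2).trans ?_
    have := Real.Gamma_add_one (add_pos hs.1 hs.2).ne'
    simp [normSq, this]
    ring

/-- The recursion that integration by parts imposes on the norms; with the value at `n = 0` it
determines all of them. -/
theorem normSq_succ {s : System} (hs : s.Pos) (n : ℕ) :
    s.lowerC n * s.lowerC n * (s.shift 1).normSq n = s.energy (n + 1) * s.normSq (n + 1) := by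
  have hn : (0 : ℝ) ≤ n := n.cast_nonneg
  have hf := Nat.cast_ne_zero (R := ℝ).2 n.factorial_ne_zero
  have hn1 : (n + 1 : ℝ) ≠ 0 := by positivity
  cases s with
  | L g =>
    simp only [normSq, System.shift, lowerC, energy, Nat.factorial_succ]
    push_cast
    rw [show (n + 1 + g + 1 / 2 : ℝ) = n + (g + 1) + 1 / 2 by ring]
    field_simp
    ring
  | J g h =>
    have hs : 0 < g ∧ 0 < h := hs
    simp only [normSq, System.shift, lowerC, energy, Nat.factorial_succ]
    push_cast
    rw [show (n + 1 + g + 1 / 2 : ℝ) = n + (g + 1) + 1 / 2 by ring,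
      show (n + 1 + h + 1 / 2 : ℝ) = n + (h + 1) + 1 / 2 by ring,
      show (n + (g + 1) + (h + 1) : ℝ) = n + 1 + g + h + 1 by ring]
    have h0 : (n + 1 + g + h : ℝ) ≠ 0 := by linarith
    have hG : Real.Gamma (n + 1 + g + h) ≠ 0 := (Real.Gamma_pos_of_pos (by linarith)).ne'
    have h2 : (2 * (n + 1) + g + h : ℝ) ≠ 0 := by linarith
    have h3 : (2 * n + (g + 1) + (h + 1) : ℝ) ≠ 0 := by linarith
    rw [Real.Gamma_add_one h0]
    field_simp
    ring

/-- Orthogonality relations of the undeformed eigenfunctions. -/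
theorem Regular.integral_mul {s : System} (hs : s.Regular) (n m : ℕ) :
    ∫ x in s.dom.D, s.phi n x * s.phi m x = if n = m then s.normSq n else 0 := by
  -- Both indices are lowered at once at the cost of raising the parameters, which is why the
  -- induction lets the system vary.
  have hsucc : ∀ {s : System} (hs : s.Regular) (n m : ℕ),
      s.lowerC n * s.lowerC m * ∫ x in s.dom.D, (s.shift 1).phi n x * (s.shift 1).phi m x
        = s.energy (m + 1) * ∫ x in s.dom.D, s.phi (n + 1) x * s.phi (m + 1) x := by
    intro s hs n m
    have := Dom.Eig.integral_darboux_mul_of_eig hs.2 hs.good_shift s.isSol_phi0 s.phi0_ne_zero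
      (hs.eig (n + 1)) (hs.eig (m + 1)) (hs.eig_shift n) (hs.eig_shift m)
      (fun x hx => s.darboux_phi n (by rwa [dom_D] at hx))
      (fun x hx => s.darboux_phi m (by rwa [dom_D] at hx))
    rwa [sub_zero] at this
  have hzero : ∀ {s : System} (hs : s.Regular) (m : ℕ),
      ∫ x in s.dom.D, s.phi 0 x * s.phi (m + 1) x = 0 := by
    intro s hs m
    have := Dom.Eig.integral_darboux_mul_of_eig hs.2 hs.good_shift s.isSol_phi0 s.phi0_ne_zero
      (hs.eig 0) (hs.eig (m + 1)) (hs.eig_shift 0) (hs.eig_shift m) (a := 0)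
      (fun x hx => by rw [s.darboux_phi_zero x (by rwa [dom_D] at hx), zero_mul])
      (fun x hx => s.darboux_phi m (by rwa [dom_D] at hx))
    rw [zero_mul, zero_mul, sub_zero, eq_comm] at this
    exact (mul_eq_zero.1 this).resolve_left (energy_succ_pos hs.1 m).ne'
  induction n generalizing s m with
  | zero =>
    rcases m with _ | m
    · rw [if_pos rfl]
      exact integral_phi0_sq hs.1
    · rw [if_neg (by omega)]
      exact hzero hs m
  | succ n ih =>
    rcases m with _ | m
    · rw [if_neg (by omega)]
      simp_rw [mul_comm (s.phi (n + 1) _)]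
      exact hzero hs n
    · have h1 := hsucc hs n m
      have h2 := ih hs.shift m
      rw [dom_shift] at h2
      rw [h2] at h1
      refine mul_left_cancel₀ (energy_succ_pos hs.1 m).ne' ?_
      rw [← h1]
      by_cases h : n = m
      · subst h
        rw [if_pos rfl, if_pos rfl]
        exact normSq_succ hs.1 n
      · rw [if_neg h, if_neg (by omega)]
        simp

theorem normSq_pos {s : System} (hs : s.Pos) (n : ℕ) : 0 < s.normSq n := by
  have hn : (0 : ℝ) ≤ n := n.cast_nonneg
  have hf : (0 : ℝ) < n.factorial := by exact_mod_cast n.factorial_pos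
  cases s with
  | L g =>
    have hs : 0 < g := hs
    have := Real.Gamma_pos_of_pos (by linarith : 0 < n + g + 1 / 2)
    simp only [normSq]
    positivity
  | J g h =>
    have hs : 0 < g ∧ 0 < h := hs
    have h1 := Real.Gamma_pos_of_pos (by linarith : 0 < n + g + 1 / 2)
    have h2 := Real.Gamma_pos_of_pos (by linarith : 0 < n + h + 1 / 2)
    have h3 := Real.Gamma_pos_of_pos (by linarith : 0 < n + g + h)
    have h4 : 0 < 2 * n + g + h := by linarith
    simp only [normSq]
    positivity

theorem image_eta (s : System) : s.eta '' s.xDom = s.etaDom := by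
  refine (mapsTo_iff_image_subset.1 s.mapsTo_eta).antisymm fun y hy => ?_
  cases s with
  | L g =>
    have hy : 0 < y := hy
    exact ⟨√y, Real.sqrt_pos.2 hy, Real.sq_sqrt hy.le⟩
  | J g h =>
    have hy : -1 < y ∧ y < 1 := hy
    refine ⟨Real.arccos y / 2, ⟨half_pos (Real.arccos_pos.2 hy.2), ?_⟩, ?_⟩
    · have := Real.arccos_lt_pi.2 hy.1
      linarith
    · simp only [eta]
      rw [mul_div_cancel₀ _ two_ne_zero, Real.cos_arccos hy.1.le hy.2.le]

theorem measurableSet_xDom (s : System) : MeasurableSet s.xDom := s.isOpen_xDom.measurableSet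

theorem measurableSet_etaDom (s : System) : MeasurableSet s.etaDom := s.isOpen_etaDom.measurableSet

theorem integral_etaDom (s : System) (g : ℝ → ℝ) :
    ∫ y in s.etaDom, g y = ∫ x in s.xDom, |s.etaD x| * g (s.eta x) := by
  rw [← image_eta, integral_image_eq_integral_abs_deriv_smul s.measurableSet_xDom
    (fun x _ => (s.hasDerivAt_eta x).hasDerivWithinAt) s.eta_injOn]
  rfl

theorem integrableOn_etaDom (s : System) (g : ℝ → ℝ) :
    IntegrableOn g s.etaDom ↔ IntegrableOn (fun x => |s.etaD x| * g (s.eta x)) s.xDom := by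
  rw [← image_eta, integrableOn_image_iff_integrableOn_abs_deriv_smul s.measurableSet_xDom
    (fun x _ => (s.hasDerivAt_eta x).hasDerivWithinAt) s.eta_injOn]
  rfl

end System

/-! ### Completeness of the undeformed eigenfunctions -/

theorem coeff_comp_affine (p : ℝ[X]) (a b : ℝ) {n : ℕ} (hn : p.natDegree ≤ n) :
    (p.comp (C a + C b * X)).coeff n = p.coeff n * b ^ n := by
  have hq : (C a + C b * X : ℝ[X]).natDegree ≤ 1 := by compute_degree
  conv_lhs => rw [p.as_sum_range_C_mul_X_pow' (Nat.lt_succ_of_le hn)]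
  rw [Polynomial.sum_comp, finsetSum_coeff, Finset.sum_eq_single n]
  · have := coeff_pow_of_natDegree_le (m := n) hq
    rw [mul_one] at this
    simp [this]
  · intro k hk hkn
    have hk' : k < n := lt_of_le_of_ne (Nat.lt_succ_iff.1 (Finset.mem_range.1 hk)) hkn
    rw [mul_comp, C_comp, pow_comp, X_comp, coeff_C_mul,
      coeff_eq_zero_of_natDegree_lt (n := n) (p := (C a + C b * X) ^ k), mul_zero]
    exact (natDegree_pow_le_of_le k hq).trans_lt (by simpa using hk')
  · intro h
    simp at h

namespace System

/-- The leading coefficients of the classical polynomials. -/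
noncomputable def leadCoeff : System → ℕ → ℝ
  | L _, n => (-1) ^ n / n.factorial
  | J g h, n => (ascPochhammer ℝ n).eval (n + g + h) / (2 ^ n * n.factorial)

theorem coeff_classicalPoly_self (s : System) (n : ℕ) :
    (s.classicalPoly n).coeff n = s.leadCoeff n := by
  cases s with
  | L g => exact coeff_lagPoly_self ..
  | J g h =>
    rw [classicalPoly, show (C (1 / 2) - C (1 / 2) * X : ℝ[X]) = C (1 / 2) + C (-1 / 2) * X by
      rw [neg_div, C_neg]; ring, coeff_comp_affine _ _ _ (natDegree_jacPoly_le ..),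
      coeff_jacPoly_self, leadCoeff, show (n + (g - 1 / 2) + (h - 1 / 2) + 1 : ℝ) = n + g + h by ring,
      div_pow]
    have : ((-1 : ℝ) ^ n) * (-1) ^ n = 1 := by rw [← mul_pow]; simp
    field_simp
    linear_combination eval (n + g + h) (ascPochhammer ℝ n) * this

theorem leadCoeff_ne_zero {s : System} (hs : s.Pos) (n : ℕ) : s.leadCoeff n ≠ 0 := by
  have hf := Nat.cast_ne_zero (R := ℝ).2 n.factorial_ne_zero
  cases s with
  | L g => exact div_ne_zero (pow_ne_zero _ (by norm_num)) hf
  | J g h =>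
    have hs : 0 < g ∧ 0 < h := hs
    refine div_ne_zero (ascPochhammer_pos n _ ?_).ne' (mul_ne_zero (by positivity) hf)
    have hn : (0 : ℝ) ≤ n := n.cast_nonneg
    linarith

theorem degree_classicalPoly {s : System} (hs : s.Pos) (n : ℕ) :
    (s.classicalPoly n).degree = n := by
  refine degree_eq_of_le_of_coeff_ne_zero
    (natDegree_le_iff_degree_le.1 (s.natDegree_classicalPoly_le n)) ?_
  rw [coeff_classicalPoly_self]
  exact leadCoeff_ne_zero hs n

theorem span_classicalPoly {s : System} (hs : s.Pos) :
    Submodule.span ℝ (Set.range s.classicalPoly) = ⊤ := by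
  let S : Polynomial.Sequence ℝ := ⟨s.classicalPoly, degree_classicalPoly hs⟩
  refine S.span fun n => ?_
  rw [isUnit_iff_ne_zero, leadingCoeff_ne_zero]
  exact classicalPoly_ne_zero hs n

end System

/-- An integrable function whose integrals against all polynomials in a bounded function `y` vanish
is zero, provided test functions are continuous functions of `y`. -/
theorem ae_eq_zero_of_moments {D : Set ℝ} (hD : IsOpen D) {G y : ℝ → ℝ} (hG : IntegrableOn G D)
    (hy : ContinuousOn y D) {a b : ℝ} (hab : MapsTo y D (Icc a b))
    (hinv : ∀ g : ℝ → ℝ, Continuous g → HasCompactSupport g → tsupport g ⊆ D →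
      ∃ Γ : ℝ → ℝ, Continuous Γ ∧ ∀ x ∈ D, Γ (y x) = g x)
    (hmom : ∀ p : ℝ[X], ∫ x in D, p.eval (y x) * G x = 0) :
    G =ᵐ[volume.restrict D] 0 := by
  have hDm := hD.measurableSet
  rw [Filter.EventuallyEq, ae_restrict_iff' hDm]
  refine hD.ae_eq_zero_of_integral_contDiff_smul_eq_zero hG.locallyIntegrableOn
    fun g hg hgc hgD => ?_
  have hgzero : ∀ x, x ∉ D → g x • G x = 0 := fun x hx => by
    rw [image_eq_zero_of_notMem_tsupport fun h => hx (hgD h), zero_smul]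
  rw [← setIntegral_eq_integral_of_forall_compl_eq_zero hgzero]
  obtain ⟨Γ, hΓ, hΓg⟩ := hinv g hg.continuous hgc hgD
  obtain ⟨C, hC⟩ := hgc.exists_bound_of_continuous hg.continuous
  have hgi : IntegrableOn (fun x => g x * G x) D :=
    hG.bdd_mul hg.continuous.aestronglyMeasurable (Eventually.of_forall hC)
  -- By Weierstrass, `Γ` is uniformly within `ε` of a polynomial on the compact range of `y`, and
  -- polynomials in `y` contribute nothing by `hmom`.
  have key : ∀ ε > 0, |∫ x in D, g x • G x| ≤ ε * ∫ x in D, |G x| := by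
    intro ε hε
    obtain ⟨p, hp⟩ := exists_polynomial_near_of_continuousOn a b Γ hΓ.continuousOn ε hε
    have hd : ∀ x ∈ D, |p.eval (y x) - g x| ≤ ε := fun x hx => by
      rw [← hΓg x hx]
      exact (hp _ (hab hx)).le
    have hpm : ContinuousOn (fun x => p.eval (y x)) D := p.continuous.comp_continuousOn hy
    have hpg : IntegrableOn (fun x => (p.eval (y x) - g x) * G x) D := by
      refine hG.bdd_mul (c := ε) ((hpm.sub hg.continuous.continuousOn).aestronglyMeasurable hDm) ?_
      rw [ae_restrict_iff' hDm]
      exact Eventually.of_forall hd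
    have e : ∫ x in D, g x • G x = -∫ x in D, (p.eval (y x) - g x) * G x := by
      have hi : IntegrableOn (fun x => p.eval (y x) * G x) D :=
        (hpg.add hgi).congr (Eventually.of_forall fun x => by simp only [Pi.add_apply]; ring)
      have := integral_sub hi hgi
      rw [hmom p, zero_sub] at this
      simp only [smul_eq_mul]
      rw [← neg_eq_iff_eq_neg, ← this]
      refine integral_congr_ae (Eventually.of_forall fun x => ?_)
      simp only
      ring
    rw [e, abs_neg, ← integral_const_mul]
    rw [← Real.norm_eq_abs]
    refine norm_integral_le_of_norm_le (hG.abs.const_mul ε) ?_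
    rw [ae_restrict_iff' hDm]
    refine Eventually.of_forall fun x hx => ?_
    rw [norm_mul]
    exact mul_le_mul_of_nonneg_right (hd x hx) (abs_nonneg _)
  have h0 : |∫ x in D, g x • G x| ≤ 0 := by
    refine le_of_tendsto_of_tendsto (b := 𝓝[>] (0 : ℝ)) tendsto_const_nhds
      (g := fun ε => ε * ∫ x in D, |G x|) ?_ ?_
    · have : Tendsto (fun ε : ℝ => ε * ∫ x in D, |G x|) (𝓝 0) (𝓝 (0 * ∫ x in D, |G x|)) :=
        (continuous_id.mul continuous_const).tendsto 0
      rw [zero_mul] at this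
      exact this.mono_left nhdsWithin_le_nhds
    · filter_upwards [self_mem_nhdsWithin] with ε hε using key ε hε
  exact abs_eq_zero.1 (h0.antisymm (abs_nonneg _))

theorem exists_continuous_comp_cos {g : ℝ → ℝ} (hg : Continuous g) :
    ∃ Γ : ℝ → ℝ, Continuous Γ ∧ ∀ x ∈ Ioo 0 (Real.pi / 2), Γ (Real.cos (2 * x)) = g x :=
  ⟨fun t => g (Real.arccos t / 2), hg.comp (Real.continuous_arccos.div_const 2), fun x hx => by
    simp only
    rw [Real.arccos_cos (by linarith [hx.1]) (by linarith [hx.2]), mul_div_cancel_left₀ _ two_ne_zero]⟩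

/-- The inverse of `x ↦ exp (-c x²)` is singular at `0`, the image of infinity, but `g` vanishes for
large arguments, so the composite extends continuously. -/
theorem exists_continuous_comp_exp {g : ℝ → ℝ} (hg : Continuous g) (hc : HasCompactSupport g)
    (hD : tsupport g ⊆ Ioi 0) {c : ℝ} (hc0 : 0 < c) :
    ∃ Γ : ℝ → ℝ, Continuous Γ ∧ ∀ x ∈ Ioi (0 : ℝ), Γ (Real.exp (-(c * x ^ 2))) = g x := by
  have hg0 : g 0 = 0 := image_eq_zero_of_notMem_tsupport fun h => lt_irrefl 0 (mem_Ioi.1 (hD h))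
  refine ⟨fun t => g √(-Real.log t / c), ?_, fun x hx => ?_⟩
  · rw [continuous_iff_continuousAt]
    intro t
    by_cases ht : t = 0
    · subst ht
      have h1 : Tendsto (fun t => √(-Real.log t / c)) (𝓝[≠] 0) atTop :=
        Real.tendsto_sqrt_atTop.comp
          ((tendsto_neg_atBot_atTop.comp Real.tendsto_log_nhdsNE_zero).atTop_div_const hc0)
      have h2 : ∀ᶠ t in 𝓝[≠] (0 : ℝ), g √(-Real.log t / c) = 0 := by
        obtain ⟨R, hR⟩ := hc.isCompact.isBounded.bddAbove
        filter_upwards [h1.eventually_gt_atTop R] with t ht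
        exact image_eq_zero_of_notMem_tsupport fun h => (hR h).not_gt ht
      have h3 : ∀ᶠ t in 𝓝 (0 : ℝ), g √(-Real.log t / c) = 0 := by
        rw [eventually_nhdsWithin_iff] at h2
        filter_upwards [h2] with t ht
        by_cases h : t = 0
        -- The default value `log 0 = 0` makes this `g 0`, which is zero because the support of `g`
        -- lies in the open half line.
        · simp [h, hg0]
        · exact ht h
      exact continuousAt_const.congr (h3.mono fun t ht => ht.symm)
    · exact hg.continuousAt.comp
        (((Real.continuousAt_log ht).neg.div_const c).sqrt)
  · have hx : 0 < x := hx
    simp only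
    rw [Real.log_exp, neg_neg, mul_div_cancel_left₀ _ hc0.ne', Real.sqrt_sq hx.le]

theorem exists_abs_eval_le_exp (p : ℝ[X]) {c : ℝ} (hc : 0 < c) :
    ∃ K : ℝ, 0 ≤ K ∧ ∀ y : ℝ, 0 ≤ y → |p.eval y| ≤ K * Real.exp (c * y) := by
  induction p using Polynomial.induction_on' with
  | add p q hp hq =>
    obtain ⟨K, hK, h⟩ := hp
    obtain ⟨K', hK', h'⟩ := hq
    refine ⟨K + K', by positivity, fun y hy => ?_⟩
    rw [eval_add, add_mul]
    exact (abs_add_le _ _).trans (add_le_add (h y hy) (h' y hy))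
  | monomial n a =>
    refine ⟨|a| * (n.factorial / c ^ n), by positivity, fun y hy => ?_⟩
    have h := Real.pow_div_factorial_le_exp _ (mul_nonneg hc.le hy) n
    have hf : (0 : ℝ) < n.factorial := by exact_mod_cast n.factorial_pos
    rw [eval_monomial, abs_mul, abs_of_nonneg (pow_nonneg hy n), mul_assoc]
    refine mul_le_mul_of_nonneg_left ?_ (abs_nonneg a)
    rw [div_le_iff₀ hf, mul_pow] at h
    rw [div_mul_eq_mul_div, le_div_iff₀ (by positivity)]
    linarith

section Radial

/-- `G` decays like a Gaussian and is orthogonal to all polynomials in `x²`. -/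
def GaussNull (G : ℝ → ℝ) : Prop :=
  (∀ p : ℝ[X], IntegrableOn (fun x => G x * p.eval (x ^ 2) * Real.exp (x ^ 2 / 16)) (Ioi 0)) ∧
    ∀ p : ℝ[X], ∫ x in Ioi (0 : ℝ), G x * p.eval (x ^ 2) = 0

theorem GaussNull.integrableOn {G : ℝ → ℝ} (hG : GaussNull G) (p : ℝ[X]) :
    IntegrableOn (fun x => G x * p.eval (x ^ 2)) (Ioi 0) := by
  have h := (hG.1 p).mul_bdd (g := fun x => Real.exp (-x ^ 2 / 16)) (c := 1)
    (by fun_prop : Continuous fun x : ℝ => Real.exp (-x ^ 2 / 16)).aestronglyMeasurable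
    (Eventually.of_forall fun x => by
      rw [Real.norm_of_nonneg (Real.exp_pos _).le, Real.exp_le_one_iff]
      nlinarith [sq_nonneg x])
  refine h.congr (Eventually.of_forall fun x => ?_)
  simp only
  rw [mul_assoc, ← Real.exp_add, show x ^ 2 / 16 + -x ^ 2 / 16 = 0 by ring, Real.exp_zero, mul_one]

/-- The exponential is expanded in its power series. The partial sums are polynomials in `x²`, to
which `G` is orthogonal, and they are dominated by `exp (x² / 16)`, whose integrability against `G`
is part of `GaussNull`. The new factor restores the decay, so the step can be repeated. -/
theorem GaussNull.mul_exp {G : ℝ → ℝ} (hG : GaussNull G) :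
    GaussNull fun x => Real.exp (-(1 / 16 * x ^ 2)) * G x := by
  refine ⟨fun p => (hG.integrableOn p).congr (Eventually.of_forall fun x => ?_), fun p => ?_⟩
  · simp only
    have : Real.exp (-(1 / 16 * x ^ 2)) * Real.exp (x ^ 2 / 16) = 1 := by
      rw [← Real.exp_add, show -(1 / 16 * x ^ 2) + x ^ 2 / 16 = 0 by ring, Real.exp_zero]
    linear_combination (-(G x * eval (x ^ 2) p)) * this
  · let q : ℕ → ℝ[X] := fun K => p * ∑ k ∈ Finset.range K, C ((-1 / 16 : ℝ) ^ k / k.factorial) * X ^ k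
    have hq : ∀ K x, G x * (q K).eval (x ^ 2) = G x * p.eval (x ^ 2) *
        ∑ k ∈ Finset.range K, (-(1 / 16 * x ^ 2)) ^ k / k.factorial := by
      intro K x
      have e : ∀ k : ℕ, (-(1 / 16 * x ^ 2)) ^ k / k.factorial
          = (-1 / 16) ^ k / k.factorial * (x ^ 2) ^ k := fun k => by
        rw [show -(1 / 16 * x ^ 2) = (-1 / 16) * x ^ 2 by ring, mul_pow]
        ring
      simp only [q, eval_mul, eval_finsetSum, eval_C, eval_pow, eval_X, e]
      ring
    have hlim : Tendsto (fun K => ∫ x in Ioi (0 : ℝ), G x * (q K).eval (x ^ 2)) atTop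
        (𝓝 (∫ x in Ioi (0 : ℝ), Real.exp (-(1 / 16 * x ^ 2)) * G x * p.eval (x ^ 2))) := by
      refine tendsto_integral_of_dominated_convergence
        (fun x => |G x * p.eval (x ^ 2) * Real.exp (x ^ 2 / 16)|)
        (fun K => (hG.integrableOn _).aestronglyMeasurable) (hG.1 p).abs (fun K => ?_) ?_
      · refine Eventually.of_forall fun x => ?_
        rw [hq, norm_mul, Real.norm_eq_abs, abs_mul _ (Real.exp _)]
        refine mul_le_mul_of_nonneg_left ?_ (abs_nonneg _)
        rw [abs_of_pos (Real.exp_pos _)]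
        refine (Finset.abs_sum_le_sum_abs _ _).trans ?_
        refine le_trans (le_of_eq ?_) (Real.sum_le_exp_of_nonneg (by positivity) K)
        refine Finset.sum_congr rfl fun k _ => ?_
        rw [abs_div, abs_pow, abs_neg, abs_of_nonneg (by positivity : (0 : ℝ) ≤ 1 / 16 * x ^ 2),
          Nat.abs_cast]
        congr 2
        ring
      · refine Eventually.of_forall fun x => ?_
        simp only [hq]
        have h := (NormedSpace.expSeries_div_hasSum_exp (-(1 / 16 * x ^ 2) : ℝ)).tendsto_sum_nat
        rw [← Real.exp_eq_exp_ℝ] at h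
        have := h.const_mul (G x * p.eval (x ^ 2))
        rw [mul_comm _ (Real.exp _), ← mul_assoc] at this
        exact this
    simp_rw [hG.2] at hlim
    exact tendsto_nhds_unique hlim tendsto_const_nhds |>.symm ▸ rfl

/-- Repeated multiplication shows that `G` is orthogonal to all polynomials in `exp (-x² / 16)`.
This function is bounded and determines `x > 0`, so `ae_eq_zero_of_moments` applies where
polynomials in `x²` would be of no use. -/
theorem GaussNull.ae_eq_zero {G : ℝ → ℝ} (hG : GaussNull G) :
    G =ᵐ[volume.restrict (Ioi 0)] 0 := by
  have h1 : IntegrableOn G (Ioi 0) := by simpa using hG.integrableOn 1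
  have hn : ∀ j : ℕ, GaussNull fun x => Real.exp (-(1 / 16 * x ^ 2)) ^ j * G x := by
    intro j
    induction j with
    | zero => simpa using hG
    | succ j ih =>
      have := ih.mul_exp
      simp_rw [← mul_assoc, ← pow_succ'] at this
      exact this
  refine ae_eq_zero_of_moments (y := fun x => Real.exp (-(1 / 16 * x ^ 2))) (a := 0) (b := 1)
    isOpen_Ioi h1 (by fun_prop) (fun x _ => ⟨(Real.exp_pos _).le, ?_⟩)
    (fun g hg hgc hgD => exists_continuous_comp_exp hg hgc hgD (by norm_num)) fun p => ?_
  · rw [Real.exp_le_one_iff]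
    nlinarith [sq_nonneg x]
  · induction p using Polynomial.induction_on' with
    | add p q hp hq =>
      have hi : ∀ p : ℝ[X], IntegrableOn (fun x => p.eval (Real.exp (-(1 / 16 * x ^ 2))) * G x)
          (Ioi 0) := by
        intro p
        obtain ⟨K, hK⟩ := isCompact_Icc.exists_bound_of_continuousOn (s := Icc (0 : ℝ) 1)
          p.continuous.continuousOn
        refine h1.bdd_mul (c := K) (p.continuous.comp (by fun_prop)).aestronglyMeasurable
          (Eventually.of_forall fun x => hK _ ⟨(Real.exp_pos _).le, ?_⟩)
        rw [Real.exp_le_one_iff]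
        nlinarith [sq_nonneg x]
      simp_rw [eval_add, add_mul]
      rw [integral_add (hi p) (hi q), hp, hq, add_zero]
    | monomial j a =>
      have := (hn j).2 1
      simp_rw [eval_monomial, mul_assoc]
      rw [integral_const_mul]
      simp only [eval_one, mul_one] at this
      rw [this, mul_zero]

end Radial

namespace System

/-- A functional vanishing on all eigenfunctions vanishes on `φ₀` times all polynomials. -/
theorem Regular.integral_phi0_mul {s : System} (hs : s.Regular) {f : ℝ → ℝ}
    (hf : IntegrableOn (fun x => f x * s.dom.ρ x) s.dom.D)
    (h0 : ∀ n, ∫ x in s.dom.D, f x * s.phi n x = 0) (q : ℝ[X]) :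
    IntegrableOn (fun x => f x * (s.phi0 x * q.eval (s.eta x))) s.dom.D ∧
      ∫ x in s.dom.D, f x * (s.phi0 x * q.eval (s.eta x)) = 0 := by
  have hq : q ∈ Submodule.span ℝ (Set.range s.classicalPoly) := by
    rw [span_classicalPoly hs.1]
    trivial
  induction hq using Submodule.span_induction with
  | mem q hq =>
    obtain ⟨n, rfl⟩ := hq
    have e : (fun x => f x * (s.phi0 x * (s.classicalPoly n).eval (s.eta x)))
        = fun x => f x * s.phi n x := by rw [phi_eq]
    rw [e]
    refine ⟨?_, h0 n⟩
    obtain ⟨C, hC, hb⟩ := Dom.Eig.bound hs.2 (hs.eig n)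
    have hc := (hs.eig n).sol.smooth.continuousOn
    have := hf.mul_bdd (g := fun x => s.phi n x / s.dom.ρ x) (c := C)
      ((hc.div s.dom.ρ_smooth.continuousOn fun x hx =>
        (s.dom.ρ_pos x hx).ne').aestronglyMeasurable s.dom.measurableSet_D)
      ((ae_restrict_iff' s.dom.measurableSet_D).2 (Eventually.of_forall fun x hx => by
        rw [norm_div, Real.norm_of_nonneg (s.dom.ρ_pos x hx).le, div_le_iff₀ (s.dom.ρ_pos x hx)]
        exact hb x hx))
    refine this.congr ((ae_restrict_iff' s.dom.measurableSet_D).2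
      (Eventually.of_forall fun x hx => ?_))
    have := (s.dom.ρ_pos x hx).ne'
    simp only
    field_simp
  | zero => simp
  | add p q _ _ hp hq =>
    simp_rw [eval_add, mul_add]
    exact ⟨hp.1.add hq.1, by rw [integral_add hp.1 hq.1, hp.2, hq.2, add_zero]⟩
  | smul a q _ hq =>
    have e : ∀ x, f x * (s.phi0 x * (a • q).eval (s.eta x))
        = a * (f x * (s.phi0 x * q.eval (s.eta x))) := fun x => by
      rw [eval_smul, smul_eq_mul]; ring
    simp_rw [e]
    exact ⟨hq.1.const_mul a, by rw [integral_const_mul, hq.2, mul_zero]⟩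

theorem ae_eq_zero_of_mul_phi0 (s : System) {f : ℝ → ℝ}
    (h : (fun x => f x * s.phi0 x) =ᵐ[volume.restrict s.dom.D] 0) :
    f =ᵐ[volume.restrict s.dom.D] 0 := by
  filter_upwards [h, ae_restrict_mem s.dom.measurableSet_D] with x hx hxD
  exact (mul_eq_zero.1 hx).resolve_right (s.phi0_ne_zero x hxD)

theorem exists_rpow_mul_le {g : ℝ} (hg : 0 < g) (p : ℝ[X]) :
    ∃ K : ℝ, 0 ≤ K ∧ ∀ x : ℝ, 0 < x → |x ^ g * p.eval (x ^ 2)| ≤ K * Real.exp (x ^ 2 / 8) := by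
  obtain ⟨m, hm⟩ := exists_nat_ge g
  obtain ⟨K, hK, h⟩ := exists_abs_eval_le_exp ((1 + X ^ m) * p) (c := 1 / 8) (by norm_num)
  refine ⟨K, hK, fun x hx => ?_⟩
  have h1 := h (x ^ 2) (by positivity)
  rw [show 1 / 8 * x ^ 2 = x ^ 2 / 8 by ring] at h1
  refine le_trans ?_ h1
  rw [eval_mul, abs_mul, abs_mul]
  refine mul_le_mul_of_nonneg_right ?_ (abs_nonneg _)
  simp only [eval_add, eval_one, eval_pow, eval_X]
  rw [abs_of_pos (Real.rpow_pos_of_pos hx g), abs_of_pos (by positivity)]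
  rcases le_or_gt x 1 with h2 | h2
  · have := Real.rpow_le_one hx.le h2 hg.le
    have : 0 ≤ (x ^ 2) ^ m := by positivity
    linarith
  · have h3 : x ^ g ≤ x ^ ((2 * m : ℕ) : ℝ) := Real.rpow_le_rpow_of_exponent_le h2.le (by
      push_cast
      have : (0 : ℝ) ≤ m := m.cast_nonneg
      linarith)
    rw [Real.rpow_natCast, pow_mul] at h3
    linarith

theorem Regular.complete {s : System} (hs : s.Regular) : s.dom.Complete s.phi := by
  intro f hf h0
  have hq := hs.integral_phi0_mul hf h0
  refine s.ae_eq_zero_of_mul_phi0 ?_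
  cases s with
  | L g =>
    have hg : 0 < g := hs.1
    refine GaussNull.ae_eq_zero ⟨fun p => ?_, fun p => ?_⟩
    · obtain ⟨K, hK, hb⟩ := exists_rpow_mul_le hg p
      -- One half of the Gaussian in `φ₀` is the weight `ρ` and makes `f ρ` integrable. The other
      -- half bounds the remaining factor, because `1/8 - 1/4 + 1/16` is negative.
      have := hf.mul_bdd (c := K) (g := fun x : ℝ => x ^ g * p.eval (x ^ 2) *
        Real.exp (-x ^ 2 / 4) * Real.exp (x ^ 2 / 16)) ?_ ?_
      · refine this.congr (Eventually.of_forall fun x => ?_)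
        have e : (L g).phi0 x = Real.exp (-x ^ 2 / 4) * Real.exp (-x ^ 2 / 4) * x ^ g := by
          rw [← Real.exp_add, phi0]
          congr 2
          ring
        change f x * Real.exp (-x ^ 2 / 4) * _ = _
        simp only
        rw [e]
        ring
      · refine ContinuousOn.aestronglyMeasurable ?_ measurableSet_Ioi
        refine ((ContinuousOn.mul (fun x hx => ?_) ?_).mul ?_).mul ?_
        · exact (Real.continuousAt_rpow_const _ _ (Or.inl (ne_of_gt hx))).continuousWithinAt
        · exact (p.continuous.comp (continuous_pow 2)).continuousOn
        · fun_prop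
        · fun_prop
      · refine (ae_restrict_iff' measurableSet_Ioi).2 (Eventually.of_forall fun x hx => ?_)
        rw [norm_mul, norm_mul, Real.norm_of_nonneg (Real.exp_pos _).le,
          Real.norm_of_nonneg (Real.exp_pos _).le]
        calc _ ≤ K * Real.exp (x ^ 2 / 8) * Real.exp (-x ^ 2 / 4) * Real.exp (x ^ 2 / 16) :=
              mul_le_mul_of_nonneg_right (mul_le_mul_of_nonneg_right (hb x hx)
                (Real.exp_pos _).le) (Real.exp_pos _).le
          _ = K * Real.exp (-x ^ 2 / 16) := by
              rw [mul_assoc, mul_assoc, ← Real.exp_add, ← Real.exp_add]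
              congr 2
              ring
          _ ≤ K * 1 := by
              refine mul_le_mul_of_nonneg_left (Real.exp_le_one_iff.2 ?_) hK
              nlinarith [sq_nonneg x]
          _ = K := mul_one K
    · have := (hq p).2
      simp_rw [← mul_assoc] at this
      exact this
  | J g h =>
    have h1 : IntegrableOn (fun x => f x * (J g h).phi0 x) (Ioo 0 (Real.pi / 2)) := by
      have := (hq 1).1
      simp_rw [eval_one, mul_one] at this
      exact this
    refine ae_eq_zero_of_moments (y := fun x => Real.cos (2 * x)) (a := -1) (b := 1)
      isOpen_Ioo h1 (by fun_prop) (fun x _ => Real.cos_mem_Icc _)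
      (fun g hg _ _ => exists_continuous_comp_cos hg) fun p => ?_
    have := (hq p).2
    refine Eq.trans ?_ this
    refine integral_congr_ae (Eventually.of_forall fun x => ?_)
    simp only [eta]
    ring

end System

/-! ### From Wronskians in `x` to Wronskians in `η` -/

theorem two_mul_cast_choose_two (n : ℕ) :
    2 * ((n * (n - 1) / 2 : ℕ) : ℝ) = n * (n - 1) := by
  have h : 2 * (n * (n - 1) / 2) = n * (n - 1) := Nat.two_mul_div_two_of_even n.even_mul_pred_self
  rcases n with _ | n
  · simp
  · have := congrArg (fun k : ℕ => (k : ℝ)) h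
    push_cast [Nat.add_sub_cancel] at this ⊢
    linarith

theorem one_sub_cos_two_mul (x : ℝ) : (1 - Real.cos (2 * x)) / 2 = Real.sin x ^ 2 := by
  rw [Real.cos_two_mul]
  linarith [Real.sin_sq_add_cos_sq x]

theorem one_add_cos_two_mul (x : ℝ) : (1 + Real.cos (2 * x)) / 2 = Real.cos x ^ 2 := by
  rw [Real.cos_two_mul]
  ring

theorem rpow_eq_exp_log {x : ℝ} (hx : 0 < x) (c : ℝ) : x ^ c = Real.exp (Real.log x * c) :=
  Real.rpow_def_of_pos hx c

theorem pow_eq_exp_log {x : ℝ} (hx : 0 < x) (n : ℕ) : x ^ n = Real.exp (n * Real.log x) := by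
  rw [Real.exp_nat_mul, Real.exp_log hx]

theorem sq_rpow_eq_exp_log {x : ℝ} (hx : 0 < x) (c : ℝ) :
    (x ^ 2) ^ c = Real.exp (2 * Real.log x * c) := by
  rw [rpow_eq_exp_log (pow_pos hx 2), Real.log_pow]
  norm_num

theorem exp_mul_identity {A B C D E F G : ℝ} (c : ℝ) (h : A + B + C = D + E + (F + G)) :
    Real.exp A * Real.exp B * (c * Real.exp C)
      = c * (Real.exp D * Real.exp E) * (Real.exp F * Real.exp G) := by
  have := congrArg Real.exp h
  simp only [Real.exp_add] at this
  linear_combination c * this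

namespace System

variable {M N : ℕ}

/-- The factor relating the Wronskian in `x` of the seeds and the denominator polynomial. -/
noncomputable def gauge (M N : ℕ) : System → ℝ → ℝ
  | L g, x => Real.exp (((M : ℝ) - N) * x ^ 2 / 2) *
      x ^ (g * ((M : ℝ) - N) + ((M : ℝ) - N) * ((M : ℝ) - N - 1) / 2)
  | J g h, x => Real.sin x ^ (g * ((M : ℝ) - N) + ((M : ℝ) - N) * ((M : ℝ) - N - 1) / 2) *
      Real.cos x ^ (-h * ((M : ℝ) - N) + ((M : ℝ) - N) * ((M : ℝ) - N + 1) / 2)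

/-- The left side is the factor supplied by `wronskian_mul_comp`. Removing the prefactor of `Ξ_D`
leaves `gauge`, whose exponents depend on `M` and `N` only through `M - N`. After taking logarithms
it is a linear identity. -/
theorem phi0_pow_mul_etaD_pow (s : System) (M N : ℕ) {x : ℝ} (hx : x ∈ s.xDom) :
    s.phi0 x ^ (M + N) * s.etaD x ^ ((M + N) * (M + N - 1) / 2)
      = s.cF ^ ((M + N) * (M + N - 1) / 2) * s.gauge M N x * s.prefactorXi M N (s.eta x) := by
  have hT := two_mul_cast_choose_two (M + N)
  push_cast at hT
  generalize (M + N) * (M + N - 1) / 2 = T at *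
  cases s with
  | L g =>
    have hx : 0 < x := hx
    simp only [phi0, etaD, cF, gauge, prefactorXi, eta]
    rw [mul_pow, mul_pow, pow_eq_exp_log hx T, rpow_eq_exp_log hx, rpow_eq_exp_log hx,
      sq_rpow_eq_exp_log hx, ← Real.exp_nat_mul, ← Real.exp_nat_mul]
    refine exp_mul_identity _ ?_
    push_cast
    linear_combination (Real.log x / 2) * hT
  | J g h =>
    have hs := sin_pos_of_mem hx
    have hc := cos_pos_of_mem hx
    simp only [phi0, etaD, cF, gauge, prefactorXi, eta, one_sub_cos_two_mul, one_add_cos_two_mul]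
    rw [mul_assoc (-4 : ℝ), mul_pow, mul_pow, mul_pow, pow_eq_exp_log hs T, pow_eq_exp_log hc T,
      rpow_eq_exp_log hs, rpow_eq_exp_log hs, rpow_eq_exp_log hc, rpow_eq_exp_log hc,
      sq_rpow_eq_exp_log hs, sq_rpow_eq_exp_log hc, ← Real.exp_nat_mul, ← Real.exp_nat_mul,
      ← Real.exp_add (T * _)]
    refine exp_mul_identity _ ?_
    push_cast
    linear_combination (Real.log (Real.sin x) / 2 + Real.log (Real.cos x) / 2) * hT

/-- The quotient of Wronskians defining `phiD` carries the extra factor `φ₀ η' ^ (M + N)`;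
exchanging the two prefactors turns it into the ground state at the parameters `λ^{[M,N]}`. -/
theorem phi0_shiftMN_mul (s : System) (M N : ℕ) {x : ℝ} (hx : x ∈ s.xDom) :
    s.phi0 x * s.etaD x ^ (M + N) * s.prefactorXi M N (s.eta x)
      = s.cF ^ (M + N) * (s.shiftMN M N).phi0 x * s.prefactorP M N (s.eta x) := by
  cases s with
  | L g =>
    have hx : 0 < x := hx
    simp only [phi0, etaD, cF, shiftMN, prefactorXi, prefactorP, eta]
    rw [mul_pow, pow_eq_exp_log hx (M + N), rpow_eq_exp_log hx, rpow_eq_exp_log hx,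
      sq_rpow_eq_exp_log hx, sq_rpow_eq_exp_log hx]
    have e : Real.log x * g + ((M + N : ℕ) : ℝ) * Real.log x
        + 2 * Real.log x * ((M + g - 1 / 2) * N)
        = Real.log x * (g + M - N) + 2 * Real.log x * ((M + g + 1 / 2) * N) := by
      push_cast; ring
    have := congrArg Real.exp e
    simp only [Real.exp_add] at this
    linear_combination (Real.exp (-x ^ 2 / 2) * 2 ^ (M + N) * Real.exp (-M * x ^ 2)) * this
  | J g h =>
    have hs := sin_pos_of_mem hx
    have hc := cos_pos_of_mem hx
    simp only [phi0, etaD, cF, shiftMN, prefactorXi, prefactorP, eta, one_sub_cos_two_mul,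
      one_add_cos_two_mul]
    rw [mul_pow, mul_pow, pow_eq_exp_log hs (M + N), pow_eq_exp_log hc (M + N),
      rpow_eq_exp_log hs, rpow_eq_exp_log hc, rpow_eq_exp_log hs, rpow_eq_exp_log hc,
      sq_rpow_eq_exp_log hs, sq_rpow_eq_exp_log hc, sq_rpow_eq_exp_log hs, sq_rpow_eq_exp_log hc]
    generalize Real.log (Real.sin x) = a
    generalize Real.log (Real.cos x) = b
    have e : a * g + b * h + (((M + N : ℕ) : ℝ) * a + ((M + N : ℕ) : ℝ) * b)
        + (2 * a * ((M + g - 1 / 2) * N) + 2 * b * ((N + h - 1 / 2) * M))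
        = a * (g + M - N) + b * (h - M + N) +
          (2 * a * ((M + g + 1 / 2) * N) + 2 * b * ((N + h + 1 / 2) * M)) := by
      push_cast; ring
    have := congrArg Real.exp e
    simp only [Real.exp_add] at this
    linear_combination (-4 : ℝ) ^ (M + N) * this

theorem prefactorXi_pos (s : System) (M N : ℕ) {y : ℝ} (hy : y ∈ s.etaDom) :
    0 < s.prefactorXi M N y := by
  cases s with
  | L g => exact mul_pos (Real.exp_pos _) (Real.rpow_pos_of_pos hy _)
  | J g h =>
    have hy : -1 < y ∧ y < 1 := hy
    exact mul_pos (Real.rpow_pos_of_pos (by linarith) _) (Real.rpow_pos_of_pos (by linarith) _)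

theorem contDiffOn_prefactorXi (s : System) (M N : ℕ) :
    ContDiffOn ℝ ∞ (s.prefactorXi M N) s.etaDom := by
  intro y hy
  refine ContDiffAt.contDiffWithinAt ?_
  cases s with
  | L g =>
    exact (by fun_prop : ContDiff ℝ ∞ fun y : ℝ => Real.exp (-M * y)).contDiffAt.mul
      (contDiffAt_id.rpow_const_of_ne (ne_of_gt hy))
  | J g h =>
    have hy : -1 < y ∧ y < 1 := hy
    exact ((by fun_prop : ContDiff ℝ ∞ fun y : ℝ => (1 - y) / 2).contDiffAt.rpow_const_of_ne
      (by linarith)).mul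
      ((by fun_prop : ContDiff ℝ ∞ fun y : ℝ => (1 + y) / 2).contDiffAt.rpow_const_of_ne
      (by linarith))

theorem contDiffOn_prefactorP (s : System) (M N : ℕ) :
    ContDiffOn ℝ ∞ (s.prefactorP M N) s.etaDom := by
  intro y hy
  refine ContDiffAt.contDiffWithinAt ?_
  cases s with
  | L g =>
    exact (by fun_prop : ContDiff ℝ ∞ fun y : ℝ => Real.exp (-M * y)).contDiffAt.mul
      (contDiffAt_id.rpow_const_of_ne (ne_of_gt hy))
  | J g h =>
    have hy : -1 < y ∧ y < 1 := hy
    exact ((by fun_prop : ContDiff ℝ ∞ fun y : ℝ => (1 - y) / 2).contDiffAt.rpow_const_of_ne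
      (by linarith)).mul
      ((by fun_prop : ContDiff ℝ ∞ fun y : ℝ => (1 + y) / 2).contDiffAt.rpow_const_of_ne
      (by linarith))

theorem contDiffOn_mu (s : System) (d : ℕ) : ContDiffOn ℝ ∞ (s.mu d) s.etaDom := by
  intro y hy
  refine ContDiffAt.contDiffWithinAt ?_
  cases s with
  | L g =>
    refine ContDiffAt.mul Real.contDiff_exp.contDiffAt ?_
    rw [funext ((L g).xiI_eq d)]
    exact (contDiff_eval _).contDiffAt
  | J g h =>
    have hy : -1 < y ∧ y < 1 := hy
    refine ContDiffAt.mul ((by fun_prop : ContDiff ℝ ∞ fun y : ℝ =>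
      (1 + y) / 2).contDiffAt.rpow_const_of_ne (by linarith)) ?_
    rw [funext ((J g h).xiI_eq d)]
    exact (contDiff_eval _).contDiffAt

theorem contDiffOn_nu (s : System) (d : ℕ) : ContDiffOn ℝ ∞ (s.nu d) s.etaDom := by
  intro y hy
  refine ContDiffAt.contDiffWithinAt ?_
  cases s with
  | L g =>
    refine ContDiffAt.mul (contDiffAt_id.rpow_const_of_ne (ne_of_gt hy)) ?_
    rw [funext ((L g).xiII_eq d)]
    exact (contDiff_eval _).contDiffAt
  | J g h =>
    have hy : -1 < y ∧ y < 1 := hy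
    refine ContDiffAt.mul ((by fun_prop : ContDiff ℝ ∞ fun y : ℝ =>
      (1 - y) / 2).contDiffAt.rpow_const_of_ne (by linarith)) ?_
    rw [funext ((J g h).xiII_eq d)]
    exact (contDiff_eval _).contDiffAt

theorem virtualI_eq_phi0_mul (s : System) (v : ℕ) {x : ℝ} (hx : x ∈ s.xDom) :
    s.virtualI v x = s.phi0 x * s.mu v (s.eta x) := by
  cases s with
  | L g =>
    have : Real.exp (x ^ 2 / 2) = Real.exp (-x ^ 2 / 2) * Real.exp (x ^ 2) := by
      rw [← Real.exp_add]; congr 1; ring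
    simp only [virtualI, phi0, mu, eta, this]
    ring
  | J g h =>
    have hc := cos_pos_of_mem hx
    simp only [virtualI, phi0, mu, eta, one_add_cos_two_mul]
    rw [sq_rpow_eq_exp_log hc, rpow_eq_exp_log hc (1 - h), rpow_eq_exp_log hc h,
      show Real.log (Real.cos x) * (1 - h) = Real.log (Real.cos x) * h +
        2 * Real.log (Real.cos x) * (1 / 2 - h) by ring, Real.exp_add]
    ring

theorem virtualII_eq_phi0_mul (s : System) (v : ℕ) {x : ℝ} (hx : x ∈ s.xDom) :
    s.virtualII v x = s.phi0 x * s.nu v (s.eta x) := by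
  cases s with
  | L g =>
    have hx : 0 < x := hx
    simp only [virtualII, phi0, nu, eta]
    rw [sq_rpow_eq_exp_log hx, rpow_eq_exp_log hx (1 - g), rpow_eq_exp_log hx g,
      show Real.log x * (1 - g) = Real.log x * g + 2 * Real.log x * (1 / 2 - g) by ring,
      Real.exp_add]
    ring
  | J g h =>
    have hs := sin_pos_of_mem hx
    simp only [virtualII, phi0, nu, eta, one_sub_cos_two_mul]
    rw [sq_rpow_eq_exp_log hs, rpow_eq_exp_log hs (1 - g), rpow_eq_exp_log hs g,
      show Real.log (Real.sin x) * (1 - g) = Real.log (Real.sin x) * g +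
        2 * Real.log (Real.sin x) * (1 / 2 - g) by ring, Real.exp_add]
    ring

variable (s : System) (dI : Fin M → ℕ) (dII : Fin N → ℕ)

theorem contDiffOn_muNu (j : Fin (M + N)) : ContDiffOn ℝ ∞ (s.muNu dI dII j) s.etaDom := by
  refine Fin.addCases (fun i => ?_) (fun i => ?_) j
  · simpa only [muNu, Fin.append_left] using s.contDiffOn_mu (dI i)
  · simpa only [muNu, Fin.append_right] using s.contDiffOn_nu (dII i)

theorem contDiffOn_classicalP (n : ℕ) : ContDiffOn ℝ ∞ (s.classicalP n) s.etaDom := by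
  rw [funext (s.classicalP_eq n)]
  exact (contDiff_eval _).contDiffOn

theorem contDiffOn_muNu_append (n : ℕ) (j : Fin (M + N + 1)) : ContDiffOn ℝ ∞
    (Fin.append (s.muNu dI dII) (fun _ : Fin 1 => s.classicalP n) j) s.etaDom := by
  refine Fin.addCases (fun i => ?_) (fun i => ?_) j
  · simpa only [Fin.append_left] using s.contDiffOn_muNu dI dII i
  · simpa only [Fin.append_right] using s.contDiffOn_classicalP n

theorem seeds_eq_phi0_mul (j : Fin (M + N)) : EqOn (s.seeds dI dII j)
    (fun x => s.phi0 x * s.muNu dI dII j (s.eta x)) s.xDom := fun x hx => by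
  refine Fin.addCases (fun i => ?_) (fun i => ?_) j
  · simpa only [seeds, muNu, Fin.append_left] using s.virtualI_eq_phi0_mul (dI i) hx
  · simpa only [seeds, muNu, Fin.append_right] using s.virtualII_eq_phi0_mul (dII i) hx

theorem deriv_eta : deriv s.eta = s.etaD := funext fun x => (s.hasDerivAt_eta x).deriv

theorem wronskian_seeds_eq {x : ℝ} (hx : x ∈ s.xDom) : wronskian (s.seeds dI dII) x
    = s.phi0 x ^ (M + N) * s.etaD x ^ ((M + N) * (M + N - 1) / 2)
      * wronskian (s.muNu dI dII) (s.eta x) := by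
  rw [wronskian_eqOn s.isOpen_xDom (s.seeds_eq_phi0_mul dI dII) hx,
    wronskian_mul_comp s.isOpen_xDom s.isOpen_etaDom s.contDiffOn_phi0 s.contDiff_eta.contDiffOn
      s.mapsTo_eta (s.contDiffOn_muNu dI dII) hx, deriv_eta]

theorem wronskian_seeds {x : ℝ} (hx : x ∈ s.xDom) : wronskian (s.seeds dI dII) x
    = s.cF ^ ((M + N) * (M + N - 1) / 2) * s.gauge M N x * s.denomXi dI dII (s.eta x) := by
  rw [wronskian_seeds_eq s dI dII hx, phi0_pow_mul_etaD_pow s M N hx, denomXi]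
  ring

theorem wronskian_seeds_append_eq (n : ℕ) {x : ℝ} (hx : x ∈ s.xDom) :
    wronskian (Fin.append (s.seeds dI dII) (fun _ : Fin 1 => s.phi n)) x
    = s.phi0 x ^ (M + N + 1) * s.etaD x ^ ((M + N + 1) * (M + N) / 2)
      * wronskian (Fin.append (s.muNu dI dII) (fun _ : Fin 1 => s.classicalP n)) (s.eta x) := by
  have h : ∀ j : Fin (M + N + 1), EqOn (Fin.append (s.seeds dI dII) (fun _ : Fin 1 => s.phi n) j)
      (fun x => s.phi0 x *
        Fin.append (s.muNu dI dII) (fun _ : Fin 1 => s.classicalP n) j (s.eta x)) s.xDom := by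
    intro j x hx
    refine Fin.addCases (fun i => ?_) (fun i => ?_) j
    · simpa only [Fin.append_left] using s.seeds_eq_phi0_mul dI dII i hx
    · simp only [Fin.append_right]
      rfl
  rw [wronskian_eqOn s.isOpen_xDom h hx,
    wronskian_mul_comp s.isOpen_xDom s.isOpen_etaDom s.contDiffOn_phi0 s.contDiff_eta.contDiffOn
      s.mapsTo_eta (s.contDiffOn_muNu_append dI dII n) hx, deriv_eta]
  rfl

theorem phiD_eq (n : ℕ) {x : ℝ} (hx : x ∈ s.xDom)
    (h0 : wronskian (s.muNu dI dII) (s.eta x) ≠ 0) : s.phiD dI dII n x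
      = s.cF ^ (M + N) * s.psiD dI dII x * s.multiP dI dII n (s.eta x) := by
  have h1 := (s.phi0_pos hx).ne'
  have h2 := s.etaD_ne_zero hx
  have h3 := (s.prefactorXi_pos M N (s.mapsTo_eta hx)).ne'
  rw [phiD, wronskian_seeds_append_eq s dI dII n hx, wronskian_seeds_eq s dI dII hx, psiD, denomXi,
    multiP]
  have e : (M + N + 1) * (M + N) / 2 = (M + N) * (M + N - 1) / 2 + (M + N) := by
    generalize M + N = K
    rcases K with _ | K
    · rfl
    · rw [Nat.add_sub_cancel, show (K + 1 + 1) * (K + 1) = (K + 1) * K + (K + 1) * 2 by ring,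
        Nat.add_mul_div_right _ _ two_pos]
  rw [e, pow_add (s.etaD x), pow_succ (s.phi0 x)]
  have h4 := s.phi0_shiftMN_mul M N hx
  generalize wronskian (Fin.append _ _) _ = W
  field_simp
  linear_combination W * h4

end System

/-! ### The deformed eigenfunctions -/

theorem Dom.Eig.congr {𝓓 : Dom} {U U' φ φ' : ℝ → ℝ} {p : Bool → ℝ} {E : ℝ} (h : 𝓓.Eig U p E φ)
    (hU : EqOn U U' 𝓓.D) (hφ : EqOn φ φ' 𝓓.D) : 𝓓.Eig U' p E φ' where
  sol := ⟨h.sol.smooth.congr fun x hx => (hφ hx).symm, fun x hx => by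
    rw [← deriv_eqOn 𝓓.isOpen (deriv_eqOn 𝓓.isOpen hφ) hx, h.sol.ode x hx, hU hx, hφ hx]⟩
  rate b := (h.rate b).congr (𝓓.isEnd b) 𝓓.isOpen hφ

theorem Dom.ZeroCount.congr {𝓓 : Dom} {φ φ' : ℝ → ℝ} {n : ℕ} (h : ZeroCount 𝓓.D φ n)
    (hφ : EqOn φ φ' 𝓓.D) : ZeroCount 𝓓.D φ' n := by
  refine ⟨?_, fun x hx h0 => ?_⟩
  · rw [← h.1]
    congr 1
    ext x
    exact and_congr_right fun hx => by rw [hφ hx]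
  · rw [← deriv_eqOn 𝓓.isOpen hφ hx]
    exact h.2 x hx (by rwa [hφ hx])

namespace System

theorem weight_mul_abs_etaD (s : System) {x : ℝ} (hx : x ∈ s.xDom) :
    s.weight (s.eta x) * |s.etaD x| = s.phi0 x ^ 2 := by
  cases s with
  | L g =>
    have hx : 0 < x := hx
    have h1 : (x ^ 2) ^ (g - 1 / 2) * x = (x ^ g) ^ 2 := by
      rw [sq_rpow_eq_exp_log hx, rpow_eq_exp_log hx, ← Real.exp_nat_mul]
      nth_rw 2 [← Real.exp_log hx]
      rw [← Real.exp_add]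
      congr 1
      push_cast
      ring
    have h2 : Real.exp (-x ^ 2) = Real.exp (-x ^ 2 / 2) ^ 2 := by
      rw [← Real.exp_nat_mul]
      congr 1
      push_cast
      ring
    simp only [weight, eta, etaD, phi0]
    rw [abs_of_pos (mul_pos two_pos hx), mul_pow, ← h1, ← h2]
    ring
  | J g h =>
    have h1 := sin_pos_of_mem hx
    have h2 := cos_pos_of_mem hx
    have h3 : 1 - Real.cos (2 * x) = 2 * Real.sin x ^ 2 := by
      linarith [one_sub_cos_two_mul x]
    have h4 : 1 + Real.cos (2 * x) = 2 * Real.cos x ^ 2 := by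
      linarith [one_add_cos_two_mul x]
    simp only [weight, eta, etaD, phi0]
    rw [show -4 * Real.sin x * Real.cos x = -(4 * (Real.sin x * Real.cos x)) by ring, abs_neg,
      abs_of_pos (by positivity), h3, h4, Real.mul_rpow zero_le_two (by positivity),
      Real.mul_rpow zero_le_two (by positivity), sq_rpow_eq_exp_log h1, sq_rpow_eq_exp_log h2,
      rpow_eq_exp_log h1, rpow_eq_exp_log h2]
    have h5 : (2 : ℝ) ^ (g + h + 1) = 4 * (2 ^ (g - 1 / 2) * 2 ^ (h - 1 / 2)) := by
      rw [← Real.rpow_add two_pos, show g + h + 1 = g - 1 / 2 + (h - 1 / 2) + (2 : ℕ) by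
        push_cast; ring, Real.rpow_add two_pos, Real.rpow_natCast]
      ring
    have h6 : ∀ {y : ℝ}, 0 < y → ∀ c : ℝ,
        Real.exp (2 * Real.log y * (c - 1 / 2)) * y = Real.exp (Real.log y * c) ^ 2 := by
      intro y hy c
      nth_rw 2 [← Real.exp_log hy]
      rw [← Real.exp_add, ← Real.exp_nat_mul]
      congr 1
      push_cast
      ring
    have h7 := (Real.rpow_pos_of_pos two_pos (g - 1 / 2)).ne'
    have h8 := (Real.rpow_pos_of_pos two_pos (h - 1 / 2)).ne'
    rw [h5, mul_pow, ← h6 h1, ← h6 h2]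
    field_simp

/-- The conditions on the set of labels. -/
structure Admissible (s : System) {M N : ℕ} (dI : Fin M → ℕ) (dII : Fin N → ℕ) : Prop where
  bound : s.Bound dI dII
  injI : Function.Injective fun j => s.energyI (dI j)
  injII : Function.Injective fun j => s.energyII (dII j)

namespace Admissible

variable {s : System} {M N : ℕ} {dI : Fin M → ℕ} {dII : Fin N → ℕ}

theorem stage (h : s.Admissible dI dII) :
    s.dom.Stage s.potential s.endP (s.seedEnergy dI dII) (seedSign M N) (s.seeds dI dII) :=
  h.bound.stage h.injI h.injII

theorem regular (h : s.Admissible dI dII) : s.Regular := ⟨h.bound.pos, h.bound.good⟩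

theorem wronskian_seeds_ne_zero (h : s.Admissible dI dII) {x : ℝ} (hx : x ∈ s.xDom) :
    wronskian (s.seeds dI dII) x ≠ 0 :=
  h.stage.wronskian_ne_zero x (by rwa [dom_D])

theorem denomXi_ne_zero (h : s.Admissible dI dII) {y : ℝ} (hy : y ∈ s.etaDom) :
    s.denomXi dI dII y ≠ 0 := by
  rw [← image_eta] at hy
  obtain ⟨x, hx, rfl⟩ := hy
  intro h0
  apply h.wronskian_seeds_ne_zero hx
  rw [wronskian_seeds s dI dII hx, h0, mul_zero]

theorem phiD_eq (h : s.Admissible dI dII) (n : ℕ) {x : ℝ} (hx : x ∈ s.xDom) :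
    s.phiD dI dII n x = s.cF ^ (M + N) * s.psiD dI dII x * s.multiP dI dII n (s.eta x) :=
  s.phiD_eq dI dII n hx (left_ne_zero_of_mul (h.denomXi_ne_zero (s.mapsTo_eta hx)))

theorem phiD_eqOn (h : s.Admissible dI dII) (n : ℕ) :
    EqOn (iterDarboux (s.seeds dI dII) (s.phi n)) (s.phiD dI dII n) s.dom.D := fun x hx => by
  rw [phiD, h.stage.wronskian_append (h.regular.eig n).sol.smooth hx,
    mul_div_cancel_left₀ _ (h.stage.wronskian_ne_zero x hx)]

theorem potentialD_eqOn (h : s.Admissible dI dII) :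
    EqOn (iterPot s.potential (s.seedEnergy dI dII) (s.seeds dI dII)) (s.potentialD dI dII)
      s.dom.D := fun x hx => by
  simp only [potentialD, Real.log_abs, iteratedDeriv_two]
  exact h.stage.iterPot_eq hx

/-- The end exponents of the deformed eigenfunctions. -/
noncomputable def _root_.MultiIndexed.System.endPD (s : System) (M N : ℕ) : Bool → ℝ :=
  s.dom.finalP s.endP (seedSign M N)

theorem good (h : s.Admissible dI dII) : s.dom.Good (s.endPD M N) := h.stage.good_finalP

theorem eig (h : s.Admissible dI dII) (n : ℕ) :
    s.dom.Eig (s.potentialD dI dII) (s.endPD M N) (s.energy n) (s.phiD dI dII n) :=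
  (h.stage.eig (h.regular.eig n) (h.bound.seedEnergy_ne n)).congr h.potentialD_eqOn (h.phiD_eqOn n)

theorem contDiffOn_phiD (h : s.Admissible dI dII) (n : ℕ) :
    ContDiffOn ℝ ∞ (s.phiD dI dII n) s.xDom := by
  rw [← dom_D]
  exact (h.eig n).sol.smooth

theorem hamD_phiD (h : s.Admissible dI dII) (n : ℕ) {x : ℝ} (hx : x ∈ s.xDom) :
    s.hamD dI dII (s.phiD dI dII n) x = s.energy n * s.phiD dI dII n x := by
  rw [hamD, iteratedDeriv_two, (h.eig n).sol.ode x (by rwa [dom_D])]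
  ring

theorem integrableOn_phiD_mul (h : s.Admissible dI dII) (n m : ℕ) :
    IntegrableOn (fun x => s.phiD dI dII n x * s.phiD dI dII m x) s.xDom := by
  rw [← dom_D]
  exact (h.eig n).integrableOn_mul h.good h.good (h.eig m)

theorem memLp_phiD (h : s.Admissible dI dII) (n : ℕ) :
    MemLp (s.phiD dI dII n) 2 (volume.restrict s.xDom) := by
  rw [memLp_two_iff_integrable_sq
    ((h.contDiffOn_phiD n).continuousOn.aestronglyMeasurable s.measurableSet_xDom)]
  simpa only [sq, IntegrableOn] using h.integrableOn_phiD_mul n n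

theorem zeroCount (h : s.Admissible dI dII) (n : ℕ) :
    Dom.ZeroCount s.xDom (s.phiD dI dII n) n := by
  rw [← dom_D]
  exact (h.stage.zeroCount (h.regular.eig n) (h.bound.seedEnergy_ne n)
    (h.regular.zeroCount n)).congr (h.phiD_eqOn n)

theorem phiD_zero_ne_zero (h : s.Admissible dI dII) {x : ℝ} (hx : x ∈ s.xDom) :
    s.phiD dI dII 0 x ≠ 0 := fun h0 => by
  have h1 := (h.zeroCount 0).1
  rw [Nat.cast_zero, Set.encard_eq_zero] at h1
  exact (h1 ▸ (⟨hx, h0⟩ : x ∈ {x ∈ s.xDom | s.phiD dI dII 0 x = 0}) : x ∈ (∅ : Set ℝ))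

end Admissible

variable (s : System) {M N : ℕ} (dI : Fin M → ℕ) (dII : Fin N → ℕ)

theorem cF_ne_zero : s.cF ≠ 0 := by cases s <;> norm_num [cF]

/-- Each Darboux step contributes one factor `E(n) - ε_j` to the norm. The powers of `c_F` split off
here are those of `φ_{D,n} = c_F ^ (M + N) ψ_D P_{D,n}`, squared. -/
theorem prod_energy_sub (n : ℕ) : ∏ j, (s.energy n - s.seedEnergy dI dII j)
    = (s.cF ^ 2) ^ (M + N) * s.normFactor dI dII n := by
  rw [Fin.prod_univ_add]
  simp only [seedEnergy, Fin.append_left, Fin.append_right]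
  cases s with
  | L g =>
    simp only [energy, energyI, energyII, cF, normFactor]
    rw [Finset.prod_congr rfl fun j _ => (by ring : (4 : ℝ) * n - -4 * (g + dI j + 1 / 2)
        = 4 * (n + g + dI j + 1 / 2)),
      Finset.prod_congr rfl fun j _ => (by ring : (4 : ℝ) * n - -4 * (g - dII j - 1 / 2)
        = 4 * (n + g - dII j - 1 / 2)), Finset.prod_mul_distrib, Finset.prod_mul_distrib]
    simp only [Finset.prod_const, Finset.card_univ, Fintype.card_fin]
    norm_num [pow_add]
    ring
  | J g h =>
    simp only [energy, energyI, energyII, cF, normFactor]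
    rw [Finset.prod_congr rfl fun j _ => (by ring :
        (4 : ℝ) * n * (n + g + h) - -4 * (g + dI j + 1 / 2) * (h - dI j - 1 / 2)
          = 4 * ((n + g + dI j + 1 / 2) * (n + h - dI j - 1 / 2))),
      Finset.prod_congr rfl fun j _ => (by ring :
        (4 : ℝ) * n * (n + g + h) - -4 * (g - dII j - 1 / 2) * (h + dII j + 1 / 2)
          = 4 * ((n + g - dII j - 1 / 2) * (n + h + dII j + 1 / 2))),
      Finset.prod_mul_distrib (f := fun _ => (4 : ℝ)), Finset.prod_mul_distrib (f := fun _ => (4 : ℝ))]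
    simp only [Finset.prod_const, Finset.card_univ, Fintype.card_fin]
    rw [show ((-4 : ℝ) ^ 2) = 4 * 4 by norm_num, mul_pow, mul_assoc ((4 : ℝ) ^ (M + N))⁻¹,
      mul_assoc ((4 : ℝ) ^ (M + N)), mul_inv_cancel_left₀ (by positivity), pow_add]
    ring

theorem xDom_shiftMN (M N : ℕ) : (s.shiftMN M N).xDom = s.xDom := by cases s <;> rfl

theorem eta_shiftMN (M N : ℕ) : (s.shiftMN M N).eta = s.eta := by cases s <;> rfl

theorem etaD_shiftMN (M N : ℕ) : (s.shiftMN M N).etaD = s.etaD := by cases s <;> rfl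

theorem abs_etaD_mul_weightD {x : ℝ} (hx : x ∈ s.xDom) :
    |s.etaD x| * s.weightD dI dII (s.eta x) = s.psiD dI dII x ^ 2 := by
  have := (s.shiftMN M N).weight_mul_abs_etaD (x := x) (by rwa [xDom_shiftMN])
  rw [eta_shiftMN, etaD_shiftMN] at this
  rw [weightD, psiD, div_pow, ← this]
  ring

namespace Admissible

variable {s dI dII}

theorem phiD_mul_phiD (h : s.Admissible dI dII) (n m : ℕ) {x : ℝ} (hx : x ∈ s.xDom) :
    s.phiD dI dII n x * s.phiD dI dII m x = (s.cF ^ 2) ^ (M + N) * (|s.etaD x| *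
      (s.weightD dI dII (s.eta x) * s.multiP dI dII n (s.eta x) * s.multiP dI dII m (s.eta x))) := by
  rw [h.phiD_eq n hx, h.phiD_eq m hx, mul_assoc (s.weightD dI dII (s.eta x)), ← mul_assoc |s.etaD x|,
    abs_etaD_mul_weightD s dI dII hx]
  ring

/-- The substitution `η = η(x)` turns the weighted integral into that of `φ_{D,n} φ_{D,m}`, which
`Stage.integral_mul` reduces to the undeformed one. -/
theorem orthogonality (h : s.Admissible dI dII) (n m : ℕ) :
    IntegrableOn (fun y => s.weightD dI dII y * s.multiP dI dII n y * s.multiP dI dII m y) s.etaDom ∧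
      ∫ y in s.etaDom, s.weightD dI dII y * s.multiP dI dII n y * s.multiP dI dII m y
        = if n = m then s.normSq n * s.normFactor dI dII n else 0 := by
  have hc : (s.cF ^ 2) ^ (M + N) ≠ 0 := pow_ne_zero _ (pow_ne_zero _ s.cF_ne_zero)
  constructor
  · rw [integrableOn_etaDom]
    refine IntegrableOn.congr_fun (f := fun x => ((s.cF ^ 2) ^ (M + N))⁻¹ *
      (s.phiD dI dII n x * s.phiD dI dII m x)) ((h.integrableOn_phiD_mul n m).const_mul _)
      (fun x hx => ?_) s.measurableSet_xDom
    simp only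
    rw [h.phiD_mul_phiD n m hx, inv_mul_cancel_left₀ hc]
  · rw [integral_etaDom, ← mul_right_inj' hc, ← integral_const_mul,
      ← setIntegral_congr_fun s.measurableSet_xDom fun x hx => h.phiD_mul_phiD n m hx]
    have h1 := h.stage.integral_mul (h.regular.eig n) (h.bound.seedEnergy_ne n)
      (h.regular.eig m) (h.bound.seedEnergy_ne m)
    rw [h.regular.integral_mul, setIntegral_congr_fun s.dom.measurableSet_D fun x hx => by
      rw [h.phiD_eqOn n hx, h.phiD_eqOn m hx], dom_D, prod_energy_sub] at h1
    rw [h1]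
    split_ifs with hnm
    · subst hnm; ring
    · simp

theorem norm_pos (h : s.Admissible dI dII) (n : ℕ) :
    0 < s.normSq n * s.normFactor dI dII n := by
  refine mul_pos (normSq_pos h.bound.pos n) ?_
  have h1 : 0 < ∏ j, (s.energy n - s.seedEnergy dI dII j) := Finset.prod_pos fun j _ =>
    sub_pos.2 ((h.bound.seedEnergy_neg j).trans_le (energy_nonneg h.bound.pos n))
  rw [prod_energy_sub] at h1
  exact pos_of_mul_pos_right h1 (by have := s.cF_ne_zero; positivity)

end Admissible

end System

/-! ### The similarity-transformed Hamiltonian -/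

theorem deriv_deriv_eq {D : Set ℝ} (hD : IsOpen D) {f f' : ℝ → ℝ} {c : ℝ}
    (hf : ∀ x ∈ D, HasDerivAt f (f' x) x) {x : ℝ} (hx : x ∈ D) (hf' : HasDerivAt f' c x) :
    deriv (deriv f) x = c := by
  rw [deriv_eqOn hD (fun y hy => (hf y hy).deriv) hx, hf'.deriv]

/-- The first and second derivatives of a `C²` function. -/
theorem hasDerivAt_of_contDiffOn_two {D : Set ℝ} (hD : IsOpen D) {f : ℝ → ℝ}
    (hf : ContDiffOn ℝ 2 f D) {x : ℝ} (hx : x ∈ D) :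
    HasDerivAt f (deriv f x) x ∧ HasDerivAt (deriv f) (deriv (deriv f) x) x :=
  ⟨((hf.differentiableOn (by norm_num)).differentiableAt (hD.mem_nhds hx)).hasDerivAt,
    (((hf.deriv_of_isOpen (m := 1) hD (by norm_num)).differentiableOn
      (by norm_num)).differentiableAt (hD.mem_nhds hx)).hasDerivAt⟩

namespace System

theorem deriv_deriv_phi0_mul_comp (s : System) {F F' F'' : ℝ → ℝ}
    (hF : ∀ y ∈ s.etaDom, HasDerivAt F (F' y) y) (hF' : ∀ y ∈ s.etaDom, HasDerivAt F' (F'' y) y)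
    {x : ℝ} (hx : x ∈ s.xDom) : deriv (deriv fun y => s.phi0 y * F (s.eta y)) x
      = s.phi0 x * (s.potential x * F (s.eta x)
        + 4 * (s.c1 (s.eta x) * F' (s.eta x) + s.c2 (s.eta x) * F'' (s.eta x))) := by
  have h1 : ∀ y ∈ s.xDom, HasDerivAt (fun y => s.phi0 y * F (s.eta y))
      (s.phi0 y * (s.phi0D y * F (s.eta y) + F' (s.eta y) * s.etaD y)) y := fun y hy =>
    ((s.hasDerivAt_phi0 hy).fun_mul ((hF _ (s.mapsTo_eta hy)).comp y (s.hasDerivAt_eta y))).congr_deriv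
      (by simp only [Function.comp]; ring)
  have h2 := (s.hasDerivAt_phi0 hx).fun_mul (((s.hasDerivAt_phi0D hx).fun_mul
    ((hF _ (s.mapsTo_eta hx)).comp x (s.hasDerivAt_eta x))).fun_add
    (((hF' _ (s.mapsTo_eta hx)).comp x (s.hasDerivAt_eta x)).fun_mul (s.hasDerivAt_etaD x)))
  rw [deriv_deriv_eq s.isOpen_xDom h1 hx h2]
  simp only [Function.comp]
  linear_combination s.phi0 x * (F (s.eta x) * s.phi0DD_add hx + F'' (s.eta x) * s.etaD_sq x
    + F' (s.eta x) * s.etaDD_add hx)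

theorem etaDD_eq (s : System) (M N : ℕ) (x : ℝ) :
    (((s.shiftMN M N).shift (-1)).c1 (s.eta x)) = (s.shiftMN M N).c1 (s.eta x) - s.etaDD x / 2 := by
  cases s
  · simp only [shiftMN, shift, c1, eta, etaDD]; ring
  · simp only [shiftMN, shift, c1, eta, etaDD, Real.cos_two_mul]
    linear_combination (2 : ℝ) * Real.sin_sq_add_cos_sq x

/-- The logarithmic derivative of `gauge`. -/
theorem exists_hasDerivAt_gauge (s : System) (M N : ℕ) : ∃ a : ℝ → ℝ, ∀ x ∈ s.xDom,
    0 < s.gauge M N x ∧ HasDerivAt (s.gauge M N) (a x * s.gauge M N x) x ∧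
      HasDerivAt a ((s.potential x - (s.shiftMN M N).potential x) / 2) x := by
  cases s with
  | L g =>
    refine ⟨_, fun x hx => ⟨mul_pos (Real.exp_pos _) (Real.rpow_pos_of_pos hx _),
      hasDerivAt_exp_mul_rpow _ _ hx, (hasDerivAt_mul_add_div _ _ hx).congr_deriv ?_⟩⟩
    have : x ≠ 0 := ne_of_gt hx
    simp only [potential, shiftMN]
    field_simp
    ring
  | J g h =>
    refine ⟨_, fun x hx => ⟨mul_pos (Real.rpow_pos_of_pos (sin_pos_of_mem hx) _)
      (Real.rpow_pos_of_pos (cos_pos_of_mem hx) _), hasDerivAt_sin_rpow_mul_cos_rpow _ _ hx,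
      (hasDerivAt_cot_sub_tan _ _ hx).congr_deriv ?_⟩⟩
    have hs := (sin_pos_of_mem hx).ne'
    have hc := (cos_pos_of_mem hx).ne'
    simp only [potential, shiftMN]
    field_simp
    ring

variable (s : System) {M N : ℕ} (dI : Fin M → ℕ) (dII : Fin N → ℕ)

theorem contDiffOn_denomXi : ContDiffOn ℝ ∞ (s.denomXi dI dII) s.etaDom :=
  (contDiffOn_wronskian s.isOpen_etaDom (s.contDiffOn_muNu dI dII)).mul (s.contDiffOn_prefactorXi M N)

theorem contDiffOn_multiP (n : ℕ) : ContDiffOn ℝ ∞ (s.multiP dI dII n) s.etaDom :=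
  (contDiffOn_wronskian s.isOpen_etaDom (s.contDiffOn_muNu_append dI dII n)).mul
    (s.contDiffOn_prefactorP M N)

variable {s dI dII}

/-- The logarithm of the Wronskian splits into a constant, `log gauge` and `log Ξ_D(η)`. The second
derivative of `log gauge` is half the difference of the potentials at `λ` and `λ^{[M,N]}`, so it
replaces one by the other. -/
theorem Admissible.potentialD_eq (h : s.Admissible dI dII) {x : ℝ} (hx : x ∈ s.xDom) :
    s.potentialD dI dII x = (s.shiftMN M N).potential x
      - 2 * ((deriv (deriv (s.denomXi dI dII)) (s.eta x) / s.denomXi dI dII (s.eta x)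
          - (deriv (s.denomXi dI dII) (s.eta x) / s.denomXi dI dII (s.eta x)) ^ 2)
            * (4 * s.c2 (s.eta x))
        + deriv (s.denomXi dI dII) (s.eta x) / s.denomXi dI dII (s.eta x) * s.etaDD x) := by
  obtain ⟨a, ha⟩ := s.exists_hasDerivAt_gauge M N
  have hX := s.contDiffOn_denomXi dI dII
  have hc := pow_ne_zero ((M + N) * (M + N - 1) / 2) s.cF_ne_zero
  set Ξ := s.denomXi dI dII with hΞ
  set c := s.cF ^ ((M + N) * (M + N - 1) / 2) with hcdef
  have d1 := fun y hy => hX.smooth_hasDerivAt s.isOpen_etaDom (x := y) hy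
  have d2 := fun y hy => (hX.smooth_deriv s.isOpen_etaDom).smooth_hasDerivAt s.isOpen_etaDom (x := y) hy
  have h0 : ∀ x ∈ s.xDom, Ξ (s.eta x) ≠ 0 := fun x hx => h.denomXi_ne_zero (s.mapsTo_eta hx)
  have h1 : ∀ x ∈ s.xDom, HasDerivAt (fun x => Real.log (wronskian (s.seeds dI dII) x))
      (a x + deriv Ξ (s.eta x) * s.etaD x / Ξ (s.eta x)) x := by
    intro x hx
    have hg := (ha x hx).1.ne'
    have := (((ha x hx).2.1.const_mul c).fun_mul
      ((d1 _ (s.mapsTo_eta hx)).comp x (s.hasDerivAt_eta x))).log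
      (mul_ne_zero (mul_ne_zero hc hg) (h0 x hx))
    refine (this.congr_of_eventuallyEq ?_).congr_deriv ?_
    · filter_upwards [s.isOpen_xDom.mem_nhds hx] with y hy
      rw [wronskian_seeds s dI dII hy]
      rfl
    · have := h0 x hx
      simp only [Function.comp]
      field_simp
  have h2 := (ha x hx).2.2.fun_add ((((d2 _ (s.mapsTo_eta hx)).comp x (s.hasDerivAt_eta x)).fun_mul
    (s.hasDerivAt_etaD x)).fun_div ((d1 _ (s.mapsTo_eta hx)).comp x (s.hasDerivAt_eta x)) (h0 x hx))
  simp only [potentialD, Real.log_abs, iteratedDeriv_two]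
  rw [deriv_deriv_eq s.isOpen_xDom h1 hx h2, ← s.etaD_sq]
  have := h0 x hx
  simp only [Function.comp]
  field_simp
  ring

theorem Admissible.hamTilde_eq (h : s.Admissible dI dII) {f : ℝ → ℝ}
    (hf : ContDiffOn ℝ 2 f s.etaDom) {x : ℝ} (hx : x ∈ s.xDom) :
    s.hamTilde dI dII f x = s.etaOp dI dII f (s.eta x) := by
  have hX := s.contDiffOn_denomXi dI dII
  have h0 : ∀ y ∈ s.etaDom, s.denomXi dI dII y ≠ 0 := fun y hy => h.denomXi_ne_zero hy
  rw [hamTilde, hamD, etaOp, h.potentialD_eq hx, etaDD_eq]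
  simp only [iteratedDeriv_two]
  have hψ : s.psiD dI dII = fun x => (s.shiftMN M N).phi0 x / s.denomXi dI dII (s.eta x) := rfl
  simp only [hψ]
  set Ξ := s.denomXi dI dII with hΞ
  have d1 := fun y hy => hX.smooth_hasDerivAt s.isOpen_etaDom (x := y) hy
  have d2 := fun y hy => (hX.smooth_deriv s.isOpen_etaDom).smooth_hasDerivAt s.isOpen_etaDom (x := y) hy
  have f1 := fun y hy => (hasDerivAt_of_contDiffOn_two s.isOpen_etaDom hf (x := y) hy).1
  have f2 := fun y hy => (hasDerivAt_of_contDiffOn_two s.isOpen_etaDom hf (x := y) hy).2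
  have k1 := fun y hy => (f1 y hy).fun_div (d1 y hy) (h0 y hy)
  have k2 := fun y hy => (((f2 y hy).fun_mul (d1 y hy)).fun_sub ((f1 y hy).fun_mul (d2 y hy))).fun_div
    ((d1 y hy).fun_pow 2) (pow_ne_zero 2 (h0 y hy))
  have hs : (s.shiftMN M N).etaDom = s.etaDom := by cases s <;> rfl
  have hc2 : (s.shiftMN M N).c2 = s.c2 := by cases s <;> rfl
  have hx' : x ∈ (s.shiftMN M N).xDom := by rwa [xDom_shiftMN]
  have key := (s.shiftMN M N).deriv_deriv_phi0_mul_comp (by rw [hs]; exact k1) (by rw [hs]; exact k2) hx'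
  -- The denominator is moved from `ψ_D` onto `f`, so that the undeformed computation at `λ^{[M,N]}`
  -- applies to `f / Ξ`.
  have hfun : (fun y => (s.shiftMN M N).phi0 y / Ξ (s.eta y) * f (s.eta y))
      = fun y => (s.shiftMN M N).phi0 y * (f ((s.shiftMN M N).eta y) / Ξ ((s.shiftMN M N).eta y)) := by
    funext y
    rw [eta_shiftMN]
    ring
  rw [hfun, key, hc2, eta_shiftMN]
  have h3 := h0 _ (s.mapsTo_eta hx)
  have h4 := ((s.shiftMN M N).phi0_pos hx').ne'
  field_simp
  ring

theorem Admissible.etaOp_multiP (h : s.Admissible dI dII) (n : ℕ) {y : ℝ} (hy : y ∈ s.etaDom) :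
    s.etaOp dI dII (s.multiP dI dII n) y = s.energy n * s.multiP dI dII n y := by
  rw [← image_eta] at hy
  obtain ⟨x, hx, rfl⟩ := hy
  rw [← h.hamTilde_eq (mod_cast contDiffOn_infty.1 (s.contDiffOn_multiP dI dII n) 2) hx,
    hamTilde]
  have hc := pow_ne_zero (M + N) s.cF_ne_zero
  have hψ : s.psiD dI dII x ≠ 0 := div_ne_zero
    ((s.shiftMN M N).phi0_pos (by rwa [xDom_shiftMN])).ne' (h.denomXi_ne_zero (s.mapsTo_eta hx))
  have h1 : EqOn (fun y => s.psiD dI dII y * s.multiP dI dII n (s.eta y))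
      (fun y => (s.cF ^ (M + N))⁻¹ * s.phiD dI dII n y) s.xDom := fun y hy => by
    simp only
    rw [h.phiD_eq n hy, mul_assoc, inv_mul_cancel_left₀ hc]
  have h2 := h.hamD_phiD n hx
  have h3 : deriv (deriv fun y => (s.cF ^ (M + N))⁻¹ * s.phiD dI dII n y) x
      = (s.cF ^ (M + N))⁻¹ * deriv (deriv (s.phiD dI dII n)) x := by
    rw [show deriv (fun y => (s.cF ^ (M + N))⁻¹ * s.phiD dI dII n y)
      = fun y => (s.cF ^ (M + N))⁻¹ * deriv (s.phiD dI dII n) y from funext fun y => deriv_const_mul_field _,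
      deriv_const_mul_field]
  rw [hamD, iteratedDeriv_two] at h2 ⊢
  rw [deriv_eqOn s.isOpen_xDom (deriv_eqOn s.isOpen_xDom h1) hx, h3]
  have h4 := h.phiD_eq n hx
  rw [inv_mul_eq_iff_eq_mul₀ hψ]
  have h5 : s.psiD dI dII x * s.multiP dI dII n (s.eta x)
      = (s.cF ^ (M + N))⁻¹ * s.phiD dI dII n x := h1 hx
  linear_combination (s.cF ^ (M + N))⁻¹ * h2 + (s.potentialD dI dII x - s.energy n) * h5

end System

/-! ### Factorisation and shape invariance -/

theorem wronskian_const_mul {n : ℕ} (c : Fin n → ℝ) (f : Fin n → ℝ → ℝ) (x : ℝ) :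
    wronskian (fun j y => c j * f j y) x = (∏ j, c j) * wronskian f x := by
  unfold wronskian
  rw [← Matrix.det_mul_row]
  congr 1
  ext i j
  simp only [Matrix.of_apply, iteratedDeriv_const_mul_field]

/-- A cyclic permutation of the columns brings the last function to the front, so that the ground
state can act as the first seed. Only the fact that its sign is nonzero matters later. -/
theorem wronskian_append_eq_cons {n : ℕ} (f : Fin n → ℝ → ℝ) (w : ℝ → ℝ) (x : ℝ) :
    wronskian (Fin.append f fun _ : Fin 1 => w) x
      = (Equiv.Perm.sign (finRotate (n + 1)) : ℤ) *
        wronskian (Fin.cons w f : Fin (n + 1) → ℝ → ℝ) x := by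
  rw [Fin.append_right_eq_snoc, Fin.snoc_eq_cons_rotate]
  exact Matrix.det_permute' (finRotate (n + 1)) (Matrix.of fun i j : Fin (n + 1) =>
    iteratedDeriv (i : ℕ) ((Fin.cons w f : Fin (n + 1) → ℝ → ℝ) j) x)

namespace System

/-- The constants relating the derivatives of `mu` to `mu` with shifted parameters. -/
noncomputable def muC : System → ℕ → ℝ
  | L _, _ => 1
  | J _ h, d => (d + 1 / 2 - h) / 2

/-- The constants relating the derivatives of `nu` to `nu` with shifted parameters. -/
noncomputable def nuC : System → ℕ → ℝ
  | L g, d => d + 1 / 2 - g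
  | J g _, d => -(d + 1 / 2 - g) / 2

/-- The contiguous relations shift both parameters at once: the gauge factor absorbs the part of the
derivative that would not be a polynomial of the same family. The label stays fixed, in contrast to
the classical polynomials. -/
theorem hasDerivAt_mu (s : System) (d : ℕ) {y : ℝ} (hy : y ∈ s.etaDom) :
    HasDerivAt (s.mu d) (s.muC d * (s.shift 1).mu d y) y := by
  cases s with
  | L g =>
    have h1 : ∀ g : ℝ, (L g).mu d = fun y => Real.exp y * (lagPoly d (g - 1 / 2)).eval (-y) := by
      intro g
      funext y
      rw [mu, xiI, classicalP, laguerreP_eq]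
    have h2 := (Real.hasDerivAt_exp y).fun_mul
      (((lagPoly d (g - 1 / 2)).hasDerivAt (-y)).comp y (hasDerivAt_neg y))
    have h3 := congrArg (eval (-y)) (lagPoly_sub_derivative d (g - 1 / 2))
    rw [h1, shift, h1, show g + 1 - 1 / 2 = g - 1 / 2 + 1 by ring]
    refine h2.congr_deriv ?_
    simp only [← h3, muC, eval_sub, Function.comp]
    ring
  | J g h =>
    have hy : -1 < y ∧ y < 1 := hy
    have h1 : ∀ g h : ℝ, (J g h).mu d = fun y => ((1 + y) / 2) ^ (1 / 2 - h) *
        (jacPoly d (g - 1 / 2) (1 / 2 - h)).eval ((1 - y) / 2) := by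
      intro g h
      funext y
      rw [mu, xiI, classicalP, jacobiP_eq, show 1 - h - 1 / 2 = 1 / 2 - h by ring]
    have h0 : (0 : ℝ) < (1 + y) / 2 := by linarith
    have h2 := ((((hasDerivAt_id' y).const_add 1).div_const 2).rpow_const (p := 1 / 2 - h)
      (Or.inl h0.ne')).fun_mul (((jacPoly d (g - 1 / 2) (1 / 2 - h)).hasDerivAt ((1 - y) / 2)).comp y
        (((hasDerivAt_id' y).const_sub 1).div_const 2))
    have h3 := congrArg (eval ((1 - y) / 2)) (one_sub_X_mul_derivative_jacPoly d (g - 1 / 2) (1 / 2 - h))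
    simp only [eval_sub, eval_mul, eval_C, eval_one, eval_X] at h3
    rw [h1, shift, h1, show g + 1 - 1 / 2 = g - 1 / 2 + 1 by ring,
      show 1 / 2 - (h + 1) = 1 / 2 - h - 1 by ring]
    refine h2.congr_deriv ?_
    have h4 : ((1 + y) / 2) ^ (1 / 2 - h) = ((1 + y) / 2) ^ (1 / 2 - h - 1) * ((1 + y) / 2) := by
      rw [← Real.rpow_add_one h0.ne']; congr 1; ring
    simp only [muC, Function.comp]
    rw [h4]
    linear_combination ((1 + y) / 2) ^ (1 / 2 - h - 1) / 2 * h3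

theorem hasDerivAt_nu (s : System) (d : ℕ) {y : ℝ} (hy : y ∈ s.etaDom) :
    HasDerivAt (s.nu d) (s.nuC d * (s.shift 1).nu d y) y := by
  cases s with
  | L g =>
    have hy : 0 < y := hy
    have h1 : ∀ g : ℝ, (L g).nu d = fun y => y ^ (1 / 2 - g) * (lagPoly d (1 / 2 - g)).eval y := by
      intro g
      funext y
      rw [nu, xiII, classicalP, laguerreP_eq, show 1 - g - 1 / 2 = 1 / 2 - g by ring]
    have h2 := (Real.hasDerivAt_rpow_const (p := 1 / 2 - g) (Or.inl hy.ne')).fun_mul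
      ((lagPoly d (1 / 2 - g)).hasDerivAt y)
    have h3 := congrArg (eval y) (X_mul_derivative_lagPoly d (1 / 2 - g))
    simp only [eval_add, eval_mul, eval_C, eval_X] at h3
    rw [h1, shift, h1, show 1 / 2 - (g + 1) = 1 / 2 - g - 1 by ring]
    refine h2.congr_deriv ?_
    have h4 : y ^ (1 / 2 - g) = y ^ (1 / 2 - g - 1) * y := by
      rw [← Real.rpow_add_one hy.ne']; congr 1; ring
    simp only [nuC]
    rw [h4]
    linear_combination y ^ (1 / 2 - g - 1) * h3
  | J g h =>
    have hy : -1 < y ∧ y < 1 := hy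
    have h1 : ∀ g h : ℝ, (J g h).nu d = fun y => ((1 - y) / 2) ^ (1 / 2 - g) *
        (jacPoly d (1 / 2 - g) (h - 1 / 2)).eval ((1 - y) / 2) := by
      intro g h
      funext y
      rw [nu, xiII, classicalP, jacobiP_eq, show 1 - g - 1 / 2 = 1 / 2 - g by ring]
    have h0 : (0 : ℝ) < (1 - y) / 2 := by linarith
    have h2 := ((((hasDerivAt_id' y).const_sub 1).div_const 2).rpow_const (p := 1 / 2 - g)
      (Or.inl h0.ne')).fun_mul (((jacPoly d (1 / 2 - g) (h - 1 / 2)).hasDerivAt ((1 - y) / 2)).comp y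
        (((hasDerivAt_id' y).const_sub 1).div_const 2))
    have h3 := congrArg (eval ((1 - y) / 2)) (X_mul_derivative_jacPoly d (1 / 2 - g) (h - 1 / 2))
    simp only [eval_add, eval_mul, eval_C, eval_X] at h3
    rw [h1, shift, h1, show h + 1 - 1 / 2 = h - 1 / 2 + 1 by ring,
      show 1 / 2 - (g + 1) = 1 / 2 - g - 1 by ring]
    refine h2.congr_deriv ?_
    have h4 : ((1 - y) / 2) ^ (1 / 2 - g) = ((1 - y) / 2) ^ (1 / 2 - g - 1) * ((1 - y) / 2) := by
      rw [← Real.rpow_add_one h0.ne']; congr 1; ring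
    simp only [nuC, Function.comp]
    rw [h4]
    linear_combination -((1 - y) / 2) ^ (1 / 2 - g - 1) / 2 * h3

theorem phi0_mul_etaD (s : System) {x : ℝ} (hx : x ∈ s.xDom) :
    s.phi0 x * s.etaD x = s.cF * (s.shift 1).phi0 x := by
  cases s with
  | L g =>
    rw [phi0_shift_L g hx, etaD, cF]
    ring
  | J g h =>
    rw [phi0_shift_J g h hx, etaD, cF]
    ring

section

variable (s : System) {M N : ℕ} (dI : Fin M → ℕ) (dII : Fin N → ℕ)

/-- The constants in the intertwining of the seeds with shifted parameters. -/
noncomputable def seedC : Fin (M + N) → ℝ :=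
  Fin.append (fun j => s.cF * s.muC (dI j)) fun j => s.cF * s.nuC (dII j)

/-- On `φ₀ f(η)` the Darboux step with seed `φ₀` acts as `f ↦ φ₀ η' f'(η)`, and `φ₀ η'` is `c_F`
times the shifted ground state. So virtual states go to virtual states with the same labels and
shifted parameters. -/
theorem darboux_phi0_seeds (j : Fin (M + N)) :
    EqOn (darboux s.phi0 (s.seeds dI dII j))
      (fun x => s.seedC dI dII j * (s.shift 1).seeds dI dII j x) s.xDom := fun x hx => by
  have hx' : x ∈ (s.shift 1).xDom := by rwa [xDom_shift]
  have h1 : HasDerivAt (s.muNu dI dII j) (s.seedC dI dII j / s.cF *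
      (s.shift 1).muNu dI dII j (s.eta x)) (s.eta x) := by
    have hc := s.cF_ne_zero
    refine Fin.addCases (fun i => ?_) (fun i => ?_) j
    · simp only [muNu, seedC, Fin.append_left, mul_div_cancel_left₀ _ hc]
      exact s.hasDerivAt_mu _ (s.mapsTo_eta hx)
    · simp only [muNu, seedC, Fin.append_right, mul_div_cancel_left₀ _ hc]
      exact s.hasDerivAt_nu _ (s.mapsTo_eta hx)
  have h2 := s.darboux_phi0_mul (f' := fun x => s.seedC dI dII j / s.cF *
      (s.shift 1).muNu dI dII j (s.eta x)) hx h1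
  simp only
  rw [darboux_congr s.isOpen_xDom (fun _ _ => rfl) (s.seeds_eq_phi0_mul dI dII j) hx, h2,
    (s.shift 1).seeds_eq_phi0_mul dI dII j hx', phi0_mul_etaD s hx, eta_shift]
  have hc := s.cF_ne_zero
  field_simp

variable {s dI dII}

theorem Bound.seedC_ne_zero (h : s.Bound dI dII) (j : Fin (M + N)) : s.seedC dI dII j ≠ 0 := by
  refine Fin.addCases (fun i => ?_) (fun i => ?_) j
  · simp only [seedC, Fin.append_left]
    refine mul_ne_zero s.cF_ne_zero ?_
    have := h.labelI i
    cases s with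
    | L g => exact one_ne_zero
    | J g h' => exact div_ne_zero (by linarith [this.2]) two_ne_zero
  · simp only [seedC, Fin.append_right]
    refine mul_ne_zero s.cF_ne_zero ?_
    have := h.labelII i
    cases s with
    | L g =>
      have : dII i + 1 / 2 < g := this
      exact (by linarith : (dII i + 1 / 2 - g : ℝ) < 0).ne
    | J g h' => exact div_ne_zero (by linarith [this.1]) two_ne_zero

/-- All energies of one type move by a common constant, so their distinctness survives the parameter
shift. -/
theorem energyI_shift (s : System) : ∃ c : ℝ, ∀ v, (s.shift 1).energyI v = s.energyI v + c := by
  cases s with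
  | L g => exact ⟨-4, fun v => by simp only [shift, energyI]; ring⟩
  | J g h => exact ⟨-4 * (g + h + 1), fun v => by simp only [shift, energyI]; ring⟩

theorem energyII_shift (s : System) : ∃ c : ℝ, ∀ v, (s.shift 1).energyII v = s.energyII v + c := by
  cases s with
  | L g => exact ⟨-4, fun v => by simp only [shift, energyII]; ring⟩
  | J g h => exact ⟨-4 * (g + h + 1), fun v => by simp only [shift, energyII]; ring⟩

theorem Admissible.shift (h : s.Admissible dI dII) : (s.shift 1).Admissible dI dII where
  bound := by
    have hb := h.bound
    cases s with
    | L g => exact ⟨by linarith [hb.1], fun j => by linarith [hb.2 j]⟩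
    | J g h' =>
      exact ⟨⟨by linarith [hb.1.1], fun j => by linarith [hb.1.2 j]⟩,
        ⟨by linarith [hb.2.1], fun j => by linarith [hb.2.2 j]⟩⟩
  injI := by
    obtain ⟨c, hc⟩ := s.energyI_shift
    intro i j hij
    simp only [hc] at hij
    exact h.injI (add_right_cancel hij)
  injII := by
    obtain ⟨c, hc⟩ := s.energyII_shift
    intro i j hij
    simp only [hc] at hij
    exact h.injII (add_right_cancel hij)

/-- The left side is `W[seeds, φ₀]`. With `φ₀` moved to the front and used as first seed, the
remaining Wronskian is that of the seeds at `λ + δ`, up to the constants `seedC`, which do not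
vanish. Shape invariance follows by taking second logarithmic derivatives. -/
theorem Admissible.wronskian_mul_phiD_zero (h : s.Admissible dI dII) : ∃ K : ℝ, K ≠ 0 ∧
    EqOn (fun x => wronskian (s.seeds dI dII) x * s.phiD dI dII 0 x)
      (fun x => K * s.phi0 x * wronskian ((s.shift 1).seeds dI dII) x) s.xDom := by
  refine ⟨(Equiv.Perm.sign (finRotate (M + N + 1)) : ℤ) * ∏ j, s.seedC dI dII j,
    mul_ne_zero (by simp) (Finset.prod_ne_zero_iff.2 fun j _ => h.bound.seedC_ne_zero j),
    fun x hx => ?_⟩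
  have hF : ∀ j, ContDiffOn ℝ ∞ ((Fin.cons s.phi0 (s.seeds dI dII) : Fin (M + N + 1) → ℝ → ℝ) j)
      s.xDom := Fin.cases s.contDiffOn_phi0 fun j => by
    rw [← dom_D]
    exact (h.stage.seed j).sol.smooth
  simp only
  rw [phiD, mul_div_cancel₀ _ (h.wronskian_seeds_ne_zero hx), phi_zero, wronskian_append_eq_cons,
    wronskian_succ s.isOpen_xDom hF (fun x hx => (s.phi0_pos hx).ne') hx]
  simp only [Fin.cons_zero, Fin.cons_succ]
  rw [wronskian_eqOn s.isOpen_xDom (s.darboux_phi0_seeds dI dII) hx, wronskian_const_mul]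
  ring

theorem phi0DD_eq_shift (s : System) {x : ℝ} (hx : x ∈ s.xDom) :
    s.potential x - 2 * s.phi0DD x = (s.shift 1).potential x + s.energy 1 := by
  cases s with
  | L g =>
    have : x ≠ 0 := ne_of_gt hx
    simp only [potential, shift, phi0DD, energy]
    field_simp
    ring
  | J g h =>
    have hs := (sin_pos_of_mem hx).ne'
    have hc := (cos_pos_of_mem hx).ne'
    simp only [potential, shift, phi0DD, energy]
    field_simp
    ring

/-- The Darboux transformation by the ground state shifts the parameters. -/
theorem Admissible.deriv_deriv_log_phiD_zero (h : s.Admissible dI dII) {x : ℝ} (hx : x ∈ s.xDom) :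
    s.potentialD dI dII x - 2 * deriv (deriv fun y => Real.log (s.phiD dI dII 0 y)) x
      = (s.shift 1).potentialD dI dII x + s.energy 1 := by
  obtain ⟨K, hK, hKeq⟩ := h.wronskian_mul_phiD_zero
  have hx' : x ∈ s.dom.D := by rwa [dom_D]
  have hW : ContDiffOn ℝ ∞ (wronskian ((s.shift 1).seeds dI dII)) s.dom.D := by
    rw [← s.dom_shift 1]
    exact Dom.smooth_wronskian h.shift.stage
  have h1 := Dom.deriv_deriv_log_mul (Dom.smooth_wronskian h.stage) (h.eig 0).sol.smooth
    h.stage.wronskian_ne_zero (fun x hx => h.phiD_zero_ne_zero (by rwa [← dom_D])) hx'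
  have h2 := Dom.deriv_deriv_log_mul (𝓓 := s.dom) (u := fun x => K * s.phi0 x)
    (contDiffOn_const.mul s.isSol_phi0.smooth) hW
    (fun x hx => mul_ne_zero hK (s.phi0_ne_zero x hx)) (fun x hx => by
      rw [dom_D, ← s.xDom_shift 1] at hx
      exact h.shift.wronskian_seeds_ne_zero hx) hx'
  have h3 : EqOn (fun x => Real.log (wronskian (s.seeds dI dII) x * s.phiD dI dII 0 x))
      (fun x => Real.log (K * s.phi0 x * wronskian ((s.shift 1).seeds dI dII) x)) s.xDom :=
    fun x hx => congrArg Real.log (hKeq hx)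
  have h4 : deriv (deriv fun y => Real.log (K * s.phi0 y)) x = s.phi0DD x := by
    refine deriv_deriv_eq s.isOpen_xDom (f' := s.phi0D) (fun y hy => ?_) hx (s.hasDerivAt_phi0D hx)
    have hp := (s.phi0_pos hy).ne'
    exact (((s.hasDerivAt_phi0 hy).const_mul K).log (mul_ne_zero hK hp)).congr_deriv
      (by field_simp)
  rw [deriv_eqOn s.isOpen_xDom (deriv_eqOn s.isOpen_xDom h3) hx, h2, h4] at h1
  simp only [potentialD, Real.log_abs, iteratedDeriv_two]
  linear_combination 2 * h1 + s.phi0DD_eq_shift hx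

theorem Admissible.hasDerivAt_logDeriv (h : s.Admissible dI dII) {x : ℝ} (hx : x ∈ s.xDom) :
    HasDerivAt (fun x => deriv (s.phiD dI dII 0) x / s.phiD dI dII 0 x)
      (s.potentialD dI dII x - (deriv (s.phiD dI dII 0) x / s.phiD dI dII 0 x) ^ 2) x := by
  have h1 := (h.contDiffOn_phiD 0).smooth_hasDerivAt s.isOpen_xDom hx
  have h2 := ((h.contDiffOn_phiD 0).smooth_deriv s.isOpen_xDom).smooth_hasDerivAt s.isOpen_xDom hx
  have h0 := h.phiD_zero_ne_zero hx
  refine (h2.fun_div h1 h0).congr_deriv ?_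
  rw [(h.eig 0).sol.ode x (by rwa [dom_D]), energy_zero]
  field_simp
  ring

theorem Admissible.two_mul_sq_sub (h : s.Admissible dI dII) {x : ℝ} (hx : x ∈ s.xDom) :
    2 * (deriv (s.phiD dI dII 0) x / s.phiD dI dII 0 x) ^ 2 - s.potentialD dI dII x
      = (s.shift 1).potentialD dI dII x + s.energy 1 := by
  rw [← h.deriv_deriv_log_phiD_zero hx, deriv_deriv_eq s.isOpen_xDom (fun y hy =>
    ((h.contDiffOn_phiD 0).smooth_hasDerivAt s.isOpen_xDom hy).log (h.phiD_zero_ne_zero hy)) hx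
    (h.hasDerivAt_logDeriv hx)]
  ring

theorem Admissible.hamD_eq (h : s.Admissible dI dII) {f : ℝ → ℝ} (hf : ContDiffOn ℝ 2 f s.xDom)
    {x : ℝ} (hx : x ∈ s.xDom) : s.hamD dI dII f x = s.opAdag dI dII (s.opA dI dII f) x := by
  obtain ⟨h1, h2⟩ := hasDerivAt_of_contDiffOn_two s.isOpen_xDom hf hx
  have h3 : HasDerivAt (s.opA dI dII f) _ x := h2.sub ((h.hasDerivAt_logDeriv hx).mul h1)
  rw [opAdag, h3.deriv, hamD, opA, iteratedDeriv_two]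
  ring

theorem Admissible.opA_opAdag (h : s.Admissible dI dII) {f : ℝ → ℝ} (hf : ContDiffOn ℝ 2 f s.xDom)
    {x : ℝ} (hx : x ∈ s.xDom) : s.opA dI dII (s.opAdag dI dII f) x
      = (s.shift 1).opAdag dI dII ((s.shift 1).opA dI dII f) x + s.energy 1 * f x := by
  obtain ⟨h1, h2⟩ := hasDerivAt_of_contDiffOn_two s.isOpen_xDom hf hx
  have h3 : HasDerivAt (s.opAdag dI dII f) _ x := h2.neg.sub ((h.hasDerivAt_logDeriv hx).mul h1)
  rw [← h.shift.hamD_eq (by rwa [xDom_shift]) (by rwa [xDom_shift]), opA, h3.deriv, hamD, opAdag,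
    iteratedDeriv_two]
  linear_combination f x * h.two_mul_sq_sub hx

end

end System

/-! ### Completeness of the deformed polynomials -/

/-- In the Hilbert space `L²` a subspace with trivial orthogonal complement is dense; the rest
translates between functions and their classes. -/
theorem exists_mem_span_eLpNorm_lt {α : Type*} [MeasurableSpace α] {μ : Measure α} {P : ℕ → α → ℝ}
    (hP : ∀ n, MemLp (P n) 2 μ)
    (hc : ∀ h : α → ℝ, StronglyMeasurable h → MemLp h 2 μ → (∀ n, ∫ x, P n x * h x ∂μ = 0) →
      h =ᵐ[μ] 0)
    {f : α → ℝ} (hf : MemLp f 2 μ) {ε : ℝ≥0∞} (hε : 0 < ε) :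
    ∃ p ∈ Submodule.span ℝ (Set.range P), eLpNorm (f - p) 2 μ < ε := by
  let S : Submodule ℝ (Lp ℝ 2 μ) := Submodule.span ℝ (Set.range fun n => (hP n).toLp (P n))
  have hS : ∀ g ∈ S, ∃ p ∈ Submodule.span ℝ (Set.range P), ∃ hp : MemLp p 2 μ, g = hp.toLp p := by
    intro g hg
    induction hg using Submodule.span_induction with
    | mem x hx =>
      obtain ⟨n, rfl⟩ := hx
      exact ⟨P n, Submodule.subset_span ⟨n, rfl⟩, hP n, rfl⟩
    | zero => exact ⟨0, zero_mem _, MemLp.zero, rfl⟩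
    | add x y _ _ hx hy =>
      obtain ⟨p, hp, hp', rfl⟩ := hx
      obtain ⟨q, hq, hq', rfl⟩ := hy
      exact ⟨p + q, add_mem hp hq, hp'.add hq', rfl⟩
    | smul a x _ hx =>
      obtain ⟨p, hp, hp', rfl⟩ := hx
      exact ⟨a • p, Submodule.smul_mem _ a hp, hp'.const_smul a, rfl⟩
  have htop : S.topologicalClosure = ⊤ := by
    rw [Submodule.topologicalClosure_eq_top_iff, eq_bot_iff]
    intro h hh
    rw [Submodule.mem_bot, Lp.eq_zero_iff_ae_eq_zero]
    refine hc h (Lp.stronglyMeasurable h) (Lp.memLp h) fun n => ?_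
    have := (Submodule.mem_orthogonal S h).1 hh _ (Submodule.subset_span ⟨n, rfl⟩)
    rw [L2.inner_def] at this
    rw [← this]
    refine integral_congr_ae ?_
    filter_upwards [(hP n).coeFn_toLp] with x hx
    rw [hx]
    simp [mul_comm]
  have hmem : hf.toLp f ∈ closure (S : Set (Lp ℝ 2 μ)) := by
    rw [← Submodule.topologicalClosure_coe, htop]
    trivial
  obtain ⟨g, hg, hlt⟩ := EMetric.mem_closure_iff.1 hmem ε hε
  obtain ⟨p, hp, hp', rfl⟩ := hS g hg
  exact ⟨p, hp, by rwa [Lp.edist_toLp_toLp] at hlt⟩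

namespace System

theorem weight_pos {s : System} {y : ℝ} (hy : y ∈ s.etaDom) : 0 < s.weight y := by
  cases s with
  | L g =>
    have : 0 < y := hy
    simp only [weight]
    positivity
  | J g h =>
    have : -1 < y ∧ y < 1 := hy
    have h1 : 0 < 1 - y := by linarith
    have h2 : 0 < 1 + y := by linarith
    simp only [weight]
    positivity

theorem continuousOn_weight (s : System) : ContinuousOn s.weight s.etaDom := by
  intro y hy
  refine ContinuousAt.continuousWithinAt ?_
  cases s with
  | L g =>
    exact (by fun_prop : ContinuousAt (fun y : ℝ => 1 / 2 * Real.exp (-y)) y).mul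
      (Real.continuousAt_rpow_const _ _ (Or.inl (ne_of_gt hy)))
  | J g h =>
    have hy : -1 < y ∧ y < 1 := hy
    exact (continuousAt_const.mul ((by fun_prop : ContinuousAt (fun y : ℝ => 1 - y) y).rpow_const
      (Or.inl (by linarith)))).mul ((by fun_prop : ContinuousAt (fun y : ℝ => 1 + y) y).rpow_const
      (Or.inl (by linarith)))

namespace Admissible

variable {s : System} {M N : ℕ} {dI : Fin M → ℕ} {dII : Fin N → ℕ}

theorem weightD_pos (h : s.Admissible dI dII) {y : ℝ} (hy : y ∈ s.etaDom) :
    0 < s.weightD dI dII y :=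
  div_pos (weight_pos (s := s.shiftMN M N) (by cases s <;> exact hy))
    (by have := h.denomXi_ne_zero hy; positivity)

theorem continuousOn_weightD (h : s.Admissible dI dII) :
    ContinuousOn (s.weightD dI dII) s.etaDom := by
  have h1 := (s.shiftMN M N).continuousOn_weight
  rw [show (s.shiftMN M N).etaDom = s.etaDom by cases s <;> rfl] at h1
  exact h1.div ((s.contDiffOn_denomXi dI dII).continuousOn.pow 2) fun y hy =>
    pow_ne_zero 2 (h.denomXi_ne_zero hy)

theorem aemeasurable_weightD (h : s.Admissible dI dII) :
    AEMeasurable (fun y => (s.weightD dI dII y).toNNReal) (volume.restrict s.etaDom) :=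
  (h.continuousOn_weightD.aestronglyMeasurable s.measurableSet_etaDom).aemeasurable.real_toNNReal

theorem integral_measureD (h : s.Admissible dI dII) (F : ℝ → ℝ) :
    ∫ y, F y ∂s.measureD dI dII = ∫ y in s.etaDom, s.weightD dI dII y * F y := by
  refine (integral_withDensity_eq_integral_smul₀ h.aemeasurable_weightD F).trans ?_
  refine setIntegral_congr_fun s.measurableSet_etaDom fun y hy => ?_
  simp only [NNReal.smul_def, Real.coe_toNNReal _ (h.weightD_pos hy).le, smul_eq_mul]

theorem integrable_measureD (h : s.Admissible dI dII) (F : ℝ → ℝ) :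
    Integrable F (s.measureD dI dII)
      ↔ IntegrableOn (fun y => s.weightD dI dII y * F y) s.etaDom := by
  refine (integrable_withDensity_iff_integrable_smul₀ h.aemeasurable_weightD).trans ?_
  refine integrableOn_congr_fun (fun y hy => ?_) s.measurableSet_etaDom
  simp only [NNReal.smul_def, Real.coe_toNNReal _ (h.weightD_pos hy).le, smul_eq_mul]

theorem memLp_multiP (h : s.Admissible dI dII) (n : ℕ) :
    MemLp (s.multiP dI dII n) 2 (s.measureD dI dII) := by
  have hm : AEStronglyMeasurable (s.multiP dI dII n) (s.measureD dI dII) :=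
    ((s.contDiffOn_multiP dI dII n).continuousOn.aestronglyMeasurable
      s.measurableSet_etaDom).mono_ac (withDensity_absolutelyContinuous _ _)
  rw [memLp_two_iff_integrable_sq hm, h.integrable_measureD]
  simpa only [sq, mul_assoc] using (h.orthogonality n n).1

theorem complete (h : s.Admissible dI dII) : s.dom.Complete (s.phiD dI dII) := by
  intro f hf h0
  refine h.stage.complete (fun n => h.regular.eig n) h.bound.seedEnergy_ne h.regular.complete f hf
    fun n => ?_
  rw [← h0 n]
  exact setIntegral_congr_fun s.dom.measurableSet_D fun x hx => by
    simp only [h.phiD_eqOn n hx]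

/-- In the variable `x` the function becomes `F = ψ_D f(η)`, which lies in `L²(dx)`. As `ρ` is in
`L²` as well, `F ρ` is integrable, so the completeness proved by Darboux steps applies to `F`. -/
theorem ae_eq_zero_of_integral_multiP (h : s.Admissible dI dII) {f : ℝ → ℝ}
    (hfm : StronglyMeasurable f) (hf : MemLp f 2 (s.measureD dI dII))
    (h0 : ∀ n, ∫ y, s.multiP dI dII n y * f y ∂s.measureD dI dII = 0) :
    f =ᵐ[s.measureD dI dII] 0 := by
  have hc := pow_ne_zero (M + N) s.cF_ne_zero
  have hsq := hf.integrable_sq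
  have hψ : ContinuousOn (s.psiD dI dII) s.xDom := by
    have h1 := (s.shiftMN M N).contDiffOn_phi0.continuousOn
    rw [xDom_shiftMN] at h1
    exact h1.div ((s.contDiffOn_denomXi dI dII).continuousOn.comp s.contDiff_eta.continuous.continuousOn
      s.mapsTo_eta) fun x hx => h.denomXi_ne_zero (s.mapsTo_eta hx)
  have hψ0 : ∀ x ∈ s.xDom, s.psiD dI dII x ≠ 0 := fun x hx => div_ne_zero
    ((s.shiftMN M N).phi0_pos (by rwa [xDom_shiftMN])).ne' (h.denomXi_ne_zero (s.mapsTo_eta hx))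
  set F : ℝ → ℝ := fun x => s.psiD dI dII x * f (s.eta x) with hF
  have hFm : AEStronglyMeasurable F (volume.restrict s.xDom) :=
    (hψ.aestronglyMeasurable s.measurableSet_xDom).mul
      (hfm.comp_measurable s.contDiff_eta.continuous.measurable).aestronglyMeasurable
  have hkey : ∀ x ∈ s.xDom, |s.etaD x| * (s.weightD dI dII (s.eta x) * f (s.eta x) ^ 2) = F x ^ 2 :=
    fun x hx => by rw [← mul_assoc, s.abs_etaD_mul_weightD dI dII hx, hF]; ring
  have hF2 : MemLp F 2 (volume.restrict s.xDom) := by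
    rw [memLp_two_iff_integrable_sq hFm]
    rw [h.integrable_measureD, integrableOn_etaDom] at hsq
    exact hsq.congr_fun hkey s.measurableSet_xDom
  have hρ2 : MemLp s.dom.ρ 2 (volume.restrict s.xDom) := by
    rw [← dom_D, memLp_two_iff_integrable_sq
      (s.dom.ρ_smooth.continuousOn.aestronglyMeasurable s.dom.measurableSet_D)]
    refine s.dom.ρ_int.mono' ((s.dom.ρ_smooth.continuousOn.pow 2).aestronglyMeasurable
      s.dom.measurableSet_D) (ae_restrict_of_forall_mem s.dom.measurableSet_D fun x hx => ?_)
    have h1 := s.dom.ρ_pos x hx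
    have h2 := s.dom.ρ_le x hx
    rw [Real.norm_of_nonneg (by positivity)]
    nlinarith
  have hzero : F =ᵐ[volume.restrict s.xDom] 0 := by
    rw [← dom_D]
    refine h.complete F ?_ fun n => ?_
    · rw [dom_D]
      exact hF2.integrable_mul hρ2
    · have h1 := h0 n
      rw [h.integral_measureD, integral_etaDom] at h1
      rw [dom_D, ← mul_zero (s.cF ^ (M + N)), ← h1, ← integral_const_mul]
      refine setIntegral_congr_fun s.measurableSet_xDom fun x hx => ?_
      rw [h.phiD_eq n hx, ← mul_assoc |s.etaD x|, s.abs_etaD_mul_weightD dI dII hx, hF]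
      ring
  have h2 : ∫ y, f y ^ 2 ∂s.measureD dI dII = 0 := by
    rw [h.integral_measureD, integral_etaDom]
    refine integral_eq_zero_of_ae ?_
    filter_upwards [hzero, ae_restrict_mem s.measurableSet_xDom] with x hx hxD
    rw [hkey x hxD, hx]
    simp
  filter_upwards [(integral_eq_zero_iff_of_nonneg (fun y => sq_nonneg (f y)) hsq).1 h2] with y hy
  exact pow_eq_zero_iff two_ne_zero |>.1 hy

theorem dense (h : s.Admissible dI dII) {f : ℝ → ℝ} (hf : MemLp f 2 (s.measureD dI dII))
    {ε : ℝ≥0∞} (hε : 0 < ε) : ∃ p ∈ Submodule.span ℝ (Set.range fun n => s.multiP dI dII n),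
      eLpNorm (f - p) 2 (s.measureD dI dII) < ε :=
  exists_mem_span_eLpNorm_lt h.memLp_multiP
    (fun _ hm hf h0 => h.ae_eq_zero_of_integral_multiP hm hf h0) hf hε

end Admissible

end System

/-! ### Behaviour of the deformed polynomials at the ends -/

/-- A bounded `Φ` forces `B` to vanish at `a`. Cancelling one factor leaves the same situation with
a smaller power, and `u ≠ a` near the end permits the cancellation. -/
theorem X_sub_C_pow_dvd_of_tendsto {l : Filter ℝ} [l.NeBot] {u : ℝ → ℝ} {a L : ℝ}
    (hu : Tendsto u l (𝓝 a)) (hne : ∀ᶠ x in l, u x ≠ a) {Φ : ℝ → ℝ} (hΦ : Tendsto Φ l (𝓝 L)) (T : ℕ)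
    {B : ℝ[X]} (h : ∀ᶠ x in l, Φ x * (u x - a) ^ T = B.eval (u x)) : (X - C a) ^ T ∣ B := by
  induction T generalizing B with
  | zero => simp
  | succ T ih =>
    have h1 : Tendsto (fun x => Φ x * (u x - a) ^ (T + 1)) l (𝓝 (L * (a - a) ^ (T + 1))) :=
      hΦ.mul ((hu.sub_const a).pow _)
    have h2 : Tendsto (fun x => B.eval (u x)) l (𝓝 (B.eval a)) := (B.continuous.tendsto a).comp hu
    have h3 := tendsto_nhds_unique (h1.congr' h) h2
    rw [sub_self, zero_pow T.succ_ne_zero, mul_zero] at h3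
    obtain ⟨B', rfl⟩ := dvd_iff_isRoot.2 h3.symm
    rw [pow_succ']
    refine mul_dvd_mul_left _ (ih ?_)
    filter_upwards [h, hne] with x hx hxne
    refine mul_right_cancel₀ (sub_ne_zero.2 hxne) ?_
    rw [mul_assoc, ← pow_succ, hx, eval_mul, eval_sub, eval_X, eval_C, mul_comm]

theorem tendsto_cos_two_mul_ends :
    Tendsto (fun x => Real.cos (2 * x)) (𝓝[>] 0) (𝓝 1) ∧
      Tendsto (fun x => Real.cos (2 * x)) (𝓝[<] (Real.pi / 2)) (𝓝 (-1)) := by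
  have hc : Continuous fun x : ℝ => Real.cos (2 * x) := by fun_prop
  constructor
  · simpa using (hc.tendsto 0).mono_left (nhdsWithin_le_nhds (s := Ioi 0))
  · have := (hc.tendsto (Real.pi / 2)).mono_left (nhdsWithin_le_nhds (s := Iio (Real.pi / 2)))
    simpa [mul_div_cancel₀] using this

namespace System

/-- The rate function at the right end. -/
noncomputable def rate : System → ℝ → ℝ
  | L _, x => x
  | J _ _, x => Real.sin x / Real.cos x

/-- Half the derivative of `η`, up to sign. -/
noncomputable def halfD : System → ℝ → ℝ
  | L _, x => x
  | J _ _, x => Real.sin x * Real.cos x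

theorem dom_r_true (s : System) (x : ℝ) : s.dom.r true x = -(s.rate x)⁻¹ := by
  cases s with
  | L g => rfl
  | J g h => simp [dom, trigDom, rate]

theorem dom_r_false (s : System) (x : ℝ) : s.dom.r false x = s.rate x := by cases s <;> rfl

theorem rate_pos (s : System) {x : ℝ} (hx : x ∈ s.xDom) : 0 < s.rate x := by
  cases s with
  | L g => exact hx
  | J g h => exact div_pos (sin_pos_of_mem hx) (cos_pos_of_mem hx)

theorem phi0_shiftMN (s : System) (M N : ℕ) {x : ℝ} (hx : x ∈ s.xDom) :
    (s.shiftMN M N).phi0 x = s.phi0 x * s.rate x ^ ((M : ℤ) - N) := by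
  cases s with
  | L g =>
    have hx : 0 < x := hx
    simp only [phi0, shiftMN, rate]
    rw [← Real.rpow_intCast, mul_assoc, ← Real.rpow_add hx]
    push_cast
    rw [add_sub_assoc]
  | J g h =>
    have hs := sin_pos_of_mem hx
    have hc := cos_pos_of_mem hx
    simp only [phi0, shiftMN, rate]
    rw [← Real.rpow_intCast, Real.div_rpow hs.le hc.le, add_sub_assoc, Real.rpow_add hs,
      show h - M + N = h - ((M : ℝ) - N) by ring, Real.rpow_sub hc]
    push_cast
    ring

theorem exists_tendsto_halfD_mul_r (s : System) (b : Bool) {a : ℝ}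
    (ha : Tendsto s.eta (s.dom.l b) (𝓝 a)) :
    ∃ c : ℝ, c ≠ 0 ∧ Tendsto (fun x => s.halfD x * s.dom.r b x) (s.dom.l b) (𝓝 c) := by
  have he := s.dom.isEnd b
  have := he.neBot
  cases s with
  | L g =>
    cases b
    · exact absurd ha (not_tendsto_nhds_of_tendsto_atTop (tendsto_pow_atTop two_ne_zero) a)
    · refine ⟨-1, by norm_num, tendsto_const_nhds.congr' ?_⟩
      filter_upwards [he.mem] with x hx
      have : x ≠ 0 := ne_of_gt hx
      simp [dom_r_true, rate, halfD, this]
  | J g h =>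
    have h1 : ∀ᶠ x in (J g h).dom.l b, (J g h).halfD x * (J g h).dom.r b x
        = if b then -(1 + (J g h).eta x) / 2 else (1 - (J g h).eta x) / 2 := by
      filter_upwards [he.mem] with x hx
      have hs := (sin_pos_of_mem hx).ne'
      have hc := (cos_pos_of_mem hx).ne'
      cases b
      · simp only [dom_r_false, rate, halfD, eta, Bool.false_eq_true, if_false]
        rw [one_sub_cos_two_mul]
        field_simp
      · simp only [dom_r_true, rate, halfD, eta, if_true]
        rw [neg_div, one_add_cos_two_mul]
        field_simp
    cases b
    · refine ⟨1, one_ne_zero, (Tendsto.congr' (EventuallyEq.symm h1) ?_)⟩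
      have := (tendsto_cos_two_mul_ends.2.const_sub 1).div_const 2
      rw [show (1 - -1 : ℝ) / 2 = 1 by norm_num] at this
      simp only [Bool.false_eq_true, if_false]
      exact this
    · refine ⟨-1, by norm_num, (Tendsto.congr' (EventuallyEq.symm h1) ?_)⟩
      have := (tendsto_cos_two_mul_ends.1.const_add 1).neg.div_const 2
      rw [show -(1 + 1 : ℝ) / 2 = -1 by norm_num] at this
      simp only [if_true]
      exact this

variable (s : System) {M N : ℕ} (dI : Fin M → ℕ) (dII : Fin N → ℕ)

/-- The polynomial parts of the seeds. -/
noncomputable def seedPoly : Fin (M + N) → ℝ[X] :=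
  Fin.append (fun j => s.xiIPoly (dI j)) fun j => s.xiIIPoly (dII j)

theorem seedSign_eq_or (j : Fin (M + N)) : seedSign M N j = 1 ∨ seedSign M N j = -1 := by
  refine Fin.addCases (fun i => ?_) (fun i => ?_) j <;> simp [seedSign]

theorem sum_seedSign (M N : ℕ) : ∑ j, seedSign M N j = M - N := by
  simp [seedSign, Fin.sum_univ_add, sub_eq_add_neg]

theorem two_mul_crossExp_seedSign (M N : ℕ) :
    2 * crossExp (seedSign M N) = M + N - ((M : ℤ) - N) ^ 2 := by
  rw [two_mul_crossExp _ seedSign_eq_or, sum_seedSign]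
  push_cast
  rfl

/-- The product of the seeds contains the same gauge factor as their Wronskian, apart from a power
of `halfD`. In the quotient only `(halfD · r) ^ crossExp` and the polynomial parts survive. -/
theorem prod_seeds {x : ℝ} (hx : x ∈ s.xDom) : ∏ j, s.seeds dI dII j x
    = s.gauge M N x * s.halfD x ^ crossExp (seedSign M N)
      * ∏ j, (s.seedPoly dI dII j).eval (s.eta x) := by
  have he : 2 * (crossExp (seedSign M N) : ℝ) = M + N - ((M : ℝ) - N) ^ 2 := by
    exact_mod_cast two_mul_crossExp_seedSign M N
  rw [← Real.rpow_intCast, Fin.prod_univ_add, Fin.prod_univ_add]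
  simp only [seeds, seedPoly, Fin.append_left, Fin.append_right]
  generalize ((crossExp (seedSign M N) : ℤ) : ℝ) = e at *
  cases s with
  | L g =>
    have hx : 0 < x := hx
    simp only [virtualI, virtualII, xiI_eq, xiII_eq, gauge, halfD, Finset.prod_mul_distrib,
      Finset.prod_const, Finset.card_univ, Fintype.card_fin]
    rw [rpow_eq_exp_log hx, rpow_eq_exp_log hx, rpow_eq_exp_log hx, rpow_eq_exp_log hx]
    simp only [← Real.exp_nat_mul]
    generalize Real.log x = a
    have h1 : (M : ℝ) * (x ^ 2 / 2) + M * (a * g) + (N * (-x ^ 2 / 2) + N * (a * (1 - g)))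
        = ((M : ℝ) - N) * x ^ 2 / 2 + a * (g * ((M : ℝ) - N) + ((M : ℝ) - N) * ((M : ℝ) - N - 1) / 2)
          + a * e := by
      linear_combination (-a / 2) * he
    have := congrArg Real.exp h1
    simp only [Real.exp_add] at this
    linear_combination ((∏ j, eval ((L g).eta x) ((L g).xiIPoly (dI j))) *
      ∏ j, eval ((L g).eta x) ((L g).xiIIPoly (dII j))) * this
  | J g h =>
    have hs := sin_pos_of_mem hx
    have hc := cos_pos_of_mem hx
    simp only [virtualI, virtualII, xiI_eq, xiII_eq, gauge, halfD, Finset.prod_mul_distrib,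
      Finset.prod_const, Finset.card_univ, Fintype.card_fin]
    rw [Real.mul_rpow hs.le hc.le, rpow_eq_exp_log hs, rpow_eq_exp_log hs, rpow_eq_exp_log hs,
      rpow_eq_exp_log hs, rpow_eq_exp_log hc, rpow_eq_exp_log hc, rpow_eq_exp_log hc,
      rpow_eq_exp_log hc]
    simp only [← Real.exp_nat_mul]
    generalize Real.log (Real.sin x) = a
    generalize Real.log (Real.cos x) = b
    have h1 : (M : ℝ) * (a * g) + M * (b * (1 - h)) + (N * (a * (1 - g)) + N * (b * h))
        = a * (g * ((M : ℝ) - N) + ((M : ℝ) - N) * ((M : ℝ) - N - 1) / 2)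
          + b * (-h * ((M : ℝ) - N) + ((M : ℝ) - N) * ((M : ℝ) - N + 1) / 2) + (a * e + b * e) := by
      linear_combination (-a / 2 - b / 2) * he
    have := congrArg Real.exp h1
    simp only [Real.exp_add] at this
    linear_combination ((∏ j, eval ((J g h).eta x) ((J g h).xiIPoly (dI j))) *
      ∏ j, eval ((J g h).eta x) ((J g h).xiIIPoly (dII j))) * this

variable {s dI dII}

theorem Admissible.asym_denomXi (h : s.Admissible dI dII) (b : Bool) :
    AsymC (s.dom.l b) (fun x => s.denomXi dI dII (s.eta x))
      (fun x => (s.halfD x * s.dom.r b x) ^ crossExp (seedSign M N)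
        * ∏ j, (s.seedPoly dI dII j).eval (s.eta x)) := by
  obtain ⟨C, hC, hlim⟩ := h.stage.asym_wronskian b
  obtain ⟨a, ha⟩ := s.exists_hasDerivAt_gauge M N
  have hc := pow_ne_zero ((M + N) * (M + N - 1) / 2) s.cF_ne_zero
  refine ⟨C / _, div_ne_zero hC hc, (hlim.div_const _).congr' ?_⟩
  filter_upwards [(s.dom.isEnd b).mem] with x hx
  have hx' : x ∈ s.xDom := by rwa [← dom_D]
  have hg := (ha x hx').1.ne'
  rw [wronskian_seeds s dI dII hx', prod_seeds s dI dII hx', mul_zpow]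
  field_simp

/-- The power of `r` created by the Darboux steps equals, up to a constant, the one that turns `φ₀`
at `λ` into `φ₀` at `λ^{[M,N]}`, so the two cancel at both ends. -/
theorem Admissible.asym_multiP (h : s.Admissible dI dII) (n : ℕ) (b : Bool) :
    AsymC (s.dom.l b) (fun x => s.multiP dI dII n (s.eta x))
      (fun x => (s.classicalPoly n).eval (s.eta x) * s.denomXi dI dII (s.eta x)) := by
  obtain ⟨C, hC, hlim⟩ := h.stage.asym_eig (h.regular.eig n) (h.bound.seedEnergy_ne n) b
  have hc := pow_ne_zero (M + N) s.cF_ne_zero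
  obtain ⟨σ, hσ, hr⟩ : ∃ σ : ℝ, σ ≠ 0 ∧ ∀ x ∈ s.xDom,
      s.dom.r b x ^ (-∑ j, endSign b (seedSign M N j)) = σ * s.rate x ^ ((M : ℤ) - N) := by
    cases b
    · refine ⟨1, one_ne_zero, fun x _ => ?_⟩
      simp only [endSign, Bool.false_eq_true, if_false, Finset.sum_neg_distrib, sum_seedSign,
        dom_r_false, neg_neg, one_mul]
    · refine ⟨(-1) ^ ((M : ℤ) - N), zpow_ne_zero _ (by norm_num), fun x _ => ?_⟩
      simp only [endSign, if_true, sum_seedSign, dom_r_true]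
      rw [← inv_neg, zpow_neg, inv_zpow, inv_inv, ← mul_zpow, neg_one_mul]
  refine ⟨C * (σ / s.cF ^ (M + N)), mul_ne_zero hC (div_ne_zero hσ hc),
    (hlim.mul_const (σ / s.cF ^ (M + N))).congr' ?_⟩
  filter_upwards [(s.dom.isEnd b).mem] with x hx
  have hx' : x ∈ s.xDom := by rwa [← dom_D]
  have h1 := h.denomXi_ne_zero (s.mapsTo_eta hx')
  have h2 := (s.phi0_pos hx').ne'
  have h3 : s.rate x ^ ((M : ℤ) - N) ≠ 0 := zpow_ne_zero _ (s.rate_pos hx').ne'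
  rw [h.phiD_eqOn n hx, h.phiD_eq n hx', hr x hx', psiD, phi0_shiftMN s M N hx', phi_eq]
  simp only
  field_simp

theorem Admissible.exists_tendsto_denomXi (h : s.Admissible dI dII) (b : Bool) {a : ℝ}
    (ha : Tendsto s.eta (s.dom.l b) (𝓝 a)) :
    ∃ L, Tendsto (fun x => s.denomXi dI dII (s.eta x)) (s.dom.l b) (𝓝 L) := by
  have hne := (h.asym_denomXi b).eventually_ne
  obtain ⟨C, hC, hlim⟩ := h.asym_denomXi b
  obtain ⟨c, hc, hr⟩ := s.exists_tendsto_halfD_mul_r b ha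
  refine ⟨_, (hlim.mul ((hr.zpow₀ (crossExp (seedSign M N)) (Or.inl hc)).mul (tendsto_finsetProd Finset.univ fun j _ =>
    ((s.seedPoly dI dII j).continuous.tendsto a).comp ha))).congr' ?_⟩
  filter_upwards [hne] with x hx
  exact div_mul_cancel₀ _ hx.2

theorem Admissible.exists_tendsto_multiP (h : s.Admissible dI dII) (n : ℕ) (b : Bool) {a : ℝ}
    (ha : Tendsto s.eta (s.dom.l b) (𝓝 a)) :
    ∃ L, Tendsto (fun x => s.multiP dI dII n (s.eta x)) (s.dom.l b) (𝓝 L) := by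
  have hne := (h.asym_multiP n b).eventually_ne
  obtain ⟨C, hC, hlim⟩ := h.asym_multiP n b
  obtain ⟨L, hL⟩ := h.exists_tendsto_denomXi b ha
  refine ⟨_, (hlim.mul ((((s.classicalPoly n).continuous.tendsto a).comp ha).mul hL)).congr' ?_⟩
  filter_upwards [hne] with x hx
  exact div_mul_cancel₀ _ hx.2

/-- A function on the range of `η` which becomes a polynomial after multiplication by a power of
`c₂` is a polynomial if it has limits at the finite ends. -/
theorem exists_poly (s : System) {Φ : ℝ → ℝ} {B : ℝ[X]} {T : ℕ}
    (hB : ∀ y ∈ s.etaDom, Φ y * s.c2 y ^ T = B.eval y)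
    (hlim : ∀ b a, Tendsto s.eta (s.dom.l b) (𝓝 a) →
      ∃ L, Tendsto (fun x => Φ (s.eta x)) (s.dom.l b) (𝓝 L)) :
    ∃ Q : ℝ[X], (∀ y ∈ s.etaDom, Φ y = Q.eval y) ∧ B = s.c2Poly ^ T * Q := by
  have hfin : s.c2Poly ^ T ∣ B := by
    cases s with
    | L g =>
      have h1 : Tendsto (L g).eta ((L g).dom.l true) (𝓝 0) := by
        have := ((continuous_pow 2).tendsto (0 : ℝ)).mono_left (nhdsWithin_le_nhds (s := Ioi 0))
        rw [zero_pow two_ne_zero] at this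
        exact this
      have hne := ((L g).dom.isEnd true).neBot
      obtain ⟨l, hl⟩ := hlim true 0 h1
      have := X_sub_C_pow_dvd_of_tendsto (B := B) h1 ?_ hl T ?_
      · simpa [c2Poly] using this
      · filter_upwards [((L g).dom.isEnd true).mem] with x hx
        exact ((L g).mapsTo_eta hx).ne'
      · filter_upwards [((L g).dom.isEnd true).mem] with x hx
        rw [← hB _ ((L g).mapsTo_eta hx), sub_zero]
        rfl
    | J g h =>
      have h1 : ∀ b : Bool, Tendsto (J g h).eta ((J g h).dom.l b) (𝓝 (if b then 1 else -1)) := by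
        intro b
        cases b
        · exact tendsto_cos_two_mul_ends.2
        · exact tendsto_cos_two_mul_ends.1
      have key : ∀ b : Bool, (X - C (if b then 1 else -1) : ℝ[X]) ^ T ∣ B := by
        intro b
        have hne := ((J g h).dom.isEnd b).neBot
        obtain ⟨l, hl⟩ := hlim b _ (h1 b)
        -- Only one of the two linear factors of `1 - η²` vanishes at this end; the other is joined
        -- to `Φ`, where it has a finite limit.
        refine X_sub_C_pow_dvd_of_tendsto (h1 b) ?_ (hl.mul ((((h1 b).add_const
          (if b then 1 else -1)).neg).pow T)) T ?_
        · filter_upwards [((J g h).dom.isEnd b).mem] with x hx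
          have := (J g h).mapsTo_eta hx
          cases b
          · exact this.1.ne'
          · exact this.2.ne
        · filter_upwards [((J g h).dom.isEnd b).mem] with x hx
          rw [← hB _ ((J g h).mapsTo_eta hx), mul_assoc, ← mul_pow]
          congr 2
          simp only [c2]
          cases b
          · simp; ring
          · simp; ring
      have hco : IsCoprime ((X - C 1 : ℝ[X]) ^ T) ((X - C (-1)) ^ T) :=
        (isCoprime_X_sub_C_of_isUnit_sub (by norm_num : IsUnit ((1 : ℝ) - -1))).pow
      have := hco.mul_dvd (by simpa using key true) (by simpa using key false)
      rw [← mul_pow] at this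
      rw [show (J g h).c2Poly = -((X - C 1) * (X - C (-1))) by simp [c2Poly]; ring, neg_pow]
      exact (IsUnit.mul_left_dvd ((isUnit_one.neg).pow T)).2 this
  obtain ⟨Q, rfl⟩ := hfin
  refine ⟨Q, fun y hy => ?_, rfl⟩
  have hc : s.c2 y ≠ 0 := by
    cases s with
    | L g => exact ne_of_gt hy
    | J g h =>
      have : -1 < y ∧ y < 1 := hy
      exact (by nlinarith : (0 : ℝ) < 1 - y ^ 2).ne'
  have := hB y hy
  rw [eval_mul, eval_pow, eval_c2Poly, mul_comm] at this
  exact mul_left_cancel₀ (pow_ne_zero T hc) this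

end System

/-! ### Wronskians of gauge functions times polynomials -/

/-- If `w' = (A / c) w`, then `c ^ i (w p)^{(i)} = w · derivPoly c A p i`. -/
noncomputable def derivPoly (c A p : ℝ[X]) : ℕ → ℝ[X]
  | 0 => p
  | i + 1 => c * derivative (derivPoly c A p i) + (A - C (i : ℝ) * derivative c) * derivPoly c A p i

/-- Each derivative costs one power of `c`; differentiating the power already present produces the
term with `i` and `derivative c` in `derivPoly`. -/
theorem pow_mul_iteratedDeriv {D : Set ℝ} (hD : IsOpen D) {c A p : ℝ[X]} {w f : ℝ → ℝ}
    (hc : ∀ y ∈ D, c.eval y ≠ 0) (hw : ∀ y ∈ D, HasDerivAt w (A.eval y / c.eval y * w y) y)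
    (hf : ∀ y ∈ D, f y = w y * p.eval y) (i : ℕ) {y : ℝ} (hy : y ∈ D) :
    c.eval y ^ i * iteratedDeriv i f y = w y * (derivPoly c A p i).eval y := by
  induction i generalizing y with
  | zero => simpa [derivPoly] using hf y hy
  | succ i ih =>
    have h1 : EqOn (iteratedDeriv i f)
        (fun y => w y * (derivPoly c A p i).eval y / c.eval y ^ i) D := fun y hy => by
      simp only
      rw [← ih hy, mul_div_cancel_left₀ _ (pow_ne_zero i (hc y hy))]
    have h2 := ((hw y hy).fun_mul ((derivPoly c A p i).hasDerivAt y)).fun_div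
      ((c.hasDerivAt y).fun_pow i) (pow_ne_zero i (hc y hy))
    rw [iteratedDeriv_succ, deriv_eqOn hD h1 hy, h2.deriv]
    have h3 := hc y hy
    simp only [derivPoly, eval_add, eval_mul, eval_sub, eval_C]
    rcases i with _ | i
    · simp
      field_simp
      ring
    · field_simp
      simp only [Nat.add_sub_cancel, pow_succ]
      ring

theorem wronskian_mul_pow_eq_eval {D : Set ℝ} (hD : IsOpen D) {c : ℝ[X]} {k : ℕ}
    {A p : Fin k → ℝ[X]} {w f : Fin k → ℝ → ℝ} (hc : ∀ y ∈ D, c.eval y ≠ 0)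
    (hw : ∀ j, ∀ y ∈ D, HasDerivAt (w j) ((A j).eval y / c.eval y * w j y) y)
    (hf : ∀ j, ∀ y ∈ D, f j y = w j y * (p j).eval y) {y : ℝ} (hy : y ∈ D) :
    wronskian f y * c.eval y ^ (k * (k - 1) / 2) = (∏ j, w j y)
      * (Matrix.of fun i j : Fin k => derivPoly c (A j) (p j) i).det.eval y := by
  have h1 : c.eval y ^ (k * (k - 1) / 2) = ∏ i : Fin k, c.eval y ^ (i : ℕ) := by
    rw [Finset.prod_pow_eq_pow_sum, Fin.sum_univ_eq_sum_range (fun i => i), Finset.sum_range_id]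
  rw [h1, mul_comm, wronskian, ← Matrix.det_mul_column, ← coe_evalRingHom, RingHom.map_det,
    ← Matrix.det_mul_row]
  congr 1
  ext i j
  simp only [Matrix.of_apply, RingHom.mapMatrix_apply, Matrix.map_apply, coe_evalRingHom]
  exact pow_mul_iteratedDeriv hD hc (hw j) (hf j) i hy

theorem natDegree_prod_le_and_coeff {ι : Type*} (S : Finset ι) {f : ι → ℝ[X]} {n : ι → ℕ}
    (h : ∀ i ∈ S, (f i).natDegree ≤ n i) : (∏ i ∈ S, f i).natDegree ≤ ∑ i ∈ S, n i ∧
      (∏ i ∈ S, f i).coeff (∑ i ∈ S, n i) = ∏ i ∈ S, (f i).coeff (n i) := by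
  classical
  induction S using Finset.induction_on with
  | empty => simp
  | insert a S ha ih =>
    obtain ⟨h1, h2⟩ := ih fun i hi => h i (Finset.mem_insert_of_mem hi)
    have h3 := h a (Finset.mem_insert_self a S)
    rw [Finset.prod_insert ha, Finset.sum_insert ha, Finset.prod_insert ha, ← h2]
    exact ⟨natDegree_mul_le_of_le h3 h1, coeff_mul_add_eq_of_natDegree_le h3 h1⟩

/-- The degree bounds of the entries add up to the same number for every permutation, so the top
coefficient of the determinant is the determinant of the top coefficients. -/
theorem natDegree_det_le_and_coeff {k : ℕ} {B : Matrix (Fin k) (Fin k) ℝ[X]} {d e : Fin k → ℕ}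
    (h : ∀ i j, (B i j).natDegree ≤ d j + e i) : B.det.natDegree ≤ ∑ j, d j + ∑ i, e i ∧
      B.det.coeff (∑ j, d j + ∑ i, e i) = (Matrix.of fun i j => (B i j).coeff (d j + e i)).det := by
  have h1 : ∀ σ : Equiv.Perm (Fin k), ∑ j, d j + ∑ i, e i = ∑ j, (d j + e (σ j)) := fun σ => by
    rw [Finset.sum_add_distrib, Equiv.sum_comp σ e]
  have h2 := fun σ : Equiv.Perm (Fin k) => natDegree_prod_le_and_coeff Finset.univ
    (f := fun j => B (σ j) j) (n := fun j => d j + e (σ j)) fun j _ => h (σ j) j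
  rw [Matrix.det_apply, Matrix.det_apply]
  constructor
  · refine natDegree_sum_le_of_forall_le _ _ fun σ _ => (natDegree_smul_le _ _).trans ?_
    rw [h1 σ]
    exact (h2 σ).1
  · rw [finsetSum_coeff]
    refine Finset.sum_congr rfl fun σ _ => ?_
    rw [coeff_smul, h1 σ, (h2 σ).2]
    rfl

/-! ### Top degrees of Wronskian determinants for J -/

section Jacobi

variable {p : ℝ[X]} {a₀ a₁ : ℝ} {d : ℕ}

theorem coeff_derivPoly_succ (i m : ℕ) :
    (derivPoly (1 - X ^ 2) (C a₀ + C a₁ * X) p (i + 1)).coeff (m + 1)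
      = (m + 2) * (derivPoly (1 - X ^ 2) (C a₀ + C a₁ * X) p i).coeff (m + 2)
        + a₀ * (derivPoly (1 - X ^ 2) (C a₀ + C a₁ * X) p i).coeff (m + 1)
        + (a₁ + 2 * i - m) * (derivPoly (1 - X ^ 2) (C a₀ + C a₁ * X) p i).coeff m := by
  rw [derivPoly]
  generalize derivPoly (1 - X ^ 2) (C a₀ + C a₁ * X) p i = q
  have h1 : (1 - X ^ 2) * derivative q + (C a₀ + C a₁ * X - C (i : ℝ) * derivative (1 - X ^ 2)) * q
      = derivative q - X * (X * derivative q) + C a₀ * q + C (a₁ + 2 * i) * (X * q) := by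
    simp only [derivative_sub, derivative_one, derivative_X_pow, C_add, C_mul]
    simp
    ring
  have h2 : (X * derivative q).coeff m = m * q.coeff m := by
    rcases m with _ | m
    · simp
    · rw [coeff_X_mul, coeff_derivative]
      push_cast
      ring
  rw [h1]
  simp only [coeff_add, coeff_sub, coeff_C_mul, coeff_X_mul, coeff_derivative, h2]
  push_cast
  ring

theorem natDegree_derivPoly_le (hp : p.natDegree ≤ d) (i : ℕ) :
    (derivPoly (1 - X ^ 2) (C a₀ + C a₁ * X) p i).natDegree ≤ d + i := by
  induction i with
  | zero => exact hp
  | succ i ih =>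
    refine natDegree_le_iff_coeff_eq_zero.2 fun m hm => ?_
    obtain ⟨m, rfl⟩ : ∃ m', m = m' + 1 := ⟨m - 1, by omega⟩
    have h0 := fun m (hm : d + i < m) => coeff_eq_zero_of_natDegree_lt (ih.trans_lt hm)
    rw [coeff_derivPoly_succ, h0 (m + 2) (by omega), h0 (m + 1) (by omega), h0 m (by omega)]
    ring

/-- At infinity the gauge factor times `p` behaves like the power `d - a₁`, whose `i`-th derivative
brings out a falling factorial; the sign comes from `1 - X ^ 2`. -/
theorem coeff_derivPoly_self (hp : p.natDegree ≤ d) (i : ℕ) :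
    (derivPoly (1 - X ^ 2) (C a₀ + C a₁ * X) p i).coeff (d + i)
      = (-1) ^ i * (p.coeff d * (descPochhammer ℝ i).eval (d - a₁)) := by
  induction i with
  | zero => simp [derivPoly]
  | succ i ih =>
    have h0 := fun m (hm : d + i < m) =>
      coeff_eq_zero_of_natDegree_lt ((natDegree_derivPoly_le (a₀ := a₀) (a₁ := a₁) hp i).trans_lt hm)
    rw [← add_assoc, coeff_derivPoly_succ, h0 (d + i + 2) (by omega), h0 (d + i + 1) (by omega), ih,
      descPochhammer_succ_eval]
    push_cast
    ring

/-- Falling factorials are monic of degree `i`, so up to row and column factors this is a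
Vandermonde determinant. -/
theorem det_leading_ne_zero {k : ℕ} {t a : Fin k → ℝ} (ht : ∀ j, t j ≠ 0)
    (ha : Function.Injective a) : (Matrix.of fun i j : Fin k =>
      (-1 : ℝ) ^ (i : ℕ) * (t j * (descPochhammer ℝ i).eval (a j))).det ≠ 0 := by
  have h1 : (Matrix.of fun i j : Fin k => (-1 : ℝ) ^ (i : ℕ) *
      (t j * (descPochhammer ℝ i).eval (a j))).det = (∏ i : Fin k, (-1 : ℝ) ^ (i : ℕ)) *
        ((∏ j, t j) * (Matrix.of fun i j : Fin k => (descPochhammer ℝ i).eval (a j)).det) := by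
    rw [← Matrix.det_mul_row, ← Matrix.det_mul_column]
    rfl
  have h2 := Matrix.det_eval_matrixOfPolynomials_eq_det_vandermonde a
    (fun i : Fin k => descPochhammer ℝ i) (fun i => descPochhammer_natDegree ℝ i)
    fun i => monic_descPochhammer ℝ i
  rw [h1, ← Matrix.det_transpose (Matrix.of fun i j : Fin k => (descPochhammer ℝ i).eval (a j))]
  refine mul_ne_zero (Finset.prod_ne_zero_iff.2 fun i _ => pow_ne_zero _ (by norm_num))
    (mul_ne_zero (Finset.prod_ne_zero_iff.2 fun j _ => ht j) ?_)
  have h3 := Matrix.det_vandermonde_ne_zero_iff.2 ha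
  rw [h2] at h3
  exact h3

/-- The rows add `T` to the degree of the determinant and the power of `1 - X ^ 2` accounts for `2
T`, which leaves a single `T` beside the degree of `Q`. -/
theorem natDegree_of_det_derivPoly {k : ℕ} {p : Fin k → ℝ[X]} {a₀ a₁ : Fin k → ℝ} {d : Fin k → ℕ}
    (hp : ∀ j, (p j).natDegree ≤ d j) {Q E : ℝ[X]} {T : ℕ} (hT : T = k * (k - 1) / 2) (hQ : Q ≠ 0)
    (h : (Matrix.of fun i j : Fin k =>
      derivPoly (1 - X ^ 2) (C (a₀ j) + C (a₁ j) * X) (p j) i).det * E = (1 - X ^ 2) ^ T * Q) :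
    Q.natDegree + T ≤ ∑ j, d j + E.natDegree ∧
      ((∀ j, (p j).coeff (d j) ≠ 0) → Function.Injective (fun j => (d j : ℝ) - a₁ j) →
        Q.natDegree + T = ∑ j, d j + E.natDegree) := by
  obtain ⟨h1, h2⟩ := natDegree_det_le_and_coeff (B := Matrix.of fun i j : Fin k =>
    derivPoly (1 - X ^ 2) (C (a₀ j) + C (a₁ j) * X) (p j) i) (d := d) (e := fun i => (i : ℕ))
    fun i j => natDegree_derivPoly_le (hp j) i
  simp only [Matrix.of_apply, coeff_derivPoly_self (hp _)] at h2
  have hs : ∑ i : Fin k, (i : ℕ) = T := by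
    rw [Fin.sum_univ_eq_sum_range (fun i => i), Finset.sum_range_id, hT]
  rw [hs] at h1 h2
  have hc : (1 - X ^ 2 : ℝ[X]).natDegree = 2 := by compute_degree!
  have hc0 : (1 - X ^ 2 : ℝ[X]) ≠ 0 := fun h0 => by simp [h0] at hc
  have hr : (1 - X ^ 2 : ℝ[X]) ^ T * Q ≠ 0 := mul_ne_zero (pow_ne_zero T hc0) hQ
  have hd : (Matrix.of fun i j : Fin k =>
      derivPoly (1 - X ^ 2) (C (a₀ j) + C (a₁ j) * X) (p j) i).det ≠ 0 := fun h0 => by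
    rw [← h, h0, zero_mul] at hr
    exact hr rfl
  have hE : E ≠ 0 := fun h0 => by
    rw [← h, h0, mul_zero] at hr
    exact hr rfl
  have h3 := congrArg natDegree h
  rw [natDegree_mul hd hE, natDegree_mul (pow_ne_zero T hc0) hQ, natDegree_pow, hc] at h3
  refine ⟨by omega, fun ht ha => ?_⟩
  have h4 := le_natDegree_of_ne_zero (h2.trans_ne (det_leading_ne_zero ht ha))
  omega

end Jacobi

theorem natDegree_eq_of_asymC {p q : ℝ[X]} (hp : p ≠ 0) (hq : q ≠ 0)
    (h : AsymC atTop (fun y => p.eval y) (fun y => q.eval y)) : p.natDegree = q.natDegree := by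
  have key : ∀ {p q : ℝ[X]}, p ≠ 0 → q ≠ 0 → AsymC atTop (fun y => p.eval y) (fun y => q.eval y) →
      q.natDegree ≤ p.natDegree := by
    intro p q hp hq h
    obtain ⟨c, hc, hlim⟩ := h
    by_contra! hlt
    exact hc (tendsto_nhds_unique hlim ((div_tendsto_atTop_zero_iff_degree_lt p q hq).2
      ((natDegree_lt_natDegree_iff hp).1 hlt)))
  exact le_antisymm (key hq hp h.symm) (key hp hq h)

/-! ### The deformed polynomials and their degrees -/

theorem card_mul_le_two_mul_sum (S : Finset ℕ) (h : ∀ a ∈ S, 1 ≤ a) :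
    S.card * (S.card + 1) ≤ 2 * ∑ a ∈ S, a := by
  induction S using Finset.induction_on_max with
  | empty => simp
  | insert a S ha ih =>
    have hS : a ∉ S := fun h => lt_irrefl a (ha a h)
    have h1 := ih fun b hb => h b (Finset.mem_insert_of_mem hb)
    have h2 : S.card ≤ (Finset.Ico 1 a).card := Finset.card_le_card fun b hb =>
      Finset.mem_Ico.2 ⟨h b (Finset.mem_insert_of_mem hb), ha b hb⟩
    have h3 := h a (Finset.mem_insert_self a S)
    rw [Nat.card_Ico] at h2
    rw [Finset.card_insert_of_notMem hS, Finset.sum_insert hS]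
    nlinarith [Nat.sub_add_cancel h3]

theorem mul_succ_le_two_mul_sum {M : ℕ} {d : Fin M → ℕ} (hd : Function.Injective d)
    (h1 : ∀ j, 1 ≤ d j) : M * (M + 1) ≤ 2 * ∑ j, d j := by
  have := card_mul_le_two_mul_sum (Finset.univ.image d) (by simpa using h1)
  rwa [Finset.card_image_of_injective _ hd, Finset.card_univ, Fintype.card_fin,
    Finset.sum_image hd.injOn] at this

theorem two_mul_intCast_choose_two (n : ℕ) :
    2 * ((n * (n - 1) / 2 : ℕ) : ℤ) = n * (n - 1) := by
  refine Int.cast_injective (α := ℝ) ?_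
  rw [Int.cast_mul, Int.cast_mul, Int.cast_sub]
  simp only [Int.cast_natCast, Int.cast_ofNat, Int.cast_one]
  exact two_mul_cast_choose_two n

theorem AsymC.comp {l l' : Filter ℝ} {f g u : ℝ → ℝ} (h : AsymC l f g) (hu : Tendsto u l' l) :
    AsymC l' (fun x => f (u x)) fun x => g (u x) := by
  obtain ⟨C, hC, hlim⟩ := h
  exact ⟨C, hC, hlim.comp hu⟩

namespace System

section

variable {M N : ℕ} (dI : Fin M → ℕ) (dII : Fin N → ℕ)

theorem two_mul_ell : 2 * ell dI dII
    = 2 * ((∑ j, Fin.append dI dII j : ℕ) : ℤ) + 2 * crossExp (seedSign M N) := by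
  have key : ∀ k : ℕ, 2 * ((k : ℤ) * (k - 1) / 2) = k * (k - 1) := fun k => by
    refine Int.mul_ediv_cancel' ?_
    have := Int.even_mul_pred_self k
    exact this.two_dvd
  rw [two_mul_crossExp_seedSign, Fin.sum_univ_add, ell]
  simp only [Fin.append_left, Fin.append_right]
  push_cast
  linear_combination -key M - key N

/-- Distinct positive labels sum to at least `M (M + 1) / 2` and `N (N + 1) / 2`, which gives `ℓ ≥ M
+ N + M N`. -/
theorem one_le_ell {dI : Fin M → ℕ} {dII : Fin N → ℕ} (hI : Function.Injective dI)
    (hII : Function.Injective dII) (hI1 : ∀ j, 1 ≤ dI j) (hII1 : ∀ j, 1 ≤ dII j)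
    (h : 1 ≤ M + N) : 1 ≤ ell dI dII := by
  have h1 := mul_succ_le_two_mul_sum hI hI1
  have h2 := mul_succ_le_two_mul_sum hII hII1
  have h3 := two_mul_ell dI dII
  rw [two_mul_crossExp_seedSign, Fin.sum_univ_add] at h3
  simp only [Fin.append_left, Fin.append_right] at h3
  push_cast at h3
  zify at h1 h2 h
  nlinarith [mul_nonneg (Int.natCast_nonneg M) (Int.natCast_nonneg N)]

end

/-- The gauge factors of the functions `mu` and `nu`. -/
noncomputable def etaGauge : System → Bool → ℝ → ℝ
  | L g, b, y => if b then Real.exp y else y ^ (1 / 2 - g)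
  | J g h, b, y => if b then ((1 + y) / 2) ^ (1 / 2 - h) else ((1 - y) / 2) ^ (1 / 2 - g)

/-- The logarithmic derivatives of `etaGauge`, multiplied by `c₂`. -/
noncomputable def etaGaugeCoeff : System → Bool → ℝ × ℝ
  | L g, b => if b then (0, 1) else (1 / 2 - g, 0)
  | J g h, b => if b then (1 / 2 - h, -(1 / 2 - h)) else (-(1 / 2 - g), -(1 / 2 - g))

theorem c2_ne_zero (s : System) {y : ℝ} (hy : y ∈ s.etaDom) : s.c2Poly.eval y ≠ 0 := by
  cases s with
  | L g => simpa [c2Poly] using ne_of_gt hy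
  | J g h =>
    have : -1 < y ∧ y < 1 := hy
    simp only [c2Poly, eval_sub, eval_one, eval_pow, eval_X]
    exact (by nlinarith : (0 : ℝ) < 1 - y ^ 2).ne'

theorem hasDerivAt_etaGauge (s : System) (b : Bool) {y : ℝ} (hy : y ∈ s.etaDom) :
    HasDerivAt (s.etaGauge b)
      ((C (s.etaGaugeCoeff b).1 + C (s.etaGaugeCoeff b).2 * X : ℝ[X]).eval y / s.c2Poly.eval y
        * s.etaGauge b y) y := by
  have hc := s.c2_ne_zero hy
  cases s with
  | L g =>
    have hy : 0 < y := hy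
    cases b
    · refine (Real.hasDerivAt_rpow_const (p := 1 / 2 - g) (Or.inl hy.ne')).congr_deriv ?_
      simp [etaGauge, etaGaugeCoeff, c2Poly, Real.rpow_sub_one hy.ne']
      ring
    · refine (Real.hasDerivAt_exp y).congr_deriv ?_
      simp [etaGauge, etaGaugeCoeff, c2Poly, hy.ne']
  | J g h =>
    have hy : -1 < y ∧ y < 1 := hy
    simp only [c2Poly, eval_sub, eval_one, eval_pow, eval_X] at hc ⊢
    cases b
    · have h0 : (1 - y) / 2 ≠ 0 := by linarith
      refine ((((hasDerivAt_id' y).const_sub 1).div_const 2).rpow_const (p := 1 / 2 - g)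
        (Or.inl h0)).congr_deriv ?_
      simp only [etaGauge, etaGaugeCoeff, Bool.false_eq_true, if_false, eval_add, eval_mul, eval_C,
        eval_X, Real.rpow_sub_one h0]
      have h1 : 1 - y ≠ 0 := by linarith
      field_simp
      ring
    · have h0 : (1 + y) / 2 ≠ 0 := by linarith
      refine ((((hasDerivAt_id' y).const_add 1).div_const 2).rpow_const (p := 1 / 2 - h)
        (Or.inl h0)).congr_deriv ?_
      simp only [etaGauge, etaGaugeCoeff, if_true, eval_add, eval_mul, eval_C,
        eval_X, Real.rpow_sub_one h0]
      have h1 : 1 + y ≠ 0 := by linarith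
      field_simp
      ring

/-- The polynomial left over from the prefactors. -/
noncomputable def endPoly : System → ℕ → ℕ → ℝ[X]
  | L _, a, _ => X ^ a
  | J _ _, a, b => (C (1 / 2) - C (1 / 2) * X) ^ a * (C (1 / 2) + C (1 / 2) * X) ^ b

theorem natDegree_endPoly_J (g h : ℝ) (a b : ℕ) : ((J g h).endPoly a b).natDegree = a + b := by
  have h1 : (C (1 / 2) - C (1 / 2) * X : ℝ[X]).natDegree = 1 := by
    rw [show (C (1 / 2) - C (1 / 2) * X : ℝ[X]) = C (-1 / 2) * X + C (1 / 2) by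
      rw [show (-1 / 2 : ℝ) = -(1 / 2) by norm_num, C_neg]; ring]
    exact natDegree_linear (by norm_num)
  have h2 : (C (1 / 2) + C (1 / 2) * X : ℝ[X]).natDegree = 1 := by
    rw [add_comm]
    exact natDegree_linear (by norm_num)
  have h3 : (C (1 / 2) - C (1 / 2) * X : ℝ[X]) ≠ 0 := fun h0 => by
    rw [h0, natDegree_zero] at h1
    exact zero_ne_one h1
  have h4 : (C (1 / 2) + C (1 / 2) * X : ℝ[X]) ≠ 0 := fun h0 => by
    rw [h0, natDegree_zero] at h2
    exact zero_ne_one h2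
  rw [endPoly, natDegree_mul (pow_ne_zero a h3) (pow_ne_zero b h4), natDegree_pow, natDegree_pow,
    h1, h2, mul_one, mul_one]

theorem prefactor_mul (s : System) (M N : ℕ) {y : ℝ} (hy : y ∈ s.etaDom) :
    s.prefactorXi M N y * (s.etaGauge true y ^ M * s.etaGauge false y ^ N)
        = (s.endPoly (M * N) (M * N)).eval y ∧
      s.prefactorP M N y * (s.etaGauge true y ^ M * s.etaGauge false y ^ N)
        = (s.endPoly ((M + 1) * N) ((N + 1) * M)).eval y := by
  have key : ∀ {z : ℝ}, 0 < z → ∀ (c e : ℝ) (n m : ℕ), c + e * n = m →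
      z ^ c * (z ^ e) ^ n = z ^ m := by
    intro z hz c e n m h
    rw [← Real.rpow_mul_natCast hz.le, ← Real.rpow_add hz, h, Real.rpow_natCast]
  cases s with
  | L g =>
    have hy : 0 < y := hy
    have h1 : Real.exp (-M * y) * Real.exp y ^ M = 1 := by
      rw [← Real.exp_nat_mul, ← Real.exp_add]
      simp
    have h2 := key hy ((M + g - 1 / 2) * N) (1 / 2 - g) N (M * N) (by push_cast; ring)
    have h3 := key hy ((M + g + 1 / 2) * N) (1 / 2 - g) N ((M + 1) * N) (by push_cast; ring)
    simp only [prefactorXi, prefactorP, etaGauge, endPoly, eval_pow, eval_X, if_true,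
      Bool.false_eq_true, if_false, ← h2, ← h3]
    constructor
    · linear_combination (y ^ ((M + g - 1 / 2) * N) * (y ^ (1 / 2 - g)) ^ N) * h1
    · linear_combination (y ^ ((M + g + 1 / 2) * N) * (y ^ (1 / 2 - g)) ^ N) * h1
  | J g h =>
    have hy : -1 < y ∧ y < 1 := hy
    have h0 : 0 < (1 - y) / 2 := by linarith
    have h0' : 0 < (1 + y) / 2 := by linarith
    have e1 : eval y (C (1 / 2) - C (1 / 2) * X : ℝ[X]) = (1 - y) / 2 := by simp; ring
    have e2 : eval y (C (1 / 2) + C (1 / 2) * X : ℝ[X]) = (1 + y) / 2 := by simp; ring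
    have h1 := key h0 ((M + g - 1 / 2) * N) (1 / 2 - g) N (M * N) (by push_cast; ring)
    have h2 := key h0 ((M + g + 1 / 2) * N) (1 / 2 - g) N ((M + 1) * N) (by push_cast; ring)
    have h3 := key h0' ((N + h - 1 / 2) * M) (1 / 2 - h) M (M * N) (by push_cast; ring)
    have h4 := key h0' ((N + h + 1 / 2) * M) (1 / 2 - h) M ((N + 1) * M) (by push_cast; ring)
    simp only [prefactorXi, prefactorP, etaGauge, endPoly, eval_pow, eval_mul, if_true,
      Bool.false_eq_true, if_false, e1, e2, ← h1, ← h2, ← h3, ← h4]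
    constructor <;> ring

variable (s : System) {M N : ℕ} (dI : Fin M → ℕ) (dII : Fin N → ℕ)

/-- The types of the seeds. -/
def seedType (M N : ℕ) : Fin (M + N) → Bool := Fin.append (fun _ => true) fun _ => false

theorem muNu_eq (j : Fin (M + N)) (y : ℝ) :
    s.muNu dI dII j y = s.etaGauge (seedType M N j) y * (s.seedPoly dI dII j).eval y := by
  refine Fin.addCases (fun i => ?_) (fun i => ?_) j
  · simp only [muNu, seedType, seedPoly, Fin.append_left]
    cases s <;> simp [mu, etaGauge, xiI_eq]
  · simp only [muNu, seedType, seedPoly, Fin.append_right]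
    cases s <;> simp [nu, etaGauge, xiII_eq]

theorem prod_etaGauge (y : ℝ) : ∏ j, s.etaGauge (seedType M N j) y
    = s.etaGauge true y ^ M * s.etaGauge false y ^ N := by
  simp [Fin.prod_univ_add, seedType]

/-- The determinant of the polynomial rows of the Wronskian of seeds. -/
noncomputable def detXi : ℝ[X] :=
  (Matrix.of fun i j : Fin (M + N) => derivPoly s.c2Poly
    (C (s.etaGaugeCoeff (seedType M N j)).1 + C (s.etaGaugeCoeff (seedType M N j)).2 * X)
    (s.seedPoly dI dII j) i).det

/-- The coefficients of the gauge factors in the Wronskian with an eigenfunction. -/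
noncomputable def gaugeCoeffP (s : System) (M N : ℕ) : Fin (M + N + 1) → ℝ × ℝ :=
  Fin.append (fun j => s.etaGaugeCoeff (seedType M N j)) fun _ => 0

/-- The polynomial parts in the Wronskian with an eigenfunction. -/
noncomputable def polyP (n : ℕ) : Fin (M + N + 1) → ℝ[X] :=
  Fin.append (s.seedPoly dI dII) fun _ => s.classicalPoly n

/-- The determinant of the polynomial rows of the Wronskian with an eigenfunction. -/
noncomputable def detP (n : ℕ) : ℝ[X] :=
  (Matrix.of fun i j : Fin (M + N + 1) => derivPoly s.c2Poly
    (C (s.gaugeCoeffP M N j).1 + C (s.gaugeCoeffP M N j).2 * X) (s.polyP dI dII n j) i).det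

theorem denomXi_mul_pow {y : ℝ} (hy : y ∈ s.etaDom) :
    s.denomXi dI dII y * s.c2 y ^ ((M + N) * (M + N - 1) / 2)
      = (s.detXi dI dII * s.endPoly (M * N) (M * N)).eval y := by
  have h1 := wronskian_mul_pow_eq_eval s.isOpen_etaDom (fun y hy => s.c2_ne_zero hy)
    (fun j y hy => s.hasDerivAt_etaGauge (seedType M N j) hy)
    (fun j y _ => s.muNu_eq dI dII j y) hy
  rw [prod_etaGauge] at h1
  rw [eval_mul, ← (s.prefactor_mul M N hy).1, ← eval_c2Poly, denomXi, detXi]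
  linear_combination s.prefactorXi M N y * h1

theorem multiP_mul_pow (n : ℕ) {y : ℝ} (hy : y ∈ s.etaDom) :
    s.multiP dI dII n y * s.c2 y ^ ((M + N + 1) * (M + N + 1 - 1) / 2)
      = (s.detP dI dII n * s.endPoly ((M + 1) * N) ((N + 1) * M)).eval y := by
  have h1 := wronskian_mul_pow_eq_eval s.isOpen_etaDom (k := M + N + 1)
    (A := fun j => C (s.gaugeCoeffP M N j).1 + C (s.gaugeCoeffP M N j).2 * X)
    (p := s.polyP dI dII n)
    (w := Fin.append (fun j => s.etaGauge (seedType M N j)) fun _ _ => 1)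
    (f := Fin.append (s.muNu dI dII) fun _ => s.classicalP n) (fun y hy => s.c2_ne_zero hy)
    (fun j y hy => by
      refine Fin.addCases (fun i => ?_) (fun i => ?_) j
      · simp only [gaugeCoeffP, Fin.append_left]
        exact s.hasDerivAt_etaGauge (seedType M N i) hy
      · simp only [gaugeCoeffP, Fin.append_right]
        simpa using hasDerivAt_const y (1 : ℝ))
    (fun j y _ => by
      refine Fin.addCases (fun i => ?_) (fun i => ?_) j
      · simp only [polyP, Fin.append_left]
        exact s.muNu_eq dI dII i y
      · simp only [polyP, Fin.append_right, one_mul]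
        exact s.classicalP_eq n y) hy
  rw [Fin.prod_univ_add (a := M + N) (b := 1)] at h1
  simp only [Fin.append_left, Fin.append_right, Finset.prod_const_one, mul_one,
    prod_etaGauge] at h1
  rw [eval_mul, ← (s.prefactor_mul M N hy).2, ← eval_c2Poly, multiP, detP]
  linear_combination s.prefactorP M N y * h1

theorem natDegree_seedPoly_le (j : Fin (M + N)) :
    (s.seedPoly dI dII j).natDegree ≤ Fin.append dI dII j := by
  refine Fin.addCases (fun i => ?_) (fun i => ?_) j
  · simp only [seedPoly, Fin.append_left]
    cases s with
    | L g =>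
      rw [xiIPoly, natDegree_comp, natDegree_neg, natDegree_X, mul_one]
      exact natDegree_lagPoly_le ..
    | J g h => exact natDegree_classicalPoly_le (J g (1 - h)) _
  · simp only [seedPoly, Fin.append_right]
    cases s with
    | L g => exact natDegree_classicalPoly_le (L (1 - g)) _
    | J g h => exact natDegree_classicalPoly_le (J (1 - g) h) _

theorem natDegree_seedPoly_L (g : ℝ) (j : Fin (M + N)) :
    ((L g).seedPoly dI dII j).natDegree = Fin.append dI dII j ∧ (L g).seedPoly dI dII j ≠ 0 := by
  have key : ∀ n α, (lagPoly n α).natDegree = n ∧ lagPoly n α ≠ 0 := fun n α => by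
    have h0 : (lagPoly n α).coeff n ≠ 0 := by
      rw [coeff_lagPoly_self]
      exact div_ne_zero (pow_ne_zero _ (by norm_num)) (Nat.cast_ne_zero.2 n.factorial_ne_zero)
    exact ⟨le_antisymm (natDegree_lagPoly_le n α) (le_natDegree_of_ne_zero h0),
      fun h => h0 (by rw [h, coeff_zero])⟩
  refine Fin.addCases (fun i => ?_) (fun i => ?_) j
  · simp only [seedPoly, Fin.append_left, xiIPoly]
    refine ⟨by rw [natDegree_comp, natDegree_neg, natDegree_X, mul_one, (key _ _).1], ?_⟩
    intro h0
    rw [comp_eq_zero_iff] at h0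
    rcases h0 with h0 | ⟨-, h0⟩
    · exact (key _ _).2 h0
    · have := congrArg natDegree h0
      rw [natDegree_neg, natDegree_X, natDegree_C] at this
      exact one_ne_zero this
  · simp only [seedPoly, Fin.append_right, xiIIPoly]
    exact key _ _

theorem coeff_seedPoly_J_ne_zero {g h : ℝ} (hG : (J g h).Generic dI dII) (j : Fin (M + N)) :
    ((J g h).seedPoly dI dII j).coeff (Fin.append dI dII j) ≠ 0 := by
  have hp : ∀ n : ℕ, (2 : ℝ) ^ n * n.factorial ≠ 0 := fun n =>
    mul_ne_zero (pow_ne_zero _ two_ne_zero) (Nat.cast_ne_zero.2 n.factorial_ne_zero)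
  refine Fin.addCases (fun i => ?_) (fun i => ?_) j
  · simp only [seedPoly, Fin.append_left, xiIPoly]
    rw [coeff_classicalPoly_self]
    refine div_ne_zero (eval_ascPochhammer_ne_zero fun k hk h0 => hG.1 i k hk ?_) (hp _)
    linear_combination -h0
  · simp only [seedPoly, Fin.append_right, xiIIPoly]
    rw [coeff_classicalPoly_self]
    refine div_ne_zero (eval_ascPochhammer_ne_zero fun k hk h0 => hG.2.1 i k hk ?_) (hp _)
    linear_combination -h0

/-- The exponents of the seeds at infinity. -/
noncomputable def infExp (s : System) (j : Fin (M + N)) : ℝ :=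
  (Fin.append dI dII j : ℕ) - (s.etaGaugeCoeff (seedType M N j)).2

/-- The functions `μ` and `ν` have exponents `d + 1/2 - h` and `d + 1/2 - g` at infinity. Across the
types these agree precisely in the case that `Generic` rules out. -/
theorem infExp_injective {g h : ℝ} (hI : Function.Injective dI) (hII : Function.Injective dII)
    (hG : (J g h).Generic dI dII) : Function.Injective ((J g h).infExp dI dII) := by
  intro i j
  refine Fin.addCases (fun i => ?_) (fun i => ?_) i <;>
    refine Fin.addCases (fun j => ?_) (fun j => ?_) j <;>
    simp only [infExp, seedType, Fin.append_left, Fin.append_right, etaGaugeCoeff,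
      Bool.false_eq_true, if_false, if_true] <;> intro hij
  · have h' : dI i = dI j := by have := sub_left_inj.1 hij; exact_mod_cast this
    rw [hI h']
  · exact absurd (by linarith) (hG.2.2 i j)
  · exact absurd (by linarith) (hG.2.2 j i)
  · have h' : dII i = dII j := by have := sub_left_inj.1 hij; exact_mod_cast this
    rw [hII h']

/-- This separates the seeds from the classical polynomial, whose exponent `n` is nonnegative. -/
theorem infExp_neg {g h : ℝ} (hb : (J g h).Bound dI dII) (j : Fin (M + N)) :
    (J g h).infExp dI dII j < 0 := by
  refine Fin.addCases (fun i => ?_) (fun i => ?_) j <;>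
    simp only [infExp, seedType, Fin.append_left, Fin.append_right, etaGaugeCoeff,
      Bool.false_eq_true, if_false, if_true]
  · linarith [hb.2.2 i]
  · linarith [hb.1.2 i]

namespace Admissible

variable {s dI dII}

theorem exists_poly_denomXi (h : s.Admissible dI dII) : ∃ Q : ℝ[X],
    (∀ y ∈ s.etaDom, s.denomXi dI dII y = Q.eval y) ∧ s.detXi dI dII * s.endPoly (M * N) (M * N)
      = s.c2Poly ^ ((M + N) * (M + N - 1) / 2) * Q :=
  s.exists_poly (fun _ hy => s.denomXi_mul_pow dI dII hy) fun b _ ha => h.exists_tendsto_denomXi b ha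

theorem exists_poly_multiP (h : s.Admissible dI dII) (n : ℕ) : ∃ Q : ℝ[X],
    (∀ y ∈ s.etaDom, s.multiP dI dII n y = Q.eval y) ∧
      s.detP dI dII n * s.endPoly ((M + 1) * N) ((N + 1) * M)
        = s.c2Poly ^ ((M + N + 1) * (M + N + 1 - 1) / 2) * Q :=
  s.exists_poly (fun _ hy => s.multiP_mul_pow dI dII n hy)
    fun b _ ha => h.exists_tendsto_multiP n b ha

theorem ne_zero_of_eq_denomXi (h : s.Admissible dI dII) {Q : ℝ[X]}
    (hQ : ∀ y ∈ s.etaDom, s.denomXi dI dII y = Q.eval y) : Q ≠ 0 := by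
  rintro rfl
  have he := s.dom.isEnd true
  obtain ⟨x, hx⟩ := he.neBot.nonempty_of_mem he.mem
  have hy := s.mapsTo_eta (by rwa [dom_D] at hx)
  exact h.denomXi_ne_zero hy (by rw [hQ _ hy, eval_zero])

theorem ne_zero_of_eq_multiP (h : s.Admissible dI dII) {n : ℕ} {Q : ℝ[X]}
    (hQ : ∀ y ∈ s.etaDom, s.multiP dI dII n y = Q.eval y) : Q ≠ 0 := by
  rintro rfl
  have he := s.dom.isEnd true
  have := he.neBot
  obtain ⟨x, hx0, hx⟩ := ((h.asym_multiP n true).eventually_ne.and he.mem).exists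
  exact hx0.1 (by rw [hQ _ (s.mapsTo_eta (by rwa [dom_D] at hx)), eval_zero])

theorem natDegree_J {g h : ℝ} {dI : Fin M → ℕ} {dII : Fin N → ℕ} (ha : (J g h).Admissible dI dII)
    (hI : Function.Injective dI) (hII : Function.Injective dII) {Q : ℝ[X]}
    (hQ : ∀ y ∈ (J g h).etaDom, (J g h).denomXi dI dII y = Q.eval y)
    (hQ' : (J g h).detXi dI dII * (J g h).endPoly (M * N) (M * N)
      = (J g h).c2Poly ^ ((M + N) * (M + N - 1) / 2) * Q) :
    (Q.natDegree : ℤ) ≤ ell dI dII ∧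
      ((J g h).Generic dI dII → (Q.natDegree : ℤ) = ell dI dII) := by
  obtain ⟨h1, h2⟩ := natDegree_of_det_derivPoly ((J g h).natDegree_seedPoly_le dI dII) rfl
    (ha.ne_zero_of_eq_denomXi hQ) hQ'
  rw [natDegree_endPoly_J] at h1 h2
  have h3 := two_mul_ell dI dII
  rw [two_mul_crossExp_seedSign] at h3
  have h4 := two_mul_intCast_choose_two (M + N)
  generalize (M + N) * (M + N - 1) / 2 = T at h1 h2 h4
  rw [Nat.cast_add] at h4
  constructor
  · zify at h1
    push_cast at h3
    linarith
  · intro hG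
    have h5 := h2 (coeff_seedPoly_J_ne_zero dI dII hG)
      (infExp_injective dI dII hI hII hG)
    zify at h5
    push_cast at h3
    linarith

theorem natDegree_J_multiP {g h : ℝ} {dI : Fin M → ℕ} {dII : Fin N → ℕ}
    (ha : (J g h).Admissible dI dII) (hI : Function.Injective dI) (hII : Function.Injective dII)
    {n : ℕ} {Q : ℝ[X]} (hQ : ∀ y ∈ (J g h).etaDom, (J g h).multiP dI dII n y = Q.eval y)
    (hQ' : (J g h).detP dI dII n * (J g h).endPoly ((M + 1) * N) ((N + 1) * M)
      = (J g h).c2Poly ^ ((M + N + 1) * (M + N + 1 - 1) / 2) * Q) :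
    (Q.natDegree : ℤ) ≤ ell dI dII + n ∧
      ((J g h).Generic dI dII → (Q.natDegree : ℤ) = ell dI dII + n) := by
  obtain ⟨h1, h2⟩ := natDegree_of_det_derivPoly (d := Fin.append (Fin.append dI dII) fun _ => n)
    (fun j => by
      refine Fin.addCases (fun i => ?_) (fun i => ?_) j
      · simp only [polyP, Fin.append_left]
        exact (J g h).natDegree_seedPoly_le dI dII i
      · simp only [polyP, Fin.append_right]
        exact (J g h).natDegree_classicalPoly_le n) rfl (ha.ne_zero_of_eq_multiP hQ) hQ'
  rw [natDegree_endPoly_J, Fin.sum_univ_add (a := M + N) (b := 1)] at h1 h2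
  simp only [Fin.append_left, Fin.append_right, Finset.sum_const, Finset.card_univ,
    Fintype.card_fin, one_smul] at h1 h2
  have h3 := two_mul_ell dI dII
  rw [two_mul_crossExp_seedSign] at h3
  have h4 := two_mul_intCast_choose_two (M + N + 1)
  generalize (M + N + 1) * (M + N + 1 - 1) / 2 = T at h1 h2 h4
  rw [Nat.cast_add_one, add_sub_cancel_right, Nat.cast_add] at h4
  constructor
  · zify at h1
    push_cast at h3
    linarith
  · intro hG
    have h5 := h2 (fun j => by
      refine Fin.addCases (fun i => ?_) (fun i => ?_) j
      · simp only [polyP, Fin.append_left]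
        exact coeff_seedPoly_J_ne_zero dI dII hG i
      · simp only [polyP, Fin.append_right]
        rw [coeff_classicalPoly_self]
        exact leadCoeff_ne_zero ha.bound.pos n) (by
      intro i j
      have hn : (0 : ℝ) ≤ n := n.cast_nonneg
      refine Fin.addCases (fun i => ?_) (fun i => ?_) i <;>
        refine Fin.addCases (fun j => ?_) (fun j => ?_) j <;>
        simp only [gaugeCoeffP, Fin.append_left, Fin.append_right, Prod.snd_zero, sub_zero] <;>
        intro hij
      · rw [infExp_injective dI dII hI hII hG hij]
      · have := infExp_neg dI dII ha.bound i
        rw [infExp, hij] at this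
        linarith
      · have := infExp_neg dI dII ha.bound j
        rw [infExp, ← hij] at this
        linarith
      · rw [Subsingleton.elim i j])
    zify at h5
    push_cast at h3
    linarith

/-- On the half line the degree is read from the growth at infinity: there `halfD · r = η`, so `Ξ_D`
grows like `η ^ crossExp` times the product of the polynomial parts, whose degrees are the labels.
-/
theorem natDegree_L {g : ℝ} {dI : Fin M → ℕ} {dII : Fin N → ℕ} (ha : (L g).Admissible dI dII)
    {Q : ℝ[X]} (hQ : ∀ y ∈ (L g).etaDom, (L g).denomXi dI dII y = Q.eval y) :
    (Q.natDegree : ℤ) = ell dI dII := by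
  have hQ0 := ha.ne_zero_of_eq_denomXi hQ
  set e := crossExp (seedSign M N) with he
  have h1 := (ha.asym_denomXi false).comp (u := Real.sqrt) Real.tendsto_sqrt_atTop
  -- The exponent `e` may have either sign, so its positive and negative parts are put on opposite
  -- sides to compare genuine polynomials.
  have h2 : AsymC atTop (fun y => (Q * X ^ (-e).toNat).eval y)
      (fun y => ((∏ j, (L g).seedPoly dI dII j) * X ^ e.toNat).eval y) := by
    obtain ⟨c, hc, hlim⟩ := h1
    refine ⟨c, hc, hlim.congr' ?_⟩
    filter_upwards [eventually_gt_atTop 0] with y hy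
    have hy1 : (L g).eta √y = y := Real.sq_sqrt hy.le
    have hy2 : (L g).halfD √y * (L g).dom.r false √y = y := Real.mul_self_sqrt hy.le
    rw [hy1, hy2, hQ y hy, eval_mul, eval_mul, eval_prod, eval_pow, eval_pow, eval_X, ← he,
      show e = e.toNat - (-e).toNat by omega, zpow_sub₀ hy.ne', zpow_natCast, zpow_natCast]
    have h3 : y ^ (-e).toNat ≠ 0 := pow_ne_zero _ hy.ne'
    have h4 : y ^ e.toNat ≠ 0 := pow_ne_zero _ hy.ne'
    rw [show ((e.toNat : ℤ) - (-e).toNat).toNat = e.toNat by omega,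
      show (-((e.toNat : ℤ) - (-e).toNat)).toNat = (-e).toNat by omega]
    field_simp
  have hS : ∏ j, (L g).seedPoly dI dII j ≠ 0 :=
    Finset.prod_ne_zero_iff.2 fun j _ => (natDegree_seedPoly_L dI dII g j).2
  have h3 := natDegree_eq_of_asymC (mul_ne_zero hQ0 (pow_ne_zero _ X_ne_zero))
    (mul_ne_zero hS (pow_ne_zero _ X_ne_zero)) h2
  rw [natDegree_mul_X_pow _ hQ0, natDegree_mul_X_pow _ hS, natDegree_prod _ _ fun j _ =>
    (natDegree_seedPoly_L dI dII g j).2, Finset.sum_congr rfl fun j _ =>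
    (natDegree_seedPoly_L dI dII g j).1] at h3
  have h4 := two_mul_ell dI dII
  change _ = ∑ j, Fin.append dI dII j + _ at h3
  omega

theorem natDegree_L_multiP {g : ℝ} {dI : Fin M → ℕ} {dII : Fin N → ℕ}
    (ha : (L g).Admissible dI dII) {n : ℕ} {Q : ℝ[X]}
    (hQ : ∀ y ∈ (L g).etaDom, (L g).multiP dI dII n y = Q.eval y) :
    (Q.natDegree : ℤ) = ell dI dII + n := by
  obtain ⟨P, hP, -⟩ := ha.exists_poly_denomXi
  have hP0 := ha.ne_zero_of_eq_denomXi hP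
  have h1 := (ha.asym_multiP n false).comp (u := Real.sqrt) Real.tendsto_sqrt_atTop
  have h2 : AsymC atTop (fun y => Q.eval y) (fun y => ((L g).classicalPoly n * P).eval y) := by
    obtain ⟨c, hc, hlim⟩ := h1
    refine ⟨c, hc, hlim.congr' ?_⟩
    filter_upwards [eventually_gt_atTop 0] with y hy
    have hy1 : (L g).eta √y = y := Real.sq_sqrt hy.le
    rw [hy1, hQ y hy, hP y hy, eval_mul]
  have hc := classicalPoly_ne_zero ha.bound.pos n
  rw [natDegree_eq_of_asymC (ha.ne_zero_of_eq_multiP hQ) (mul_ne_zero hc hP0) h2,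
    natDegree_mul hc hP0, natDegree_eq_of_degree_eq_some (degree_classicalPoly ha.bound.pos n),
    Nat.cast_add, ha.natDegree_L hP, add_comm]

theorem exists_denomXi (h : s.Admissible dI dII) (hI : Function.Injective dI)
    (hII : Function.Injective dII) : ∃ Q : ℝ[X],
    (∀ y ∈ s.etaDom, s.denomXi dI dII y = Q.eval y) ∧ Q ≠ 0 ∧ (Q.natDegree : ℤ) ≤ ell dI dII ∧
      (s.Generic dI dII → (Q.natDegree : ℤ) = ell dI dII) := by
  obtain ⟨Q, hQ, hQ'⟩ := h.exists_poly_denomXi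
  refine ⟨Q, hQ, h.ne_zero_of_eq_denomXi hQ, ?_⟩
  cases s with
  | L g => exact ⟨(h.natDegree_L hQ).le, fun _ => h.natDegree_L hQ⟩
  | J g h' => exact h.natDegree_J hI hII hQ hQ'

theorem exists_multiP (h : s.Admissible dI dII) (hI : Function.Injective dI)
    (hII : Function.Injective dII) (n : ℕ) : ∃ Q : ℝ[X],
    (∀ y ∈ s.etaDom, s.multiP dI dII n y = Q.eval y) ∧ Q ≠ 0 ∧
      (Q.natDegree : ℤ) ≤ ell dI dII + n ∧
      (s.Generic dI dII → (Q.natDegree : ℤ) = ell dI dII + n) := by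
  obtain ⟨Q, hQ, hQ'⟩ := h.exists_poly_multiP n
  refine ⟨Q, hQ, h.ne_zero_of_eq_multiP hQ, ?_⟩
  cases s with
  | L g => exact ⟨(h.natDegree_L_multiP hQ).le, fun _ => h.natDegree_L_multiP hQ⟩
  | J g h' => exact h.natDegree_J_multiP hI hII hQ hQ'

end Admissible

end System

end MultiIndexed

theorem mainTheorem2 (s : MultiIndexed.System) {M N : ℕ} (dI : Fin M → ℕ) (dII : Fin N → ℕ)
    -- `D` consists of `M` distinct type I labels and `N` distinct type II labels, all positive
    (hI : Function.Injective dI) (hII : Function.Injective dII)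
    (hI1 : ∀ j, 1 ≤ dI j) (hII1 : ∀ j, 1 ≤ dII j)
    (hbound : s.Bound dI dII)
    -- seeds of the same type have distinct energies (automatic for L)
    (hEI : Function.Injective fun j => s.energyI (dI j))
    (hEII : Function.Injective fun j => s.energyII (dII j)) :
    -- `ℓ ≥ 1` as soon as something is deleted
    (1 ≤ M + N → 1 ≤ MultiIndexed.System.ell dI dII) ∧
    -- `Ξ_D` is a polynomial of degree `ℓ` without zeros in the range of `η`
    (∃ Q : Polynomial ℝ, (∀ η ∈ s.etaDom, s.denomXi dI dII η = Q.eval η) ∧ Q ≠ 0 ∧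
      (Q.natDegree : ℤ) ≤ MultiIndexed.System.ell dI dII ∧
      (s.Generic dI dII → (Q.natDegree : ℤ) = MultiIndexed.System.ell dI dII)) ∧
    (∀ η ∈ s.etaDom, s.denomXi dI dII η ≠ 0) ∧
    -- `P_{D,n}` is a polynomial of degree `ℓ + n`
    (∀ n : ℕ, ∃ Q : Polynomial ℝ, (∀ η ∈ s.etaDom, s.multiP dI dII n η = Q.eval η) ∧ Q ≠ 0 ∧
      (Q.natDegree : ℤ) ≤ MultiIndexed.System.ell dI dII + n ∧
      (s.Generic dI dII → (Q.natDegree : ℤ) = MultiIndexed.System.ell dI dII + n)) ∧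
    -- factorised form of the Darboux-transformed eigenfunctions
    (∀ n : ℕ, ∀ x ∈ s.xDom, s.phiD dI dII n x
      = s.cF ^ (M + N) * s.psiD dI dII x * s.multiP dI dII n (s.eta x)) ∧
    -- they are square integrable eigenfunctions of `H_D` with the original eigenvalues
    (∀ n : ℕ, MeasureTheory.MemLp (s.phiD dI dII n) 2 (MeasureTheory.volume.restrict s.xDom) ∧
      ∀ x ∈ s.xDom, s.hamD dI dII (s.phiD dI dII n) x = s.energy n * s.phiD dI dII n x) ∧
    -- the `n`-th one has exactly `n` zeros, all simple
    (∀ n : ℕ, {x ∈ s.xDom | s.phiD dI dII n x = 0}.encard = n ∧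
      ∀ x ∈ s.xDom, s.phiD dI dII n x = 0 → deriv (s.phiD dI dII n) x ≠ 0) ∧
    -- orthogonality relations with explicit norms
    (∀ n m : ℕ,
      MeasureTheory.IntegrableOn
        (fun η => s.weightD dI dII η * s.multiP dI dII n η * s.multiP dI dII m η) s.etaDom ∧
      ∫ η in s.etaDom, s.weightD dI dII η * s.multiP dI dII n η * s.multiP dI dII m η
        = if n = m then s.normSq n * s.normFactor dI dII n else 0) ∧
    (∀ n : ℕ, 0 < s.normSq n * s.normFactor dI dII n) ∧
    -- the undeformed weight satisfies `W(η) |dη| = φ₀(x)² dx`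
    (∀ x ∈ s.xDom, s.weight (s.eta x) * |deriv s.eta x| = s.phi0 x ^ 2) ∧
    -- completeness: finite linear combinations of the `P_{D,n}` are dense in the weighted `L²`
    (∀ f : ℝ → ℝ, MeasureTheory.MemLp f 2 (s.measureD dI dII) → ∀ ε : ENNReal, 0 < ε →
      ∃ p ∈ Submodule.span ℝ (Set.range fun n : ℕ => s.multiP dI dII n),
        MeasureTheory.eLpNorm (f - p) 2 (s.measureD dI dII) < ε) ∧
    -- the deformed Hamiltonian is factorised by its ground state
    (∀ x ∈ s.xDom, s.phiD dI dII 0 x ≠ 0) ∧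
    (∀ f : ℝ → ℝ, ContDiffOn ℝ 2 f s.xDom → ∀ x ∈ s.xDom,
      s.hamD dI dII f x = s.opAdag dI dII (s.opA dI dII f) x) ∧
    -- shape invariance
    (∀ f : ℝ → ℝ, ContDiffOn ℝ 2 f s.xDom → ∀ x ∈ s.xDom,
      s.opA dI dII (s.opAdag dI dII f) x
        = (s.shift 1).opAdag dI dII ((s.shift 1).opA dI dII f) x + s.energy 1 * f x) ∧
    -- the similarity-transformed Hamiltonian is an explicit second order operator in `η`
    (∀ f : ℝ → ℝ, ContDiffOn ℝ 2 f s.etaDom → ∀ x ∈ s.xDom,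
      s.hamTilde dI dII f x = s.etaOp dI dII f (s.eta x)) ∧
    -- second order differential equation for the `P_{D,n}`
    (∀ n : ℕ, ∀ η ∈ s.etaDom,
      s.etaOp dI dII (s.multiP dI dII n) η = s.energy n * s.multiP dI dII n η) := by
  have h : s.Admissible dI dII := ⟨hbound, hEI, hEII⟩
  exact ⟨MultiIndexed.System.one_le_ell hI hII hI1 hII1, h.exists_denomXi hI hII,
    fun _ hy => h.denomXi_ne_zero hy, fun n => h.exists_multiP hI hII n,
    fun n x hx => h.phiD_eq n hx,
    fun n => ⟨h.memLp_phiD n, fun x hx => h.hamD_phiD n hx⟩, h.zeroCount, h.orthogonality,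
    h.norm_pos,
    fun x hx => by
      rw [MultiIndexed.System.deriv_eta]
      exact MultiIndexed.System.weight_mul_abs_etaD s hx,
    fun f hf ε hε => h.dense hf hε, fun x hx => h.phiD_zero_ne_zero hx,
    fun f hf x hx => h.hamD_eq hf hx, fun f hf x hx => h.opA_opAdag hf hx,
    fun f hf x hx => h.hamTilde_eq hf hx, fun n y hy => h.etaOp_multiP n hy⟩
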